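/- Let $\alpha>0$ and $0<\delta<b$. Let $\gamma$ be the contour that comes from $-\infty-i\delta$ along a horizontal ray to $-i\delta$, runs counterclockwise along the half circle $|z|=\delta$, $\operatorname{Re} z\ge 0$, to $i\delta$, and returns along a horizontal ray to $-\infty+i\delta$ (so it encircles the poles $0,-1,-2,\dots$ of $\Gamma$), and let $\tilde\gamma$ be the line $\operatorname{Re} z=b$ directed upwards. For $x,y\in\mathbb R$ put $$K_{\mathrm{crit}}(x,y)=\frac{1}{(2\pi i)^2}\int_{\tilde\gamma}ds\int_{\gamma}dt\,\frac{\Gamma(t)}{\Gamma(s)}\,\frac{e^{\alpha s^2/2-ys}}{e^{\alpha t^2/2-xt}}\,\frac1{s-t},$$ and for $a>0$ put $$\mathcal P(a)=1+\sum_{n\ge1}\frac{(-1)^n}{n!}\int_a^\infty\!\!\cdots\!\int_a^\infty\det\big(K_{\mathrm{crit}}(x_j,x_k)\big)_{j,k=1}^n\,dx_1\cdots dx_n .$$ Let $Q_a$ be the operator $(Q_af)(x)=\int_{\gamma\cup\tilde\gamma}Q_a(x,y)f(y)\,dy$ on $L_2(\gamma\cup\tilde\gamma)$ (with respect to arc length)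 with kernel $$Q_a(x,y)=\frac{1_{\tilde\gamma}(x)1_\gamma(y)\Gamma(y)e^{\alpha(x^2-y^2)/4-a(x-y)}-1_\gamma(x)1_{\tilde\gamma}(y)\Gamma(y)^{-1}e^{-\alpha(x^2-y^2)/4}}{2\pi i(x-y)}.$$ The problem Y-RH (for given $a$) is to find a $2\times2$ matrix function $Y(z)$ such that (i) $Y$ is analytic in $\mathbb C\setminus(\gamma\cup\tilde\gamma)$; (ii) at each point $z$ of $\gamma\cup\tilde\gamma$ the limits $Y^+(z)$ from the left and $Y^-(z)$ from the right of the contour exist and $Y^+(z)=Y^-(z)J_Y(z)$, where $$J_Y(z)=\begin{pmatrix}1&1_{\tilde\gamma}(z)\,\Gamma(z)^{-1}e^{\alpha z^2/2-az}\\-1_\gamma(z)\,\Gamma(z)e^{-\alpha z^2/2+az}&1\end{pmatrix};$$ (iii) $Y(z)\to I$ as $z\to\infty$, $z\in\mathbb C\setminus(\gamma\cup\tilde\gamma)$. Then: 1. For every $a>0$ the integrals and the series defining $\mathcal P(a)$ converge absolutely, and $\mathcal P(a)$ is real and strictly positive. If $\mathscr X$ is any determinantal point process on $\mathbb R$ with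 correlation kernel $K_{\mathrm{crit}}$, then $\mathcal P(a)$ is its gap probability: $\mathcal P(a)=\mathrm{Prob}[\mathscr X\cap(a,+\infty)=\varnothing]$ for all $a>0$. 2. There is a constant $C>0$ (independent of $a$) such that $|1-\mathcal P(a)|\le Ce^{-a/2}$ for all $a>0$. 3. For every $a>0$ the operator $Q_a$ is bounded and $I-Q_a$ is invertible on $L_2(\gamma\cup\tilde\gamma)$. 4. For every $a>0$ the problem Y-RH has a solution $Y$, unique on $\mathbb C\setminus(\gamma\cup\tilde\gamma)$. It has an expansion $$Y(z)=I+\frac{Y_1(a)}{z}+\frac{Y_2(a)}{z^2}+O\Big(\frac1{z^3}\Big),\qquad z\to\infty,\ z\in\mathbb C\setminus(\gamma\cup\tilde\gamma),$$ $\mathcal P$ is differentiable at $a$, and $$\frac{\mathcal P'(a)}{\mathcal P(a)}=\big(Y_1(a)\big)_{1,1}.$$ -/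

import Mathlib

open MeasureTheory Set Filter Topology Asymptotics Bornology
open scoped NNReal ENNReal Nat

noncomputable section

namespace CritRH

/-! ### Contours -/

/-- The contour `γ`, parametrized by arc length: it comes from `-∞ - iδ` along a horizontal ray,
runs counterclockwise along the right half of the circle of radius `δ` around `0`, and returns to
`-∞ + iδ` along a horizontal ray. It encircles the poles `0, -1, -2, …` of the Gamma function. -/
def hook (δ r : ℝ) : ℂ :=
  if r < -(Real.pi * δ / 2) then ((r + Real.pi * δ / 2 : ℝ) : ℂ) - δ * Complex.I
  else if r ≤ Real.pi * δ / 2 then δ * Complex.exp ((r / δ : ℝ) * Complex.I)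
  else -((r - Real.pi * δ / 2 : ℝ) : ℂ) + δ * Complex.I

/-- The contour `γ̃`: the vertical line `Re z = b`, directed upwards. -/
def vline (b r : ℝ) : ℂ := (b : ℂ) + r * Complex.I

/-- The integral of `f` along the curve `c : ℝ → ℂ`. -/
def contourInt (c : ℝ → ℂ) (f : ℂ → ℂ) : ℂ := ∫ r : ℝ, f (c r) * deriv c r

/-- The set `γ ∪ γ̃`. -/
def contours (δ b : ℝ) : Set ℂ := range (hook δ) ∪ range (vline b)

/-! ### The kernel and the gap probability -/

/-- The critical kernel `K_crit(x, y)`. -/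
def Kcrit (α δ b x y : ℝ) : ℂ :=
  1 / (2 * Real.pi * Complex.I) ^ 2 *
    contourInt (vline b) fun s => contourInt (hook δ) fun t =>
      Complex.Gamma t / Complex.Gamma s *
        (Complex.exp (α * s ^ 2 / 2 - y * s) / Complex.exp (α * t ^ 2 / 2 - x * t)) *
        (1 / (s - t))

/-- `det (K_crit(x_j, x_k))_{j,k}`. -/
def corrDet (α δ b : ℝ) {n : ℕ} (x : Fin n → ℝ) : ℂ :=
  (Matrix.of fun j k : Fin n => Kcrit α δ b (x j) (x k)).det

/-- The `n`-th term of the Fredholm series on `(a, +∞)`. -/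
def gapTerm (α δ b a : ℝ) (n : ℕ) : ℂ :=
  (-1) ^ n / (n ! : ℂ) * ∫ x in {x : Fin n → ℝ | ∀ j, a < x j}, corrDet α δ b x

/-- `P(a) = 1 + ∑_{n ≥ 1} (-1)^n / n! ∫_a^∞ … ∫_a^∞ det (K_crit(x_j, x_k)) dx_1 … dx_n`. -/
def gapProb (α δ b a : ℝ) : ℂ := 1 + ∑' n : ℕ, gapTerm α δ b a (n + 1)

/-- `X` is a (simple, locally finite) random point configuration on `ℝ`, defined on the
probability space `(Ω, μ)`, which is determinantal with correlation kernel `K`: its `n`-point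
correlation function with respect to Lebesgue measure is `ρ_n(x) = det (K(x_j, x_k))`, that is,
the expected number of `n`-tuples of distinct points of `X` lying in `B` is `∫_B ρ_n`. -/
structure IsDeterminantal {Ω : Type*} [MeasurableSpace Ω] (μ : Measure Ω)
    (X : Ω → Set ℝ) (K : ℝ → ℝ → ℂ) : Prop where
  locallyFinite : ∀ ω, ∀ r : ℝ, (X ω ∩ Icc (-r) r).Finite
  measurable_count : ∀ B : Set ℝ, MeasurableSet B →
    Measurable fun ω => ((X ω ∩ B).encard : ℝ≥0∞)
  correlation : ∀ n : ℕ, ∃ ρ : (Fin n → ℝ) → ℝ≥0,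
    (∀ x, ((ρ x : ℝ) : ℂ) = (Matrix.of fun j k : Fin n => K (x j) (x k)).det) ∧
    ∀ B : Set (Fin n → ℝ), MeasurableSet B →
      ∫⁻ ω, ({x : Fin n → ℝ | x ∈ B ∧ Function.Injective x ∧ ∀ j, x j ∈ X ω}.encard : ℝ≥0∞) ∂μ
        = ∫⁻ x in B, (ρ x : ℝ≥0∞)

/-! ### The Riemann–Hilbert problem -/

/-- The component of `ℂ \ γ` containing the poles `0, -1, -2, …`; it lies to the left of `γ`. -/
def inner (δ : ℝ) : Set ℂ := {z | ‖z‖ < δ} ∪ {z | z.re < 0 ∧ |z.im| < δ}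

/-- The region between `γ` and `γ̃`; it lies to the right of `γ` and to the left of `γ̃`. -/
def middle (δ b : ℝ) : Set ℂ := {z | z.re < b ∧ z ∉ inner δ ∧ z ∉ range (hook δ)}

/-- The region to the right of `γ̃`. -/
def outer (b : ℝ) : Set ℂ := {z | b < z.re}

/-- The jump matrix `J_Y(z)`. -/
def jumpMatrix (α δ b a : ℝ) (z : ℂ) : Matrix (Fin 2) (Fin 2) ℂ :=
  !![1, (range (vline b)).indicator
        (fun w => (Complex.Gamma w)⁻¹ * Complex.exp (α * w ^ 2 / 2 - a * w)) z;
     -(range (hook δ)).indicator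
        (fun w => Complex.Gamma w * Complex.exp (-(α * w ^ 2 / 2) + a * w)) z, 1]

/-- `z → ∞` with `z ∈ ℂ \ (γ ∪ γ̃)`. -/
def atInfinity (δ b : ℝ) : Filter ℂ := cobounded ℂ ⊓ 𝓟 (contours δ b)ᶜ

/-- `Y` solves the Riemann–Hilbert problem. The values of `Y` on the contours are
irrelevant; `Y⁺` and `Y⁻` are the limits from the left and from the right of each contour. -/
structure IsSolution (α δ b a : ℝ) (Y : ℂ → Matrix (Fin 2) (Fin 2) ℂ) : Prop where
  analytic : ∀ i j, AnalyticOnNhd ℂ (fun z => Y z i j) (contours δ b)ᶜ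
  jump_hook : ∀ z ∈ range (hook δ), ∃ Yp Ym : Matrix (Fin 2) (Fin 2) ℂ,
    Tendsto Y (𝓝[inner δ] z) (𝓝 Yp) ∧ Tendsto Y (𝓝[middle δ b] z) (𝓝 Ym) ∧
      Yp = Ym * jumpMatrix α δ b a z
  jump_vline : ∀ z ∈ range (vline b), ∃ Yp Ym : Matrix (Fin 2) (Fin 2) ℂ,
    Tendsto Y (𝓝[middle δ b] z) (𝓝 Yp) ∧ Tendsto Y (𝓝[outer b] z) (𝓝 Ym) ∧
      Yp = Ym * jumpMatrix α δ b a z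
  normalized : Tendsto Y (atInfinity δ b) (𝓝 1)

/-- `Y(z) = I + Y₁ / z + Y₂ / z² + O(1 / z³)` as `z → ∞` off the contours. -/
def HasExpansion (δ b : ℝ) (Y : ℂ → Matrix (Fin 2) (Fin 2) ℂ)
    (Y₁ Y₂ : Matrix (Fin 2) (Fin 2) ℂ) : Prop :=
  ∀ i j, (fun z : ℂ => Y z i j -
      ((1 : Matrix (Fin 2) (Fin 2) ℂ) i j + Y₁ i j / z + Y₂ i j / z ^ 2))
    =O[atInfinity δ b] fun z : ℂ => 1 / z ^ 3

/-! ### The integrable operator -/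

/-- Arc length measure on `γ ∪ γ̃`. -/
def arcLength (δ b : ℝ) : Measure ℂ :=
  Measure.map (hook δ) volume + Measure.map (vline b) volume

/-- The kernel `Q_a(x, y)`. -/
def Qker (α δ b a : ℝ) (x y : ℂ) : ℂ :=
  ((range (vline b)).indicator 1 x * (range (hook δ)).indicator 1 y *
      Complex.Gamma y * Complex.exp (α * (x ^ 2 - y ^ 2) / 4 - a * (x - y)) -
    (range (hook δ)).indicator 1 x * (range (vline b)).indicator 1 y *
      (Complex.Gamma y)⁻¹ * Complex.exp (-(α * (x ^ 2 - y ^ 2) / 4))) /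
    (2 * Real.pi * Complex.I * (x - y))

/-- `Q` is the bounded operator on `L₂(γ ∪ γ̃)` with kernel `Q_a`, that is,
`(Q f)(x) = ∫_{γ ∪ γ̃} Q_a(x, y) f(y) dy`. -/
def IsQOperator (α δ b a : ℝ)
    (Q : Lp ℂ 2 (arcLength δ b) →L[ℂ] Lp ℂ 2 (arcLength δ b)) : Prop :=
  ∀ f : Lp ℂ 2 (arcLength δ b), ∀ᵐ x ∂arcLength δ b,
    Q f x = contourInt (hook δ) (fun y => Qker α δ b a x y * f y) +
      contourInt (vline b) (fun y => Qker α δ b a x y * f y)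

end CritRH

end

/-!
The proof diagonalizes everything over the poles `0, -1, -2, …` of the Gamma function. The residue
theorem on the contour `γ` (`HookDecay.contourInt_Gamma_mul`) turns the critical kernel into a sum
`∑_k φ_k(x) G_k(y)` with `φ_k(x) = (-1)^k e^{-αk²/2 - kx} / k!` and
`G_k(y) = (2πi)⁻¹ ∫ Γ(s)⁻¹ e^{αs²/2 - ys} / (s + k) ds` (`Kcrit_eq_sumKernel`). The Fredholm series
therefore equals the determinant `det (1 - M(a))` of the infinite matrix
`M_{kj}(a) = ∫_a^∞ φ_j G_k`, defined as the limit of its finite truncations (`gapProb_eq_critDet`).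
The entries of `M` decay factorially in the column index, so Hadamard's inequality controls all
limits, and Cramer's rule solves `v = r + M v` whenever the determinant does not vanish
(`ColBound.exists_solution`). The derivative of `M` has rank one, and Jacobi's formula gives
`P'(a) = ∑_j ξ_j D_j`, where `ξ_j = (-1)^j e^{-αj²/2 - aj} / j!` and `D_j` is the determinant of
`1 - M(a)` with column `j` replaced by `g_k = G_k(a)` (`hasDerivAt_gapProb`).

Positivity has no evident reason in terms of `M`. It comes from finite ensembles: if `Γ` is replaced
by Euler's product `GammaSeq`, the finite determinants become integrals over `(-∞, a]^N` of a product
of two Vandermonde determinants, in `x` and in `e^{-x}`, against a Gaussian weight, by Andreief's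
identity (`exists_det_approx_eq`). Up to constants they are nonnegative and monotone in `a`, and so
is the limit `P`. Since `P` is analytic and tends to `1`, a zero of `P` would make it vanish on an
interval and hence everywhere. So `P(a) > 0` (`critDet_ne_zero`), which also makes `1 - M(a)` invertible.

The identification with the gap probability is inclusion-exclusion: the correlation functions give
the factorial moments of the number of points in `(a, ∞)` (`IsDeterminantal.tsum_fredTerm`).

The operator `Q_a` is a sum `A + B` of two blocks with `A² = B² = 0`, so `1 - Q_a` is invertible as
soon as `1 - A B` is. Again by residues, `A B f` is a series `∑_k L_k(f) u_k` whose matrix `L_k(u_j)`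
is `M_{kj}(a)`, and the equation is solved by inverting `1 - M(a)` (`exists_isUnit_one_sub`).

The same linear system solves the Riemann–Hilbert problem. To the right of `γ` a row consists of
`S(z) = e₁ + ∑_k ξ_k v_k / (z + k)` and of `T(z) = e₂ +` the Cauchy transform over `γ̃` of the jump of
`T`. To the left of `γ` the jump condition forces the first entry `S - Γ e^{-αz²/2 + az} T`, and its
poles cancel exactly if `v_k = T(-k)`, which is the system `v = r + M v` (`isRow_of_eq`). The expansions
at infinity are those of a sum of poles and of a Cauchy transform; near the poles of the Gamma
function the maximum principle is used. For the first row `r = g`, so `∑_k ξ_k v_k` is the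
logarithmic derivative of `P` by Cramer's rule and Jacobi's formula (`exists_isSolution`). Uniqueness
is Liouville's theorem for the quotient of two solutions (`IsSolution.eqOn`).
-/

noncomputable section

namespace CritRH

/-! ### Hadamard's inequality and determinants of infinite matrices -/

/-- Hadamard's inequality. -/
theorem norm_det_le_prod_col {n : ℕ} (A : Matrix (Fin n) (Fin n) ℂ) :
    ‖A.det‖ ≤ ∏ j, Real.sqrt (∑ i, ‖A i j‖ ^ 2) := by
  have hfr : Module.finrank ℂ (EuclideanSpace ℂ (Fin n)) = Fintype.card (Fin n) := by simp
  set v : Fin n → EuclideanSpace ℂ (Fin n) := fun j => WithLp.toLp 2 fun i => A i j with hv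
  set G := InnerProductSpace.gramSchmidtOrthonormalBasis hfr v with hG
  have h1 : G.toBasis.det v = ∏ i, Inner.inner ℂ (G i) (v i) :=
    InnerProductSpace.gramSchmidtOrthonormalBasis_det hfr v
  set E := EuclideanSpace.basisFun (Fin n) ℂ with hE
  have h2 : E.toBasis.det v = A.det := by
    rw [Module.Basis.det_apply]
    congr 1
  have h3 : ‖E.toBasis.det G‖ = 1 := E.det_to_matrix_orthonormalBasis G
  have h4 : E.toBasis.det v = E.toBasis.det G * G.toBasis.det v := by
    have := Module.Basis.det_apply E.toBasis v
    rw [Module.Basis.det_apply, Module.Basis.det_apply, Module.Basis.det_apply, ← Matrix.det_mul,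
      ← OrthonormalBasis.coe_toBasis G, Module.Basis.toMatrix_mul_toMatrix]
  rw [← h2, h4, norm_mul, h3, one_mul, h1, norm_prod]
  refine Finset.prod_le_prod (fun _ _ => norm_nonneg _) fun j _ => ?_
  refine (norm_inner_le_norm _ _).trans ?_
  rw [G.orthonormal.1 j, one_mul, EuclideanSpace.norm_eq]

/-- The Euclidean norm of the first `N` entries of a sequence. -/
def truncNorm (N : ℕ) (x : ℕ → ℂ) : ℝ := Real.sqrt (∑ i : Fin N, ‖x i‖ ^ 2)

theorem truncNorm_eq (N : ℕ) (x : ℕ → ℂ) :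
    truncNorm N x = ‖(WithLp.toLp 2 fun i : Fin N => x i : EuclideanSpace ℂ (Fin N))‖ := by
  rw [EuclideanSpace.norm_eq]; rfl

theorem truncNorm_nonneg (N : ℕ) (x : ℕ → ℂ) : 0 ≤ truncNorm N x := Real.sqrt_nonneg _

theorem truncNorm_sub_le (N : ℕ) (x y : ℕ → ℂ) :
    truncNorm N (fun k => x k - y k) ≤ truncNorm N x + truncNorm N y := by
  simp only [truncNorm_eq]
  exact norm_sub_le (WithLp.toLp 2 fun i : Fin N => x i : EuclideanSpace ℂ (Fin N))
    (WithLp.toLp 2 fun i : Fin N => y i)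

theorem truncNorm_single_le (N j : ℕ) : truncNorm N (Pi.single j 1) ≤ 1 := by
  unfold truncNorm
  rw [Real.sqrt_le_one]
  have : ∀ i : Fin N, ‖(Pi.single j (1 : ℂ) : ℕ → ℂ) i‖ ^ 2 = if (i : ℕ) = j then 1 else 0 := by
    intro i
    by_cases h : (i : ℕ) = j <;> simp [h]
  simp only [this]
  rw [Finset.sum_ite, Finset.sum_const_zero, add_zero, Finset.sum_const, nsmul_eq_mul, mul_one]
  norm_cast
  rw [Finset.card_le_one]
  intro a ha b hb
  simp only [Finset.mem_filter, Finset.mem_univ, true_and] at ha hb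
  exact Fin.ext (ha.trans hb.symm)

/-- If `‖x k‖ ≤ R η k` and `η` has `ℓ²`-norm at most one, then `x` has `ℓ²`-norm at most `R`. -/
theorem truncNorm_le {η : ℕ → ℝ} (hη : ∀ N, ∑ k : Fin N, η k ^ 2 ≤ 1) {x : ℕ → ℂ} {R : ℝ}
    (hR : 0 ≤ R) (hx : ∀ k, ‖x k‖ ≤ R * η k) (N : ℕ) : truncNorm N x ≤ R := by
  unfold truncNorm
  refine Real.sqrt_le_iff.2 ⟨hR, ?_⟩
  calc ∑ i : Fin N, ‖x i‖ ^ 2 ≤ ∑ i : Fin N, (R * η i) ^ 2 :=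
        Finset.sum_le_sum fun i _ => pow_le_pow_left₀ (norm_nonneg _) (hx i) 2
    _ = R ^ 2 * ∑ i : Fin N, η i ^ 2 := by simp only [mul_pow, Finset.mul_sum]
    _ ≤ R ^ 2 := by nlinarith [hη N, sq_nonneg R]

/-- The `N × N` upper left corner of an infinite matrix. -/
def corner (M : ℕ → ℕ → ℂ) (N : ℕ) : Matrix (Fin N) (Fin N) ℂ := Matrix.of fun i j => M i j

/-- `det (1 - M)` for the `N × N` upper left corner of an infinite matrix `M`. -/
def truncDet (M : ℕ → ℕ → ℂ) (N : ℕ) : ℂ := (1 - corner M N).det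

/-- The determinant `det (1 - M)` of an infinite matrix, as the limit of its corners. -/
def infDet (M : ℕ → ℕ → ℂ) : ℂ := limUnder atTop (truncDet M)

/-- The `j`-th column of `M` is replaced so that the `j`-th column of `1 - M` becomes `r`. -/
def replaceCol (M : ℕ → ℕ → ℂ) (r : ℕ → ℂ) (j : ℕ) : ℕ → ℕ → ℂ :=
  fun k i => if i = j then (Pi.single j 1 : ℕ → ℂ) k - r k else M k i

theorem one_sub_corner_apply (M : ℕ → ℕ → ℂ) (N : ℕ) (i j : Fin N) :
    (1 - corner M N) i j = (Pi.single (j : ℕ) 1 : ℕ → ℂ) i - M i j := by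
  simp [corner, Matrix.one_apply, Pi.single_apply, Fin.ext_iff]

theorem norm_det_updateCol_le {M : ℕ → ℕ → ℂ} {ε : ℕ → ℝ}
    (hM : ∀ N j, truncNorm N (fun k => M k j) ≤ ε j) (hε : ∀ j, 0 ≤ ε j) (hs : Summable ε)
    (N : ℕ) (x : ℕ → ℂ) (j : Fin N) :
    ‖((1 - corner M N).updateCol j fun k => x k).det‖ ≤ truncNorm N x * Real.exp (∑' j, ε j) := by
  refine (norm_det_le_prod_col _).trans ?_
  rw [← Finset.mul_prod_erase _ _ (Finset.mem_univ j)]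
  refine mul_le_mul ?_ ?_ (Finset.prod_nonneg fun _ _ => Real.sqrt_nonneg _)
    (truncNorm_nonneg _ _)
  · simp [truncNorm]
  · calc _ ≤ ∏ i ∈ Finset.univ.erase j, Real.exp (ε i) := by
          refine Finset.prod_le_prod (fun _ _ => Real.sqrt_nonneg _) fun i hi => ?_
          have hij := Finset.ne_of_mem_erase hi
          have : Real.sqrt (∑ k, ‖((1 - corner M N).updateCol j fun k => x k) k i‖ ^ 2) =
              truncNorm N (fun k => (Pi.single (i : ℕ) 1 : ℕ → ℂ) k - M k i) := by
            simp only [truncNorm, Matrix.updateCol_ne hij, one_sub_corner_apply]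
          rw [this]
          refine (truncNorm_sub_le _ _ _).trans ?_
          have := truncNorm_single_le N i
          have := hM N i
          linarith [Real.add_one_le_exp (ε i)]
      _ ≤ Real.exp (∑' j, ε j) := by
          rw [← Real.exp_sum]
          refine Real.exp_le_exp.2 ?_
          calc ∑ i ∈ Finset.univ.erase j, ε i ≤ ∑ i : Fin N, ε i :=
                Finset.sum_le_univ_sum_of_nonneg fun i => hε i
            _ = ∑ i ∈ Finset.range N, ε i := Fin.sum_univ_eq_sum_range ε N
            _ ≤ _ := hs.sum_le_tsum _ fun i _ => hε i

theorem truncDet_succ_sub {M : ℕ → ℕ → ℂ} (N : ℕ) :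
    truncDet M (N + 1) - truncDet M N =
      -((1 - corner M (N + 1)).updateCol (Fin.last N) fun k => M k N).det := by
  set A := 1 - corner M (N + 1) with hA
  have h1 : A = A.updateCol (Fin.last N)
      ((fun k : Fin (N + 1) => (Pi.single N 1 : ℕ → ℂ) k) + (-1 : ℂ) • fun k : Fin (N + 1) => M k N) := by
    ext i j
    by_cases h : j = Fin.last N
    · subst h
      rw [hA, one_sub_corner_apply]
      simp [sub_eq_add_neg]
    · rw [Matrix.updateCol_ne h]
  have h2 : (A.updateCol (Fin.last N) fun k : Fin (N + 1) => (Pi.single N 1 : ℕ → ℂ) k).det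
      = truncDet M N := by
    rw [Matrix.det_succ_column _ (Fin.last N), Finset.sum_eq_single (Fin.last N)]
    · simp only [Matrix.updateCol_self, Fin.val_last, Pi.single_eq_same, mul_one, ← two_mul,
        pow_mul, even_two, Even.neg_pow, one_pow, one_mul, truncDet]
      norm_num
      congr 1
      ext i j
      have hi : (Fin.castSucc j) ≠ Fin.last N := (Fin.castSucc_lt_last j).ne
      simp only [Matrix.submatrix_apply, Matrix.updateCol_ne hi, hA,
        one_sub_corner_apply, Fin.val_castSucc]
    · intro i _ hi
      have : (i : ℕ) ≠ N := fun h => hi (Fin.ext h)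
      simp [Pi.single_apply, this]
    · simp
  have h3 : truncDet M (N + 1) = truncDet M N -
      ((1 - corner M (N + 1)).updateCol (Fin.last N) fun k => M k N).det := by
    rw [truncDet, ← hA, h1, Matrix.det_updateCol_add, Matrix.det_updateCol_smul, h2, ← h1]
    ring
  rw [h3]; ring

theorem norm_truncDet_succ_sub_le {M : ℕ → ℕ → ℂ} {ε : ℕ → ℝ}
    (hM : ∀ N j, truncNorm N (fun k => M k j) ≤ ε j) (hε : ∀ j, 0 ≤ ε j) (hs : Summable ε)
    (N : ℕ) : dist (truncDet M N) (truncDet M (N + 1)) ≤ ε N * Real.exp (∑' j, ε j) := by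
  rw [dist_comm, dist_eq_norm, truncDet_succ_sub, norm_neg]
  refine (norm_det_updateCol_le hM hε hs _ (fun k => M k N) _).trans ?_
  exact mul_le_mul_of_nonneg_right (hM _ _) (Real.exp_nonneg _)

theorem tendsto_truncDet {M : ℕ → ℕ → ℂ} {ε : ℕ → ℝ}
    (hM : ∀ N j, truncNorm N (fun k => M k j) ≤ ε j) (hε : ∀ j, 0 ≤ ε j) (hs : Summable ε) :
    Tendsto (truncDet M) atTop (𝓝 (infDet M)) :=
  (cauchySeq_of_dist_le_of_summable _ (norm_truncDet_succ_sub_le hM hε hs)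
    (hs.mul_right _)).tendsto_limUnder

theorem dist_truncDet_infDet_le {M : ℕ → ℕ → ℂ} {ε : ℕ → ℝ}
    (hM : ∀ N j, truncNorm N (fun k => M k j) ≤ ε j) (hε : ∀ j, 0 ≤ ε j) (hs : Summable ε)
    (N : ℕ) : dist (truncDet M N) (infDet M) ≤
      ∑' m, ε (N + m) * Real.exp (∑' j, ε j) :=
  dist_le_tsum_of_dist_le_of_tendsto _ (norm_truncDet_succ_sub_le hM hε hs)
    (hs.mul_right _) (tendsto_truncDet hM hε hs) N

theorem truncDet_replaceCol (M : ℕ → ℕ → ℂ) (r : ℕ → ℂ) (N : ℕ) (j : Fin N) :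
    truncDet (replaceCol M r j) N = ((1 - corner M N).updateCol j fun k => r k).det := by
  unfold truncDet
  congr 1
  ext i k
  rw [one_sub_corner_apply]
  by_cases h : k = j
  · subst h; simp [replaceCol]
  · have h' : (k : ℕ) ≠ j := fun h' => h (Fin.ext h')
    rw [Matrix.updateCol_ne h, one_sub_corner_apply]
    simp [replaceCol, h']

theorem tendsto_truncDet_replaceCol {M : ℕ → ℕ → ℂ} {ε : ℕ → ℝ} {r : ℕ → ℂ} {R : ℝ}
    (hM : ∀ N j, truncNorm N (fun k => M k j) ≤ ε j) (hε : ∀ j, 0 ≤ ε j) (hs : Summable ε)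
    (hr : ∀ N, truncNorm N r ≤ R) (j : ℕ) :
    Tendsto (truncDet (replaceCol M r j)) atTop (𝓝 (infDet (replaceCol M r j))) := by
  have hR : 0 ≤ R := (truncNorm_nonneg 0 r).trans (hr 0)
  have h1 : ∀ N i, truncNorm N (fun k => replaceCol M r j k i) ≤
      (ε i + if i = j then 1 + R else 0) := by
    intro N i
    by_cases h : i = j
    · subst h
      simp only [replaceCol, if_true]
      refine (truncNorm_sub_le _ _ _).trans ?_
      linarith [truncNorm_single_le N i, hr N, hε i]
    · simp only [replaceCol, h, if_false, add_zero]
      exact hM N i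
  refine tendsto_truncDet h1 ?_ ?_
  · intro i
    split_ifs <;> linarith [hε i]
  · exact hs.add (summable_of_ne_finset_zero (s := {j}) fun b hb => by
      simp at hb; simp [hb])

theorem norm_truncDet_replaceCol_le {M : ℕ → ℕ → ℂ} {ε : ℕ → ℝ} {r : ℕ → ℂ} {R : ℝ}
    (hM : ∀ N j, truncNorm N (fun k => M k j) ≤ ε j) (hε : ∀ j, 0 ≤ ε j) (hs : Summable ε)
    (hr : ∀ N, truncNorm N r ≤ R) {j N : ℕ} (hj : j < N) :
    ‖truncDet (replaceCol M r j) N‖ ≤ R * Real.exp (∑' j, ε j) := by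
  have := truncDet_replaceCol M r N ⟨j, hj⟩
  rw [this]
  exact (norm_det_updateCol_le hM hε hs _ _ _).trans
    (mul_le_mul_of_nonneg_right (hr N) (Real.exp_nonneg _))

theorem norm_infDet_replaceCol_le {M : ℕ → ℕ → ℂ} {ε : ℕ → ℝ} {r : ℕ → ℂ} {R : ℝ}
    (hM : ∀ N j, truncNorm N (fun k => M k j) ≤ ε j) (hε : ∀ j, 0 ≤ ε j) (hs : Summable ε)
    (hr : ∀ N, truncNorm N r ≤ R) (j : ℕ) :
    ‖infDet (replaceCol M r j)‖ ≤ R * Real.exp (∑' j, ε j) := by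
  refine le_of_tendsto (tendsto_truncDet_replaceCol hM hε hs hr j).norm ?_
  filter_upwards [eventually_gt_atTop j] with N hN
  exact norm_truncDet_replaceCol_le hM hε hs hr hN

/-- Weighted sums of Cramer numerators of the corners converge. -/
theorem tendsto_sum_cramer {M : ℕ → ℕ → ℂ} {ε : ℕ → ℝ} {r : ℕ → ℂ} {R : ℝ}
    (hM : ∀ N j, truncNorm N (fun k => M k j) ≤ ε j) (hε : ∀ j, 0 ≤ ε j) (hs : Summable ε)
    (hr : ∀ N, truncNorm N r ≤ R) {c : ℕ → ℂ} (hc : Summable fun j => ‖c j‖) :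
    Tendsto (fun N => ∑ j : Fin N, c j * ((1 - corner M N).updateCol j fun k => r k).det) atTop
      (𝓝 (∑' j, c j * infDet (replaceCol M r j))) := by
  have hR : 0 ≤ R := (truncNorm_nonneg 0 r).trans (hr 0)
  have h : ∀ N, ∑ j : Fin N, c j * ((1 - corner M N).updateCol j fun k => r k).det =
      ∑' j, if j < N then c j * truncDet (replaceCol M r j) N else 0 := by
    intro N
    rw [tsum_eq_sum (s := Finset.range N) (by intro b hb; simp at hb; simp [hb])]
    rw [← Fin.sum_univ_eq_sum_range
      (fun j => if j < N then c j * truncDet (replaceCol M r j) N else 0) N]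
    refine Finset.sum_congr rfl fun j _ => ?_
    rw [← truncDet_replaceCol, if_pos j.2]
  simp only [h]
  refine tendsto_tsum_of_dominated_convergence
    (bound := fun j => ‖c j‖ * (R * Real.exp (∑' j, ε j))) (hc.mul_right _) ?_ ?_
  · intro j
    refine ((tendsto_truncDet_replaceCol hM hε hs hr j).const_mul (c j)).congr' ?_
    filter_upwards [eventually_gt_atTop j] with N hN
    simp [hN]
  · refine Eventually.of_forall fun N j => ?_
    split_ifs with hj
    · rw [norm_mul]
      exact mul_le_mul_of_nonneg_left (norm_truncDet_replaceCol_le hM hε hs hr hj) (norm_nonneg _)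
    · simp only [norm_zero]
      positivity

/-- An infinite matrix whose `j`-th column is bounded by `ε j • η`, where `ε` is summable and `η`
has `ℓ²`-norm at most one. -/
structure ColBound (M : ℕ → ℕ → ℂ) (ε η : ℕ → ℝ) : Prop where
  bound : ∀ k j, ‖M k j‖ ≤ ε j * η k
  eps_nonneg : ∀ j, 0 ≤ ε j
  summable : Summable ε
  eta_nonneg : ∀ k, 0 ≤ η k
  eta_sq : ∀ N, ∑ k : Fin N, η k ^ 2 ≤ 1

namespace ColBound

variable {M : ℕ → ℕ → ℂ} {ε η : ℕ → ℝ}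

theorem truncNorm_col (h : ColBound M ε η) (N j : ℕ) : truncNorm N (fun k => M k j) ≤ ε j :=
  truncNorm_le h.eta_sq (h.eps_nonneg j) (fun k => h.bound k j) N

theorem tendsto (h : ColBound M ε η) : Tendsto (truncDet M) atTop (𝓝 (infDet M)) :=
  tendsto_truncDet h.truncNorm_col h.eps_nonneg h.summable

/-- Cramer's rule for the infinite matrix `1 - M`. -/
theorem cramer (h : ColBound M ε η) {r : ℕ → ℂ} {R : ℝ} (hR : 0 ≤ R)
    (hr : ∀ k, ‖r k‖ ≤ R * η k) (k : ℕ) :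
    infDet (replaceCol M r k) = infDet M * r k + ∑' j, M k j * infDet (replaceCol M r j) := by
  have hr' := truncNorm_le h.eta_sq hR hr
  have h1 := tendsto_sum_cramer h.truncNorm_col h.eps_nonneg h.summable hr' (c := fun j => M k j)
    (Summable.of_nonneg_of_le (fun _ => norm_nonneg _) (fun j => h.bound k j)
      (h.summable.mul_right _))
  have h2 := (h.tendsto.mul_const (r k)).add h1
  refine tendsto_nhds_unique
    (tendsto_truncDet_replaceCol h.truncNorm_col h.eps_nonneg h.summable hr' k) (h2.congr' ?_)
  filter_upwards [eventually_gt_atTop k] with N hN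
  have h3 := congrFun (Matrix.mulVec_cramer (1 - corner M N) fun k : Fin N => r k) ⟨k, hN⟩
  have h4 := truncDet_replaceCol M r N ⟨k, hN⟩
  simp only at h4
  simp only [Matrix.mulVec, dotProduct, Matrix.cramer_apply, Matrix.sub_apply, sub_mul,
    Finset.sum_sub_distrib, Matrix.one_apply, ite_mul, one_mul, zero_mul, Finset.sum_ite_eq,
    Finset.mem_univ, if_true, Pi.smul_apply, smul_eq_mul] at h3
  rw [h4, truncDet, ← h3]
  simp [corner]

/-- If `det (1 - M) ≠ 0`, then `v = r + M v` has a bounded solution. -/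
theorem exists_solution (h : ColBound M ε η) (hd : infDet M ≠ 0) {r : ℕ → ℂ} {R : ℝ} (hR : 0 ≤ R)
    (hr : ∀ k, ‖r k‖ ≤ R * η k) :
    (∃ B, ∀ k, ‖infDet (replaceCol M r k) / infDet M‖ ≤ B) ∧
      ∀ k, infDet (replaceCol M r k) / infDet M =
        r k + ∑' j, M k j * (infDet (replaceCol M r j) / infDet M) := by
  constructor
  · refine ⟨R * Real.exp (∑' j, ε j) / ‖infDet M‖, fun k => ?_⟩
    rw [norm_div]
    gcongr
    exact norm_infDet_replaceCol_le h.truncNorm_col h.eps_nonneg h.summable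
      (truncNorm_le h.eta_sq hR hr) k
  · intro k
    rw [h.cramer hR hr k]
    simp only [← mul_div_assoc]
    rw [tsum_div_const]
    field_simp

/-- If `det (1 - M) ≠ 0`, then `v = M v` has no nonzero bounded solution. -/
theorem eq_zero_of_eq (h : ColBound M ε η) (hd : infDet M ≠ 0) {v : ℕ → ℂ} {B : ℝ}
    (hB : ∀ k, ‖v k‖ ≤ B) (hv : ∀ k, v k = ∑' j, M k j * v j) (j : ℕ) : v j = 0 := by
  have hB0 : 0 ≤ B := (norm_nonneg _).trans (hB 0)
  have hsum : ∀ k, Summable fun j => M k j * v j := fun k =>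
    Summable.of_norm_bounded (g := fun j => ε j * η k * B) ((h.summable.mul_right _).mul_right _)
      fun j => by
        rw [norm_mul]
        exact mul_le_mul (h.bound k j) (hB j) (norm_nonneg _)
          (mul_nonneg (h.eps_nonneg j) (h.eta_nonneg k))
  have hεN : ∀ N, Summable fun i => ε (i + N) := fun N => (summable_nat_add_iff N).2 h.summable
  -- The truncated system `(1 - M^N) v = t N` has the tail of the series as its right-hand side, so
  -- Cramer's rule bounds `det (1 - M^N) v_j` by a quantity that tends to zero.
  set t : ℕ → ℕ → ℂ := fun N k => ∑' i, M k (i + N) * v (i + N) with ht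
  have htb : ∀ N k, ‖t N k‖ ≤ (B * ∑' i, ε (i + N)) * η k := by
    intro N k
    have : HasSum (fun i => ε (i + N) * (B * η k)) ((∑' i, ε (i + N)) * (B * η k)) :=
      (hεN N).hasSum.mul_right _
    refine (tsum_of_norm_bounded this fun i => ?_).trans (le_of_eq (by ring))
    rw [norm_mul]
    calc ‖M k (i + N)‖ * ‖v (i + N)‖ ≤ (ε (i + N) * η k) * B :=
          mul_le_mul (h.bound k _) (hB _) (norm_nonneg _)
            (mul_nonneg (h.eps_nonneg _) (h.eta_nonneg k))
      _ = _ := by ring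
  have hdet : ∀ N, j < N → ‖truncDet M N * v j‖ ≤
      (B * ∑' i, ε (i + N)) * Real.exp (∑' j, ε j) := by
    intro N hN
    have h1 : (1 - corner M N).mulVec (fun k : Fin N => v k) = fun k : Fin N => t N k := by
      funext k
      have := hv k
      rw [← (hsum k).sum_add_tsum_nat_add N, ← Fin.sum_univ_eq_sum_range] at this
      simp only [Matrix.mulVec, dotProduct, Matrix.sub_apply, sub_mul,
        Finset.sum_sub_distrib, Matrix.one_apply, ite_mul, one_mul, zero_mul, Finset.sum_ite_eq,
        Finset.mem_univ, if_true, corner, Matrix.of_apply]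
      rw [this]
      simp [ht]
    have h2 : truncDet M N * v j =
        ((1 - corner M N).updateCol ⟨j, hN⟩ fun k : Fin N => t N k).det := by
      rw [← Matrix.cramer_apply, ← h1, Matrix.cramer_eq_adjugate_mulVec, Matrix.mulVec_mulVec,
        Matrix.adjugate_mul]
      simp [truncDet, Matrix.smul_mulVec]
    rw [h2]
    refine (norm_det_updateCol_le h.truncNorm_col h.eps_nonneg h.summable N (t N) _).trans ?_
    refine mul_le_mul_of_nonneg_right ?_ (Real.exp_nonneg _)
    exact truncNorm_le h.eta_sq
      (mul_nonneg hB0 (tsum_nonneg fun i => h.eps_nonneg _)) (htb N) N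
  have hlim : Tendsto (fun N => (B * ∑' i, ε (i + N)) * Real.exp (∑' j, ε j)) atTop (𝓝 0) := by
    have := ((tendsto_sum_nat_add ε).const_mul B).mul_const (Real.exp (∑' j, ε j))
    simpa using this
  have h0 : Tendsto (fun N => truncDet M N * v j) atTop (𝓝 0) := by
    refine squeeze_zero_norm' ?_ hlim
    filter_upwards [eventually_gt_atTop j] with N hN using hdet N hN
  have := tendsto_nhds_unique (h.tendsto.mul_const (v j)) h0
  exact (mul_eq_zero.1 this).resolve_left hd

end ColBound

theorem hasDerivAt_det {N : ℕ} {A : ℂ → Matrix (Fin N) (Fin N) ℂ} {A' : Matrix (Fin N) (Fin N) ℂ}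
    {z : ℂ} (h : ∀ i j, HasDerivAt (fun w => A w i j) (A' i j) z) :
    HasDerivAt (fun w => (A w).det) (∑ j, ((A z).updateCol j fun k => A' k j).det) z := by
  simp only [Matrix.det_apply']
  rw [Finset.sum_comm]
  refine HasDerivAt.fun_sum fun σ _ => ?_
  rw [← Finset.mul_sum]
  refine HasDerivAt.const_mul _ ?_
  have := HasDerivAt.fun_finsetProd (u := Finset.univ) (f := fun i w => A w (σ i) i)
    (f' := fun i => A' (σ i) i) (x := z) fun i _ => h (σ i) i
  refine this.congr_deriv ?_
  refine Finset.sum_congr rfl fun i _ => ?_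
  rw [← Finset.mul_prod_erase _ _ (Finset.mem_univ i)]
  simp only [Matrix.updateCol_self, smul_eq_mul]
  rw [mul_comm]
  congr 1
  refine Finset.prod_congr rfl fun k hk => ?_
  rw [Matrix.updateCol_ne (Finset.ne_of_mem_erase hk)]

/-- A locally uniformly bounded holomorphic family of infinite matrices with rank one derivative
`-g ξᵀ` has a holomorphic determinant, and its derivative is given by Cramer numerators. -/
theorem hasDerivAt_infDet {U : Set ℂ} (hU : IsOpen U) {M : ℂ → ℕ → ℕ → ℂ} {ε η : ℕ → ℝ}
    (h : ∀ z ∈ U, ColBound (M z) ε η) {ξ g : ℂ → ℕ → ℂ} {R : ℝ} (hR : 0 ≤ R)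
    (hd : ∀ z ∈ U, ∀ k j, HasDerivAt (fun w => M w k j) (-(g z k * ξ z j)) z)
    (hg : ∀ z ∈ U, ∀ k, ‖g z k‖ ≤ R * η k) (hξ : ∀ z ∈ U, Summable fun j => ‖ξ z j‖)
    {z : ℂ} (hz : z ∈ U) :
    HasDerivAt (fun w => infDet (M w)) (∑' j, ξ z j * infDet (replaceCol (M z) (g z) j)) z := by
  have hdN : ∀ N, ∀ z ∈ U, HasDerivAt (fun w => truncDet (M w) N)
      (∑ j : Fin N, ξ z j * ((1 - corner (M z) N).updateCol j fun k => g z k).det) z := by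
    intro N z hz
    have : ∀ i j : Fin N, HasDerivAt (fun w => (1 - corner (M w) N) i j)
        (ξ z j * g z i) z := by
      intro i j
      simp only [Matrix.sub_apply, corner, Matrix.of_apply]
      refine ((hd z hz i j).const_sub _).congr_deriv (by ring)
    refine (hasDerivAt_det (A' := Matrix.of fun i j : Fin N => ξ z j * g z i) this).congr_deriv ?_
    refine Finset.sum_congr rfl fun j _ => ?_
    have : (fun k : Fin N => (Matrix.of fun i j : Fin N => ξ z j * g z i) k j) =
        ξ z j • fun k : Fin N => g z k := by
      funext k; simp
    rw [this, Matrix.det_updateCol_smul]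
  -- Locally uniform convergence of holomorphic functions passes to the derivatives.
  have hunif : TendstoUniformlyOn (fun N w => truncDet (M w) N) (fun w => infDet (M w)) atTop U := by
    rw [Metric.tendstoUniformlyOn_iff]
    intro e he
    have hlim : Tendsto (fun N => ∑' m, ε (N + m) * Real.exp (∑' j, ε j)) atTop (𝓝 0) := by
      have := (tendsto_sum_nat_add ε).mul_const (Real.exp (∑' j, ε j))
      simp only [zero_mul] at this
      refine this.congr fun N => ?_
      rw [← tsum_mul_right]
      simp only [add_comm]
    filter_upwards [hlim.eventually (gt_mem_nhds he)] with N hN w hw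
    rw [dist_comm]
    exact (dist_truncDet_infDet_le (h w hw).truncNorm_col (h w hw).eps_nonneg
      (h w hw).summable N).trans_lt hN
  have hdiff : ∀ N, DifferentiableOn ℂ (fun w => truncDet (M w) N) U := fun N w hw =>
    (hdN N w hw).differentiableAt.differentiableWithinAt
  have hloc := hunif.tendstoLocallyUniformlyOn
  have h1 := hloc.differentiableOn (Eventually.of_forall hdiff) hU
  have h2 := (hloc.deriv (Eventually.of_forall hdiff) hU).tendsto_at hz
  have h3 := tendsto_sum_cramer (h z hz).truncNorm_col (h z hz).eps_nonneg (h z hz).summable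
    (truncNorm_le (h z hz).eta_sq hR (hg z hz)) (hξ z hz)
  have h4 : deriv (fun w => infDet (M w)) z = ∑' j, ξ z j * infDet (replaceCol (M z) (g z) j) := by
    refine tendsto_nhds_unique h2 (h3.congr fun N => ?_)
    exact (hdN N z hz).deriv.symm
  rw [← h4]
  exact (h1.differentiableAt (hU.mem_nhds hz)).hasDerivAt

/-! ### Fredholm series -/

/-- The `n`-th term of the Fredholm series of `det (1 - K)` on `L²(S)`. -/
def fredTerm (S : Set ℝ) (K : ℝ → ℝ → ℂ) (n : ℕ) : ℂ :=
  (-1) ^ n / (n ! : ℂ) * ∫ x in {x : Fin n → ℝ | ∀ j, x j ∈ S},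
    (Matrix.of fun j k : Fin n => K (x j) (x k)).det

theorem box_eq_pi (S : Set ℝ) (n : ℕ) :
    {x : Fin n → ℝ | ∀ j, x j ∈ S} = Set.univ.pi fun _ => S := by
  ext x; simp

theorem restrict_box (S : Set ℝ) (n : ℕ) :
    (volume : Measure (Fin n → ℝ)).restrict {x | ∀ j, x j ∈ S} =
      Measure.pi fun _ => volume.restrict S := by
  rw [box_eq_pi, volume_pi, Measure.restrict_pi_pi]

theorem measurableSet_box {S : Set ℝ} (hS : MeasurableSet S) (n : ℕ) :
    MeasurableSet {x : Fin n → ℝ | ∀ j, x j ∈ S} := by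
  rw [box_eq_pi]
  exact MeasurableSet.univ_pi fun _ => hS

theorem integral_box_prod (S : Set ℝ) {n : ℕ} (f : Fin n → ℝ → ℂ) :
    ∫ x in {x : Fin n → ℝ | ∀ j, x j ∈ S}, ∏ i, f i (x i) = ∏ i, ∫ x in S, f i x := by
  rw [restrict_box, integral_fintype_prod_eq_prod]

theorem integrableOn_box_prod {𝕜 : Type*} [RCLike 𝕜] {S : Set ℝ} {n : ℕ} {f : Fin n → ℝ → 𝕜}
    (hf : ∀ i, IntegrableOn (f i) S) :
    IntegrableOn (fun x : Fin n → ℝ => ∏ i, f i (x i)) {x | ∀ j, x j ∈ S} := by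
  rw [IntegrableOn, restrict_box]
  exact Integrable.fintype_prod hf

theorem norm_corr_le {S : Set ℝ} {K : ℝ → ℝ → ℂ} {q : ℝ → ℝ}
    (hq : ∀ x ∈ S, ∀ y ∈ S, ‖K x y‖ ≤ q y) {n : ℕ} {x : Fin n → ℝ} (hx : ∀ j, x j ∈ S) :
    ‖(Matrix.of fun j k : Fin n => K (x j) (x k)).det‖ ≤ √n ^ n * ∏ j, q (x j) := by
  refine (norm_det_le_prod_col _).trans ?_
  have : √n ^ n * ∏ j, q (x j) = ∏ j, (√n * q (x j)) := by
    rw [Finset.prod_mul_distrib]; simp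
  rw [this]
  refine Finset.prod_le_prod (fun _ _ => Real.sqrt_nonneg _) fun j _ => ?_
  have hq0 : 0 ≤ q (x j) := (norm_nonneg _).trans (hq _ (hx j) _ (hx j))
  refine Real.sqrt_le_iff.2 ⟨by positivity, ?_⟩
  rw [mul_pow, Real.sq_sqrt (Nat.cast_nonneg n)]
  calc ∑ i, ‖(Matrix.of fun j k : Fin n => K (x j) (x k)) i j‖ ^ 2
      ≤ ∑ _i : Fin n, q (x j) ^ 2 := Finset.sum_le_sum fun i _ =>
        pow_le_pow_left₀ (norm_nonneg _) (hq _ (hx i) _ (hx j)) 2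
    _ = _ := by simp

theorem aestronglyMeasurable_corr {S : Set ℝ} {K : ℝ → ℝ → ℂ}
    (hK : Measurable (Function.uncurry K)) (n : ℕ) :
    AEStronglyMeasurable (fun x : Fin n → ℝ => (Matrix.of fun j k : Fin n => K (x j) (x k)).det)
      (volume.restrict {x | ∀ j, x j ∈ S}) := by
  refine Measurable.aestronglyMeasurable ?_
  simp only [Matrix.det_apply', Matrix.of_apply]
  refine Finset.measurable_fun_sum _ fun σ _ => Measurable.const_mul ?_ _
  refine Finset.measurable_fun_prod _ fun i _ => ?_
  exact hK.comp (f := fun x : Fin n → ℝ => (x (σ i), x i))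
    ((measurable_pi_apply (σ i)).prodMk (measurable_pi_apply i))

theorem integrableOn_corr {S : Set ℝ} (hS : MeasurableSet S) {K : ℝ → ℝ → ℂ}
    (hK : Measurable (Function.uncurry K)) {q : ℝ → ℝ}
    (hq : ∀ x ∈ S, ∀ y ∈ S, ‖K x y‖ ≤ q y) (hqi : IntegrableOn q S) (n : ℕ) :
    IntegrableOn (fun x : Fin n → ℝ => (Matrix.of fun j k : Fin n => K (x j) (x k)).det)
      {x | ∀ j, x j ∈ S} := by
  refine Integrable.mono' ((integrableOn_box_prod (n := n) fun _ => hqi).const_mul (√n ^ n))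
    (aestronglyMeasurable_corr hK n) ?_
  filter_upwards [ae_restrict_mem (measurableSet_box hS n)] with x hx
  exact norm_corr_le hq hx

theorem integral_norm_corr_le {S : Set ℝ} (hS : MeasurableSet S) {K : ℝ → ℝ → ℂ}
    {q : ℝ → ℝ} (hq : ∀ x ∈ S, ∀ y ∈ S, ‖K x y‖ ≤ q y) (hqi : IntegrableOn q S) (n : ℕ) :
    ∫ x in {x : Fin n → ℝ | ∀ j, x j ∈ S}, ‖(Matrix.of fun j k : Fin n => K (x j) (x k)).det‖
      ≤ √n ^ n * (∫ x in S, q x) ^ n := by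
  have h1 : ∫ x in {x : Fin n → ℝ | ∀ j, x j ∈ S}, √n ^ n * ∏ j, q (x j) =
      √n ^ n * (∫ x in S, q x) ^ n := by
    rw [integral_const_mul, restrict_box, integral_fintype_prod_eq_prod (fun _ => q)]
    simp
  rw [← h1]
  refine integral_mono_of_nonneg (Eventually.of_forall fun _ => norm_nonneg _)
    ((integrableOn_box_prod (n := n) fun _ => hqi).const_mul (√n ^ n)) ?_
  filter_upwards [ae_restrict_mem (measurableSet_box hS n)] with x hx
  exact norm_corr_le hq hx

/-- `n ^ (n / 2) / n! * t ^ n`, the bound for the Fredholm series from Hadamard's inequality. -/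
def hadamardTerm (t : ℝ) (n : ℕ) : ℝ := √n ^ n / n ! * t ^ n

theorem hadamardTerm_nonneg {t : ℝ} (ht : 0 ≤ t) (n : ℕ) : 0 ≤ hadamardTerm t n := by
  unfold hadamardTerm; positivity

theorem summable_hadamardTerm {t : ℝ} (ht : 0 ≤ t) : Summable (hadamardTerm t) := by
  have hb : ∀ n : ℕ, hadamardTerm t n ≤ (1 / 2) ^ n + (4 * t ^ 2 * Real.exp 1) ^ n / n ! := by
    intro n
    have hfac : (0 : ℝ) < n ! := by exact_mod_cast Nat.factorial_pos n
    -- `2 a b ≤ a² + b²` separates a geometric series from an exponential one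
    have h1 : (n : ℝ) ^ n / n ! ≤ Real.exp 1 ^ n := by
      rw [← Real.exp_nat_mul, mul_one]
      exact Real.pow_div_factorial_le_exp _ (Nat.cast_nonneg n) n
    have h2 : (√n ^ n) ^ 2 = (n : ℝ) ^ n := by
      rw [← pow_mul, mul_comm, pow_mul, Real.sq_sqrt (Nat.cast_nonneg n)]
    have h3 : (hadamardTerm t n) ^ 2 ≤ (1 / 4) ^ n * ((4 * t ^ 2 * Real.exp 1) ^ n / n !) := by
      unfold hadamardTerm
      calc (√n ^ n / n ! * t ^ n) ^ 2 = (n : ℝ) ^ n / n ! * ((t ^ 2) ^ n / n !) := by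
            rw [mul_pow, div_pow, h2]; ring
        _ ≤ Real.exp 1 ^ n * ((t ^ 2) ^ n / n !) := by gcongr
        _ = _ := by rw [mul_pow, mul_pow, div_pow, one_pow]; field_simp
    have h4 : (0 : ℝ) ≤ (4 * t ^ 2 * Real.exp 1) ^ n / n ! := by positivity
    have h5 : ((1 : ℝ) / 4) ^ n = ((1 / 2) ^ n) ^ 2 := by rw [← pow_mul, mul_comm, pow_mul]; norm_num
    have h6 : ((1 : ℝ) / 2) ^ n ≤ 1 := pow_le_one₀ (by norm_num) (by norm_num)
    have h7 : (0 : ℝ) < (1 / 2) ^ n := by positivity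
    rw [h5] at h3
    refine abs_le_of_sq_le_sq' ?_ (by positivity) |>.2
    nlinarith [mul_nonneg h4 (mul_nonneg h7.le (sub_nonneg.2 h6)), mul_nonneg h4 h7.le]
  refine Summable.of_nonneg_of_le (hadamardTerm_nonneg ht) hb ?_
  exact (summable_geometric_of_lt_one (by norm_num) (by norm_num)).add
    (Real.summable_pow_div_factorial _)

theorem norm_fredTerm_le {S : Set ℝ} (hS : MeasurableSet S) {K : ℝ → ℝ → ℂ}
    {q : ℝ → ℝ} (hq : ∀ x ∈ S, ∀ y ∈ S, ‖K x y‖ ≤ q y) (hqi : IntegrableOn q S) (n : ℕ) :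
    ‖fredTerm S K n‖ ≤ hadamardTerm (∫ x in S, q x) n := by
  unfold fredTerm hadamardTerm
  rw [norm_mul, norm_div, norm_pow, norm_neg, norm_one, one_pow, Complex.norm_natCast]
  calc 1 / (n ! : ℝ) * ‖∫ x in {x : Fin n → ℝ | ∀ j, x j ∈ S},
        (Matrix.of fun j k : Fin n => K (x j) (x k)).det‖
      ≤ 1 / (n ! : ℝ) * (√n ^ n * (∫ x in S, q x) ^ n) := by
        gcongr
        exact (norm_integral_le_integral_norm _).trans (integral_norm_corr_le hS hq hqi n)
    _ = _ := by ring

/-- The Fredholm series is continuous under dominated pointwise convergence of kernels. -/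
theorem tendsto_tsum_fredTerm {S : Set ℝ} (hS : MeasurableSet S) {K : ℕ → ℝ → ℝ → ℂ}
    {L : ℝ → ℝ → ℂ} (hK : ∀ N, Measurable (Function.uncurry (K N))) {q : ℝ → ℝ}
    (hq : ∀ N, ∀ x ∈ S, ∀ y ∈ S, ‖K N x y‖ ≤ q y) (hqi : IntegrableOn q S)
    (hlim : ∀ x ∈ S, ∀ y ∈ S, Tendsto (fun N => K N x y) atTop (𝓝 (L x y))) :
    Tendsto (fun N => ∑' n, fredTerm S (K N) n) atTop (𝓝 (∑' n, fredTerm S L n)) := by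
  have hq0 : 0 ≤ ∫ x in S, q x := by
    refine setIntegral_nonneg hS fun x hx => (norm_nonneg _).trans (hq 0 x hx x hx)
  refine tendsto_tsum_of_dominated_convergence (summable_hadamardTerm hq0) ?_
    (Eventually.of_forall fun N n => norm_fredTerm_le hS (hq N) hqi n)
  intro n
  refine Tendsto.const_mul _ ?_
  refine tendsto_integral_of_dominated_convergence (fun x => √n ^ n * ∏ j, q (x j))
    (fun N => aestronglyMeasurable_corr (hK N) n)
    ((integrableOn_box_prod (n := n) fun _ => hqi).const_mul (√n ^ n)) ?_ ?_
  · intro N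
    filter_upwards [ae_restrict_mem (measurableSet_box hS n)] with x hx
    exact norm_corr_le (hq N) hx
  · filter_upwards [ae_restrict_mem (measurableSet_box hS n)] with x hx
    simp only [Matrix.det_apply', Matrix.of_apply]
    refine tendsto_finsetSum _ fun σ _ => Tendsto.const_mul _ ?_
    exact tendsto_finsetProd _ fun i _ => hlim _ (hx _) _ (hx _)

/-- A sum of principal minors over tuples is `n!` times the sum over subsets: tuples with a repeated
index contribute a determinant with equal rows. -/
theorem sum_det_submatrix_eq {n N : ℕ} (M : Matrix (Fin N) (Fin N) ℂ) :
    ∑ k : Fin n → Fin N, (M.submatrix k k).det =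
      n ! * ∑ s ∈ Finset.univ.powersetCard n,
        (M.submatrix (Subtype.val : s → Fin N) (Subtype.val : s → Fin N)).det := by
  classical
  have h1 : ∑ k : Fin n → Fin N, (M.submatrix k k).det =
      ∑ k ∈ Finset.univ.filter fun k : Fin n → Fin N => Function.Injective k,
        (M.submatrix k k).det := by
    refine (Finset.sum_filter_of_ne fun k _ hk => ?_).symm
    by_contra hinj
    simp only [Function.Injective, not_forall] at hinj
    obtain ⟨i, j, hij, hne⟩ := hinj
    exact hk (Matrix.det_zero_of_row_eq hne (by ext l; simp [hij]))
  rw [h1, ← Finset.sum_fiberwise_of_maps_to (t := Finset.univ.powersetCard n)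
    (g := fun k => Finset.univ.image k), Finset.mul_sum]
  · refine Finset.sum_congr rfl fun s hs => ?_
    have hcard := (Finset.mem_powersetCard.1 hs).2
    set F := (Finset.univ.filter fun k : Fin n → Fin N => Function.Injective k).filter
      fun k => Finset.univ.image k = s with hF
    have hF' : ∀ k, k ∈ F ↔ Function.Injective k ∧ Finset.univ.image k = s := by
      intro k; simp [hF]
    have hmem : ∀ k ∈ F, ∀ i, k i ∈ s := fun k hk i => by
      rw [← ((hF' k).1 hk).2]; exact Finset.mem_image_of_mem _ (Finset.mem_univ _)
    have hbij : ∀ (k) (hk : k ∈ F),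
        Function.Bijective (fun i => (⟨k i, hmem k hk i⟩ : s)) := by
      intro k hk
      refine ⟨fun i j hij => ((hF' k).1 hk).1 (Subtype.ext_iff.1 hij), fun ⟨y, hy⟩ => ?_⟩
      rw [← ((hF' k).1 hk).2, Finset.mem_image] at hy
      obtain ⟨i, _, hi⟩ := hy
      exact ⟨i, Subtype.ext hi⟩
    have hdet : ∀ k ∈ F, (M.submatrix k k).det =
        (M.submatrix (Subtype.val : s → Fin N) (Subtype.val : s → Fin N)).det := by
      intro k hk
      rw [← Matrix.det_submatrix_equiv_self (Equiv.ofBijective _ (hbij k hk))]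
      rfl
    rw [Finset.sum_congr rfl hdet, Finset.sum_const, nsmul_eq_mul]
    congr 2
    have hcardF : F.card = Fintype.card (Fin n ≃ s) := by
      rw [← Finset.card_univ]
      refine Finset.card_bij (fun k hk => Equiv.ofBijective _ (hbij k hk))
        (fun _ _ => Finset.mem_univ _) ?_ ?_
      · intro k hk k' hk' h
        funext i
        have := congrArg (fun e : Fin n ≃ s => ((e i : s) : Fin N)) h
        simpa using this
      · intro e _
        refine ⟨fun i => e i, (hF' _).2 ⟨fun i j hij => e.injective (Subtype.ext hij), ?_⟩, ?_⟩
        · ext y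
          simp only [Finset.mem_image, Finset.mem_univ, true_and]
          refine ⟨fun ⟨i, hi⟩ => hi ▸ (e i).2, fun hy => ⟨e.symm ⟨y, hy⟩, by simp⟩⟩
        · ext i; rfl
    have e : Fin n ≃ s := Fintype.equivOfCardEq (by simp [hcard])
    rw [hcardF, Fintype.card_equiv e, Fintype.card_fin]
  · intro k hk
    simp only [Finset.mem_filter, Finset.mem_univ, true_and] at hk
    rw [Finset.mem_powersetCard]
    exact ⟨Finset.subset_univ _, by rw [Finset.card_image_of_injective _ hk]; simp⟩

/-- The von Koch expansion of `det (1 - M)`. -/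
theorem tsum_minors_eq_det {N : ℕ} (M : Matrix (Fin N) (Fin N) ℂ) :
    ∑' n : ℕ, (-1) ^ n / (n ! : ℂ) * ∑ k : Fin n → Fin N, (M.submatrix k k).det =
      (1 - M).det := by
  set p : Polynomial ℂ := (1 + (Polynomial.X : Polynomial ℂ) • (-M).map Polynomial.C).det with hp
  have h1 : (1 - M).det = p.eval 1 := by
    rw [hp, ← Polynomial.coe_evalRingHom, RingHom.map_det]
    congr 1
    ext i j
    by_cases h : i = j <;> simp [h, sub_eq_add_neg]
  have h2 : ∀ n : ℕ, (-1) ^ n / (n ! : ℂ) * ∑ k : Fin n → Fin N, (M.submatrix k k).det =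
      p.coeff n := by
    intro n
    have hfac : (n ! : ℂ) ≠ 0 := by exact_mod_cast Nat.factorial_ne_zero n
    rw [sum_det_submatrix_eq, hp, Matrix.coeff_det_one_add_X_smul_eq_sum_minors]
    field_simp
    rw [Finset.mul_sum]
    refine Finset.sum_congr rfl fun s hs => ?_
    rw [Matrix.submatrix_neg, Pi.neg_apply, Pi.neg_apply, Matrix.det_neg, Fintype.card_coe,
      (Finset.mem_powersetCard.mp hs).2]
  simp only [h2]
  rw [h1, Polynomial.eval_eq_sum_range, tsum_eq_sum (s := Finset.range (p.natDegree + 1))]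
  · simp
  · intro n hn
    simp only [Finset.mem_range, not_lt] at hn
    exact Polynomial.coeff_eq_zero_of_natDegree_lt (by omega)

theorem integral_corr_finite_rank {S : Set ℝ} {N : ℕ} {u G : Fin N → ℝ → ℂ}
    (hi : ∀ j k, IntegrableOn (fun x => u j x * G k x) S) (n : ℕ) :
    ∫ x in {x : Fin n → ℝ | ∀ j, x j ∈ S},
      (Matrix.of fun i j : Fin n => ∑ k, u k (x i) * G k (x j)).det =
    ∑ k : Fin n → Fin N,
      ((Matrix.of fun k j : Fin N => ∫ x in S, u j x * G k x).submatrix k k).det := by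
  have h1 : ∀ x : Fin n → ℝ, (Matrix.of fun i j : Fin n => ∑ k, u k (x i) * G k (x j)).det =
      ∑ k : Fin n → Fin N, ∑ σ : Equiv.Perm (Fin n), ((Equiv.Perm.sign σ : ℤ) : ℂ) *
        ∏ i, (u (k (σ⁻¹ i)) (x i) * G (k i) (x i)) := by
    intro x
    rw [Matrix.det_apply', Finset.sum_comm]
    refine Finset.sum_congr rfl fun σ _ => ?_
    simp only [Matrix.of_apply]
    rw [Finset.prod_univ_sum, Fintype.piFinset_univ, Finset.mul_sum]
    refine Finset.sum_congr rfl fun k _ => ?_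
    congr 1
    rw [Finset.prod_mul_distrib, Finset.prod_mul_distrib]
    congr 1
    rw [← Equiv.prod_comp σ fun i => u (k (σ⁻¹ i)) (x i)]
    simp
  simp only [h1]
  have hint : ∀ (k : Fin n → Fin N) (σ : Equiv.Perm (Fin n)),
      IntegrableOn (fun x : Fin n → ℝ => ((Equiv.Perm.sign σ : ℤ) : ℂ) *
        ∏ i, (u (k (σ⁻¹ i)) (x i) * G (k i) (x i))) {x | ∀ j, x j ∈ S} := fun k σ =>
    (integrableOn_box_prod fun i => hi _ _).const_mul _
  rw [integral_finsetSum _ fun k _ => integrable_finsetSum _ fun σ _ => hint k σ]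
  refine Finset.sum_congr rfl fun k _ => ?_
  rw [integral_finsetSum _ fun σ _ => hint k σ, Matrix.det_apply']
  refine Finset.sum_congr rfl fun σ _ => ?_
  rw [integral_const_mul, integral_box_prod S fun i x => u (k (σ⁻¹ i)) x * G (k i) x]
  congr 1
  rw [← Equiv.prod_comp σ]
  simp

/-- The Fredholm series of a kernel of finite rank is a determinant. -/
theorem tsum_fredTerm_finite_rank {S : Set ℝ} {N : ℕ} {u G : Fin N → ℝ → ℂ}
    (hi : ∀ j k, IntegrableOn (fun x => u j x * G k x) S) :
    ∑' n, fredTerm S (fun x y => ∑ k, u k x * G k y) n =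
      (1 - Matrix.of fun k j : Fin N => ∫ x in S, u j x * G k x).det := by
  rw [← tsum_minors_eq_det]
  refine tsum_congr fun n => ?_
  rw [fredTerm, integral_corr_finite_rank hi]

/-- Andréief's identity: the determinant of the matrix of the pairings of two families of functions
is an integral of a product of two determinants. -/
theorem integral_det_mul_det {S : Set ℝ} {N : ℕ} {u G : Fin N → ℝ → ℂ}
    (hi : ∀ j k, IntegrableOn (fun x => u j x * G k x) S) :
    IntegrableOn (fun x : Fin N → ℝ => (Matrix.of fun i j : Fin N => u j (x i)).det *
        (Matrix.of fun i j : Fin N => G j (x i)).det) {x | ∀ j, x j ∈ S} ∧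
    ∫ x in {x : Fin N → ℝ | ∀ j, x j ∈ S},
      (Matrix.of fun i j : Fin N => u j (x i)).det * (Matrix.of fun i j : Fin N => G j (x i)).det =
    N ! * (Matrix.of fun k j : Fin N => ∫ x in S, u j x * G k x).det := by
  have h1 : ∀ x : Fin N → ℝ,
      (Matrix.of fun i j : Fin N => u j (x i)).det * (Matrix.of fun i j : Fin N => G j (x i)).det =
      ∑ σ : Equiv.Perm (Fin N), ∑ τ : Equiv.Perm (Fin N),
        (((Equiv.Perm.sign σ : ℤ) : ℂ) * ((Equiv.Perm.sign τ : ℤ) : ℂ)) *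
        ∏ i, (u (σ i) (x i) * G (τ i) (x i)) := by
    intro x
    rw [← Matrix.det_transpose, ← Matrix.det_transpose (Matrix.of fun i j : Fin N => G j (x i)),
      Matrix.det_apply', Matrix.det_apply', Finset.sum_mul_sum]
    refine Finset.sum_congr rfl fun σ _ => Finset.sum_congr rfl fun τ _ => ?_
    simp only [Matrix.transpose_apply, Matrix.of_apply, Finset.prod_mul_distrib]
    ring
  simp only [h1]
  have hint : ∀ (σ τ : Equiv.Perm (Fin N)),
      IntegrableOn (fun x : Fin N → ℝ =>
        (((Equiv.Perm.sign σ : ℤ) : ℂ) * ((Equiv.Perm.sign τ : ℤ) : ℂ)) *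
        ∏ i, (u (σ i) (x i) * G (τ i) (x i))) {x | ∀ j, x j ∈ S} := fun k σ =>
    (integrableOn_box_prod fun i => hi _ _).const_mul _
  refine ⟨integrable_finsetSum _ fun σ _ => integrable_finsetSum _ fun τ _ => hint σ τ, ?_⟩
  rw [integral_finsetSum _ fun σ _ => integrable_finsetSum _ fun τ _ => hint σ τ]
  have h2 : ∀ σ : Equiv.Perm (Fin N), ∫ x in {x : Fin N → ℝ | ∀ j, x j ∈ S},
      ∑ τ : Equiv.Perm (Fin N), (((Equiv.Perm.sign σ : ℤ) : ℂ) * ((Equiv.Perm.sign τ : ℤ) : ℂ)) *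
        ∏ i, (u (σ i) (x i) * G (τ i) (x i)) =
      (Matrix.of fun k j : Fin N => ∫ x in S, u j x * G k x).det := by
    intro σ
    -- Substituting `τ σ` for `τ` shows that every `σ` contributes the same determinant.
    rw [integral_finsetSum _ fun τ _ => hint σ τ, Matrix.det_apply',
      ← Equiv.sum_comp (Equiv.mulRight σ)]
    refine Finset.sum_congr rfl fun τ _ => ?_
    rw [integral_const_mul, integral_box_prod S fun i x => u (σ i) x * G _ x]
    simp only [Equiv.coe_mulRight, Matrix.of_apply, Equiv.Perm.mul_apply, Equiv.Perm.sign_mul]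
    rw [Equiv.prod_comp σ fun i => ∫ x in S, u i x * G (τ i) x]
    have : ((Equiv.Perm.sign σ : ℤ) : ℂ) * ((Equiv.Perm.sign σ : ℤ) : ℂ) = 1 := by
      norm_cast
      simp
    push_cast
    linear_combination ((Equiv.Perm.sign τ : ℤ) : ℂ) *
      (∏ i, ∫ x in S, u i x * G (τ i) x) * this
  rw [Finset.sum_congr rfl fun σ _ => h2 σ, Finset.sum_const, Finset.card_univ,
    Fintype.card_perm, Fintype.card_fin, nsmul_eq_mul]

/-! ### Integrals over vertical lines -/

/-- `(2πi)⁻¹ ∫ F(w) dw` over the vertical line `Re w = c`. -/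
def lineInt (c : ℝ) (F : ℂ → ℂ) : ℂ := (2 * Real.pi : ℂ)⁻¹ * ∫ τ : ℝ, F (vline c τ)

/-- The closed vertical strip `l ≤ Re z ≤ u`. -/
def vstrip (l u : ℝ) : Set ℂ := {z | l ≤ z.re ∧ z.re ≤ u}

/-- Gaussian decay in a vertical strip. -/
def GaussDecay (l u : ℝ) (F : ℂ → ℂ) : Prop :=
  ∃ κ > 0, ∃ C, ∀ z ∈ vstrip l u, ‖F z‖ ≤ C * Real.exp (-κ * z.im ^ 2)

@[simp] theorem vline_re (c τ : ℝ) : (vline c τ).re = c := by simp [vline]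

@[simp] theorem vline_im (c τ : ℝ) : (vline c τ).im = τ := by simp [vline]

theorem continuous_vline (c : ℝ) : Continuous (vline c) := by unfold vline; fun_prop

theorem vline_mem_vstrip {l u c : ℝ} (h1 : l ≤ c) (h2 : c ≤ u) (τ : ℝ) : vline c τ ∈ vstrip l u := by
  simp [vstrip, h1, h2]

theorem eq_vline (z : ℂ) : z = vline z.re z.im := by
  apply Complex.ext <;> simp

theorem GaussDecay.mono {l u l' u' : ℝ} {F : ℂ → ℂ} (h : GaussDecay l u F) (hl : l ≤ l')
    (hu : u' ≤ u) : GaussDecay l' u' F := by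
  obtain ⟨κ, hκ, C, h⟩ := h
  exact ⟨κ, hκ, C, fun z hz => h z ⟨hl.trans hz.1, hz.2.trans hu⟩⟩

theorem GaussDecay.congr {l u : ℝ} {F G : ℂ → ℂ} (h : GaussDecay l u F)
    (hFG : ∀ z ∈ vstrip l u, G z = F z) : GaussDecay l u G := by
  obtain ⟨κ, hκ, C, h⟩ := h
  exact ⟨κ, hκ, C, fun z hz => hFG z hz ▸ h z hz⟩

theorem GaussDecay.bound {l u : ℝ} {F : ℂ → ℂ} (h : GaussDecay l u F) :
    ∃ κ > 0, ∃ C ≥ 0, ∀ z ∈ vstrip l u, ‖F z‖ ≤ C * Real.exp (-κ * z.im ^ 2) := by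
  obtain ⟨κ, hκ, C, h⟩ := h
  refine ⟨κ, hκ, max C 0, le_max_right _ _, fun z hz => (h z hz).trans ?_⟩
  gcongr
  exact le_max_left _ _

theorem GaussDecay.add {l u : ℝ} {F G : ℂ → ℂ} (hF : GaussDecay l u F) (hG : GaussDecay l u G) :
    GaussDecay l u fun z => F z + G z := by
  obtain ⟨κ, hκ, C, hC, h⟩ := hF.bound
  obtain ⟨κ', hκ', C', hC', h'⟩ := hG.bound
  refine ⟨min κ κ', lt_min hκ hκ', C + C', fun z hz => ?_⟩
  refine (norm_add_le _ _).trans ?_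
  rw [add_mul]
  refine add_le_add ((h z hz).trans ?_) ((h' z hz).trans ?_)
  · gcongr; exact min_le_left _ _
  · gcongr; exact min_le_right _ _

/-- A factor of at most exponential growth does not destroy Gaussian decay. -/
theorem GaussDecay.mul_of_le {l u : ℝ} {F G : ℂ → ℂ} (hF : GaussDecay l u F) {A B : ℝ}
    (hG : ∀ z ∈ vstrip l u, ‖G z‖ ≤ A * Real.exp (B * |z.im|)) :
    GaussDecay l u fun z => F z * G z := by
  obtain ⟨κ, hκ, C, hC, h⟩ := hF.bound
  refine ⟨κ / 2, by positivity, C * (|A| * Real.exp (B ^ 2 / (2 * κ))), fun z hz => ?_⟩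
  rw [norm_mul]
  have h1 : ‖G z‖ ≤ |A| * Real.exp (B * |z.im|) := (hG z hz).trans (by gcongr; exact le_abs_self A)
  have h2 : -κ * z.im ^ 2 + B * |z.im| ≤ B ^ 2 / (2 * κ) + -(κ / 2) * z.im ^ 2 := by
    rw [← sq_abs z.im]
    have : B ^ 2 / (2 * κ) + -(κ / 2) * |z.im| ^ 2 - (-κ * |z.im| ^ 2 + B * |z.im|) =
        (κ * |z.im| - B) ^ 2 / (2 * κ) := by field_simp; ring
    have h3 : 0 ≤ (κ * |z.im| - B) ^ 2 / (2 * κ) := by positivity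
    linarith
  calc ‖F z‖ * ‖G z‖ ≤ (C * Real.exp (-κ * z.im ^ 2)) * (|A| * Real.exp (B * |z.im|)) :=
        mul_le_mul (h z hz) h1 (norm_nonneg _) (by positivity)
    _ = C * |A| * Real.exp (-κ * z.im ^ 2 + B * |z.im|) := by rw [Real.exp_add]; ring
    _ ≤ C * |A| * Real.exp (B ^ 2 / (2 * κ) + -(κ / 2) * z.im ^ 2) := by gcongr
    _ = _ := by rw [Real.exp_add]; ring

theorem GaussDecay.mul_bounded {l u : ℝ} {F G : ℂ → ℂ} (hF : GaussDecay l u F) {A : ℝ}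
    (hG : ∀ z ∈ vstrip l u, ‖G z‖ ≤ A) : GaussDecay l u fun z => F z * G z :=
  hF.mul_of_le (A := A) (B := 0) (by simpa using hG)

theorem GaussDecay.mul_exp {l u : ℝ} {F : ℂ → ℂ} (hF : GaussDecay l u F) (a : ℂ) :
    GaussDecay l u fun z => F z * Complex.exp (-a * z) := by
  refine hF.mul_of_le (A := Real.exp (|a.re| * (|l| + |u|))) (B := |a.im|) fun z hz => ?_
  rw [Complex.norm_exp, ← Real.exp_add]
  refine Real.exp_le_exp.2 ?_
  simp only [Complex.mul_re, Complex.neg_re, Complex.neg_im]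
  have h1 : |z.re| ≤ |l| + |u| := by
    rw [abs_le]
    constructor
    · linarith [neg_abs_le l, hz.1, abs_nonneg u]
    · linarith [le_abs_self u, hz.2, abs_nonneg l]
  have h2 : -a.re * z.re ≤ |a.re| * |z.re| := by
    rw [← abs_mul]; linarith [neg_abs_le (a.re * z.re)]
  have h3 : a.im * z.im ≤ |a.im| * |z.im| := by rw [← abs_mul]; exact le_abs_self _
  nlinarith [mul_le_mul_of_nonneg_left h1 (abs_nonneg a.re)]

theorem GaussDecay.mul_id {l u : ℝ} {F : ℂ → ℂ} (hF : GaussDecay l u F) (a : ℂ) :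
    GaussDecay l u fun z => F z * (z + a) := by
  refine hF.mul_of_le (A := |l| + |u| + ‖a‖ + 1) (B := 1) fun z hz => ?_
  have h1 : |z.re| ≤ |l| + |u| := by
    rw [abs_le]
    constructor
    · linarith [neg_abs_le l, hz.1, abs_nonneg u]
    · linarith [le_abs_self u, hz.2, abs_nonneg l]
  have h2 : ‖z + a‖ ≤ |z.re| + |z.im| + ‖a‖ :=
    (norm_add_le _ _).trans (by gcongr; exact Complex.norm_le_abs_re_add_abs_im z)
  have h3 := Real.add_one_le_exp (1 * |z.im|)
  have h4 : 0 ≤ |l| + |u| + ‖a‖ := by positivity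
  have h5 := abs_nonneg z.im
  nlinarith [mul_le_mul_of_nonneg_left h3 h4]

theorem GaussDecay.of_large {l u : ℝ} {F : ℂ → ℂ} (hc : ContinuousOn F (vstrip l u)) {R : ℝ}
    {κ C : ℝ} (hκ : 0 < κ)
    (h : ∀ z ∈ vstrip l u, R ≤ |z.im| → ‖F z‖ ≤ C * Real.exp (-κ * z.im ^ 2)) :
    GaussDecay l u F := by
  have hcomp : IsCompact (Icc l u ×ℂ Icc (-|R|) |R|) := isCompact_Icc.reProdIm isCompact_Icc
  obtain ⟨D, hD⟩ := hcomp.exists_bound_of_continuousOn (f := F)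
    (hc.mono fun z hz => ⟨hz.1.1, hz.1.2⟩)
  refine ⟨κ, hκ, max C (|D| * Real.exp (κ * R ^ 2)), fun z hz => ?_⟩
  by_cases hR : R ≤ |z.im|
  · refine (h z hz hR).trans ?_
    gcongr
    exact le_max_left _ _
  · push Not at hR
    have h1 : |z.im| ≤ |R| := hR.le.trans (le_abs_self R)
    have h2 : z.im ^ 2 ≤ R ^ 2 := sq_le_sq.2 h1
    calc ‖F z‖ ≤ D := hD z ⟨hz, abs_le.1 h1⟩
      _ ≤ |D| := le_abs_self D
      _ = |D| * Real.exp (κ * R ^ 2) * Real.exp (-κ * R ^ 2) := by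
        rw [mul_assoc, ← Real.exp_add]; simp
      _ ≤ max C (|D| * Real.exp (κ * R ^ 2)) * Real.exp (-κ * z.im ^ 2) := by
        have : Real.exp (-κ * R ^ 2) ≤ Real.exp (-κ * z.im ^ 2) :=
          Real.exp_le_exp.2 (by nlinarith)
        gcongr
        exact le_max_right _ _

theorem GaussDecay.integrable {l u : ℝ} {F : ℂ → ℂ} (h : GaussDecay l u F) {c : ℝ} (h1 : l ≤ c)
    (h2 : c ≤ u) (hc : ContinuousOn F (vstrip l u)) : Integrable fun τ : ℝ => F (vline c τ) := by
  obtain ⟨κ, hκ, C, h⟩ := h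
  refine Integrable.mono' ((integrable_exp_neg_mul_sq hκ).const_mul C) ?_ ?_
  · exact (hc.comp_continuous (continuous_vline c)
      fun τ => vline_mem_vstrip h1 h2 τ).aestronglyMeasurable
  · refine Eventually.of_forall fun τ => ?_
    simpa using h _ (vline_mem_vstrip h1 h2 τ)

/-- Cauchy's theorem: the integral over a vertical line does not depend on the line. -/
theorem lineInt_shift {l u : ℝ} {F : ℂ → ℂ} (hlu : l ≤ u) (hF : DifferentiableOn ℂ F (vstrip l u))
    (h : GaussDecay l u F) : lineInt l F = lineInt u F := by
  have hil := h.integrable le_rfl hlu hF.continuousOn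
  have hiu := h.integrable hlu le_rfl hF.continuousOn
  obtain ⟨κ, hκ, C, hC, hb⟩ := h.bound
  have hrect : ∀ T : ℝ, (((∫ x : ℝ in l..u, F (x + (-T : ℝ) * Complex.I)) -
      ∫ x : ℝ in l..u, F (x + (T : ℝ) * Complex.I)) +
      Complex.I • ∫ y : ℝ in (-T)..T, F (u + y * Complex.I)) -
      Complex.I • ∫ y : ℝ in (-T)..T, F (l + y * Complex.I) = 0 := by
    intro T
    have := Complex.integral_boundary_rect_eq_zero_of_differentiableOn F ⟨l, -T⟩ ⟨u, T⟩
      (hF.mono fun z hz => ?_)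
    · simpa using this
    · have h1 := hz.1
      simp only [Set.mem_preimage, uIcc_of_le hlu] at h1
      exact h1
  have hhor : ∀ s : ℝ → ℝ, (∀ T, s T ^ 2 = T ^ 2) →
      Tendsto (fun T : ℝ => ∫ x : ℝ in l..u, F (x + (s T : ℝ) * Complex.I)) atTop (𝓝 0) := by
    intro s hs
    have hlim : Tendsto (fun T : ℝ => C * Real.exp (-κ * T ^ 2) * |u - l|) atTop (𝓝 0) := by
      have h1 : Tendsto (fun T : ℝ => -κ * T ^ 2) atTop atBot :=
        (tendsto_pow_atTop two_ne_zero).const_mul_atTop_of_neg (by linarith)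
      simpa using ((Real.tendsto_exp_atBot.comp h1).const_mul C).mul_const |u - l|
    refine squeeze_zero_norm (fun T => ?_) hlim
    refine intervalIntegral.norm_integral_le_of_norm_le_const fun x hx => ?_
    rw [uIoc_of_le hlu] at hx
    have := hb (x + (s T : ℝ) * Complex.I) ⟨by simpa using hx.1.le, by simpa using hx.2⟩
    simpa [hs] using this
  have e1 := hhor (fun T => -T) (fun T => by ring)
  have e2 := hhor (fun T => T) (fun T => rfl)
  have e3 := (intervalIntegral_tendsto_integral hiu tendsto_neg_atTop_atBot tendsto_id)
  have e4 := (intervalIntegral_tendsto_integral hil tendsto_neg_atTop_atBot tendsto_id)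
  have e5 := (((e1.sub e2).add (e3.const_smul Complex.I)).sub (e4.const_smul Complex.I))
  have e6 := tendsto_nhds_unique (tendsto_const_nhds (x := (0 : ℂ)) (f := atTop (α := ℝ)))
    (e5.congr fun T => by simpa [vline] using hrect T)
  have e7 : Complex.I * ((∫ τ, F (vline u τ)) - ∫ τ, F (vline l τ)) = 0 := by
    rw [mul_sub]
    simpa using e6.symm
  have e8 := (mul_eq_zero.1 e7).resolve_left Complex.I_ne_zero
  unfold lineInt
  rw [sub_eq_zero.1 e8]

theorem lineInt_congr {c : ℝ} {F G : ℂ → ℂ} (h : ∀ z, z.re = c → F z = G z) :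
    lineInt c F = lineInt c G := by
  unfold lineInt
  congr 1
  exact integral_congr_ae (Eventually.of_forall fun τ => h _ (by simp))

theorem lineInt_const_mul (c : ℝ) (k : ℂ) (F : ℂ → ℂ) :
    lineInt c (fun z => k * F z) = k * lineInt c F := by
  unfold lineInt
  rw [integral_const_mul]; ring

theorem lineInt_add {c : ℝ} {F G : ℂ → ℂ} (hF : Integrable fun τ => F (vline c τ))
    (hG : Integrable fun τ => G (vline c τ)) :
    lineInt c (fun z => F z + G z) = lineInt c F + lineInt c G := by
  unfold lineInt
  rw [integral_add hF hG]; ring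

theorem norm_lineInt_le {c : ℝ} {F : ℂ → ℂ} {κ C : ℝ} (hκ : 0 < κ)
    (h : ∀ τ, ‖F (vline c τ)‖ ≤ C * Real.exp (-κ * τ ^ 2)) :
    ‖lineInt c F‖ ≤ C * √(Real.pi / κ) := by
  have hC : 0 ≤ C := by
    have := (norm_nonneg _).trans (h 0)
    simpa using this
  have h1 : ‖∫ τ : ℝ, F (vline c τ)‖ ≤ C * √(Real.pi / κ) := by
    rw [← integral_gaussian κ, ← integral_const_mul]
    exact norm_integral_le_of_norm_le ((integrable_exp_neg_mul_sq hκ).const_mul C)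
      (Eventually.of_forall h)
  unfold lineInt
  rw [norm_mul, norm_inv]
  have h2 : ‖(2 * Real.pi : ℂ)‖⁻¹ ≤ 1 := by
    rw [norm_mul, Complex.norm_real, Complex.norm_ofNat, Real.norm_of_nonneg Real.pi_pos.le]
    exact inv_le_one_of_one_le₀ (by linarith [Real.pi_gt_three])
  calc _ ≤ 1 * (C * √(Real.pi / κ)) :=
        mul_le_mul h2 h1 (norm_nonneg _) zero_le_one
    _ = _ := one_mul _

/-- The residue of `e^{s²} / s`, by writing `1 / s` as a Laplace transform and integrating the
Gaussian first; this avoids deforming the contour across the pole. -/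
theorem integral_gauss_div {c : ℝ} (hc : 0 < c) :
    ∫ τ : ℝ, Complex.exp (vline c τ ^ 2) / vline c τ = Real.pi := by
  have h1 : ∀ τ : ℝ, Complex.exp (vline c τ ^ 2) / vline c τ =
      ∫ t in Ioi (0 : ℝ), Complex.exp (vline c τ ^ 2 - t * vline c τ) := by
    intro τ
    have : ∫ t in Ioi (0 : ℝ), Complex.exp (-(vline c τ) * t) = 1 / vline c τ := by
      rw [integral_exp_mul_complex_Ioi (by simpa using hc)]
      simp
    rw [div_eq_mul_one_div, ← this, ← integral_const_mul]
    refine integral_congr_ae (Eventually.of_forall fun t => ?_)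
    simp only
    rw [← Complex.exp_add]; ring_nf
  simp only [h1]
  rw [integral_integral_swap]
  · have h2 : ∀ t : ℝ, ∫ τ : ℝ, Complex.exp (vline c τ ^ 2 - t * vline c τ) =
        ((√Real.pi * Real.exp (-(1 / 4) * t ^ 2) : ℝ) : ℂ) := by
      intro t
      have := integral_cexp_quadratic (b := -1) (by simp) (Complex.I * (2 * c - t)) (c ^ 2 - t * c)
      have e1 : ∀ τ : ℝ, vline c τ ^ 2 - t * vline c τ =
          -1 * (τ : ℂ) ^ 2 + Complex.I * (2 * c - t) * τ + (c ^ 2 - t * c) := by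
        intro τ
        unfold vline
        linear_combination (τ : ℂ) ^ 2 * Complex.I_sq
      simp only [e1, this]
      have e2 : ((c : ℂ) ^ 2 - t * c - (Complex.I * (2 * c - t)) ^ 2 / (4 * -1)) =
          ((-(1 / 4) * t ^ 2 : ℝ) : ℂ) := by
        push_cast
        rw [mul_pow, Complex.I_sq]; ring
      rw [e2, ← Complex.ofReal_exp, Complex.ofReal_mul]
      congr 1
      rw [neg_neg, div_one, Real.sqrt_eq_rpow, Complex.ofReal_cpow Real.pi_pos.le]
      norm_num
    simp only [h2]
    rw [integral_complex_ofReal, integral_const_mul, integral_gaussian_Ioi]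
    have : √(Real.pi / (1 / 4)) = 2 * √Real.pi := by
      rw [show Real.pi / (1 / 4) = 2 ^ 2 * Real.pi by ring, Real.sqrt_mul (by norm_num),
        Real.sqrt_sq (by norm_num)]
    rw [this]
    norm_cast
    nlinarith [Real.mul_self_sqrt Real.pi_pos.le]
  · have hi : Integrable (fun p : ℝ × ℝ => (Real.exp (c ^ 2) * Real.exp (-1 * p.1 ^ 2)) *
        Real.exp (-c * p.2)) (volume.prod (volume.restrict (Ioi 0))) :=
      ((integrable_exp_neg_mul_sq one_pos).const_mul _).mul_prod
        (integrableOn_exp_mul_Ioi (by linarith) 0)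
    refine hi.mono' ?_ (Eventually.of_forall fun p => ?_)
    · refine Continuous.aestronglyMeasurable ?_
      unfold Function.uncurry vline
      fun_prop
    · simp only [Function.uncurry]
      rw [Complex.norm_exp, ← Real.exp_add, ← Real.exp_add]
      refine le_of_eq ?_
      congr 1
      simp [vline, pow_two]
      ring

/-- Cauchy's integral formula in a vertical strip. -/
theorem lineInt_sub_lineInt_div {l u : ℝ} {F : ℂ → ℂ} (hF : DifferentiableOn ℂ F (vstrip l u))
    (h : GaussDecay l u F) {z : ℂ} (hl : l < z.re) (hu : z.re < u) :
    lineInt u (fun w => F w / (w - z)) - lineInt l (fun w => F w / (w - z)) = F z := by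
  have hlu : l ≤ u := (hl.trans hu).le
  -- the Gaussian `E` has the same residue as `F` up to the factor `F z`
  set E : ℂ → ℂ := fun w => Complex.exp ((w - z) ^ 2) with hE
  have hEd : Differentiable ℂ E := by rw [hE]; fun_prop
  have hEg : GaussDecay l u E := by
    refine ⟨1 / 2, by norm_num, Real.exp ((u - l) ^ 2 + z.im ^ 2), fun w hw => ?_⟩
    rw [hE, Complex.norm_exp, ← Real.exp_add]
    refine Real.exp_le_exp.2 ?_
    simp only [pow_two, Complex.mul_re, Complex.sub_re, Complex.sub_im]
    have h1 : |w.re - z.re| ≤ u - l := by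
      rw [abs_le]; constructor <;> linarith [hw.1, hw.2]
    have h2 : (w.re - z.re) ^ 2 ≤ (u - l) ^ 2 := sq_le_sq' (by linarith [(abs_le.1 h1).1])
      (abs_le.1 h1).2
    nlinarith [sq_nonneg (w.im - 2 * z.im)]
  set H : ℂ → ℂ := fun w => F w + -F z * E w with hH
  have hHz : H z = 0 := by simp [hH, hE]
  have hHd : DifferentiableOn ℂ H (vstrip l u) :=
    hF.add ((hEd.const_mul _).differentiableOn)
  have hHg : GaussDecay l u H := by
    refine h.add ?_
    refine (hEg.mul_bounded (G := fun _ => -F z) (A := ‖F z‖) fun w _ => ?_).congr fun w _ =>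
      mul_comm _ _
    simp
  have hnhds : vstrip l u ∈ 𝓝 z := by
    have : {w : ℂ | l < w.re ∧ w.re < u} ∈ 𝓝 z :=
      ((isOpen_lt continuous_const Complex.continuous_re).inter
        (isOpen_lt Complex.continuous_re continuous_const)).mem_nhds ⟨hl, hu⟩
    filter_upwards [this] with w hw using ⟨hw.1.le, hw.2.le⟩
  have hDd : DifferentiableOn ℂ (dslope H z) (vstrip l u) :=
    (Complex.differentiableOn_dslope hnhds).2 hHd
  have hDe : ∀ w, w ≠ z → dslope H z w = F w / (w - z) + -F z * (E w / (w - z)) := by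
    intro w hw
    rw [dslope_of_ne _ hw, slope_def_field, hHz]
    simp only [hH]
    ring
  have hDg : GaussDecay l u (dslope H z) := by
    obtain ⟨κ, hκ, C, hC, hb⟩ := hHg.bound
    refine GaussDecay.of_large hDd.continuousOn (R := |z.im| + 1) hκ (C := C) fun w hw hR => ?_
    have h1 : 1 ≤ ‖w - z‖ := by
      refine le_trans ?_ (Complex.abs_im_le_norm (w - z))
      rw [Complex.sub_im]
      linarith [abs_sub_abs_le_abs_sub w.im z.im]
    have hne : w ≠ z := by
      rintro rfl; simp at h1; linarith
    rw [dslope_of_ne _ hne, slope_def_field, hHz, sub_zero, norm_div]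
    exact (div_le_self (norm_nonneg _) h1).trans (hb w hw)
  have key := lineInt_shift hlu hDd hDg
  have hint : ∀ {K : ℂ → ℂ}, DifferentiableOn ℂ K (vstrip l u) → GaussDecay l u K → ∀ {c : ℝ},
      l ≤ c → c ≤ u → c ≠ z.re → Integrable fun τ => K (vline c τ) / (vline c τ - z) := by
    intro K hK hKg c h1 h2 hc
    have h3 : Integrable fun τ => K (vline c τ) := hKg.integrable h1 h2 hK.continuousOn
    have h4 : ∀ τ, vline c τ - z ≠ 0 := fun τ h0 => hc (by
      have := congrArg Complex.re h0; simp at this; linarith)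
    refine (h3.norm.mul_const |c - z.re|⁻¹).mono' ?_ (Eventually.of_forall fun τ => ?_)
    · exact h3.aestronglyMeasurable.mul
        (((continuous_vline c).sub continuous_const).inv₀ h4).aestronglyMeasurable
    · rw [norm_div, div_eq_mul_inv]
      have h5 := abs_pos.2 (sub_ne_zero.2 hc)
      gcongr
      simpa using Complex.abs_re_le_norm (vline c τ - z)
  have hsplit : ∀ {c : ℝ}, l ≤ c → c ≤ u → c ≠ z.re → lineInt c (dslope H z) =
      lineInt c (fun w => F w / (w - z)) + -F z * lineInt c (fun w => E w / (w - z)) := by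
    intro c h1 h2 hc
    rw [← lineInt_const_mul, ← lineInt_add (hint hF h h1 h2 hc)
      ((hint hEd.differentiableOn hEg h1 h2 hc).const_mul _)]
    refine lineInt_congr fun w hw => hDe w ?_
    rintro rfl
    exact hc hw.symm
  have hline : ∀ c : ℝ, ∫ τ : ℝ, E (vline c τ) / (vline c τ - z) =
      ∫ τ : ℝ, Complex.exp (vline (c - z.re) τ ^ 2) / vline (c - z.re) τ := by
    intro c
    rw [← integral_sub_right_eq_self
      (fun τ : ℝ => Complex.exp (vline (c - z.re) τ ^ 2) / vline (c - z.re) τ) z.im]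
    refine integral_congr_ae (Eventually.of_forall fun τ => ?_)
    have : vline c τ - z = vline (c - z.re) (τ - z.im) := by
      apply Complex.ext <;> simp
    simp only [hE, this]
  have hU : lineInt u (fun w => E w / (w - z)) = 1 / 2 := by
    unfold lineInt
    rw [hline, integral_gauss_div (by linarith)]
    have : (Real.pi : ℂ) ≠ 0 := by exact_mod_cast Real.pi_ne_zero
    field_simp
  have hL : lineInt l (fun w => E w / (w - z)) = -(1 / 2) := by
    unfold lineInt
    have : ∫ τ : ℝ, Complex.exp (vline (l - z.re) τ ^ 2) / vline (l - z.re) τ = -Real.pi := by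
      rw [← integral_gauss_div (c := z.re - l) (by linarith), ← integral_neg,
        ← integral_neg_eq_self]
      refine integral_congr_ae (Eventually.of_forall fun τ => ?_)
      have : vline (l - z.re) (-τ) = -vline (z.re - l) τ := by
        apply Complex.ext <;> simp
      simp only [this, neg_sq, div_neg]
    rw [hline, this]
    have : (Real.pi : ℂ) ≠ 0 := by exact_mod_cast Real.pi_ne_zero
    field_simp
  rw [hsplit le_rfl hlu hl.ne, hsplit hlu le_rfl hu.ne', hU, hL] at key
  linear_combination -key

/-- The Cauchy transform of an integrable density on a vertical line is holomorphic off the line. -/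
theorem differentiableAt_cauchy_line {c : ℝ} {f : ℝ → ℂ} (hf : Integrable f) {z : ℂ}
    (hz : z.re ≠ c) : DifferentiableAt ℂ (fun z => ∫ τ : ℝ, f τ / (vline c τ - z)) z := by
  set d := |c - z.re| / 2 with hd
  have hd0 : 0 < d := by
    have := abs_pos.2 (sub_ne_zero.2 hz.symm); positivity
  have hdist : ∀ w ∈ Metric.ball z d, ∀ τ, d ≤ ‖vline c τ - w‖ := by
    intro w hw τ
    have h1 : |(w - z).re| < d :=
      (Complex.abs_re_le_norm _).trans_lt (by simpa [dist_eq_norm] using hw)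
    have h2 := Complex.abs_re_le_norm (vline c τ - w)
    simp only [Complex.sub_re, vline_re] at h1 h2
    have h3 : |c - z.re| ≤ |c - w.re| + |w.re - z.re| := abs_sub_le _ _ _
    linarith
  have hne : ∀ w ∈ Metric.ball z d, ∀ τ, vline c τ - w ≠ 0 := fun w hw τ h0 => by
    have := hdist w hw τ
    rw [h0, norm_zero] at this
    linarith
  have hmeas : ∀ w ∈ Metric.ball z d, ∀ n : ℕ,
      AEStronglyMeasurable (fun τ => f τ / (vline c τ - w) ^ n) volume := by
    intro w hw n
    exact hf.aestronglyMeasurable.mul ((((continuous_vline c).sub continuous_const).pow n).inv₀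
      fun τ => pow_ne_zero _ (hne w hw τ)).aestronglyMeasurable
  have hzm : z ∈ Metric.ball z d := Metric.mem_ball_self hd0
  have := hasDerivAt_integral_of_dominated_loc_of_deriv_le (𝕜 := ℂ) (μ := volume)
    (F := fun w τ => f τ / (vline c τ - w)) (F' := fun w τ => f τ / (vline c τ - w) ^ 2)
    (bound := fun τ => ‖f τ‖ * (d ^ 2)⁻¹) (x₀ := z) (Metric.ball_mem_nhds z hd0) ?_ ?_ ?_ ?_ ?_ ?_
  · exact this.2.differentiableAt
  · filter_upwards [Metric.ball_mem_nhds z hd0] with w hw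
    simpa using hmeas w hw 1
  · refine (hf.norm.mul_const d⁻¹).mono' (by simpa using hmeas z hzm 1)
      (Eventually.of_forall fun τ => ?_)
    rw [norm_div, div_eq_mul_inv]
    gcongr
    exact hdist z hzm τ
  · exact hmeas z hzm 2
  · refine Eventually.of_forall fun τ w hw => ?_
    rw [norm_div, norm_pow, div_eq_mul_inv]
    gcongr
    exact hdist w hw τ
  · exact hf.norm.mul_const _
  · refine Eventually.of_forall fun τ w hw => ?_
    have h1 : HasDerivAt (fun w : ℂ => vline c τ - w) (-1) w := by
      simpa using (hasDerivAt_id w).const_sub (vline c τ)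
    refine ((h1.inv (hne w hw τ)).const_mul (f τ)).congr_deriv ?_
    simp [div_eq_mul_inv]

/-! ### The discrete matrix of the kernel -/

/-- The function `G_k(y) = (2πi)⁻¹ ∫ ρ(s) e^{-ys} / (s + k) ds` over the line `Re s = c`. -/
def Gfun (c : ℝ) (ρ : ℂ → ℂ) (k : ℕ) (y : ℂ) : ℂ :=
  lineInt c fun s => ρ s * Complex.exp (-y * s) / (s + k)

/-- The matrix `M_{kj}(a) = w_j e^{-aj} (2πi)⁻¹ ∫ ρ(s) e^{-as} / ((s + k) (s + j)) ds`. For real `a`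
it consists of the pairings `∫_a^∞ w_j e^{-jx} G_k(x) dx`. -/
def Mmat (c : ℝ) (ρ : ℂ → ℂ) (w : ℕ → ℂ) (a : ℂ) (k j : ℕ) : ℂ :=
  w j * lineInt c fun s => ρ s * Complex.exp (-a * (s + j)) / ((s + k) * (s + j))

/-- The half strip `0 < Re a`, `|Im a| < 1`. -/
def halfStrip : Set ℂ := {a | 0 < a.re ∧ |a.im| < 1}

theorem isOpen_halfStrip : IsOpen halfStrip :=
  (isOpen_lt continuous_const Complex.continuous_re).inter
    (isOpen_lt (continuous_abs.comp Complex.continuous_im) continuous_const)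

theorem isPreconnected_halfStrip : IsPreconnected halfStrip := by
  have h1 : Convex ℝ {a : ℂ | 0 < a.re} := convex_halfSpace_re_gt 0
  have h2 : Convex ℝ {a : ℂ | a.im < 1} := convex_halfSpace_im_lt 1
  have h3 : Convex ℝ {a : ℂ | -1 < a.im} := convex_halfSpace_im_gt (-1)
  have : halfStrip = {a : ℂ | 0 < a.re} ∩ ({a : ℂ | a.im < 1} ∩ {a : ℂ | -1 < a.im}) := by
    ext a
    simp only [halfStrip, mem_ofPred_eq, mem_inter_iff, abs_lt]
    tauto
  rw [this]
  exact (h1.inter (h2.inter h3)).isPreconnected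

theorem ofReal_mem_halfStrip {a : ℝ} (ha : 0 < a) : (a : ℂ) ∈ halfStrip := by
  simp [halfStrip, ha]

/-- Gaussian decay on the line `Re s = c`, where `1 ≤ c`. -/
structure LineBound (c κ A : ℝ) (ρ : ℂ → ℂ) : Prop where
  one_le : 1 ≤ c
  pos : 0 < κ
  cont : Continuous fun τ : ℝ => ρ (vline c τ)
  bound : ∀ τ : ℝ, ‖ρ (vline c τ)‖ ≤ A * Real.exp (-κ * τ ^ 2)

theorem add_one_le_norm_vline_add {c : ℝ} (hc : 1 ≤ c) (τ : ℝ) (k : ℕ) :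
    (k : ℝ) + 1 ≤ ‖vline c τ + k‖ := by
  have := Complex.re_le_norm (vline c τ + k)
  simp only [Complex.add_re, vline_re, Complex.natCast_re] at this
  linarith

theorem vline_add_ne_zero {c : ℝ} (hc : 0 < c) (τ : ℝ) (k : ℕ) : vline c τ + k ≠ 0 := by
  intro h
  have := congrArg Complex.re h
  simp at this
  have h2 : (0 : ℝ) ≤ k := Nat.cast_nonneg k
  linarith

theorem sum_inv_sq_le (N : ℕ) : ∑ k : Fin N, (1 / (2 * ((k : ℝ) + 1))) ^ 2 ≤ 1 := by
  have h : ∀ N : ℕ, ∑ k ∈ Finset.range N, (1 / (2 * ((k : ℝ) + 1))) ^ 2 ≤ 1 - 1 / (4 * (N : ℝ)) := by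
    intro N
    induction N with
    | zero => simp
    | succ n ih =>
      rw [Finset.sum_range_succ]
      rcases Nat.eq_zero_or_pos n with rfl | hn
      · norm_num
      · have hn' : (0 : ℝ) < n := by exact_mod_cast hn
        have : (1 / (2 * ((n : ℝ) + 1))) ^ 2 ≤ 1 / (4 * (n : ℝ)) - 1 / (4 * ((n : ℝ) + 1)) := by
          rw [div_sub_div _ _ (by positivity) (by positivity), div_pow,
            div_le_div_iff₀ (by positivity) (by positivity)]
          ring_nf
          nlinarith [mul_pos hn' hn']
        push_cast
        linarith
  rw [Fin.sum_univ_eq_sum_range (fun k => (1 / (2 * ((k : ℝ) + 1))) ^ 2) N]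
  refine (h N).trans ?_
  have : 0 ≤ 1 / (4 * (N : ℝ)) := by positivity
  linarith

namespace LineBound

variable {c κ A : ℝ} {ρ : ℂ → ℂ}

theorem nonneg (h : LineBound c κ A ρ) : 0 ≤ A := by
  have := (norm_nonneg _).trans (h.bound 0)
  simpa using this

/-- The constant in the bounds for `Gfun` and `Mmat`. -/
def const (κ A : ℝ) : ℝ := A * Real.exp (1 / (2 * κ)) * √(Real.pi / (κ / 2))

theorem const_nonneg (h : LineBound c κ A ρ) : 0 ≤ const κ A := by
  have := h.nonneg
  unfold const; positivity

theorem norm_mul_exp_le (h : LineBound c κ A ρ) {a : ℂ} (ha : |a.im| < 1) (τ : ℝ) (j : ℕ) :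
    ‖ρ (vline c τ) * Complex.exp (-a * (vline c τ + j))‖ ≤
      A * Real.exp (1 / (2 * κ)) * Real.exp (-(a.re * (c + j))) * Real.exp (-(κ / 2) * τ ^ 2) := by
  have hκ := h.pos
  have hA := h.nonneg
  rw [norm_mul, Complex.norm_exp]
  have h1 : (-a * (vline c τ + j)).re = -(a.re * (c + j)) + a.im * τ := by
    simp
    ring
  have h2 : a.im * τ ≤ |τ| := by
    calc a.im * τ ≤ |a.im| * |τ| := by rw [← abs_mul]; exact le_abs_self _
      _ ≤ 1 * |τ| := by gcongr
      _ = _ := one_mul _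
  have h3 : -κ * τ ^ 2 + |τ| ≤ 1 / (2 * κ) + -(κ / 2) * τ ^ 2 := by
    rw [← sq_abs τ]
    have e : 1 / (2 * κ) + -(κ / 2) * |τ| ^ 2 - (-κ * |τ| ^ 2 + |τ|) =
        (κ * |τ| - 1) ^ 2 / (2 * κ) := by field_simp; ring
    have h3 : 0 ≤ (κ * |τ| - 1) ^ 2 / (2 * κ) := by positivity
    linarith
  rw [h1]
  calc ‖ρ (vline c τ)‖ * Real.exp (-(a.re * (c + j)) + a.im * τ)
      ≤ A * Real.exp (-κ * τ ^ 2) * Real.exp (-(a.re * (c + j)) + |τ|) := by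
        gcongr
        exact h.bound τ
    _ = A * Real.exp (-κ * τ ^ 2 + |τ|) * Real.exp (-(a.re * (c + j))) := by
        rw [Real.exp_add, Real.exp_add]; ring
    _ ≤ A * Real.exp (1 / (2 * κ) + -(κ / 2) * τ ^ 2) * Real.exp (-(a.re * (c + j))) := by gcongr
    _ = _ := by rw [Real.exp_add]; ring

theorem norm_Gfun_le (h : LineBound c κ A ρ) {a : ℂ} (ha : |a.im| < 1) (k : ℕ) :
    ‖Gfun c ρ k a‖ ≤ const κ A * Real.exp (-(a.re * c)) / (k + 1) := by
  have hκ := h.pos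
  have hA := h.nonneg
  have := norm_lineInt_le (c := c) (F := fun s => ρ s * Complex.exp (-a * s) / (s + k))
    (κ := κ / 2) (C := A * Real.exp (1 / (2 * κ)) * Real.exp (-(a.re * c)) / (k + 1))
    (by positivity) fun τ => by
      have h1 := h.norm_mul_exp_le ha τ 0
      simp only [Nat.cast_zero, add_zero] at h1
      rw [norm_div, div_mul_eq_mul_div]
      gcongr
      exact add_one_le_norm_vline_add h.one_le τ k
  refine this.trans (le_of_eq ?_)
  unfold const
  ring

theorem norm_Mmat_le (h : LineBound c κ A ρ) (w : ℕ → ℂ) {a : ℂ} (ha : |a.im| < 1)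
    (ha0 : 0 ≤ a.re) (k j : ℕ) :
    ‖Mmat c ρ w a k j‖ ≤ ‖w j‖ * (const κ A * Real.exp (-(a.re * c))) / (k + 1) := by
  have hκ := h.pos
  have hA := h.nonneg
  have := norm_lineInt_le (c := c)
    (F := fun s => ρ s * Complex.exp (-a * (s + j)) / ((s + k) * (s + j)))
    (κ := κ / 2) (C := A * Real.exp (1 / (2 * κ)) * Real.exp (-(a.re * c)) / (k + 1))
    (by positivity) fun τ => by
      have h1 := h.norm_mul_exp_le ha τ j
      have h2 : Real.exp (-(a.re * (c + j))) ≤ Real.exp (-(a.re * c)) := by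
        refine Real.exp_le_exp.2 ?_
        have : 0 ≤ a.re * j := by positivity
        linarith
      rw [norm_div, div_mul_eq_mul_div, norm_mul (vline c τ + k)]
      have h3 := add_one_le_norm_vline_add h.one_le τ k
      have h4 : (1 : ℝ) ≤ ‖vline c τ + j‖ := by
        have := add_one_le_norm_vline_add h.one_le τ j
        have h5 : (0 : ℝ) ≤ j := Nat.cast_nonneg j
        linarith
      have h6 : (k : ℝ) + 1 ≤ ‖vline c τ + k‖ * ‖vline c τ + j‖ := by
        have : (0 : ℝ) ≤ (k : ℝ) + 1 := by positivity
        nlinarith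
      gcongr
      exact h1.trans (by gcongr)
  unfold Mmat
  rw [norm_mul, mul_div_assoc]
  refine mul_le_mul_of_nonneg_left (this.trans (le_of_eq ?_)) (norm_nonneg _)
  unfold const
  ring

theorem colBound (h : LineBound c κ A ρ) {w : ℕ → ℂ} (hw : Summable fun j => ‖w j‖) {a : ℂ}
    (ha : a ∈ halfStrip) : ColBound (Mmat c ρ w a) (fun j => ‖w j‖ * (2 * const κ A))
      (fun k => 1 / (2 * ((k : ℝ) + 1))) where
  bound k j := by
    refine (h.norm_Mmat_le w ha.2 ha.1.le k j).trans ?_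
    have h1 : Real.exp (-(a.re * c)) ≤ 1 := by
      rw [Real.exp_le_one_iff]
      have := mul_pos ha.1 (zero_lt_one.trans_le h.one_le)
      linarith
    have h2 := h.const_nonneg
    calc ‖w j‖ * (const κ A * Real.exp (-(a.re * c))) / (k + 1)
        ≤ ‖w j‖ * (const κ A * 1) / (k + 1) := by gcongr
      _ = _ := by field_simp
  eps_nonneg j := by have := h.const_nonneg; positivity
  summable := hw.mul_right _
  eta_nonneg k := by positivity
  eta_sq := sum_inv_sq_le

theorem integrable_mul_exp_div (h : LineBound c κ A ρ) {a : ℂ} (ha : |a.im| < 1)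
    (ha0 : 0 ≤ a.re) (j : ℕ) {f : ℝ → ℂ} (hf : Continuous f) (hf1 : ∀ τ, 1 ≤ ‖f τ‖) :
    Integrable fun τ => ρ (vline c τ) * Complex.exp (-a * (vline c τ + j)) / f τ := by
  have hκ := h.pos
  have hA := h.nonneg
  refine ((integrable_exp_neg_mul_sq (b := κ / 2) (by positivity)).const_mul
    (A * Real.exp (1 / (2 * κ)))).mono' ?_ (Eventually.of_forall fun τ => ?_)
  · refine Continuous.aestronglyMeasurable ?_
    have := continuous_vline c
    have h1 : ∀ τ, f τ ≠ 0 := fun τ h0 => by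
      have := hf1 τ; rw [h0, norm_zero] at this; linarith
    exact (h.cont.mul (by fun_prop)).div hf h1
  · rw [norm_div]
    refine (div_le_self (norm_nonneg _) (hf1 τ)).trans ((h.norm_mul_exp_le ha τ j).trans ?_)
    have h1 : Real.exp (-(a.re * (c + j))) ≤ 1 := by
      rw [Real.exp_le_one_iff]
      have := h.one_le
      have : 0 ≤ a.re * (c + j) := by positivity
      linarith
    have h2 : 0 ≤ A * Real.exp (1 / (2 * κ)) := by positivity
    calc _ ≤ A * Real.exp (1 / (2 * κ)) * 1 * Real.exp (-(κ / 2) * τ ^ 2) := by gcongr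
      _ = _ := by rw [mul_one]

theorem one_le_norm_vline_add (h : LineBound c κ A ρ) (τ : ℝ) (k : ℕ) : 1 ≤ ‖vline c τ + k‖ := by
  have := add_one_le_norm_vline_add h.one_le τ k
  have h5 : (0 : ℝ) ≤ k := Nat.cast_nonneg k
  linarith

/-- Differentiating in `a` cancels the factor `s + j`, so that the derivative has rank one. -/
theorem hasDerivAt_Mmat (h : LineBound c κ A ρ) (w : ℕ → ℂ) {a : ℂ} (ha : a ∈ halfStrip)
    (k j : ℕ) : HasDerivAt (fun a => Mmat c ρ w a k j)
      (-(Gfun c ρ k a * (w j * Complex.exp (-a * j)))) a := by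
  have hκ := h.pos
  have hA := h.nonneg
  have hc0 : 0 < c := zero_lt_one.trans_le h.one_le
  have hcv := continuous_vline c
  have hmul : ∀ τ, 1 ≤ ‖(vline c τ + k) * (vline c τ + j)‖ := fun τ => by
    rw [norm_mul]
    have h1 := h.one_le_norm_vline_add τ k
    have h2 := h.one_le_norm_vline_add τ j
    nlinarith
  have key := hasDerivAt_integral_of_dominated_loc_of_deriv_le (𝕜 := ℂ) (μ := volume)
    (F := fun a τ => ρ (vline c τ) * Complex.exp (-a * (vline c τ + j)) /
      ((vline c τ + k) * (vline c τ + j)))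
    (F' := fun a τ => -(ρ (vline c τ) * Complex.exp (-a * (vline c τ + j)) / (vline c τ + k)))
    (bound := fun τ => A * Real.exp (1 / (2 * κ)) * Real.exp (-(κ / 2) * τ ^ 2))
    (x₀ := a) (isOpen_halfStrip.mem_nhds ha) ?_ ?_ ?_ ?_ ?_ ?_
  · have h2 := (key.2.const_mul ((2 * Real.pi : ℂ)⁻¹)).const_mul (w j)
    refine h2.congr_deriv ?_
    have h3 : ∀ τ, ρ (vline c τ) * Complex.exp (-a * (vline c τ + j)) / (vline c τ + k) =
        Complex.exp (-a * j) * (ρ (vline c τ) * Complex.exp (-a * vline c τ) / (vline c τ + k)) := by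
      intro τ
      rw [mul_add, Complex.exp_add]; ring
    simp only [h3]
    rw [integral_neg, integral_const_mul]
    unfold Gfun lineInt
    ring
  · filter_upwards [isOpen_halfStrip.mem_nhds ha] with z hz
    exact (h.integrable_mul_exp_div hz.2 hz.1.le j (by fun_prop) hmul).aestronglyMeasurable
  · exact h.integrable_mul_exp_div ha.2 ha.1.le j (by fun_prop) hmul
  · exact (h.integrable_mul_exp_div ha.2 ha.1.le j (by fun_prop)
      fun τ => h.one_le_norm_vline_add τ k).neg.aestronglyMeasurable
  · refine Eventually.of_forall fun τ z hz => ?_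
    rw [norm_neg, norm_div]
    refine (div_le_self (norm_nonneg _) (h.one_le_norm_vline_add τ k)).trans
      ((h.norm_mul_exp_le hz.2 τ j).trans ?_)
    have h1 : Real.exp (-(z.re * (c + j))) ≤ 1 := by
      rw [Real.exp_le_one_iff]
      have := hz.1
      have : 0 ≤ z.re * (c + j) := by positivity
      linarith
    calc _ ≤ A * Real.exp (1 / (2 * κ)) * 1 * Real.exp (-(κ / 2) * τ ^ 2) := by gcongr
      _ = _ := by rw [mul_one]
  · exact (integrable_exp_neg_mul_sq (b := κ / 2) (by positivity)).const_mul _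
  · refine Eventually.of_forall fun τ z _ => ?_
    have h1 : HasDerivAt (fun a : ℂ => Complex.exp (-a * (vline c τ + j)))
        (Complex.exp (-z * (vline c τ + j)) * (-1 * (vline c τ + j))) z :=
      ((hasDerivAt_id z).neg.mul_const _).cexp
    refine ((h1.const_mul (ρ (vline c τ))).div_const _).congr_deriv ?_
    have e1 := vline_add_ne_zero hc0 τ k
    have e2 := vline_add_ne_zero hc0 τ j
    field_simp

/-- `det (1 - M(a))` is holomorphic, with logarithmic derivative given by Cramer numerators. -/
theorem hasDerivAt_infDet_Mmat (h : LineBound c κ A ρ) {w : ℕ → ℂ} (hw : Summable fun j => ‖w j‖)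
    {a : ℂ} (ha : a ∈ halfStrip) : HasDerivAt (fun a => infDet (Mmat c ρ w a))
      (∑' j, w j * Complex.exp (-a * j) *
        infDet (replaceCol (Mmat c ρ w a) (fun k => Gfun c ρ k a) j)) a := by
  have hC := h.const_nonneg
  refine CritRH.hasDerivAt_infDet isOpen_halfStrip (M := Mmat c ρ w)
    (fun z hz => h.colBound hw hz) (ξ := fun a j => w j * Complex.exp (-a * j))
    (g := fun a k => Gfun c ρ k a) (R := 2 * const κ A) (by positivity)
    (fun z hz k j => h.hasDerivAt_Mmat w hz k j) (fun z hz k => ?_) (fun z hz => ?_) ha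
  · refine (h.norm_Gfun_le hz.2 k).trans ?_
    have h1 : Real.exp (-(z.re * c)) ≤ 1 := by
      rw [Real.exp_le_one_iff]
      have := mul_pos hz.1 (zero_lt_one.trans_le h.one_le)
      linarith
    calc const κ A * Real.exp (-(z.re * c)) / (k + 1)
        ≤ const κ A * 1 / (k + 1) := by gcongr
      _ = _ := by field_simp
  · refine Summable.of_nonneg_of_le (fun _ => norm_nonneg _) (fun j => ?_) hw
    rw [norm_mul, Complex.norm_exp]
    have : Real.exp (-z * j).re ≤ 1 := by
      rw [Real.exp_le_one_iff]
      have := mul_nonneg hz.1.le (Nat.cast_nonneg (α := ℝ) j)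
      simpa using this
    exact mul_le_of_le_one_right (norm_nonneg _) this

end LineBound

/-- Fubini for exponentials against a line integral, on a right half line. -/
theorem integral_Ioi_exp_mul_lineInt {c κ A : ℝ} {F : ℂ → ℂ}
    (hcont : Continuous fun τ : ℝ => F (vline c τ)) (hκ : 0 < κ)
    (hb : ∀ τ : ℝ, ‖F (vline c τ)‖ ≤ A * Real.exp (-κ * τ ^ 2)) {j : ℂ} (hj : 0 < c + j.re) (a : ℝ) :
    ∫ x in Ioi a, Complex.exp (-j * x) * lineInt c (fun s => F s * Complex.exp (-x * s)) =
      lineInt c fun s => F s * Complex.exp (-a * (s + j)) / (s + j) := by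
  have h1 : ∀ τ : ℝ, F (vline c τ) * Complex.exp (-a * (vline c τ + j)) / (vline c τ + j) =
      ∫ x in Ioi a, F (vline c τ) * Complex.exp (-(vline c τ + j) * x) := by
    intro τ
    rw [integral_const_mul, integral_exp_mul_complex_Ioi (by simpa using by linarith)]
    rw [div_neg, neg_div, neg_neg, mul_div_assoc]
    congr 3
    ring
  have h2 : ∀ x : ℝ, Complex.exp (-j * x) * lineInt c (fun s => F s * Complex.exp (-x * s)) =
      (2 * Real.pi : ℂ)⁻¹ * ∫ τ : ℝ, F (vline c τ) * Complex.exp (-(vline c τ + j) * x) := by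
    intro x
    unfold lineInt
    rw [mul_left_comm, ← integral_const_mul]
    congr 1
    refine integral_congr_ae (Eventually.of_forall fun τ => ?_)
    simp only
    rw [mul_left_comm, ← Complex.exp_add]
    congr 2
    ring
  simp only [h2]
  unfold lineInt
  simp only [h1]
  rw [integral_const_mul]
  congr 1
  refine integral_integral_swap ?_
  have hi : Integrable (fun p : ℝ × ℝ => Real.exp (-(c + j.re) * p.1) *
      (A * Real.exp (-κ * p.2 ^ 2))) ((volume.restrict (Ioi a)).prod volume) := by
    exact (integrableOn_exp_mul_Ioi (by linarith) a).mul_prod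
      ((integrable_exp_neg_mul_sq hκ).const_mul _)
  refine hi.mono' ?_ (Eventually.of_forall fun p => ?_)
  · refine Continuous.aestronglyMeasurable ?_
    have := continuous_vline c
    unfold Function.uncurry
    exact (hcont.comp continuous_snd).mul (by fun_prop)
  · simp only [Function.uncurry]
    rw [norm_mul, Complex.norm_exp, mul_comm]
    refine mul_le_mul (le_of_eq ?_) (hb _) (norm_nonneg _) (Real.exp_nonneg _)
    congr 1
    simp

/-- Fubini for exponentials against a line integral, on a left half line. -/
theorem integral_Iic_exp_mul_lineInt {c κ A : ℝ} {F : ℂ → ℂ}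
    (hcont : Continuous fun τ : ℝ => F (vline c τ)) (hκ : 0 < κ)
    (hb : ∀ τ : ℝ, ‖F (vline c τ)‖ ≤ A * Real.exp (-κ * τ ^ 2)) {j : ℂ} (hj : c + j.re < 0) (a : ℝ) :
    ∫ x in Iic a, Complex.exp (-j * x) * lineInt c (fun s => F s * Complex.exp (-x * s)) =
      -lineInt c fun s => F s * Complex.exp (-a * (s + j)) / (s + j) := by
  have h1 : ∀ τ : ℝ, F (vline c τ) * Complex.exp (-a * (vline c τ + j)) / (vline c τ + j) =
      -∫ x in Iic a, F (vline c τ) * Complex.exp (-(vline c τ + j) * x) := by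
    intro τ
    rw [integral_const_mul, integral_exp_mul_complex_Iic (by simpa using by linarith)]
    rw [div_neg, mul_neg, neg_neg, mul_div_assoc]
    congr 3
    ring
  have h2 : ∀ x : ℝ, Complex.exp (-j * x) * lineInt c (fun s => F s * Complex.exp (-x * s)) =
      (2 * Real.pi : ℂ)⁻¹ * ∫ τ : ℝ, F (vline c τ) * Complex.exp (-(vline c τ + j) * x) := by
    intro x
    unfold lineInt
    rw [mul_left_comm, ← integral_const_mul]
    congr 1
    refine integral_congr_ae (Eventually.of_forall fun τ => ?_)
    simp only
    rw [mul_left_comm, ← Complex.exp_add]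
    congr 2
    ring
  simp only [h2]
  unfold lineInt
  simp only [h1]
  rw [integral_const_mul, integral_neg, mul_neg, neg_neg]
  congr 1
  refine integral_integral_swap ?_
  have hi : Integrable (fun p : ℝ × ℝ => Real.exp (-(c + j.re) * p.1) *
      (A * Real.exp (-κ * p.2 ^ 2))) ((volume.restrict (Iic a)).prod volume) := by
    have e : IntegrableOn (fun x : ℝ => Real.exp (-(c + j.re) * x)) (Iic a) :=
      integrableOn_exp_mul_Iic (by linarith) a
    exact Integrable.mul_prod e ((integrable_exp_neg_mul_sq hκ).const_mul _)
  refine hi.mono' ?_ (Eventually.of_forall fun p => ?_)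
  · refine Continuous.aestronglyMeasurable ?_
    have := continuous_vline c
    unfold Function.uncurry
    exact (hcont.comp continuous_snd).mul (by fun_prop)
  · simp only [Function.uncurry]
    rw [norm_mul, Complex.norm_exp, mul_comm]
    refine mul_le_mul (le_of_eq ?_) (hb _) (norm_nonneg _) (Real.exp_nonneg _)
    congr 1
    simp

theorem measurable_lineInt_exp {c : ℝ} {F : ℂ → ℂ}
    (hcont : Continuous fun τ : ℝ => F (vline c τ)) :
    Measurable fun x : ℝ => lineInt c (fun s => F s * Complex.exp (-x * s)) := by
  unfold lineInt
  refine Measurable.const_mul (StronglyMeasurable.measurable ?_) _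
  refine StronglyMeasurable.integral_prod_right (ν := volume)
    (f := fun (x τ : ℝ) => F (vline c τ) * Complex.exp (-(x : ℂ) * vline c τ)) ?_
  refine Continuous.stronglyMeasurable ?_
  have := continuous_vline c
  unfold Function.uncurry
  exact (hcont.comp continuous_snd).mul (by fun_prop)

theorem norm_lineInt_exp_le {c κ A : ℝ} {F : ℂ → ℂ} (hκ : 0 < κ)
    (hb : ∀ τ : ℝ, ‖F (vline c τ)‖ ≤ A * Real.exp (-κ * τ ^ 2)) (x : ℝ) :
    ‖lineInt c (fun s => F s * Complex.exp (-x * s))‖ ≤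
      A * √(Real.pi / κ) * Real.exp (-c * x) := by
  refine (norm_lineInt_le (C := A * Real.exp (-c * x)) hκ fun τ => ?_).trans (le_of_eq (by ring))
  rw [norm_mul, Complex.norm_exp]
  have : (-(x : ℂ) * vline c τ).re = -c * x := by simp; ring
  rw [this, mul_right_comm]
  gcongr
  exact hb τ

/-! ### Fredholm determinants of the kernels as limits of finite determinants -/

/-- The kernel `∑_k w_k e^{-kx} G_k(y)`. -/
def sumKernel (c : ℝ) (ρ : ℂ → ℂ) (w : ℕ → ℂ) (x y : ℝ) : ℂ :=
  ∑' k : ℕ, w k * Complex.exp (-(k : ℂ) * x) * Gfun c ρ k y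

/-- The truncation of `sumKernel` to the first `N` terms. -/
def finKernel (c : ℝ) (ρ : ℂ → ℂ) (w : ℕ → ℂ) (N : ℕ) (x y : ℝ) : ℂ :=
  ∑ k : Fin N, w k * Complex.exp (-((k : ℕ) : ℂ) * x) * Gfun c ρ k y

theorem norm_exp_neg_nat_mul_le {x : ℝ} (hx : 0 ≤ x) (k : ℕ) :
    ‖Complex.exp (-(k : ℂ) * x)‖ ≤ 1 := by
  rw [Complex.norm_exp, Real.exp_le_one_iff]
  have := mul_nonneg (Nat.cast_nonneg (α := ℝ) k) hx
  simpa using this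

theorem Gfun_eq (c : ℝ) (ρ : ℂ → ℂ) (k : ℕ) (y : ℂ) :
    Gfun c ρ k y = lineInt c fun s => ρ s / (s + k) * Complex.exp (-y * s) := by
  unfold Gfun
  refine lineInt_congr fun s _ => ?_
  ring

namespace LineBound

variable {c κ A : ℝ} {ρ : ℂ → ℂ}

theorem div_cont (h : LineBound c κ A ρ) (k : ℕ) :
    Continuous fun τ : ℝ => ρ (vline c τ) / (vline c τ + k) :=
  h.cont.div ((continuous_vline c).add continuous_const)
    fun τ => vline_add_ne_zero (zero_lt_one.trans_le h.one_le) τ k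

theorem div_bound (h : LineBound c κ A ρ) (k : ℕ) (τ : ℝ) :
    ‖ρ (vline c τ) / (vline c τ + k)‖ ≤ A * Real.exp (-κ * τ ^ 2) := by
  rw [norm_div]
  exact (div_le_self (norm_nonneg _) (h.one_le_norm_vline_add τ k)).trans (h.bound τ)

theorem measurable_Gfun (h : LineBound c κ A ρ) (k : ℕ) :
    Measurable fun y : ℝ => Gfun c ρ k y := by
  simp only [Gfun_eq]
  exact measurable_lineInt_exp (F := fun s => ρ s / (s + k)) (h.div_cont k)

theorem norm_Gfun_real_le (h : LineBound c κ A ρ) (k : ℕ) (y : ℝ) :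
    ‖Gfun c ρ k y‖ ≤ const κ A * Real.exp (-c * y) := by
  have h1 := h.norm_Gfun_le (a := y) (by simp) k
  refine h1.trans ?_
  have h2 := h.const_nonneg
  have : -((y : ℂ).re * c) = -c * y := by simp; ring
  rw [this]
  refine div_le_self (by positivity) ?_
  have : (0 : ℝ) ≤ k := Nat.cast_nonneg k
  linarith

theorem norm_term_le (h : LineBound c κ A ρ) {w : ℕ → ℂ} {x : ℝ} (hx : 0 ≤ x) (y : ℝ) (k : ℕ) :
    ‖w k * Complex.exp (-(k : ℂ) * x) * Gfun c ρ k y‖ ≤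
      ‖w k‖ * (const κ A * Real.exp (-c * y)) := by
  rw [norm_mul, norm_mul]
  have h1 := norm_exp_neg_nat_mul_le hx k
  have h2 := h.norm_Gfun_real_le k y
  calc _ ≤ ‖w k‖ * 1 * (const κ A * Real.exp (-c * y)) := by gcongr
    _ = _ := by ring

theorem measurable_finKernel (h : LineBound c κ A ρ) (w : ℕ → ℂ) (N : ℕ) :
    Measurable (Function.uncurry (finKernel c ρ w N)) := by
  unfold finKernel Function.uncurry
  refine Finset.measurable_fun_sum _ fun k _ => ?_
  refine Measurable.mul ?_ ((h.measurable_Gfun k).comp measurable_snd)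
  refine Continuous.measurable ?_
  fun_prop

theorem norm_finKernel_le (h : LineBound c κ A ρ) {w : ℕ → ℂ} {W : ℕ → ℝ}
    (hw : ∀ k, ‖w k‖ ≤ W k) (hW : Summable W) (N : ℕ) {x : ℝ} (hx : 0 ≤ x) (y : ℝ) :
    ‖finKernel c ρ w N x y‖ ≤ (∑' k, W k) * const κ A * Real.exp (-c * y) := by
  have hC := h.const_nonneg
  have hW0 : ∀ k, 0 ≤ W k := fun k => (norm_nonneg _).trans (hw k)
  unfold finKernel
  calc _ ≤ ∑ k : Fin N, W k * (const κ A * Real.exp (-c * y)) := by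
        refine norm_sum_le_of_le _ fun k _ => (h.norm_term_le hx y k).trans ?_
        gcongr
        exact hw k
    _ = (∑ k ∈ Finset.range N, W k) * (const κ A * Real.exp (-c * y)) := by
        rw [← Finset.sum_mul, Fin.sum_univ_eq_sum_range W N]
    _ ≤ (∑' k, W k) * (const κ A * Real.exp (-c * y)) := by
        gcongr
        exact hW.sum_le_tsum _ fun i _ => hW0 i
    _ = _ := by ring

theorem norm_sumKernel_le (h : LineBound c κ A ρ) {w : ℕ → ℂ} {W : ℕ → ℝ}
    (hw : ∀ k, ‖w k‖ ≤ W k) (hW : Summable W) {x : ℝ} (hx : 0 ≤ x) (y : ℝ) :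
    ‖sumKernel c ρ w x y‖ ≤ (∑' k, W k) * const κ A * Real.exp (-c * y) := by
  have hC := h.const_nonneg
  unfold sumKernel
  rw [mul_assoc]
  refine tsum_of_norm_bounded (hW.hasSum.mul_right _) fun k => (h.norm_term_le hx y k).trans ?_
  gcongr
  exact hw k

theorem integrableOn_term (h : LineBound c κ A ρ) (w : ℂ) (j k : ℕ) {a : ℝ} (ha : 0 ≤ a) :
    IntegrableOn (fun x : ℝ => w * Complex.exp (-(j : ℂ) * x) * Gfun c ρ k x) (Ioi a) := by
  have hC := h.const_nonneg
  have h0 : IntegrableOn (fun x : ℝ => ‖w‖ * (const κ A * Real.exp (-c * x))) (Ioi a) :=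
    ((integrableOn_exp_mul_Ioi (by linarith [h.one_le]) a).const_mul _).const_mul _
  refine h0.mono' ?_ ?_
  · exact ((Continuous.measurable (by fun_prop)).mul (h.measurable_Gfun k)).aestronglyMeasurable
  · filter_upwards [ae_restrict_mem measurableSet_Ioi] with x hx
    have hx0 : 0 ≤ x := ha.trans (le_of_lt hx)
    rw [norm_mul, norm_mul]
    have h1 := norm_exp_neg_nat_mul_le hx0 j
    have h2 := h.norm_Gfun_real_le k x
    calc _ ≤ ‖w‖ * 1 * (const κ A * Real.exp (-c * x)) := by gcongr
      _ = _ := by ring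

theorem integral_Ioi_term (h : LineBound c κ A ρ) (w : ℕ → ℂ) (j k : ℕ) (a : ℝ) :
    ∫ x in Ioi a, w j * Complex.exp (-(j : ℂ) * x) * Gfun c ρ k x = Mmat c ρ w a k j := by
  simp only [mul_assoc, Gfun_eq]
  have hc : (0 : ℝ) < c + (j : ℂ).re := by
    have : (0 : ℝ) ≤ j := Nat.cast_nonneg j
    simp only [Complex.natCast_re]
    linarith [h.one_le]
  rw [integral_const_mul, integral_Ioi_exp_mul_lineInt (F := fun s => ρ s / (s + k)) (h.div_cont k)
    h.pos (h.div_bound k) hc]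
  unfold Mmat
  congr 1
  refine lineInt_congr fun s _ => ?_
  rw [div_mul_eq_mul_div, div_div]

theorem tsum_fredTerm_finKernel (h : LineBound c κ A ρ) (w : ℕ → ℂ) (N : ℕ) {a : ℝ} (ha : 0 ≤ a) :
    ∑' n, fredTerm (Ioi a) (finKernel c ρ w N) n = (1 - corner (Mmat c ρ w a) N).det := by
  have := tsum_fredTerm_finite_rank (S := Ioi a) (N := N)
    (u := fun k x => w k * Complex.exp (-((k : ℕ) : ℂ) * x)) (G := fun k y => Gfun c ρ k y)
    (fun j k => h.integrableOn_term (w j) j k ha)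
  simp only [h.integral_Ioi_term] at this
  exact this

end LineBound

theorem tendsto_Gfun {c κ A : ℝ} {ρ : ℕ → ℂ → ℂ} {ρ' : ℂ → ℂ}
    (h : ∀ N, LineBound c κ A (ρ N))
    (hlim : ∀ τ : ℝ, Tendsto (fun N => ρ N (vline c τ)) atTop (𝓝 (ρ' (vline c τ))))
    (k : ℕ) (y : ℝ) : Tendsto (fun N => Gfun c (ρ N) k y) atTop (𝓝 (Gfun c ρ' k y)) := by
  unfold Gfun lineInt
  refine Tendsto.const_mul _ ?_
  have hκ := (h 0).pos
  refine tendsto_integral_of_dominated_convergence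
    (fun τ => A * Real.exp (1 / (2 * κ)) * Real.exp (-(y * c)) * Real.exp (-(κ / 2) * τ ^ 2))
    (fun N => ?_) ?_ (fun N => Eventually.of_forall fun τ => ?_) (Eventually.of_forall fun τ => ?_)
  · have := continuous_vline c
    refine Continuous.aestronglyMeasurable ?_
    exact ((h N).cont.mul (by fun_prop)).div (by fun_prop)
      fun τ => vline_add_ne_zero (zero_lt_one.trans_le (h N).one_le) τ k
  · exact (integrable_exp_neg_mul_sq (b := κ / 2) (by positivity)).const_mul _
  · have := (h N).norm_mul_exp_le (a := y) (by simp) τ 0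
    simp only [Nat.cast_zero, add_zero, Complex.ofReal_re] at this
    rw [norm_div]
    exact (div_le_self (norm_nonneg _) ((h N).one_le_norm_vline_add τ k)).trans this
  · exact ((hlim τ).mul_const _).div_const _

/-- The Fredholm determinant of a limit of kernels is the limit of the finite determinants. -/
theorem tendsto_det_Mmat {c κ A : ℝ} {ρ : ℕ → ℂ → ℂ} {ρ' : ℂ → ℂ}
    (h : ∀ N, LineBound c κ A (ρ N))
    (hlim : ∀ τ : ℝ, Tendsto (fun N => ρ N (vline c τ)) atTop (𝓝 (ρ' (vline c τ))))
    {w : ℕ → ℕ → ℂ} {w' : ℕ → ℂ} {W : ℕ → ℝ} (hw : ∀ N k, ‖w N k‖ ≤ W k) (hW : Summable W)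
    (hwlim : ∀ k, Tendsto (fun N => w N k) atTop (𝓝 (w' k))) {m : ℕ → ℕ}
    (hm : Tendsto m atTop atTop) {a : ℝ} (ha : 0 ≤ a) :
    Tendsto (fun N => (1 - corner (Mmat c (ρ N) (w N) a) (m N)).det) atTop
      (𝓝 (∑' n, fredTerm (Ioi a) (sumKernel c ρ' w') n)) := by
  simp only [← (h _).tsum_fredTerm_finKernel _ _ ha]
  refine tendsto_tsum_fredTerm measurableSet_Ioi (fun N => (h N).measurable_finKernel _ _)
    (q := fun y => (∑' k, W k) * LineBound.const κ A * Real.exp (-c * y))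
    (fun N x hx y _ => (h N).norm_finKernel_le (hw N) hW _ (ha.trans (le_of_lt hx)) y) ?_ ?_
  · exact (integrableOn_exp_mul_Ioi (by linarith [(h 0).one_le]) a).const_mul _
  · intro x hx y _
    have hx0 : 0 ≤ x := ha.trans (le_of_lt hx)
    have e : ∀ N, finKernel c (ρ N) (w N) (m N) x y = ∑' k : ℕ, if k < m N then
        w N k * Complex.exp (-(k : ℂ) * x) * Gfun c (ρ N) k y else 0 := by
      intro N
      rw [tsum_eq_sum (s := Finset.range (m N)) (by intro b hb; simp at hb; simp [hb])]
      rw [← Fin.sum_univ_eq_sum_range (fun k => if k < m N then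
        w N k * Complex.exp (-(k : ℂ) * x) * Gfun c (ρ N) k y else 0) (m N)]
      exact Finset.sum_congr rfl fun k _ => by rw [if_pos k.2]
    simp only [e]
    have hC := (h 0).const_nonneg
    refine tendsto_tsum_of_dominated_convergence
      (bound := fun k => W k * (LineBound.const κ A * Real.exp (-c * y))) (hW.mul_right _) ?_ ?_
    · intro k
      refine (((hwlim k).mul_const _).mul (tendsto_Gfun h hlim k y)).congr' ?_
      filter_upwards [hm.eventually_gt_atTop k] with N hN
      simp [hN]
    · refine Eventually.of_forall fun N k => ?_
      have hWk : 0 ≤ W k := (norm_nonneg _).trans (hw N k)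
      split_ifs
      · refine ((h N).norm_term_le hx0 y k).trans ?_
        gcongr
        exact hw N k
      · rw [norm_zero]; positivity

/-! ### The symbols -/

/-- The symbol `e^{αs²/2} / Γ(s)` of the critical kernel. -/
def critSym (α : ℝ) (s : ℂ) : ℂ := Complex.exp (α * s ^ 2 / 2) * (Complex.Gamma s)⁻¹

/-- Replacing `Γ` by Euler's approximant gives the symbol of a finite ensemble. -/
def approxSym (α : ℝ) (n : ℕ) (s : ℂ) : ℂ :=
  Complex.exp (α * s ^ 2 / 2) * (Complex.GammaSeq s (n + 1))⁻¹

/-- The residues `(-1)^j / j! e^{-αj²/2}` of `Γ(t) e^{-αt²/2}`. -/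
def critW (α : ℝ) (j : ℕ) : ℂ := (-1) ^ j / (j ! : ℂ) * Real.exp (-(α * j ^ 2 / 2))

/-- The residues of `GammaSeq t (n + 1) e^{-αt²/2}`. -/
def approxW (α : ℝ) (n j : ℕ) : ℂ :=
  critW α j * (((n + 1).descFactorial j : ℕ) / ((n + 1 : ℕ) : ℂ) ^ j)

theorem norm_critW_le {α : ℝ} (hα : 0 ≤ α) (j : ℕ) : ‖critW α j‖ ≤ 1 / j ! := by
  unfold critW
  rw [norm_mul, norm_div, norm_pow, norm_neg, norm_one, one_pow, Complex.norm_natCast,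
    Complex.norm_real, Real.norm_of_nonneg (Real.exp_nonneg _)]
  refine mul_le_of_le_one_right (by positivity) ?_
  rw [Real.exp_le_one_iff]
  have : 0 ≤ α * j ^ 2 / 2 := by positivity
  linarith

theorem summable_inv_factorial : Summable fun j : ℕ => 1 / (j ! : ℝ) := by
  simpa using Real.summable_pow_div_factorial 1

theorem norm_approxW_le {α : ℝ} (hα : 0 ≤ α) (n j : ℕ) : ‖approxW α n j‖ ≤ 1 / j ! := by
  unfold approxW
  rw [norm_mul]
  refine (mul_le_of_le_one_right (norm_nonneg _) ?_).trans (norm_critW_le hα j)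
  rw [norm_div, norm_pow, Complex.norm_natCast, Complex.norm_natCast]
  refine div_le_one_of_le₀ ?_ (by positivity)
  exact_mod_cast Nat.descFactorial_le_pow (n + 1) j

theorem tendsto_approxW (α : ℝ) (j : ℕ) :
    Tendsto (fun n => approxW α n j) atTop (𝓝 (critW α j)) := by
  have h : Tendsto (fun n : ℕ => ((n.descFactorial j : ℕ) : ℂ) / (n : ℂ) ^ j) atTop (𝓝 1) := by
    induction j with
    | zero => simp
    | succ j ih =>
      have h1 : Tendsto (fun n : ℕ => 1 - (j : ℂ) / (n : ℂ)) atTop (𝓝 1) := by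
        have := (tendsto_const_div_atTop_nhds_zero_nat (j : ℂ)).const_sub 1
        simpa using this
      have := h1.mul ih
      rw [one_mul] at this
      refine this.congr' ?_
      filter_upwards [eventually_ge_atTop (j + 1)] with n hn
      have hn0 : (n : ℂ) ≠ 0 := by
        have : n ≠ 0 := by omega
        exact_mod_cast this
      rw [Nat.descFactorial_succ, Nat.cast_mul, Nat.cast_sub (by omega), pow_succ]
      field_simp
  have := ((tendsto_add_atTop_iff_nat 1).2 h).const_mul (critW α j)
  simpa [approxW] using this

theorem prod_one_add_sq_le (n : ℕ) (τ : ℝ) :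
    ∏ j ∈ Finset.range n, (1 + τ ^ 2 / ((j : ℝ) + 1) ^ 2) ≤ Real.exp (4 * (|τ| + 1)) := by
  have hpos : ∀ (t : ℝ) (j : ℕ), 1 ≤ 1 + t ^ 2 / ((j : ℝ) + 1) ^ 2 := fun t j => by
    have : 0 ≤ t ^ 2 / ((j : ℝ) + 1) ^ 2 := by positivity
    linarith
  -- Euler's product for `sin (π i t)` bounds the partial products
  have h1 : ∀ t : ℝ, 1 ≤ t →
      ∏ j ∈ Finset.range n, (1 + t ^ 2 / ((j : ℝ) + 1) ^ 2) ≤ Real.exp (4 * t) := by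
    intro t ht
    have hlim := (Complex.tendsto_euler_sin_prod (t * Complex.I)).norm
    have e : ∀ m : ℕ, ‖(Real.pi : ℂ) * (t * Complex.I) *
        ∏ j ∈ Finset.range m, (1 - (t * Complex.I) ^ 2 / ((j : ℂ) + 1) ^ 2)‖ =
        Real.pi * t * ∏ j ∈ Finset.range m, (1 + t ^ 2 / ((j : ℝ) + 1) ^ 2) := by
      intro m
      have : ∏ j ∈ Finset.range m, (1 - ((t : ℂ) * Complex.I) ^ 2 / ((j : ℂ) + 1) ^ 2) =
          ((∏ j ∈ Finset.range m, (1 + t ^ 2 / ((j : ℝ) + 1) ^ 2) : ℝ) : ℂ) := by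
        push_cast
        refine Finset.prod_congr rfl fun j _ => ?_
        rw [mul_pow, Complex.I_sq]; ring
      rw [this, norm_mul, norm_mul, norm_mul, Complex.norm_I, Complex.norm_real, Complex.norm_real,
        Complex.norm_real, Real.norm_of_nonneg Real.pi_pos.le, Real.norm_of_nonneg (by linarith),
        Real.norm_of_nonneg (Finset.prod_nonneg fun j _ => zero_le_one.trans (hpos t j)), mul_one]
    simp only [e] at hlim
    have hmono : Monotone fun m : ℕ =>
        Real.pi * t * ∏ j ∈ Finset.range m, (1 + t ^ 2 / ((j : ℝ) + 1) ^ 2) := by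
      refine monotone_nat_of_le_succ fun m => ?_
      rw [Finset.prod_range_succ]
      have h0 : 0 ≤ ∏ j ∈ Finset.range m, (1 + t ^ 2 / ((j : ℝ) + 1) ^ 2) :=
        Finset.prod_nonneg fun j _ => zero_le_one.trans (hpos t j)
      have := mul_le_mul_of_nonneg_left (hpos t m) h0
      have hp : 0 ≤ Real.pi * t := by have := Real.pi_pos; positivity
      nlinarith [mul_le_mul_of_nonneg_left this hp]
    have h2 := hmono.ge_of_tendsto hlim n
    have h3 : ‖Complex.sin (Real.pi * (t * Complex.I))‖ ≤ Real.exp (4 * t) := by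
      have : (Real.pi : ℂ) * (t * Complex.I) = ((Real.pi * t : ℝ) : ℂ) * Complex.I := by
        push_cast; ring
      rw [this, Complex.sin_mul_I, norm_mul, Complex.norm_I, mul_one, ← Complex.ofReal_sinh,
        Complex.norm_real, Real.norm_of_nonneg (Real.sinh_nonneg_iff.2 (by
          have := Real.pi_pos; positivity)), Real.sinh_eq]
      have h4 : Real.exp (Real.pi * t) ≤ Real.exp (4 * t) :=
        Real.exp_le_exp.2 (by nlinarith [Real.pi_le_four])
      linarith [Real.exp_pos (-(Real.pi * t)), Real.exp_pos (Real.pi * t)]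
    have h5 : 1 ≤ Real.pi * t := by nlinarith [Real.pi_gt_three]
    have h0 : 0 ≤ ∏ j ∈ Finset.range n, (1 + t ^ 2 / ((j : ℝ) + 1) ^ 2) :=
      Finset.prod_nonneg fun j _ => zero_le_one.trans (hpos t j)
    have h6 := mul_le_mul_of_nonneg_right h5 h0
    linarith
  refine le_trans ?_ (h1 (|τ| + 1) (by linarith [abs_nonneg τ]))
  refine Finset.prod_le_prod (fun j _ => zero_le_one.trans (hpos τ j)) fun j _ => ?_
  have : τ ^ 2 ≤ (|τ| + 1) ^ 2 := by rw [← sq_abs]; nlinarith [abs_nonneg τ]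
  gcongr

theorem prod_one_add_div_le {x : ℝ} (hx : 0 ≤ x) (n : ℕ) :
    ∏ j ∈ Finset.range (n + 1), (1 + x / ((j : ℝ) + 1)) ≤ Real.exp x * ((n + 1 : ℕ) : ℝ) ^ x := by
  have h1 : ∏ j ∈ Finset.range (n + 1), (1 + x / ((j : ℝ) + 1)) ≤
      Real.exp (x * ∑ j ∈ Finset.range (n + 1), 1 / ((j : ℝ) + 1)) := by
    rw [Finset.mul_sum, Real.exp_sum]
    refine Finset.prod_le_prod (fun j _ => by positivity) fun j _ => ?_
    rw [mul_one_div, add_comm]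
    exact Real.add_one_le_exp _
  have h2 : ∑ j ∈ Finset.range (n + 1), 1 / ((j : ℝ) + 1) ≤ 1 + Real.log ((n + 1 : ℕ) : ℝ) := by
    have := harmonic_le_one_add_log (n + 1)
    simpa [harmonic] using this
  refine h1.trans ?_
  rw [Real.rpow_def_of_pos (by positivity), ← Real.exp_add]
  refine Real.exp_le_exp.2 ?_
  nlinarith [mul_le_mul_of_nonneg_left h2 hx]

theorem GammaSeq_inv_eq (s : ℂ) (n : ℕ) :
    (Complex.GammaSeq s (n + 1))⁻¹ =
      ((n + 1 : ℕ) : ℂ) ^ (-s) * (s * ∏ j ∈ Finset.range (n + 1), (1 + s / ((j : ℂ) + 1))) := by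
  have h1 : ∏ j ∈ Finset.range (n + 1 + 1), (s + (j : ℕ)) =
      ((n + 1)! : ℂ) * (s * ∏ j ∈ Finset.range (n + 1), (1 + s / ((j : ℂ) + 1))) := by
    rw [Finset.prod_range_succ', ← Finset.prod_range_add_one_eq_factorial]
    push_cast
    rw [add_zero, mul_comm, mul_left_comm, ← Finset.prod_mul_distrib]
    congr 1
    refine Finset.prod_congr rfl fun j _ => ?_
    have : (j : ℂ) + 1 ≠ 0 := by exact_mod_cast Nat.succ_ne_zero j
    field_simp
    ring
  have hfac : ((n + 1)! : ℂ) ≠ 0 := by exact_mod_cast Nat.factorial_ne_zero _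
  rw [Complex.GammaSeq, h1, Complex.cpow_neg, inv_div]
  field_simp

/-- A bound for Euler's approximants of `1 / Γ` that is uniform in `n`. -/
theorem norm_GammaSeq_inv_le {s : ℂ} (hs : 0 < s.re) (n : ℕ) :
    ‖(Complex.GammaSeq s (n + 1))⁻¹‖ ≤ Real.exp (2 * s.re + 4 + 5 * |s.im|) := by
  rw [GammaSeq_inv_eq, norm_mul, norm_mul, norm_prod,
    Complex.norm_natCast_cpow_of_pos (Nat.succ_pos n)]
  have hn : (0 : ℝ) < ((n + 1 : ℕ) : ℝ) := by positivity
  have h1 : ∏ j ∈ Finset.range (n + 1), ‖1 + s / ((j : ℂ) + 1)‖ ≤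
      (Real.exp s.re * ((n + 1 : ℕ) : ℝ) ^ s.re) * Real.exp (4 * (|s.im| + 1)) := by
    refine le_trans ?_ (mul_le_mul (prod_one_add_div_le hs.le n)
      (prod_one_add_sq_le (n + 1) s.im) (Finset.prod_nonneg fun j _ => by positivity)
      (by positivity))
    rw [← Finset.prod_mul_distrib]
    refine Finset.prod_le_prod (fun _ _ => norm_nonneg _) fun j _ => ?_
    set p : ℝ := (j : ℝ) + 1 with hp
    have hp0 : 0 < p := by positivity
    have e : (1 : ℂ) + s / ((j : ℂ) + 1) = ⟨1 + s.re / p, s.im / p⟩ := by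
      have : (j : ℂ) + 1 = ((p : ℝ) : ℂ) := by rw [hp]; push_cast; ring
      rw [this]
      apply Complex.ext
      · simp [Complex.div_ofReal_re]
      · simp [Complex.div_ofReal_im]
    rw [e]
    have hsq : ‖(⟨1 + s.re / p, s.im / p⟩ : ℂ)‖ ^ 2 = (1 + s.re / p) ^ 2 + s.im ^ 2 / p ^ 2 := by
      rw [Complex.sq_norm, Complex.normSq_mk]; ring_nf
    refine abs_le_of_sq_le_sq' ?_ (by positivity) |>.2
    rw [hsq, mul_pow]
    have h3 : 0 ≤ s.im ^ 2 / p ^ 2 := by positivity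
    have h4 : 0 ≤ s.re / p := by positivity
    nlinarith [mul_nonneg h3 h4, mul_nonneg h3 (mul_nonneg h4 h4), mul_nonneg h3 h3,
      mul_nonneg (mul_nonneg h3 h3) h4, mul_nonneg (mul_nonneg h3 h3) (mul_nonneg h4 h4)]
  have h2 : ‖s‖ ≤ Real.exp (s.re + |s.im|) := by
    refine (Complex.norm_le_abs_re_add_abs_im s).trans ?_
    rw [abs_of_pos hs]
    linarith [Real.add_one_le_exp (s.re + |s.im|)]
  calc ((n + 1 : ℕ) : ℝ) ^ (-s).re * (‖s‖ * ∏ j ∈ Finset.range (n + 1), ‖1 + s / ((j : ℂ) + 1)‖)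
      ≤ ((n + 1 : ℕ) : ℝ) ^ (-s).re * (Real.exp (s.re + |s.im|) *
        ((Real.exp s.re * ((n + 1 : ℕ) : ℝ) ^ s.re) * Real.exp (4 * (|s.im| + 1)))) := by gcongr
    _ = (((n + 1 : ℕ) : ℝ) ^ (-s).re * ((n + 1 : ℕ) : ℝ) ^ s.re) *
        (Real.exp (s.re + |s.im|) * Real.exp s.re * Real.exp (4 * (|s.im| + 1))) := by ring
    _ = Real.exp (2 * s.re + 4 + 5 * |s.im|) := by
        rw [← Real.rpow_add hn, Complex.neg_re, neg_add_cancel, Real.rpow_zero, one_mul,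
          ← Real.exp_add, ← Real.exp_add]
        ring_nf

theorem norm_exp_sq_mul_le {α : ℝ} (hα : 0 < α) {s v : ℂ}
    (hv : ‖v‖ ≤ Real.exp (2 * s.re + 4 + 5 * |s.im|)) :
    ‖Complex.exp (α * s ^ 2 / 2) * v‖ ≤
      Real.exp (α * s.re ^ 2 / 2 + 2 * s.re + 4 + 25 / α) * Real.exp (-(α / 4) * s.im ^ 2) := by
  rw [norm_mul, Complex.norm_exp]
  have h1 : ((α : ℂ) * s ^ 2 / 2).re = α * (s.re ^ 2 - s.im ^ 2) / 2 := by
    have : (α : ℂ) * s ^ 2 / 2 = ((α / 2 : ℝ) : ℂ) * (s * s) := by push_cast; ring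
    rw [this, Complex.re_ofReal_mul, Complex.mul_re]; ring
  rw [h1]
  refine (mul_le_mul_of_nonneg_left hv (Real.exp_nonneg _)).trans ?_
  rw [← Real.exp_add, ← Real.exp_add]
  refine Real.exp_le_exp.2 ?_
  have h2 : 25 / α + α / 4 * |s.im| ^ 2 - 5 * |s.im| = (α * |s.im| - 10) ^ 2 / (4 * α) := by
    field_simp; ring
  have h3 : 0 ≤ (α * |s.im| - 10) ^ 2 / (4 * α) := by positivity
  rw [← sq_abs s.im]
  nlinarith

theorem tendsto_approxSym (α : ℝ) {s : ℂ} (hs : 0 < s.re) :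
    Tendsto (fun n => approxSym α n s) atTop (𝓝 (critSym α s)) := by
  unfold approxSym critSym
  refine Tendsto.const_mul _ ?_
  exact ((tendsto_add_atTop_iff_nat 1).2 (Complex.GammaSeq_tendsto_Gamma s)).inv₀
    (Complex.Gamma_ne_zero_of_re_pos hs)

/-- The constant in the bounds for the symbols on the line `Re s = c`. -/
def symConst (α c : ℝ) : ℝ := Real.exp (α * c ^ 2 / 2 + 2 * c + 4 + 25 / α)

theorem norm_approxSym_le {α : ℝ} (hα : 0 < α) (n : ℕ) {s : ℂ} (hs : 0 < s.re) :
    ‖approxSym α n s‖ ≤ symConst α s.re * Real.exp (-(α / 4) * s.im ^ 2) :=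
  norm_exp_sq_mul_le hα (norm_GammaSeq_inv_le hs n)

theorem norm_critSym_le {α : ℝ} (hα : 0 < α) {s : ℂ} (hs : 0 < s.re) :
    ‖critSym α s‖ ≤ symConst α s.re * Real.exp (-(α / 4) * s.im ^ 2) :=
  le_of_tendsto (tendsto_approxSym α hs).norm
    (Eventually.of_forall fun n => norm_approxSym_le hα n hs)

theorem differentiable_critSym (α : ℝ) : Differentiable ℂ (critSym α) := by
  unfold critSym
  exact (by fun_prop : Differentiable ℂ fun s : ℂ => Complex.exp (α * s ^ 2 / 2)).mul
    Complex.differentiable_one_div_Gamma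

theorem differentiable_approxSym (α : ℝ) (n : ℕ) : Differentiable ℂ (approxSym α n) := by
  have : approxSym α n = fun s => Complex.exp (α * s ^ 2 / 2) * (((n + 1 : ℕ) : ℂ) ^ (-s) *
      (s * ∏ j ∈ Finset.range (n + 1), (1 + s / ((j : ℂ) + 1)))) := by
    funext s
    rw [approxSym, GammaSeq_inv_eq]
  rw [this]
  have h1 : Differentiable ℂ fun s : ℂ => ((n + 1 : ℕ) : ℂ) ^ (-s) := by
    intro s
    exact (differentiableAt_id.neg).const_cpow (Or.inl (by exact_mod_cast Nat.succ_ne_zero n))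
  have h2 : Differentiable ℂ fun s : ℂ => ∏ j ∈ Finset.range (n + 1), (1 + s / ((j : ℂ) + 1)) := by
    fun_prop
  exact (by fun_prop : Differentiable ℂ fun s : ℂ => Complex.exp (α * s ^ 2 / 2)).mul
    (h1.mul (differentiable_id.mul h2))

theorem lineBound_critSym {α c : ℝ} (hα : 0 < α) (hc : 1 ≤ c) :
    LineBound c (α / 4) (symConst α c) (critSym α) where
  one_le := hc
  pos := by positivity
  cont := (differentiable_critSym α).continuous.comp (continuous_vline c)
  bound τ := by simpa using norm_critSym_le hα (s := vline c τ) (by simp; linarith)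

theorem lineBound_approxSym {α c : ℝ} (hα : 0 < α) (hc : 1 ≤ c) (n : ℕ) :
    LineBound c (α / 4) (symConst α c) (approxSym α n) where
  one_le := hc
  pos := by positivity
  cont := (differentiable_approxSym α n).continuous.comp (continuous_vline c)
  bound τ := by simpa using norm_approxSym_le hα n (s := vline c τ) (by simp; linarith)

theorem gaussDecay_critSym {α l : ℝ} (hα : 0 < α) (hl : 0 < l) (u : ℝ) :
    GaussDecay l u (critSym α) := by
  refine ⟨α / 4, by positivity, symConst α u, fun z hz => ?_⟩
  refine (norm_critSym_le hα (hl.trans_le hz.1)).trans ?_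
  have h1 : symConst α z.re ≤ symConst α u := by
    refine Real.exp_le_exp.2 ?_
    have h2 := hz.2
    have h3 : z.re ^ 2 ≤ u ^ 2 := pow_le_pow_left₀ (hl.trans_le hz.1).le h2 2
    have : α * z.re ^ 2 / 2 ≤ α * u ^ 2 / 2 := by gcongr
    linarith
  gcongr

theorem summable_norm_critW {α : ℝ} (hα : 0 ≤ α) : Summable fun j => ‖critW α j‖ :=
  Summable.of_nonneg_of_le (fun _ => norm_nonneg _) (norm_critW_le hα) summable_inv_factorial

/-- The Fredholm determinant of the critical kernel is the determinant of an infinite matrix. -/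
theorem tsum_fredTerm_eq_infDet {α c : ℝ} (hα : 0 < α) (hc : 1 ≤ c) {a : ℝ} (ha : 0 < a) :
    ∑' n, fredTerm (Ioi a) (sumKernel c (critSym α) (critW α)) n =
      infDet (Mmat c (critSym α) (critW α) a) := by
  have h1 := tendsto_det_Mmat (m := fun N => N) (fun _ => lineBound_critSym hα hc)
    (fun τ => tendsto_const_nhds) (w := fun _ => critW α) (fun _ => norm_critW_le hα.le)
    summable_inv_factorial (fun _ => tendsto_const_nhds) tendsto_id ha.le
  have h2 := ((lineBound_critSym hα hc).colBound (summable_norm_critW hα.le)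
    (ofReal_mem_halfStrip ha)).tendsto
  exact tendsto_nhds_unique h1 h2

/-- The determinants of the finite ensembles converge to that of the critical kernel. -/
theorem tendsto_det_approx {α c : ℝ} (hα : 0 < α) (hc : 1 ≤ c) {a : ℝ} (ha : 0 < a) :
    Tendsto (fun n => (1 - corner (Mmat c (approxSym α n) (approxW α n) a) (n + 2)).det) atTop
      (𝓝 (infDet (Mmat c (critSym α) (critW α) a))) := by
  rw [← tsum_fredTerm_eq_infDet hα hc ha]
  exact tendsto_det_Mmat (fun n => lineBound_approxSym hα hc n)
    (fun τ => tendsto_approxSym α (by simp; linarith)) (fun n => norm_approxW_le hα.le n)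
    summable_inv_factorial (tendsto_approxW α) (tendsto_add_atTop_nat 2) ha.le

/-! ### Positivity of the finite ensembles -/

theorem lineInt_eq_of_strip {F : ℂ → ℂ} (hF : Differentiable ℂ F)
    (hg : ∀ l u, GaussDecay l u F) (c c' : ℝ) : lineInt c F = lineInt c' F := by
  rcases le_total c c' with h | h
  · exact lineInt_shift h hF.differentiableOn (hg _ _)
  · exact (lineInt_shift h hF.differentiableOn (hg _ _)).symm

theorem gaussDecay_gauss {α : ℝ} (hα : 0 < α) (l u : ℝ) :
    GaussDecay l u fun s => Complex.exp (α * s ^ 2 / 2) := by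
  refine ⟨α / 2, by positivity, Real.exp (α * (l ^ 2 + u ^ 2) / 2), fun z hz => ?_⟩
  rw [Complex.norm_exp, ← Real.exp_add]
  refine Real.exp_le_exp.2 ?_
  have h1 : ((α : ℂ) * z ^ 2 / 2).re = α * (z.re ^ 2 - z.im ^ 2) / 2 := by
    have : (α : ℂ) * z ^ 2 / 2 = ((α / 2 : ℝ) : ℂ) * (z * z) := by push_cast; ring
    rw [this, Complex.re_ofReal_mul, Complex.mul_re]; ring
  have h2 : z.re ^ 2 ≤ l ^ 2 + u ^ 2 := by
    rcases le_total 0 z.re with h | h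
    · nlinarith [pow_le_pow_left₀ h hz.2 2, sq_nonneg l]
    · nlinarith [pow_le_pow_left₀ (neg_nonneg.2 h) (neg_le_neg hz.1) 2, sq_nonneg u]
  rw [h1]
  nlinarith [mul_le_mul_of_nonneg_left h2 hα.le]

theorem GaussDecay.mul_prod {l u : ℝ} {F : ℂ → ℂ} (hF : GaussDecay l u F) (t : Finset ℕ) :
    GaussDecay l u fun z => F z * ∏ i ∈ t, (z + i) := by
  classical
  induction t using Finset.induction_on with
  | empty => simpa using hF
  | insert i t hi ih =>
    refine (ih.mul_id i).congr fun z _ => ?_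
    rw [Finset.prod_insert hi]; ring

/-- The quotient `approxSym α n s / (s + k)` for `k ≤ n + 1`, an entire function. -/
def approxDiv (α : ℝ) (n k : ℕ) (s : ℂ) : ℂ :=
  Complex.exp (α * s ^ 2 / 2) * (∏ i ∈ (Finset.range (n + 2)).erase k, (s + i)) *
    Complex.exp (-(Real.log (n + 1 : ℕ) : ℂ) * s) / ((n + 1)! : ℂ)

theorem approxSym_eq_mul_approxDiv (α : ℝ) {n k : ℕ} (hk : k < n + 2) (s : ℂ) :
    approxSym α n s = (s + k) * approxDiv α n k s := by
  have hn : ((n + 1 : ℕ) : ℂ) ≠ 0 := by exact_mod_cast Nat.succ_ne_zero n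
  have e : ((n + 1 : ℕ) : ℂ) ^ s =
      (Complex.exp (-(Real.log (n + 1 : ℕ) : ℂ) * s))⁻¹ := by
    rw [Complex.cpow_def_of_ne_zero hn, ← Complex.natCast_log, ← Complex.exp_neg, neg_mul, neg_neg]
  rw [approxSym, approxDiv, Complex.GammaSeq, e, inv_div,
    ← Finset.mul_prod_erase (Finset.range (n + 1 + 1)) _ (Finset.mem_range.2 hk)]
  have := Complex.exp_ne_zero (-(Real.log (n + 1 : ℕ) : ℂ) * s)
  field_simp

theorem differentiable_approxDiv (α : ℝ) (n k : ℕ) : Differentiable ℂ (approxDiv α n k) := by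
  unfold approxDiv
  fun_prop

theorem gaussDecay_approxDiv {α : ℝ} (hα : 0 < α) (n k : ℕ) (l u : ℝ) :
    GaussDecay l u (approxDiv α n k) := by
  have := (((gaussDecay_gauss hα l u).mul_prod ((Finset.range (n + 2)).erase k)).mul_exp
    (Real.log (n + 1 : ℕ) : ℂ)).mul_bounded (G := fun _ => ((n + 1)! : ℂ)⁻¹) (fun _ _ => le_rfl)
  exact this.congr fun z _ => by rw [approxDiv, div_eq_mul_inv]

theorem prod_erase_sub (k d : ℕ) :
    ∏ i ∈ (Finset.range (k + d + 1)).erase k, (-(k : ℂ) + i) = (-1) ^ k * k ! * d ! := by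
  have h1 : ∏ i ∈ (Finset.range (k + d + 1)).erase k, (-(k : ℂ) + i) =
      ∏ i ∈ Finset.range (k + (d + 1)), if i = k then 1 else (-(k : ℂ) + i) := by
    rw [← add_assoc, ← Finset.mul_prod_erase (Finset.range (k + d + 1))
      (fun i => if i = k then (1 : ℂ) else (-(k : ℂ) + i)) (Finset.mem_range.2 (by omega : k < _))]
    rw [if_pos rfl, one_mul]
    exact Finset.prod_congr rfl fun i hi => by rw [if_neg (Finset.ne_of_mem_erase hi)]
  rw [h1, Finset.prod_range_add, Finset.prod_range_succ']
  have h2 : ∏ i ∈ Finset.range k, (if i = k then 1 else (-(k : ℂ) + i)) = (-1) ^ k * k ! := by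
    rw [← Finset.prod_range_reflect, ← Finset.prod_range_add_one_eq_factorial]
    push_cast
    have : ((-1 : ℂ)) ^ k = ∏ _i ∈ Finset.range k, (-1 : ℂ) := by simp
    rw [this, ← Finset.prod_mul_distrib]
    refine Finset.prod_congr rfl fun i hi => ?_
    have hi' := Finset.mem_range.1 hi
    rw [if_neg (by omega), Nat.cast_sub (by omega), Nat.cast_sub (by omega)]
    push_cast; ring
  have h3 : ∏ i ∈ Finset.range d, (if k + (i + 1) = k then 1 else (-(k : ℂ) + ((k + (i + 1) : ℕ) : ℂ)))
      = d ! := by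
    rw [← Finset.prod_range_add_one_eq_factorial]
    push_cast
    refine Finset.prod_congr rfl fun i _ => ?_
    rw [if_neg (by omega)]; ring
  rw [h2, h3]
  simp

theorem approxW_mul_approxDiv (α : ℝ) {n j k : ℕ} (hj : j < n + 2) (hk : k < n + 2) :
    approxW α n j * approxDiv α n k (-(j : ℂ)) = if k = j then 1 else 0 := by
  split_ifs with h
  · subst h
    obtain ⟨d, hd⟩ : ∃ d, n + 1 = k + d := ⟨n + 1 - k, by omega⟩
    have hn0 : ((k + d : ℕ) : ℂ) ≠ 0 := by
      rw [← hd]; exact_mod_cast Nat.succ_ne_zero n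
    have hdesc : ((k + d).descFactorial k : ℂ) * (d ! : ℂ) = ((k + d)! : ℂ) := by
      have := Nat.factorial_mul_descFactorial (n := k + d) (k := k) (by omega)
      rw [Nat.add_sub_cancel_left] at this
      rw [mul_comm]
      exact_mod_cast this
    have hexp : Complex.exp (-(Real.log (k + d : ℕ) : ℂ) * -(k : ℂ)) = ((k + d : ℕ) : ℂ) ^ k := by
      rw [neg_mul_neg, mul_comm, Complex.exp_nat_mul, Complex.natCast_log, Complex.exp_log hn0]
    have hgauss : ((Real.exp (-(α * k ^ 2 / 2)) : ℝ) : ℂ) * Complex.exp (α * (-(k : ℂ)) ^ 2 / 2)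
        = 1 := by
      rw [Complex.ofReal_exp, ← Complex.exp_add]
      push_cast
      rw [neg_sq, neg_add_cancel, Complex.exp_zero]
    have hsign : ((-1 : ℂ) ^ k) * (-1) ^ k = 1 := by rw [← mul_pow]; simp
    have e2 : n + 2 = k + d + 1 := by omega
    rw [approxW, approxDiv, critW, hd, e2, prod_erase_sub, hexp]
    have hk0 : (k ! : ℂ) ≠ 0 := by exact_mod_cast Nat.factorial_ne_zero _
    have hkd0 : ((k + d)! : ℂ) ≠ 0 := by exact_mod_cast Nat.factorial_ne_zero _
    have hp := pow_ne_zero k hn0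
    rw [div_mul_eq_mul_div, div_mul_div_comm, div_mul_div_comm, div_eq_one_iff_eq (by positivity)]
    rw [← hdesc]
    linear_combination ((k + d).descFactorial k : ℂ) * (d ! : ℂ) * (k ! : ℂ) *
      ((k + d : ℕ) : ℂ) ^ k * (hgauss * ((-1 : ℂ) ^ k * (-1) ^ k) + hsign)
  · rw [approxDiv, Finset.prod_eq_zero (i := j)
      (Finset.mem_erase.2 ⟨fun h' => h h'.symm, Finset.mem_range.2 hj⟩) (by ring)]
    simp

section

variable {α c : ℝ}

theorem Gfun_approx_eq (hα : 0 < α) (hc : 1 ≤ c) {n k : ℕ} (hk : k < n + 2) (c' : ℝ) (x : ℝ) :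
    Gfun c (approxSym α n) k x =
      lineInt c' fun s => approxDiv α n k s * Complex.exp (-x * s) := by
  rw [← lineInt_eq_of_strip (F := fun s => approxDiv α n k s * Complex.exp (-x * s))
    ((differentiable_approxDiv α n k).mul (by fun_prop))
    (fun l u => (gaussDecay_approxDiv hα n k l u).mul_exp x) c c', Gfun_eq]
  refine lineInt_congr fun s hs => ?_
  have hne : s + k ≠ 0 := by
    rw [eq_vline s, hs]; exact vline_add_ne_zero (by linarith) _ _
  rw [approxSym_eq_mul_approxDiv α hk, mul_div_cancel_left₀ _ hne]

theorem integrableOn_Iic_approx (hα : 0 < α) (hc : 1 ≤ c) {n k : ℕ} (hk : k < n + 2) (w : ℂ)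
    (j : ℕ) (a : ℝ) : IntegrableOn
      (fun x : ℝ => w * Complex.exp (-(j : ℂ) * x) * Gfun c (approxSym α n) k x) (Iic a) := by
  set c' : ℝ := -(j : ℝ) - 1 with hc'
  obtain ⟨κ, hκ, C, hC, hb⟩ := (gaussDecay_approxDiv hα n k c' c').bound
  have hb' : ∀ τ : ℝ, ‖approxDiv α n k (vline c' τ)‖ ≤ C * Real.exp (-κ * τ ^ 2) := fun τ => by
    simpa using hb _ (vline_mem_vstrip le_rfl le_rfl τ)
  have h0 : IntegrableOn (fun x : ℝ => ‖w‖ * (C * √(Real.pi / κ)) * Real.exp (1 * x)) (Iic a) :=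
    (integrableOn_exp_mul_Iic one_pos a).const_mul _
  refine h0.mono' ?_ (Eventually.of_forall fun x => ?_)
  · exact ((Continuous.measurable (by fun_prop)).mul
      ((lineBound_approxSym hα hc n).measurable_Gfun k)).aestronglyMeasurable
  · rw [norm_mul, norm_mul, Gfun_approx_eq hα hc hk c', Complex.norm_exp]
    have h1 := norm_lineInt_exp_le hκ hb' x
    have h2 : (-(j : ℂ) * x).re = -(j : ℝ) * x := by simp
    rw [h2]
    calc _ ≤ ‖w‖ * Real.exp (-(j : ℝ) * x) * (C * √(Real.pi / κ) * Real.exp (-c' * x)) := by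
          gcongr
      _ = ‖w‖ * (C * √(Real.pi / κ)) * (Real.exp (-(j : ℝ) * x) * Real.exp (-c' * x)) := by ring
      _ = _ := by rw [← Real.exp_add]; congr 2; rw [hc']; ring

/-- Biorthogonality: the pairings over the two half lines add up to the identity matrix. -/
theorem integral_Iic_approx (hα : 0 < α) (hc : 1 ≤ c) {n j k : ℕ} (hj : j < n + 2)
    (hk : k < n + 2) (a : ℝ) :
    ∫ x in Iic a, approxW α n j * Complex.exp (-(j : ℂ) * x) * Gfun c (approxSym α n) k x =
      (if k = j then 1 else 0) - Mmat c (approxSym α n) (approxW α n) a k j := by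
  set c' : ℝ := -(j : ℝ) - 1 with hc'
  have hj0 : (0 : ℝ) ≤ j := Nat.cast_nonneg j
  obtain ⟨κ, hκ, C, hC, hb⟩ := (gaussDecay_approxDiv hα n k c' c').bound
  have hb' : ∀ τ : ℝ, ‖approxDiv α n k (vline c' τ)‖ ≤ C * Real.exp (-κ * τ ^ 2) := fun τ => by
    simpa using hb _ (vline_mem_vstrip le_rfl le_rfl τ)
  simp only [mul_assoc]
  rw [integral_const_mul]
  simp only [Gfun_approx_eq hα hc hk c']
  rw [integral_Iic_exp_mul_lineInt
    ((differentiable_approxDiv α n k).continuous.comp (continuous_vline c')) hκ hb'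
    (by simp only [hc', Complex.natCast_re]; linarith)]
  set F : ℂ → ℂ := fun s => approxDiv α n k s * Complex.exp (-a * (s + j)) with hF
  have hFd : Differentiable ℂ F := (differentiable_approxDiv α n k).mul (by fun_prop)
  have hFg : GaussDecay c' c F := by
    refine (((gaussDecay_approxDiv hα n k c' c).mul_exp a).mul_bounded
      (G := fun _ => Complex.exp (-a * j)) (fun _ _ => le_rfl)).congr fun s _ => ?_
    simp only [hF]
    rw [mul_assoc, ← Complex.exp_add, mul_add]
  have hC := lineInt_sub_lineInt_div hFd.differentiableOn hFg (z := -(j : ℂ)) (by simp [hc'])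
    (by simp; linarith)
  simp only [sub_neg_eq_add] at hC
  have hM : Mmat c (approxSym α n) (approxW α n) a k j =
      approxW α n j * lineInt c fun s => F s / (s + j) := by
    unfold Mmat
    congr 1
    refine lineInt_congr fun s hs => ?_
    have hne : s + k ≠ 0 := by
      rw [eq_vline s, hs]; exact vline_add_ne_zero (by linarith) _ _
    rw [approxSym_eq_mul_approxDiv α hk, mul_assoc, mul_div_mul_left _ _ hne]
  have hFj : F (-(j : ℂ)) = approxDiv α n k (-(j : ℂ)) := by simp [hF]
  rw [hM, ← approxW_mul_approxDiv α hj hk, ← hFj, ← hC]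
  ring

end

/-- A polynomial times a Gaussian is the inverse Laplace transform of a polynomial times a
Gaussian. -/
theorem exists_lineInt_pow_mul_gauss {α : ℝ} (hα : 0 < α) (c : ℝ) (l : ℕ) :
    ∃ C : ℕ → ℂ, ∀ u : ℝ, lineInt c (fun s => Complex.exp (α * s ^ 2 / 2) * s ^ l *
      Complex.exp (-u * s)) =
      Real.exp (-(u ^ 2 / (2 * α))) * ∑ i ∈ Finset.range (l + 1), C i * (u : ℂ) ^ i := by
  have hα' : (α : ℂ) ≠ 0 := by exact_mod_cast hα.ne'
  have hint : ∀ m : ℕ, Integrable fun τ : ℝ =>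
      (τ * Complex.I : ℂ) ^ m * (Real.exp (-(α / 2) * τ ^ 2) : ℝ) := by
    intro m
    have h1 := integrable_rpow_mul_exp_neg_mul_sq (b := α / 2) (by positivity) (s := (m : ℝ))
      (by have : (0 : ℝ) ≤ m := Nat.cast_nonneg m
          linarith)
    refine (h1.ofReal (𝕜 := ℂ)).const_mul (Complex.I ^ m) |>.congr
      (Eventually.of_forall fun τ => ?_)
    simp only [Real.rpow_natCast]
    change Complex.I ^ m * ((τ ^ m * Real.exp (-(α / 2) * τ ^ 2) : ℝ) : ℂ) = _
    push_cast
    ring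
  refine ⟨fun i => (2 * Real.pi : ℂ)⁻¹ * ((l.choose i : ℂ) * ((α : ℂ)⁻¹) ^ i *
    ∫ τ : ℝ, (τ * Complex.I : ℂ) ^ (l - i) * (Real.exp (-(α / 2) * τ ^ 2) : ℝ)), fun u => ?_⟩
  have hd : Differentiable ℂ fun s : ℂ => Complex.exp (α * s ^ 2 / 2) * s ^ l *
      Complex.exp (-u * s) := by fun_prop
  have hg : ∀ p q, GaussDecay p q fun s : ℂ => Complex.exp (α * s ^ 2 / 2) * s ^ l *
      Complex.exp (-u * s) := by
    intro p q
    have : GaussDecay p q fun s : ℂ => Complex.exp (α * s ^ 2 / 2) * s ^ l := by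
      induction l with
      | zero => simpa using gaussDecay_gauss hα p q
      | succ l ih =>
        refine ((ih ?_).mul_id 0).congr fun z _ => ?_
        · fun_prop
        · rw [pow_succ]; ring
    exact this.mul_exp u
  -- the saddle point is `u / α`
  rw [lineInt_eq_of_strip hd hg c (u / α)]
  have h1 : ∀ τ : ℝ, Complex.exp (α * vline (u / α) τ ^ 2 / 2) * vline (u / α) τ ^ l *
      Complex.exp (-u * vline (u / α) τ) = Real.exp (-(u ^ 2 / (2 * α))) *
      ∑ i ∈ Finset.range (l + 1), ((l.choose i : ℂ) * ((α : ℂ)⁻¹) ^ i * (u : ℂ) ^ i) *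
        ((τ * Complex.I : ℂ) ^ (l - i) * (Real.exp (-(α / 2) * τ ^ 2) : ℝ)) := by
    intro τ
    have e1 : Complex.exp (α * vline (u / α) τ ^ 2 / 2) * Complex.exp (-u * vline (u / α) τ) =
        Real.exp (-(u ^ 2 / (2 * α))) * (Real.exp (-(α / 2) * τ ^ 2) : ℝ) := by
      rw [← Complex.exp_add, Complex.ofReal_exp, Complex.ofReal_exp, ← Complex.exp_add]
      congr 1
      unfold vline
      push_cast
      field_simp
      linear_combination (α : ℂ) ^ 2 * (τ : ℂ) ^ 2 * Complex.I_sq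
    have e2 : vline (u / α) τ ^ l = ∑ i ∈ Finset.range (l + 1),
        ((u : ℂ) / α) ^ i * (τ * Complex.I : ℂ) ^ (l - i) * (l.choose i : ℂ) := by
      rw [← add_pow]
      unfold vline
      push_cast
      ring
    rw [mul_right_comm, e1, e2, mul_assoc, Finset.mul_sum]
    congr 1
    refine Finset.sum_congr rfl fun i _ => ?_
    rw [div_eq_mul_inv, mul_pow]
    ring
  unfold lineInt
  simp only [h1]
  rw [integral_const_mul, integral_finsetSum _ fun i _ => (hint _).const_mul _, mul_left_comm,
    Finset.mul_sum]
  congr 1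
  refine Finset.sum_congr rfl fun i _ => ?_
  rw [integral_const_mul]
  ring

/-- The functions `G_k` of the finite ensemble are polynomials of degree at most `n + 1` times
a Gaussian. -/
theorem exists_Gfun_approx_eq {α c : ℝ} (hα : 0 < α) (hc : 1 ≤ c) (n : ℕ) :
    ∃ C : Matrix (Fin (n + 2)) (Fin (n + 2)) ℂ, ∀ (x : ℝ) (k : Fin (n + 2)),
      Gfun c (approxSym α n) k x =
        Real.exp (-((x + Real.log (n + 1 : ℕ)) ^ 2 / (2 * α))) *
          ∑ i : Fin (n + 2), ((x + Real.log (n + 1 : ℕ) : ℝ) : ℂ) ^ (i : ℕ) * C i k := by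
  choose D hD using fun l => exists_lineInt_pow_mul_gauss hα c l
  set p : ℕ → Polynomial ℂ := fun k =>
    Polynomial.C (((n + 1)! : ℂ)⁻¹) *
      ∏ i ∈ (Finset.range (n + 2)).erase k, (Polynomial.X + Polynomial.C (i : ℂ)) with hp
  have hdeg : ∀ k, k < n + 2 → (p k).natDegree < n + 2 := by
    intro k hk
    refine lt_of_le_of_lt (Polynomial.natDegree_C_mul_le _ _) ?_
    refine lt_of_le_of_lt (Polynomial.natDegree_prod_le _ _) ?_
    simp only [Polynomial.natDegree_X_add_C, Finset.sum_const, smul_eq_mul, mul_one]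
    rw [Finset.card_erase_of_mem (Finset.mem_range.2 hk), Finset.card_range]
    omega
  refine ⟨Matrix.of fun i k => ∑ l ∈ Finset.range (n + 2),
    (p k).coeff l * if (i : ℕ) < l + 1 then D l i else 0, fun x k => ?_⟩
  set u : ℝ := x + Real.log (n + 1 : ℕ) with hu
  rw [Gfun_approx_eq hα hc k.2 c]
  have h1 : ∀ s : ℂ, approxDiv α n k s * Complex.exp (-x * s) =
      ∑ l ∈ Finset.range (n + 2), (p k).coeff l *
        (Complex.exp (α * s ^ 2 / 2) * s ^ l * Complex.exp (-u * s)) := by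
    intro s
    have e2 := Polynomial.eval_eq_sum_range' (hdeg k k.2) s
    have e3 : Complex.exp (-(Real.log (n + 1 : ℕ) : ℂ) * s) * Complex.exp (-x * s) =
        Complex.exp (-u * s) := by
      rw [← Complex.exp_add, hu]; congr 1; push_cast; ring
    have e4 : (p k).eval s = ((n + 1)! : ℂ)⁻¹ *
        ∏ i ∈ (Finset.range (n + 2)).erase (k : ℕ), (s + i) := by
      rw [hp]; simp [Polynomial.eval_prod]
    calc approxDiv α n k s * Complex.exp (-x * s)
        = (p k).eval s * (Complex.exp (α * s ^ 2 / 2) * Complex.exp (-u * s)) := by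
          rw [e4, approxDiv, ← e3]; ring
      _ = _ := by
          rw [e2, Finset.sum_mul]
          exact Finset.sum_congr rfl fun l _ => by ring
  have hint : ∀ l : ℕ, Integrable fun τ : ℝ => (fun s : ℂ => Complex.exp (α * s ^ 2 / 2) * s ^ l *
      Complex.exp (-u * s)) (vline c τ) := by
    intro l
    have : GaussDecay c c fun s : ℂ => Complex.exp (α * s ^ 2 / 2) * s ^ l := by
      induction l with
      | zero => simpa using gaussDecay_gauss hα c c
      | succ l ih => exact (ih.mul_id 0).congr fun z _ => by rw [pow_succ]; ring
    exact (this.mul_exp u).integrable le_rfl le_rfl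
      (Continuous.continuousOn (by fun_prop))
  have h2 : lineInt c (fun s => approxDiv α n k s * Complex.exp (-x * s)) =
      ∑ l ∈ Finset.range (n + 2), (p k).coeff l *
        lineInt c (fun s => Complex.exp (α * s ^ 2 / 2) * s ^ l * Complex.exp (-u * s)) := by
    simp only [h1]
    unfold lineInt
    rw [integral_finsetSum _ fun l _ => (hint l).const_mul _, Finset.mul_sum]
    refine Finset.sum_congr rfl fun l _ => ?_
    rw [integral_const_mul]; ring
  rw [h2]
  simp only [hD, Matrix.of_apply]
  simp only [Finset.mul_sum]
  rw [Finset.sum_comm]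
  refine Finset.sum_congr rfl fun l hl => ?_
  have hl' := Finset.mem_range.1 hl
  rw [Fin.sum_univ_eq_sum_range (fun i => (Real.exp (-(u ^ 2 / (2 * α))) : ℂ) *
    ((u : ℂ) ^ i * ((p k).coeff l * if i < l + 1 then D l i else 0))) (n + 2),
    ← Finset.sum_subset (Finset.range_subset_range.2 (by omega : l + 1 ≤ n + 2))]
  · refine Finset.sum_congr rfl fun i hi => ?_
    rw [if_pos (Finset.mem_range.1 hi)]; ring
  · intro i _ hi
    rw [if_neg (by simpa using hi)]; simp

theorem det_exp_vandermonde {N : ℕ} (w : ℕ → ℂ) (x : Fin N → ℝ) :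
    (Matrix.of fun i j : Fin N => w j * Complex.exp (-((j : ℕ) : ℂ) * x i)).det =
      (∏ j : Fin N, w j) * ∏ i, ∏ j > i, ((Real.exp (-x j) - Real.exp (-x i) : ℝ) : ℂ) := by
  have h : (Matrix.of fun i j : Fin N => w j * Complex.exp (-((j : ℕ) : ℂ) * x i)) =
      Matrix.of fun i j : Fin N => w j *
        Matrix.vandermonde (fun i => ((Real.exp (-x i) : ℝ) : ℂ)) i j := by
    ext i j
    simp only [Matrix.of_apply, Matrix.vandermonde_apply]
    rw [Complex.ofReal_exp, ← Complex.exp_nat_mul]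
    push_cast
    ring_nf
  rw [h, Matrix.det_mul_row, Matrix.det_vandermonde]
  push_cast
  rfl

/-- The density of the finite ensemble, up to normalization. -/
def vandermondeWeight {N : ℕ} (α t : ℝ) (x : Fin N → ℝ) : ℝ :=
  (∏ i, Real.exp (-((x i + t) ^ 2 / (2 * α)))) *
    ∏ i, ∏ j > i, ((x j - x i) * (Real.exp (-x i) - Real.exp (-x j)))

theorem vandermondeWeight_nonneg {N : ℕ} (α t : ℝ) (x : Fin N → ℝ) :
    0 ≤ vandermondeWeight α t x := by
  refine mul_nonneg (Finset.prod_nonneg fun i _ => Real.exp_nonneg _)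
    (Finset.prod_nonneg fun i _ => Finset.prod_nonneg fun j _ => ?_)
  rcases le_total (x i) (x j) with h | h
  · exact mul_nonneg (sub_nonneg.2 h) (sub_nonneg.2 (Real.exp_le_exp.2 (neg_le_neg h)))
  · exact mul_nonneg_of_nonpos_of_nonpos (sub_nonpos.2 h)
      (sub_nonpos.2 (Real.exp_le_exp.2 (neg_le_neg h)))

/-- Up to a constant, the finite determinants are nonnegative and nondecreasing functions of `a`. -/
theorem exists_det_approx_eq {α c : ℝ} (hα : 0 < α) (hc : 1 ≤ c) (n : ℕ) :
    ∃ (z : ℂ) (I : ℝ → ℝ), Monotone I ∧ (∀ a, 0 ≤ I a) ∧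
      ∀ a : ℝ, (1 - corner (Mmat c (approxSym α n) (approxW α n) a) (n + 2)).det = z * I a := by
  obtain ⟨C, hC⟩ := exists_Gfun_approx_eq hα hc n
  set t := Real.log (n + 1 : ℕ) with ht
  set W := fun x : Fin (n + 2) → ℝ => vandermondeWeight α t x with hW
  set z : ℂ := (∏ j : Fin (n + 2), approxW α n j) * C.det * ∏ i : Fin (n + 2), ∏ _j > i, (-1 : ℂ) with hz
  have hdet : ∀ x : Fin (n + 2) → ℝ,
      (Matrix.of fun i j : Fin (n + 2) => approxW α n j * Complex.exp (-((j : ℕ) : ℂ) * x i)).det *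
        (Matrix.of fun i j : Fin (n + 2) => Gfun c (approxSym α n) j (x i)).det = z * (W x : ℝ) := by
    intro x
    have h1 : (Matrix.of fun i j : Fin (n + 2) => Gfun c (approxSym α n) j (x i)) =
        Matrix.of fun i j : Fin (n + 2) => (Real.exp (-((x i + t) ^ 2 / (2 * α))) : ℂ) *
          (Matrix.vandermonde (fun i => ((x i + t : ℝ) : ℂ)) * C) i j := by
      ext i j
      simp only [Matrix.of_apply, hC, Matrix.mul_apply, Matrix.vandermonde_apply]
    rw [det_exp_vandermonde, h1, Matrix.det_mul_column, Matrix.det_mul, Matrix.det_vandermonde]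
    have h2 : ∀ i : Fin (n + 2), ∀ j : Fin (n + 2), ((x j + t : ℝ) : ℂ) - ((x i + t : ℝ) : ℂ) =
        ((x j - x i : ℝ) : ℂ) := fun i j => by push_cast; ring
    have h3 : (∏ i : Fin (n + 2), ∏ j > i, ((Real.exp (-x j) - Real.exp (-x i) : ℝ) : ℂ)) =
        (∏ i : Fin (n + 2), ∏ _j > i, (-1 : ℂ)) *
          ∏ i : Fin (n + 2), ∏ j > i, ((Real.exp (-x i) - Real.exp (-x j) : ℝ) : ℂ) := by
      simp only [← Finset.prod_mul_distrib]
      refine Finset.prod_congr rfl fun i _ => Finset.prod_congr rfl fun j _ => ?_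
      push_cast; ring
    simp only [h2]
    rw [h3, hz, hW]
    simp only [vandermondeWeight, Complex.ofReal_mul, Complex.ofReal_prod, Finset.prod_mul_distrib]
    ring
  -- The matrix `1 - M` consists of pairings over `(-∞, a]`, because the pairings over the whole line
  -- are the identity matrix; Andreief's identity applies to them.
  have hand := fun a : ℝ => integral_det_mul_det (S := Iic a) (N := n + 2)
    (u := fun j x => approxW α n j * Complex.exp (-((j : ℕ) : ℂ) * x))
    (G := fun k x => Gfun c (approxSym α n) k x)
    (fun j k => integrableOn_Iic_approx hα hc k.2 _ j a)
  have hmat : ∀ a : ℝ, (Matrix.of fun k j : Fin (n + 2) => ∫ x in Iic a,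
      approxW α n j * Complex.exp (-((j : ℕ) : ℂ) * x) * Gfun c (approxSym α n) k x) =
      1 - corner (Mmat c (approxSym α n) (approxW α n) a) (n + 2) := by
    intro a
    ext k j
    rw [Matrix.of_apply, integral_Iic_approx hα hc j.2 k.2, one_sub_corner_apply, Pi.single_apply]
  simp only [hdet, hmat] at hand
  have hN0 : ((n + 2)! : ℂ) ≠ 0 := by exact_mod_cast Nat.factorial_ne_zero _
  by_cases hz0 : z = 0
  · refine ⟨0, fun _ => 0, monotone_const, fun _ => le_rfl, fun a => ?_⟩
    have := (hand a).2
    simp only [hz0, zero_mul, integral_zero] at this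
    rw [(mul_eq_zero.1 this.symm).resolve_left hN0]
    simp
  · have hWi : ∀ a : ℝ, IntegrableOn W {x : Fin (n + 2) → ℝ | ∀ j, x j ∈ Iic a} := by
      intro a
      have h1 := ((hand a).1.const_mul z⁻¹).re
      refine h1.congr (Eventually.of_forall fun x => ?_)
      simp [hz0]
    refine ⟨z / (n + 2)!, fun a => ∫ x in {x : Fin (n + 2) → ℝ | ∀ j, x j ∈ Iic a}, W x, ?_, ?_, ?_⟩
    · intro a a' haa'
      refine setIntegral_mono_set (hWi a') (Eventually.of_forall fun x =>
        vandermondeWeight_nonneg _ _ _) (Eventually.of_forall fun x hx j => ?_)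
      exact le_trans (hx j) haa'
    · exact fun a => integral_nonneg fun x => vandermondeWeight_nonneg _ _ _
    · intro a
      have := (hand a).2
      rw [integral_const_mul, integral_complex_ofReal] at this
      field_simp
      linear_combination -this

/-- Relative to its value at `d`, the critical determinant is real, nonnegative and nondecreasing:
the constants of `exists_det_approx_eq` cancel in the ratios, which then pass to the limit. -/
theorem ratio_infDet {α c : ℝ} (hα : 0 < α) (hc : 1 ≤ c) {a b d : ℝ} (ha : 0 < a) (hab : a ≤ b)
    (hbd : b ≤ d) (hd : infDet (Mmat c (critSym α) (critW α) d) ≠ 0) :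
    ∃ p q : ℝ, 0 ≤ p ∧ p ≤ q ∧
      infDet (Mmat c (critSym α) (critW α) a) = p * infDet (Mmat c (critSym α) (critW α) d) ∧
      infDet (Mmat c (critSym α) (critW α) b) = q * infDet (Mmat c (critSym α) (critW α) d) := by
  have hT := fun x hx => tendsto_det_approx (c := c) (a := x) hα hc hx
  choose z I hmono hI0 hI using fun n => exists_det_approx_eq hα hc n
  have hd0 : 0 < d := ha.trans_le (hab.trans hbd)
  have hlim : ∀ x, 0 < x → Tendsto (fun n => ((I n x / I n d : ℝ) : ℂ)) atTop
      (𝓝 (infDet (Mmat c (critSym α) (critW α) x) / infDet (Mmat c (critSym α) (critW α) d))) := by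
    intro x hx
    refine ((hT x hx).div (hT d hd0) hd).congr' ?_
    filter_upwards [(hT d hd0).eventually_ne hd] with n hn
    simp only [hI] at hn ⊢
    have hz : z n ≠ 0 := left_ne_zero_of_mul hn
    push_cast
    rw [Pi.div_apply, mul_div_mul_left _ _ hz]
  have hre : ∀ x, 0 < x → ∃ p : ℝ, Tendsto (fun n => I n x / I n d) atTop (𝓝 p) ∧
      infDet (Mmat c (critSym α) (critW α) x) / infDet (Mmat c (critSym α) (critW α) d) = p := by
    intro x hx
    have h1 := (Complex.continuous_re.tendsto _).comp (hlim x hx)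
    refine ⟨_, h1.congr fun n => Complex.ofReal_re _, ?_⟩
    have h2 := (Complex.continuous_ofReal.tendsto _).comp h1
    refine tendsto_nhds_unique (hlim x hx) (h2.congr fun n => ?_)
    simp
  obtain ⟨p, hp, hp'⟩ := hre a ha
  obtain ⟨q, hq, hq'⟩ := hre b (ha.trans_le hab)
  refine ⟨p, q, ?_, ?_, ?_, ?_⟩
  · exact ge_of_tendsto' hp fun n => div_nonneg (hI0 _ _) (hI0 _ _)
  · exact le_of_tendsto_of_tendsto' hp hq fun n =>
      div_le_div_of_nonneg_right (hmono n hab) (hI0 n d)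
  · rw [← hp', div_mul_cancel₀ _ hd]
  · rw [← hq', div_mul_cancel₀ _ hd]


/-! ### The contour around the poles -/

section hook

variable {δ : ℝ}

/-- The half length `πδ/2` of the arc of `hook δ`. -/
def hookLen (δ : ℝ) : ℝ := Real.pi * δ / 2

theorem hookLen_pos (hδ : 0 < δ) : 0 < hookLen δ := by unfold hookLen; positivity

theorem hook_eq (δ r : ℝ) : hook δ r =
    if r < -hookLen δ then ((r + hookLen δ : ℝ) : ℂ) - δ * Complex.I
    else if r ≤ hookLen δ then δ * Complex.exp ((r / δ : ℝ) * Complex.I)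
    else -((r - hookLen δ : ℝ) : ℂ) + δ * Complex.I := rfl

theorem hook_of_le (hδ : 0 < δ) {r : ℝ} (hr : r ≤ -hookLen δ) :
    hook δ r = ((r + hookLen δ : ℝ) : ℂ) - δ * Complex.I := by
  rcases hr.lt_or_eq with h | rfl
  · rw [hook_eq, if_pos h]
  · have hp := hookLen_pos hδ
    rw [hook_eq, if_neg (lt_irrefl _), if_pos (by linarith)]
    have e : ((-hookLen δ / δ : ℝ) : ℂ) * Complex.I = -(Real.pi / 2 * Complex.I) := by
      rw [hookLen]; push_cast
      have : (δ : ℂ) ≠ 0 := by exact_mod_cast hδ.ne'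
      field_simp
    rw [e, Complex.exp_neg, Complex.exp_pi_div_two_mul_I]
    simp

theorem hook_of_mem {r : ℝ} (hr : r ∈ Icc (-hookLen δ) (hookLen δ)) :
    hook δ r = δ * Complex.exp ((r / δ : ℝ) * Complex.I) := by
  rw [hook_eq, if_neg (not_lt.2 hr.1), if_pos hr.2]

theorem hook_of_ge (hδ : 0 < δ) {r : ℝ} (hr : hookLen δ ≤ r) :
    hook δ r = -((r - hookLen δ : ℝ) : ℂ) + δ * Complex.I := by
  have hp := hookLen_pos hδ
  rcases hr.lt_or_eq with h | rfl
  · rw [hook_eq, if_neg (by linarith), if_neg (by linarith)]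
  · rw [hook_of_mem ⟨by linarith, le_rfl⟩]
    have e : ((hookLen δ / δ : ℝ) : ℂ) * Complex.I = Real.pi / 2 * Complex.I := by
      rw [hookLen]; push_cast
      have : (δ : ℂ) ≠ 0 := by exact_mod_cast hδ.ne'
      field_simp
    rw [e, Complex.exp_pi_div_two_mul_I]
    simp

/-- The unit tangent vector of `hook δ`. -/
def hookTangent (δ r : ℝ) : ℂ :=
  if r < -hookLen δ then 1
  else if r ≤ hookLen δ then Complex.I * Complex.exp ((r / δ : ℝ) * Complex.I) else -1

theorem norm_hookTangent (δ r : ℝ) : ‖hookTangent δ r‖ = 1 := by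
  unfold hookTangent
  split_ifs
  · simp
  · rw [norm_mul, Complex.norm_exp_ofReal_mul_I]; simp
  · simp

theorem hasDerivAt_hook (hδ : 0 < δ) (r : ℝ) : HasDerivAt (hook δ) (hookTangent δ r) r := by
  have hp := hookLen_pos hδ
  have hδ' : (δ : ℂ) ≠ 0 := by exact_mod_cast hδ.ne'
  have hleft : ∀ r : ℝ, HasDerivAt
      (fun r : ℝ => ((r + hookLen δ : ℝ) : ℂ) - δ * Complex.I) 1 r := fun r => by
    have h : HasDerivAt (fun r : ℝ => r + hookLen δ) 1 r := (hasDerivAt_id r).add_const _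
    simpa using h.ofReal_comp.sub_const ((δ : ℂ) * Complex.I)
  have hmid : ∀ r : ℝ, HasDerivAt (fun r : ℝ => (δ : ℂ) * Complex.exp ((r / δ : ℝ) * Complex.I))
      (Complex.I * Complex.exp ((r / δ : ℝ) * Complex.I)) r := fun r => by
    have h : HasDerivAt (fun r : ℝ => r / δ) (1 / δ) r := (hasDerivAt_id r).div_const δ
    have e : Complex.I * Complex.exp ((r / δ : ℝ) * Complex.I) =
        δ * (Complex.exp ((r / δ : ℝ) * Complex.I) * (((1 / δ : ℝ) : ℂ) * Complex.I)) := by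
      push_cast
      field_simp
    rw [e]
    exact (h.ofReal_comp.mul_const Complex.I).cexp.const_mul (δ : ℂ)
  have hright : ∀ r : ℝ, HasDerivAt
      (fun r : ℝ => -((r - hookLen δ : ℝ) : ℂ) + δ * Complex.I) (-1) r := fun r => by
    have h : HasDerivAt (fun r : ℝ => r - hookLen δ) 1 r := (hasDerivAt_id r).sub_const _
    simpa using h.ofReal_comp.neg.add_const ((δ : ℂ) * Complex.I)
  have m1 : ∀ {r}, HasDerivWithinAt (hook δ) 1 (Iic (-hookLen δ)) r ∨ -hookLen δ < r := fun {r} => by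
    rcases le_or_gt r (-hookLen δ) with h | h
    · exact Or.inl ((hleft r).hasDerivWithinAt.congr (fun x hx => hook_of_le hδ hx)
        (hook_of_le hδ h))
    · exact Or.inr h
  rcases lt_trichotomy r (-hookLen δ) with h | h | h
  · rw [hookTangent, if_pos h]
    exact (hleft r).congr_of_eventuallyEq
      (by filter_upwards [Iio_mem_nhds h] with x hx using hook_of_le hδ (le_of_lt hx))
  · subst h
    have e : hookTangent δ (-hookLen δ) = 1 := by
      rw [hookTangent, if_neg (lt_irrefl _), if_pos (by linarith)]
      have e : ((-hookLen δ / δ : ℝ) : ℂ) * Complex.I = -(Real.pi / 2 * Complex.I) := by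
        rw [hookLen]; push_cast; field_simp
      rw [e, Complex.exp_neg, Complex.exp_pi_div_two_mul_I]
      simp
    have h1 : HasDerivWithinAt (hook δ) (hookTangent δ (-hookLen δ)) (Iic (-hookLen δ))
        (-hookLen δ) := by
      rw [e]; exact m1.resolve_right (lt_irrefl _)
    have h2 : HasDerivWithinAt (hook δ) (hookTangent δ (-hookLen δ))
        (Icc (-hookLen δ) (hookLen δ)) (-hookLen δ) := by
      have : hookTangent δ (-hookLen δ) =
          Complex.I * Complex.exp (((-hookLen δ) / δ : ℝ) * Complex.I) := by
        rw [hookTangent, if_neg (lt_irrefl _), if_pos (by linarith)]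
      rw [this]
      exact (hmid _).hasDerivWithinAt.congr (fun x hx => hook_of_mem hx)
        (hook_of_mem ⟨le_rfl, by linarith⟩)
    refine (h1.union h2).hasDerivAt (mem_of_superset (Iio_mem_nhds (show -hookLen δ < hookLen δ by
      linarith)) fun x hx => ?_)
    rcases le_total x (-hookLen δ) with h | h
    · exact Or.inl h
    · exact Or.inr ⟨h, le_of_lt hx⟩
  rcases lt_trichotomy r (hookLen δ) with h' | h' | h'
  · rw [hookTangent, if_neg (not_lt.2 h.le), if_pos h'.le]
    exact (hmid r).congr_of_eventuallyEq (by
      filter_upwards [Ioo_mem_nhds h h'] with x hx using hook_of_mem ⟨hx.1.le, hx.2.le⟩)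
  · subst h'
    have e : hookTangent δ (hookLen δ) = -1 := by
      rw [hookTangent, if_neg (not_lt.2 h.le), if_pos le_rfl]
      have e : ((hookLen δ / δ : ℝ) : ℂ) * Complex.I = Real.pi / 2 * Complex.I := by
        rw [hookLen]; push_cast; field_simp
      rw [e, Complex.exp_pi_div_two_mul_I]
      simp
    have h1 : HasDerivWithinAt (hook δ) (hookTangent δ (hookLen δ)) (Ici (hookLen δ))
        (hookLen δ) := by
      rw [e]
      exact (hright _).hasDerivWithinAt.congr (fun x hx => hook_of_ge hδ hx) (hook_of_ge hδ le_rfl)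
    have h2 : HasDerivWithinAt (hook δ) (hookTangent δ (hookLen δ))
        (Icc (-hookLen δ) (hookLen δ)) (hookLen δ) := by
      have : hookTangent δ (hookLen δ) =
          Complex.I * Complex.exp (((hookLen δ) / δ : ℝ) * Complex.I) := by
        rw [hookTangent, if_neg (not_lt.2 h.le), if_pos le_rfl]
      rw [this]
      exact (hmid _).hasDerivWithinAt.congr (fun x hx => hook_of_mem hx)
        (hook_of_mem ⟨by linarith, le_rfl⟩)
    refine (h1.union h2).hasDerivAt (mem_of_superset (Ioi_mem_nhds (show -hookLen δ < hookLen δ by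
      linarith)) fun x hx => ?_)
    rcases le_total (hookLen δ) x with h | h
    · exact Or.inl h
    · exact Or.inr ⟨le_of_lt hx, h⟩
  · rw [hookTangent, if_neg (not_lt.2 h.le), if_neg (not_le.2 h')]
    exact (hright r).congr_of_eventuallyEq
      (by filter_upwards [Ioi_mem_nhds h'] with x hx using hook_of_ge hδ (le_of_lt hx))

theorem deriv_hook (hδ : 0 < δ) : deriv (hook δ) = hookTangent δ :=
  funext fun r => (hasDerivAt_hook hδ r).deriv

theorem norm_deriv_hook (hδ : 0 < δ) (r : ℝ) : ‖deriv (hook δ) r‖ = 1 := by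
  rw [deriv_hook hδ, norm_hookTangent]

theorem continuous_hook (hδ : 0 < δ) : Continuous (hook δ) :=
  continuous_iff_continuousAt.2 fun r => (hasDerivAt_hook hδ r).continuousAt

/-- A point of the contour lies on the open right half circle or on one of the two rays. -/
theorem hook_mem (hδ : 0 < δ) (r : ℝ) :
    (0 < (hook δ r).re ∧ ‖hook δ r‖ = δ) ∨ ((hook δ r).re ≤ 0 ∧ |(hook δ r).im| = δ) := by
  rcases le_or_gt r (-hookLen δ) with h | h
  · right
    rw [hook_of_le hδ h]
    exact ⟨by simpa using (by linarith : r + hookLen δ ≤ 0), by simp [abs_of_pos hδ]⟩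
  rcases lt_or_ge r (hookLen δ) with h' | h'
  · left
    rw [hook_of_mem ⟨h.le, h'.le⟩, norm_mul, Complex.norm_exp_ofReal_mul_I]
    refine ⟨?_, by simp [abs_of_pos hδ]⟩
    rw [Complex.re_ofReal_mul, Complex.exp_ofReal_mul_I_re]
    refine mul_pos hδ (Real.cos_pos_of_mem_Ioo ⟨?_, ?_⟩)
    · rw [lt_div_iff₀ hδ]; unfold hookLen at h; linarith
    · rw [div_lt_iff₀ hδ]; unfold hookLen at h'; linarith
  · right
    rw [hook_of_ge hδ h']
    exact ⟨by simpa using h', by simp [abs_of_pos hδ]⟩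

theorem abs_hook_im_le (hδ : 0 < δ) (r : ℝ) : |(hook δ r).im| ≤ δ := by
  rcases hook_mem hδ r with h | h
  · exact (Complex.abs_im_le_norm _).trans h.2.le
  · exact h.2.le

theorem hook_re_le (hδ : 0 < δ) (r : ℝ) : (hook δ r).re ≤ δ := by
  rcases hook_mem hδ r with h | h
  · exact (Complex.re_le_norm _).trans h.2.le
  · exact h.1.trans hδ.le

theorem le_norm_hook_add (hδ : 0 < δ) (r : ℝ) (k : ℕ) : δ ≤ ‖hook δ r + k‖ := by
  rcases hook_mem hδ r with h | h
  · refine h.2.symm.le.trans ?_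
    rw [Complex.norm_def, Complex.norm_def]
    refine Real.sqrt_le_sqrt ?_
    simp only [Complex.normSq_apply, Complex.add_re, Complex.add_im, Complex.natCast_re,
      Complex.natCast_im, add_zero]
    nlinarith [mul_nonneg h.1.le (Nat.cast_nonneg (α := ℝ) k), Nat.cast_nonneg (α := ℝ) k]
  · have := Complex.abs_im_le_norm (hook δ r + k)
    simp only [Complex.add_im, Complex.natCast_im, add_zero] at this
    exact h.2.symm.le.trans this

theorem hook_add_mem_slitPlane (hδ : 0 < δ) (r : ℝ) (k : ℕ) :
    hook δ r + k ∈ Complex.slitPlane := by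
  rcases hook_mem hδ r with h | h
  · left
    simp only [Complex.add_re, Complex.natCast_re]
    have := h.1
    positivity
  · right
    simp only [Complex.add_im, Complex.natCast_im, add_zero]
    intro h0
    rw [h0, abs_zero] at h
    exact hδ.ne h.2

theorem hook_ne_neg_nat (hδ : 0 < δ) (r : ℝ) (k : ℕ) : hook δ r ≠ -k := fun h => by
  have := le_norm_hook_add hδ r k
  rw [h, neg_add_cancel, norm_zero] at this
  linarith

theorem sq_hook_re_ge (hδ : 0 < δ) (r : ℝ) :
    r ^ 2 / 2 - hookLen δ ^ 2 ≤ (hook δ r).re ^ 2 := by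
  have hp := hookLen_pos hδ
  rcases le_or_gt r (-hookLen δ) with h | h
  · rw [hook_of_le hδ h]
    simp only [Complex.sub_re, Complex.ofReal_re, Complex.mul_re, Complex.I_re, Complex.I_im,
      Complex.ofReal_im, mul_zero, zero_mul, sub_zero]
    nlinarith [sq_nonneg (r / 2 + hookLen δ)]
  rcases lt_or_ge r (hookLen δ) with h' | h'
  · have : r ^ 2 ≤ hookLen δ ^ 2 := sq_le_sq' h.le h'.le
    nlinarith [sq_nonneg (hook δ r).re, sq_nonneg (hookLen δ)]
  · rw [hook_of_ge hδ h']
    simp only [Complex.add_re, Complex.neg_re, Complex.ofReal_re, Complex.mul_re, Complex.I_re,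
      Complex.I_im, Complex.ofReal_im, mul_zero, zero_mul, sub_zero, add_zero]
    nlinarith [sq_nonneg (r / 2 - hookLen δ)]

theorem range_hook (hδ : 0 < δ) :
    range (hook δ) = {z | (0 < z.re ∧ ‖z‖ = δ) ∨ (z.re ≤ 0 ∧ |z.im| = δ)} := by
  ext z
  refine ⟨fun ⟨r, hr⟩ => hr ▸ hook_mem hδ r, ?_⟩
  have hp := hookLen_pos hδ
  rintro (⟨h1, h2⟩ | ⟨h1, h2⟩)
  · have ha : |z.arg| < Real.pi / 2 := (Complex.abs_arg_lt_pi_div_two_iff).2 (Or.inl h1)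
    rw [abs_lt] at ha
    refine ⟨δ * z.arg, ?_⟩
    rw [hook_of_mem ⟨?_, ?_⟩, mul_div_cancel_left₀ _ hδ.ne', ← h2]
    · exact Complex.norm_mul_exp_arg_mul_I z
    · unfold hookLen; nlinarith
    · unfold hookLen; nlinarith
  · rcases abs_choice z.im with h | h <;> rw [h] at h2
    · refine ⟨hookLen δ - z.re, ?_⟩
      rw [hook_of_ge hδ (by linarith)]
      apply Complex.ext <;> simp [h2]
    · refine ⟨z.re - hookLen δ, ?_⟩
      rw [hook_of_le hδ (by linarith)]
      apply Complex.ext <;> simp [← h2]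

end hook


/-! ### Residue calculus on the contour -/

section residue

variable {δ c : ℝ}

theorem tendsto_arg_add (δ : ℝ) (hδ : 0 < δ) (k : ℝ) :
    Tendsto (fun X : ℝ => (((-X + k : ℝ) : ℂ) + δ * Complex.I).arg) atTop (𝓝 Real.pi) := by
  have h1 : Tendsto (fun X : ℝ => ((-1 + k / X : ℝ) : ℂ) + (δ / X : ℝ) * Complex.I) atTop
      (𝓝[{z : ℂ | 0 ≤ z.im}] (-1)) := by
    refine tendsto_nhdsWithin_iff.2 ⟨?_, ?_⟩
    · have hk : Tendsto (fun X : ℝ => ((-1 + k / X : ℝ) : ℂ)) atTop (𝓝 ((-1 + 0 : ℝ) : ℂ)) :=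
        (Complex.continuous_ofReal.tendsto _).comp
          (tendsto_const_nhds.add (tendsto_const_nhds.div_atTop tendsto_id))
      have hd : Tendsto (fun X : ℝ => ((δ / X : ℝ) : ℂ)) atTop (𝓝 ((0 : ℝ) : ℂ)) :=
        (Complex.continuous_ofReal.tendsto _).comp (tendsto_const_nhds.div_atTop tendsto_id)
      simpa using hk.add (hd.mul_const Complex.I)
    · filter_upwards [eventually_gt_atTop 0] with X hX
      simp only [Complex.add_im, Complex.ofReal_im, Complex.mul_im,
        Complex.ofReal_re, Complex.I_im, Complex.I_re, mul_one, mul_zero, add_zero, zero_add]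
      positivity
  have h2 := Complex.tendsto_arg_nhdsWithin_im_nonneg_of_re_neg_of_im_zero (z := -1)
    (by simp) (by simp)
  refine (h2.comp h1).congr' ?_
  filter_upwards [eventually_gt_atTop 0] with X hX
  have hX' : (X : ℂ) ≠ 0 := by exact_mod_cast hX.ne'
  have e : ((-X + k : ℝ) : ℂ) + δ * Complex.I =
      (X : ℂ) * (((-1 + k / X : ℝ) : ℂ) + (δ / X : ℝ) * Complex.I) := by
    push_cast; field_simp
  rw [e, Complex.arg_real_mul _ hX]
  rfl

/-- The integral over the contour of a function with a single simple pole. -/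
theorem contourInt_hook_add_pole (hδ : 0 < δ) (hc : δ < c) {g : ℂ → ℂ}
    (hg : DifferentiableOn ℂ g {z | z.re < c})
    (hlim : ∀ ε > 0, ∃ X₀ : ℝ, ∀ z : ℂ, |z.im| ≤ δ → z.re ≤ -X₀ → ‖g z‖ ≤ ε) (m : ℂ) (k : ℕ)
    (hint : Integrable fun r => g (hook δ r) + m / (hook δ r + k)) :
    contourInt (hook δ) (fun z => g z + m / (z + k)) = 2 * Real.pi * Complex.I * m := by
  have hp := hookLen_pos hδ
  have hint' : Integrable fun r => (g (hook δ r) + m / (hook δ r + k)) * deriv (hook δ) r := by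
    refine hint.mul_bdd (c := 1) (measurable_deriv _).aestronglyMeasurable
      (Eventually.of_forall fun r => (norm_deriv_hook hδ r).le)
  have hT := intervalIntegral_tendsto_integral hint'
    (a := fun X : ℝ => -(X + hookLen δ)) (b := fun X : ℝ => X + hookLen δ) (l := atTop)
    (tendsto_neg_atTop_atBot.comp (tendsto_atTop_add_const_right _ _ tendsto_id))
    (tendsto_atTop_add_const_right _ _ tendsto_id)
  refine tendsto_nhds_unique hT ?_
  -- the value of the truncated integral from a primitive on a large disc
  have key : ∀ X : ℝ, 0 < X → ∃ G : ℂ → ℂ,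
      (∫ r in (-(X + hookLen δ))..(X + hookLen δ),
        (g (hook δ r) + m / (hook δ r + k)) * deriv (hook δ) r) =
      (G (-X + δ * Complex.I) - G (-X - δ * Complex.I)) +
        m * (2 * Complex.I * (((-X + k : ℝ) : ℂ) + δ * Complex.I).arg) ∧
      ∀ z : ℂ, z.re = -X → |z.im| ≤ δ → HasDerivAt G (g z) z := by
    intro X hX
    have hball : DifferentiableOn ℂ g (Metric.ball (-X : ℂ) (X + c)) := by
      refine hg.mono fun z hz => ?_
      rw [Metric.mem_ball, dist_eq_norm] at hz
      have := (Complex.re_le_norm _).trans_lt hz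
      simp at this
      show z.re < c
      linarith
    obtain ⟨G, hG⟩ := hball.isExactOn_ball
    have mem : ∀ z : ℂ, -X ≤ z.re → z.re ≤ 0 → |z.im| ≤ δ → z ∈ Metric.ball (-X : ℂ) (X + c) := by
      intro z h1 h2 h3
      rw [Metric.mem_ball, dist_eq_norm, Complex.norm_def, Real.sqrt_lt' (by linarith)]
      rw [Complex.normSq_apply]
      simp only [sub_neg_eq_add, Complex.add_re, Complex.add_im, Complex.ofReal_re,
        Complex.ofReal_im, add_zero]
      have := sq_abs z.im
      nlinarith [abs_nonneg z.im, mul_nonneg (sub_nonneg.2 h1) (neg_nonneg.2 h2)]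
    have hmem : ∀ r : ℝ, r ∈ Icc (-(X + hookLen δ)) (X + hookLen δ) →
        hook δ r ∈ Metric.ball (-X : ℂ) (X + c) := by
      intro r hr
      rcases hook_mem hδ r with h | h
      · rw [Metric.mem_ball, dist_eq_norm]
        calc ‖hook δ r - -X‖ ≤ ‖hook δ r‖ + ‖(-X : ℂ)‖ := norm_sub_le _ _
          _ = δ + X := by rw [h.2, norm_neg, Complex.norm_real, Real.norm_of_nonneg hX.le]
          _ < X + c := by linarith
      · refine mem _ ?_ h.1 h.2.le
        rcases le_or_gt r (-hookLen δ) with h1 | h1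
        · rw [hook_of_le hδ h1]; simp; linarith [hr.1]
        rcases lt_or_ge r (hookLen δ) with h2 | h2
        · rw [hook_of_mem ⟨h1.le, h2.le⟩, Complex.re_ofReal_mul, Complex.exp_ofReal_mul_I_re]
          have : 0 ≤ Real.cos (r / δ) := by
            refine Real.cos_nonneg_of_mem_Icc ⟨?_, ?_⟩
            · rw [le_div_iff₀ hδ]; unfold hookLen at h1; linarith
            · rw [div_le_iff₀ hδ]; unfold hookLen at h2; linarith
          nlinarith
        · rw [hook_of_ge hδ h2]; simp; linarith [hr.2]
    refine ⟨G, ?_, fun z h1 h2 => hG z (mem z h1.ge (by linarith) h2)⟩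
    rw [intervalIntegral.integral_eq_sub_of_hasDerivAt
      (f := fun r => G (hook δ r) + m * Complex.log (hook δ r + k)) (fun r hr => ?_)
      hint'.intervalIntegrable]
    · have e1 : hook δ (X + hookLen δ) = -X + δ * Complex.I := by
        rw [hook_of_ge hδ (by linarith)]; simp
      have e2 : hook δ (-(X + hookLen δ)) = -X - δ * Complex.I := by
        rw [hook_of_le hδ (by linarith)]; push_cast; ring
      have e3 : (-X - δ * Complex.I + k : ℂ) =
          (starRingEnd ℂ) (((-X + k : ℝ) : ℂ) + δ * Complex.I) := by
        simp only [map_add, map_mul, Complex.conj_ofReal, Complex.conj_I]; push_cast; ring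
      have e4 : (-X + δ * Complex.I + k : ℂ) = ((-X + k : ℝ) : ℂ) + δ * Complex.I := by
        push_cast; ring
      -- The two end points are complex conjugate, so the logarithm contributes `2i` times an argument.
      have harg : (((-X + k : ℝ) : ℂ) + δ * Complex.I).arg ≠ Real.pi := by
        intro h
        have := (Complex.arg_eq_pi_iff.1 h).2
        simp at this
        exact hδ.ne' this
      simp only [e1, e2, e3, e4]
      rw [Complex.log_conj _ harg, ← sub_eq_zero]
      have := Complex.sub_conj (Complex.log (((-X + k : ℝ) : ℂ) + δ * Complex.I))
      rw [Complex.log_im] at this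
      push_cast at this ⊢
      linear_combination m * this
    · rw [uIcc_of_le (by linarith)] at hr
      have h1 := (hasDerivAt_hook hδ r).differentiableAt.hasDerivAt
      have h2 := (hG _ (hmem r hr)).comp r h1
      have h3 := ((h1.add_const (k : ℂ)).clog_real (hook_add_mem_slitPlane hδ r k)).const_mul m
      refine (h2.add h3).congr_deriv ?_
      ring
  choose! G hG1 hG2 using key
  have hlog : Tendsto (fun X : ℝ => m * (2 * Complex.I *
      (((-X + k : ℝ) : ℂ) + δ * Complex.I).arg)) atTop (𝓝 (2 * Real.pi * Complex.I * m)) := by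
    have h := (((Complex.continuous_ofReal.tendsto _).comp
      (tendsto_arg_add δ hδ k)).const_mul (2 * Complex.I)).const_mul m
    have e : 2 * Real.pi * Complex.I * m = m * (2 * Complex.I * Real.pi) := by ring
    rw [e]
    exact h
  -- The primitives depend on `X`, but their increments over a vertical segment of length `2δ` are
  -- bounded by `2δ` times the supremum of `g` there.
  have hsmall : Tendsto (fun X : ℝ => G X (-X + δ * Complex.I) - G X (-X - δ * Complex.I)) atTop
      (𝓝 0) := by
    rw [Metric.tendsto_nhds]
    intro ε hε
    obtain ⟨X₀, hX₀⟩ := hlim (ε / (4 * δ)) (by positivity)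
    filter_upwards [eventually_ge_atTop X₀, eventually_gt_atTop 0] with X h1 h2
    rw [dist_zero_right]
    have := Convex.norm_image_sub_le_of_norm_hasDerivWithin_le (𝕜 := ℂ) (f := G X) (f' := g)
      (C := ε / (4 * δ)) (s := {z : ℂ | z.re = -X ∧ |z.im| ≤ δ}) (x := -X - δ * Complex.I)
      (y := -X + δ * Complex.I)
      (fun z hz => (hG2 X h2 z hz.1 hz.2).hasDerivWithinAt)
      (fun z hz => hX₀ z hz.2 (by rw [hz.1]; linarith)) ?_ ?_ ?_
    · refine this.trans_lt ?_
      have e : (-X + δ * Complex.I - (-X - δ * Complex.I) : ℂ) = ((2 * δ : ℝ) : ℂ) * Complex.I := by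
        push_cast; ring
      rw [e, norm_mul, Complex.norm_I, Complex.norm_real, Real.norm_of_nonneg (by positivity)]
      have : ε / (4 * δ) * (2 * δ * 1) = ε / 2 := by field_simp; norm_num
      linarith
    · have : {z : ℂ | z.re = -X ∧ |z.im| ≤ δ} = {z : ℂ | z.re = -X} ∩
          Complex.imLm ⁻¹' (Icc (-δ) δ) := by
        ext z; simp [abs_le]
      rw [this]
      exact (convex_hyperplane (f := fun z : ℂ => z.re) ⟨by simp, by simp⟩ (-X)).inter
        ((convex_Icc _ _).linear_preimage _)
    · simp [abs_of_pos hδ]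
    · simp [abs_of_pos hδ]
  have := hsmall.add hlog
  rw [zero_add] at this
  refine this.congr' ?_
  filter_upwards [eventually_gt_atTop 0] with X hX
  exact (hG1 X hX).symm

/-- Holomorphic to the left of `re z = c`, with Gaussian decay in the strip `|im z| ≤ δ`. -/
structure HookDecay (δ c : ℝ) (f : ℂ → ℂ) : Prop where
  diff : DifferentiableOn ℂ f {z | z.re < c}
  decay : ∃ κ > 0, ∃ C, ∀ z : ℂ, z.re ≤ δ → |z.im| ≤ δ → ‖f z‖ ≤ C * Real.exp (-κ * z.re ^ 2)

namespace HookDecay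

variable {f : ℂ → ℂ}

theorem mul_bounded (hf : HookDecay δ c f) {g : ℂ → ℂ} (hg : DifferentiableOn ℂ g {z | z.re < c})
    {A : ℝ} (hA : ∀ z : ℂ, z.re ≤ δ → |z.im| ≤ δ → ‖g z‖ ≤ A) :
    HookDecay δ c fun z => g z * f z := by
  refine ⟨hg.mul hf.diff, ?_⟩
  obtain ⟨κ, hκ, C, hC⟩ := hf.decay
  refine ⟨κ, hκ, A * C, fun z h1 h2 => ?_⟩
  rw [norm_mul, mul_assoc]
  exact mul_le_mul (hA z h1 h2) (hC z h1 h2) (norm_nonneg _) ((norm_nonneg _).trans (hA z h1 h2))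

theorem integrable (hδ : 0 < δ) (hc : δ < c) (hf : HookDecay δ c f) :
    Integrable fun r => f (hook δ r) := by
  obtain ⟨κ, hκ, C, hC⟩ := hf.decay
  have hC0 : 0 ≤ C := by
    have h := (norm_nonneg _).trans (hC 0 (by simpa using hδ.le) (by simpa using hδ.le))
    simpa using h
  have hI : Integrable fun r : ℝ => C * Real.exp (κ * hookLen δ ^ 2) *
      Real.exp (-(κ / 2) * r ^ 2) := (integrable_exp_neg_mul_sq (by positivity)).const_mul _
  refine hI.mono' ?_ (Eventually.of_forall fun r => ?_)
  · refine Continuous.aestronglyMeasurable (continuous_iff_continuousAt.2 fun r => ?_)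
    have : DifferentiableAt ℂ f (hook δ r) := hf.diff.differentiableAt
      ((isOpen_lt Complex.continuous_re continuous_const).mem_nhds
        ((hook_re_le hδ r).trans_lt hc))
    exact ContinuousAt.comp this.continuousAt (continuous_hook hδ).continuousAt
  · refine (hC _ (hook_re_le hδ r) (abs_hook_im_le hδ r)).trans ?_
    rw [mul_assoc, ← Real.exp_add]
    refine mul_le_mul_of_nonneg_left (Real.exp_le_exp.2 ?_) hC0
    nlinarith [sq_hook_re_ge hδ r]

theorem tendsto_zero (hδ : 0 < δ) (hf : HookDecay δ c f) :
    ∀ ε > 0, ∃ X₀ : ℝ, ∀ z : ℂ, |z.im| ≤ δ → z.re ≤ -X₀ → ‖f z‖ ≤ ε := by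
  intro ε hε
  obtain ⟨κ, hκ, C, hC⟩ := hf.decay
  have h : Tendsto (fun X : ℝ => C * Real.exp (-(κ * X ^ 2))) atTop (𝓝 (C * 0)) := by
    refine (Real.tendsto_exp_neg_atTop_nhds_zero.comp ?_).const_mul C
    exact (tendsto_pow_atTop two_ne_zero).const_mul_atTop hκ
  rw [mul_zero] at h
  obtain ⟨X₀, hX₀⟩ := eventually_atTop.1 (h.eventually (ge_mem_nhds hε))
  refine ⟨max X₀ 0, fun z h1 h2 => (hC z (h2.trans ?_) h1).trans ?_⟩
  · linarith [le_max_right X₀ 0]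
  · have := hX₀ (-z.re) (by linarith [le_max_left X₀ 0])
    simpa using this

theorem contourInt_eq_zero (hδ : 0 < δ) (hc : δ < c) (hf : HookDecay δ c f) :
    contourInt (hook δ) f = 0 := by
  have := contourInt_hook_add_pole hδ hc hf.diff (hf.tendsto_zero hδ) 0 0
    (by simpa using hf.integrable hδ hc)
  simpa using this

theorem norm_le (hf : HookDecay δ c f) : ∃ C, ∀ z : ℂ, z.re ≤ δ → |z.im| ≤ δ → ‖f z‖ ≤ C := by
  obtain ⟨κ, hκ, C, hC⟩ := hf.decay
  refine ⟨|C|, fun z h1 h2 => (hC z h1 h2).trans ?_⟩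
  calc C * Real.exp (-κ * z.re ^ 2) ≤ |C| * 1 := by
        refine mul_le_mul (le_abs_self C) (Real.exp_le_one_iff.2 ?_) (Real.exp_pos _).le
          (abs_nonneg _)
        nlinarith [sq_nonneg z.re]
    _ = |C| := mul_one _

theorem integrable_div (hδ : 0 < δ) (hc : δ < c) (hf : HookDecay δ c f) (k : ℕ) :
    Integrable fun r => f (hook δ r) / (hook δ r + k) := by
  simp only [div_eq_mul_inv]
  refine (hf.integrable hδ hc).mul_bdd (c := δ⁻¹) ?_ (Eventually.of_forall fun r => ?_)
  · have := continuous_hook hδ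
    exact (Continuous.inv₀ (by fun_prop) fun r h =>
      hook_ne_neg_nat hδ r k (eq_neg_of_add_eq_zero_left h)).aestronglyMeasurable
  · rw [norm_inv]
    exact inv_anti₀ hδ (le_norm_hook_add hδ r k)

theorem contourInt_div (hδ : 0 < δ) (hc : δ < c) (hf : HookDecay δ c f) (k : ℕ) :
    contourInt (hook δ) (fun z => f z / (z + k)) = 2 * Real.pi * Complex.I * f (-k) := by
  have e : ∀ z : ℂ, z ≠ -k → f z / (z + k) = dslope f (-k) z + f (-k) / (z + k) := by
    intro z hz
    have h0 : z + k ≠ 0 := fun h => hz (eq_neg_of_add_eq_zero_left h)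
    rw [dslope_of_ne _ hz, slope_def_field]
    rw [sub_neg_eq_add, ← add_div]; ring_nf
  have hmem : {z : ℂ | z.re < c} ∈ 𝓝 (-k : ℂ) := by
    refine (isOpen_lt Complex.continuous_re continuous_const).mem_nhds ?_
    simp only [mem_ofPred_eq, Complex.neg_re, Complex.natCast_re]
    have : (0 : ℝ) ≤ k := Nat.cast_nonneg k
    linarith
  rw [← contourInt_hook_add_pole hδ hc (g := dslope f (-k))
    ((Complex.differentiableOn_dslope hmem).2 hf.diff) ?_ (f (-k)) k ?_]
  · unfold contourInt
    congr 1; ext r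
    exact congrArg (· * _) (e _ (hook_ne_neg_nat hδ r k))
  · intro ε hε
    obtain ⟨C, hC⟩ := hf.norm_le
    have hC0 : 0 ≤ C := (norm_nonneg _).trans (hC 0 (by simpa using hδ.le) (by simpa using hδ.le))
    refine ⟨k + 2 * C / ε + 1, fun z h1 h2 => ?_⟩
    have h0 : 0 ≤ 2 * C / ε := by positivity
    have hk : (0 : ℝ) ≤ k := Nat.cast_nonneg k
    have hn : 2 * C / ε + 1 ≤ ‖z + k‖ := by
      have := Complex.abs_re_le_norm (z + k)
      have h3 := neg_abs_le (z + k).re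
      simp only [Complex.add_re, Complex.natCast_re] at this h3
      linarith
    have hz : z ≠ -k := by
      rintro rfl
      rw [neg_add_cancel, norm_zero] at hn
      linarith
    rw [dslope_of_ne _ hz, slope_def_field, sub_neg_eq_add, norm_div]
    rw [div_le_iff₀ (by linarith)]
    calc ‖f z - f (-k)‖ ≤ C + C := (norm_sub_le _ _).trans (add_le_add
            (hC z (by linarith) h1) (hC _ (by simp; linarith) (by simpa using hδ.le)))
      _ = ε * (2 * C / ε) := by field_simp; ring
      _ ≤ ε * ‖z + k‖ := mul_le_mul_of_nonneg_left (by linarith) hε.le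
  · refine (hf.integrable_div hδ hc k).congr (Eventually.of_forall fun r => ?_)
    exact e _ (hook_ne_neg_nat hδ r k)

end HookDecay

end residue


/-! ### The poles of the Gamma function -/

section gamma

/-- The integral `∫_1^∞ x ^ (t - 1) e ^ (-x) dx`, the entire part of the Gamma function. -/
def gammaTail (t : ℂ) : ℂ := ∫ x in Ioi (1 : ℝ), Complex.exp (-x) * (x : ℂ) ^ (t - 1)

theorem gammaTail_eq_mellin :
    gammaTail = mellin ((Ioi (1 : ℝ)).indicator fun x : ℝ => Complex.exp (-x)) := by
  ext t
  rw [gammaTail, mellin]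
  have e : (fun x : ℝ => (x : ℂ) ^ (t - 1) • (Ioi (1 : ℝ)).indicator
      (fun x : ℝ => Complex.exp (-x)) x) =
      (Ioi (1 : ℝ)).indicator fun x : ℝ => Complex.exp (-x) * (x : ℂ) ^ (t - 1) := by
    ext x
    by_cases hx : x ∈ Ioi (1 : ℝ)
    · rw [indicator_of_mem hx, indicator_of_mem hx, smul_eq_mul, mul_comm]
    · rw [indicator_of_notMem hx, indicator_of_notMem hx, smul_zero]
  rw [e, setIntegral_indicator measurableSet_Ioi,
    inter_eq_right.2 (Ioi_subset_Ioi zero_le_one)]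

theorem norm_exp_neg_mul_cpow {x : ℝ} (hx : 0 < x) (t : ℂ) :
    ‖Complex.exp (-x) * (x : ℂ) ^ (t - 1)‖ = Real.exp (-x) * x ^ (t.re - 1) := by
  rw [norm_mul, Complex.norm_cpow_eq_rpow_re_of_pos hx, ← Complex.ofReal_neg,
    ← Complex.ofReal_exp, Complex.norm_real, Real.norm_of_nonneg (Real.exp_pos _).le]
  simp

theorem integrableOn_exp_neg_mul_rpow (s : ℝ) :
    IntegrableOn (fun x : ℝ => Real.exp (-x) * x ^ (s - 1)) (Ioi 1) := by
  have h := (Real.GammaIntegral_convergent (s := max s 1) (by positivity)).mono_set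
    (Ioi_subset_Ioi zero_le_one)
  refine h.mono' ?_ ((ae_restrict_iff' measurableSet_Ioi).2 (Eventually.of_forall fun x hx => ?_))
  · exact (Measurable.mul (by fun_prop) (by fun_prop)).aestronglyMeasurable
  · have hx0 : (1 : ℝ) < x := hx
    rw [Real.norm_of_nonneg (by positivity)]
    gcongr
    · exact hx0.le
    · exact le_max_left _ _

theorem aestronglyMeasurable_exp_mul_cpow (t : ℂ) (μ : Measure ℝ) :
    AEStronglyMeasurable (fun x : ℝ => Complex.exp (-x) * (x : ℂ) ^ (t - 1)) μ :=
  (Measurable.mul (by fun_prop) (by fun_prop)).aestronglyMeasurable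

theorem integrableOn_exp_neg_mul_cpow (t : ℂ) :
    IntegrableOn (fun x : ℝ => Complex.exp (-x) * (x : ℂ) ^ (t - 1)) (Ioi 1) := by
  refine (integrableOn_exp_neg_mul_rpow t.re).mono' (aestronglyMeasurable_exp_mul_cpow t _)
    ((ae_restrict_iff' measurableSet_Ioi).2 (Eventually.of_forall fun x hx => ?_))
  exact (norm_exp_neg_mul_cpow (zero_lt_one.trans hx) t).le

theorem differentiable_gammaTail : Differentiable ℂ gammaTail := by
  rw [gammaTail_eq_mellin]
  intro t
  refine mellin_differentiableAt_of_isBigO_rpow (a := t.re + 1) (b := t.re - 1) ?_ ?_ (by linarith)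
    ?_ (by linarith)
  · refine (Integrable.integrableOn ?_).locallyIntegrableOn
    rw [integrable_indicator_iff measurableSet_Ioi]
    simpa using integrableOn_exp_neg_mul_cpow 1
  · refine IsBigO.of_bound 1 ?_
    have h := (isLittleO_exp_neg_mul_rpow_atTop (a := 1) one_pos (-(t.re + 1))).bound one_pos
    filter_upwards [h, eventually_gt_atTop 1] with x hx hx1
    rw [indicator_of_mem (mem_Ioi.2 hx1)]
    rw [← Complex.ofReal_neg, ← Complex.ofReal_exp, Complex.norm_real]
    simpa using hx
  · refine IsBigO.of_bound 1 ?_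
    filter_upwards [mem_nhdsWithin_of_mem_nhds (Iio_mem_nhds (zero_lt_one (α := ℝ)))] with x hx
    rw [indicator_of_notMem (by simpa using le_of_lt hx), norm_zero]
    positivity

theorem exists_norm_gammaTail_le (A : ℝ) : ∃ C, ∀ t : ℂ, t.re ≤ A → ‖gammaTail t‖ ≤ C := by
  refine ⟨∫ x in Ioi (1 : ℝ), Real.exp (-x) * x ^ (A - 1), fun t ht => ?_⟩
  refine norm_integral_le_of_norm_le (integrableOn_exp_neg_mul_rpow A)
    ((ae_restrict_iff' measurableSet_Ioi).2 (Eventually.of_forall fun x hx => ?_))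
  have hx0 : (1 : ℝ) < x := hx
  rw [norm_exp_neg_mul_cpow (by linarith) t]
  gcongr
  exact hx0.le

theorem gammaTail_add_one (t : ℂ) : t * gammaTail t = gammaTail (t + 1) - Complex.exp (-1) := by
  have hd : ∀ x ∈ Ici (1 : ℝ), HasDerivAt (fun x : ℝ => Complex.exp (-x) * (x : ℂ) ^ t)
      (t * (Complex.exp (-x) * (x : ℂ) ^ (t - 1)) - Complex.exp (-x) * (x : ℂ) ^ t) x := by
    intro x hx
    have hx0 : (0 : ℝ) < x := lt_of_lt_of_le zero_lt_one hx
    have h1 : HasDerivAt (fun x : ℝ => (x : ℂ) ^ t) (t * (x : ℂ) ^ (t - 1)) x := by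
      have h0 : HasDerivAt (fun z : ℂ => z ^ t) (t * (x : ℂ) ^ (t - 1)) (x : ℂ) := by
        simpa using (hasDerivAt_id (x : ℂ)).cpow_const (c := t)
          (Complex.ofReal_mem_slitPlane.2 hx0)
      exact h0.comp_ofReal
    have h2 : HasDerivAt (fun x : ℝ => Complex.exp (-x)) (-Complex.exp (-x)) x := by
      have h0 : HasDerivAt (fun z : ℂ => Complex.exp (-z)) (-Complex.exp (-x)) (x : ℂ) := by
        simpa using (hasDerivAt_neg (x : ℂ)).cexp
      exact h0.comp_ofReal
    refine (h2.mul h1).congr_deriv ?_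
    ring
  have e1 : ∀ x : ℝ, Complex.exp (-x) * (x : ℂ) ^ t =
      Complex.exp (-x) * (x : ℂ) ^ (t + 1 - 1) := fun x => by rw [add_sub_cancel_right]
  have hi1 := (integrableOn_exp_neg_mul_cpow t).const_mul t
  have hi2 : IntegrableOn (fun x : ℝ => Complex.exp (-x) * (x : ℂ) ^ t) (Ioi 1) := by
    simp only [e1]; exact integrableOn_exp_neg_mul_cpow (t + 1)
  have hlim : Tendsto (fun x : ℝ => Complex.exp (-x) * (x : ℂ) ^ t) atTop (𝓝 0) := by
    rw [tendsto_zero_iff_norm_tendsto_zero]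
    have h := tendsto_rpow_mul_exp_neg_mul_atTop_nhds_zero t.re 1 one_pos
    refine h.congr' ?_
    filter_upwards [eventually_gt_atTop 0] with x hx
    have := norm_exp_neg_mul_cpow hx (t + 1)
    rw [add_sub_cancel_right] at this
    rw [this]
    simp [mul_comm]
  have h := integral_Ioi_of_hasDerivAt_of_tendsto' hd (hi1.sub hi2) hlim
  rw [integral_sub hi1 hi2, integral_const_mul] at h
  simp only [e1] at h
  change t * gammaTail t - gammaTail (t + 1) = _ at h
  simp at h
  linear_combination h

/-- The sum of the principal parts of the Gamma function at its poles. -/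
def gammaPoles (t : ℂ) : ℂ := ∑' k : ℕ, (-1) ^ k / (k ! : ℂ) / (t + k)

theorem summable_inv_factorial_div {z : ℕ → ℂ} {d : ℝ} (hd : 0 < d) (hz : ∀ k, d ≤ ‖z k‖) :
    Summable fun k : ℕ => (-1) ^ k / (k ! : ℂ) / z k := by
  refine Summable.of_norm_bounded (g := fun k : ℕ => 1 / (k ! : ℝ) * d⁻¹)
    (summable_inv_factorial.mul_right _) fun k => ?_
  rw [norm_div, norm_div, norm_pow, norm_neg, norm_one, one_pow, Complex.norm_natCast,
    div_eq_mul_inv _ ‖z k‖]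
  exact mul_le_mul_of_nonneg_left (inv_anti₀ hd (hz k)) (by positivity)

theorem exists_le_norm_add_nat {t : ℂ} (ht : ∀ k : ℕ, t ≠ -k) : ∃ d > 0, ∀ k : ℕ, d ≤ ‖t + k‖ := by
  have h0 : ∀ k : ℕ, 0 < ‖t + k‖ := fun k =>
    norm_pos_iff.2 fun h => ht k (eq_neg_of_add_eq_zero_left h)
  obtain ⟨N, hN⟩ := exists_nat_ge (‖t‖ + 1)
  obtain ⟨m, -, hm⟩ := Finset.exists_min_image (Finset.range (N + 1)) (fun k => ‖t + (k : ℂ)‖)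
    ⟨0, by simp⟩
  refine ⟨min ‖t + m‖ 1, lt_min (h0 m) one_pos, fun k => ?_⟩
  rcases le_or_gt k N with h | h
  · exact (min_le_left _ _).trans (hm k (by simpa using Nat.lt_succ_of_le h))
  · refine (min_le_right _ _).trans ?_
    have h1 : ‖(k : ℂ)‖ ≤ ‖t + k‖ + ‖t‖ := by
      have := norm_sub_le (t + k) t
      rwa [add_sub_cancel_left] at this
    rw [Complex.norm_natCast] at h1
    have : (N : ℝ) ≤ k := by exact_mod_cast h.le
    linarith

theorem gammaPoles_add_one {t : ℂ} (ht : ∀ k : ℕ, t ≠ -k) :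
    t * gammaPoles t = gammaPoles (t + 1) + Complex.exp (-1) := by
  obtain ⟨d, hd, hdk⟩ := exists_le_norm_add_nat ht
  have hs := summable_inv_factorial_div hd hdk
  have hs1 : Summable fun k : ℕ => (-1) ^ k / (k ! : ℂ) / (t + 1 + k) :=
    summable_inv_factorial_div hd fun k => by
      have := hdk (k + 1)
      push_cast at this
      rwa [add_assoc, add_comm 1]
  have he : HasSum (fun k : ℕ => (-1 : ℂ) ^ k / (k ! : ℂ)) (Complex.exp (-1)) := by
    rw [Complex.exp_eq_exp_ℂ]
    exact NormedSpace.expSeries_div_hasSum_exp (-1 : ℂ)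
  have e : ∀ k : ℕ, t * ((-1) ^ k / (k ! : ℂ) / (t + k)) =
      (-1) ^ k / (k ! : ℂ) - (-1) ^ k / (k ! : ℂ) * k / (t + k) := fun k => by
    have h0 : t + k ≠ 0 := fun h => ht k (eq_neg_of_add_eq_zero_left h)
    field_simp
    ring
  have hd2 : Summable fun k : ℕ => (-1) ^ k / (k ! : ℂ) * k / (t + k) := by
    have := he.summable.sub (hs.mul_left t)
    refine this.congr fun k => ?_
    rw [e]; ring
  have h3 : ∑' k : ℕ, (-1) ^ k / (k ! : ℂ) * k / (t + k) = -gammaPoles (t + 1) := by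
    rw [hd2.tsum_eq_zero_add, gammaPoles, ← tsum_neg]
    simp only [Nat.cast_zero, mul_zero, zero_div, zero_add]
    refine tsum_congr fun k => ?_
    rw [Nat.factorial_succ]
    have hk : ((k : ℂ) + 1) ≠ 0 := by exact_mod_cast k.succ_ne_zero
    have hf : ((k ! : ℕ) : ℂ) ≠ 0 := by exact_mod_cast k.factorial_ne_zero
    push_cast
    rw [show t + ((k : ℂ) + 1) = t + 1 + k by ring]
    field_simp
    ring
  rw [gammaPoles, ← tsum_mul_left]
  simp only [e]
  rw [he.summable.tsum_sub hd2, he.tsum_eq, h3]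
  ring

/-- In the right half plane, the power series of `e^{-x}` is integrated term by term over `(0, 1]`. -/
theorem Gamma_eq_of_re_pos {t : ℂ} (ht : 0 < t.re) :
    Complex.Gamma t = gammaPoles t + gammaTail t := by
  rw [Complex.Gamma_eq_integral ht, Complex.GammaIntegral, ← Ioc_union_Ioi_eq_Ioi zero_le_one]
  have hconv := Complex.GammaIntegral_convergent ht
  have e0 : (fun x : ℝ => ((Real.exp (-x) : ℝ) : ℂ) * (x : ℂ) ^ (t - 1)) =
      fun x : ℝ => Complex.exp (-x) * (x : ℂ) ^ (t - 1) := by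
    ext x; push_cast; rfl
  rw [setIntegral_union Ioc_disjoint_Ioi_same measurableSet_Ioi
    (hconv.mono_set Ioc_subset_Ioi_self) (hconv.mono_set (Ioi_subset_Ioi zero_le_one))]
  rw [e0]
  change _ + gammaTail t = _
  congr 1
  set F : ℕ → ℝ → ℂ := fun k x => (-1) ^ k / (k ! : ℂ) * (x : ℂ) ^ (t + k - 1)
  have hre : ∀ k : ℕ, -1 < (t + k - 1 : ℂ).re := fun k => by
    have : (0 : ℝ) ≤ k := Nat.cast_nonneg k
    simp; linarith
  have hFi : ∀ k, Integrable (F k) (volume.restrict (Ioc (0 : ℝ) 1)) := fun k => by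
    have := (intervalIntegral.intervalIntegrable_cpow' (a := 0) (b := 1) (hre k))
    rw [intervalIntegrable_iff_integrableOn_Ioc_of_le zero_le_one] at this
    exact this.const_mul _
  have hne : ∀ k : ℕ, t + k ≠ 0 := fun k h => by
    have h1 := congrArg Complex.re h
    simp at h1
    have : (0 : ℝ) ≤ k := Nat.cast_nonneg k
    linarith
  have hval : ∀ k : ℕ, ∫ x in Ioc (0 : ℝ) 1, F k x = (-1) ^ k / (k ! : ℂ) / (t + k) := fun k => by
    simp only [F]
    rw [integral_const_mul, ← intervalIntegral.integral_of_le zero_le_one,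
      integral_cpow (Or.inl (hre k)), sub_add_cancel]
    simp only [Complex.ofReal_one, Complex.one_cpow, Complex.ofReal_zero,
      Complex.zero_cpow (hne k), sub_zero]
    ring
  have hnorm : ∀ k : ℕ, ∫ x in Ioc (0 : ℝ) 1, ‖F k x‖ = 1 / (k ! : ℝ) * (1 / (t.re + k)) :=
    fun k => by
    have : ∀ x ∈ Ioc (0 : ℝ) 1, ‖F k x‖ = 1 / (k ! : ℝ) * x ^ (t.re + k - 1) := fun x hx => by
      simp only [F]
      rw [norm_mul, norm_div, norm_pow, norm_neg, norm_one, one_pow, Complex.norm_natCast,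
        Complex.norm_cpow_eq_rpow_re_of_pos hx.1]
      simp
    rw [setIntegral_congr_fun measurableSet_Ioc this, integral_const_mul,
      ← intervalIntegral.integral_of_le zero_le_one, integral_rpow (Or.inl ?_)]
    · have : t.re + (k : ℝ) ≠ 0 := by positivity
      rw [sub_add_cancel, Real.one_rpow, Real.zero_rpow this, sub_zero]
    · have : (0 : ℝ) ≤ k := Nat.cast_nonneg k
      linarith
  have hsum : Summable fun k => ∫ x in Ioc (0 : ℝ) 1, ‖F k x‖ := by
    simp only [hnorm]
    refine Summable.of_nonneg_of_le (fun k => by positivity) (fun k => ?_)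
      (summable_inv_factorial.mul_right (1 / t.re))
    gcongr
    linarith [(Nat.cast_nonneg k : (0 : ℝ) ≤ k)]
  have h := hasSum_integral_of_summable_integral_norm hFi hsum
  simp only [hval] at h
  rw [gammaPoles, h.tsum_eq]
  refine setIntegral_congr_fun measurableSet_Ioc fun x hx => ?_
  have hx0 : (x : ℂ) ≠ 0 := by exact_mod_cast hx.1.ne'
  have he : HasSum (fun k : ℕ => (-x : ℂ) ^ k / (k ! : ℂ)) (Complex.exp (-x)) := by
    rw [Complex.exp_eq_exp_ℂ]
    exact NormedSpace.expSeries_div_hasSum_exp (-x : ℂ)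
  change Complex.exp (-x) * (x : ℂ) ^ (t - 1) = ∑' k, F k x
  rw [← he.tsum_eq, ← tsum_mul_right]
  refine tsum_congr fun k => ?_
  simp only [F]
  rw [show t + k - 1 = (t - 1) + k by ring, Complex.cpow_add _ _ hx0, Complex.cpow_natCast,
    neg_pow]
  ring

/-- The Mittag-Leffler expansion of the Gamma function. -/
theorem Gamma_eq_gammaPoles_add {t : ℂ} (ht : ∀ k : ℕ, t ≠ -k) :
    Complex.Gamma t = gammaPoles t + gammaTail t := by
  suffices h : ∀ n : ℕ, ∀ t : ℂ, (∀ k : ℕ, t ≠ -k) → 0 < t.re + n →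
      Complex.Gamma t = gammaPoles t + gammaTail t by
    obtain ⟨n, hn⟩ := exists_nat_gt (-t.re)
    exact h n t ht (by linarith)
  intro n
  induction n with
  | zero => intro t _ h; exact Gamma_eq_of_re_pos (by simpa using h)
  | succ n ih =>
    intro t ht h
    have h0 : t ≠ 0 := by simpa using ht 0
    have h1 := ih (t + 1) (fun k hk => ht (k + 1) (by push_cast; linear_combination hk))
      (by push_cast at h; simp; linarith)
    rw [Complex.Gamma_add_one t h0] at h1
    refine mul_left_cancel₀ h0 ?_
    rw [h1, mul_add, gammaPoles_add_one ht, gammaTail_add_one]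
    ring

/-- Integration against the Gamma function along the contour picks up the residues at the poles. -/
theorem HookDecay.contourInt_Gamma_mul {δ c : ℝ} {f : ℂ → ℂ} (hδ : 0 < δ) (hc : δ < c)
    (hf : HookDecay δ c f) :
    contourInt (hook δ) (fun z => Complex.Gamma z * f z) =
      2 * Real.pi * Complex.I * ∑' k : ℕ, (-1) ^ k / (k ! : ℂ) * f (-k) := by
  obtain ⟨C, hC⟩ := exists_norm_gammaTail_le δ
  have hT : HookDecay δ c fun z => gammaTail z * f z :=
    hf.mul_bounded differentiable_gammaTail.differentiableOn fun z h _ => hC z h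
  set F : ℕ → ℝ → ℂ := fun k r =>
    (-1) ^ k / (k ! : ℂ) * (f (hook δ r) / (hook δ r + k) * deriv (hook δ) r)
  have hi0 : ∀ g : ℝ → ℂ, Integrable g → Integrable fun r => g r * deriv (hook δ) r := fun g hg =>
    hg.mul_bdd (c := 1) (measurable_deriv _).aestronglyMeasurable
      (Eventually.of_forall fun r => (norm_deriv_hook hδ r).le)
  have hi : ∀ k, Integrable (F k) := fun k => (hi0 _ (hf.integrable_div hδ hc k)).const_mul _
  have hb : ∀ k r, ‖F k r‖ ≤ 1 / (k ! : ℝ) * (δ⁻¹ * ‖f (hook δ r)‖) := fun k r => by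
    simp only [F]
    rw [norm_mul, norm_mul, norm_div, norm_div, norm_pow, norm_neg, norm_one, one_pow,
      Complex.norm_natCast, norm_deriv_hook hδ, mul_one, mul_comm δ⁻¹, ← div_eq_mul_inv]
    have := le_norm_hook_add hδ r k
    gcongr
  have hs : Summable fun k => ∫ r, ‖F k r‖ := by
    refine Summable.of_nonneg_of_le (fun k => by positivity) (fun k => ?_)
      (summable_inv_factorial.mul_right (∫ r, δ⁻¹ * ‖f (hook δ r)‖))
    rw [← integral_const_mul]
    exact integral_mono (hi k).norm ((((hf.integrable hδ hc).norm.const_mul _)).const_mul _)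
      (hb k)
  have h := hasSum_integral_of_summable_integral_norm hi hs
  have hval : ∀ k, ∫ r, F k r = (-1) ^ k / (k ! : ℂ) * (2 * Real.pi * Complex.I * f (-k)) :=
    fun k => by
    simp only [F]
    rw [integral_const_mul]
    congr 1
    exact hf.contourInt_div hδ hc k
  simp only [hval] at h
  have hsumI : Integrable fun r => ∑' k, F k r := by
    have hmeas : ∀ k, AEStronglyMeasurable (F k) volume := fun k => (hi k).aestronglyMeasurable
    have hsr : ∀ r, Summable fun k => F k r := fun r => Summable.of_norm_bounded
      (summable_inv_factorial.mul_right _) (fun k => hb k r)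
    refine Integrable.mono' (((hf.integrable hδ hc).norm.const_mul δ⁻¹).const_mul
      (∑' k : ℕ, 1 / (k ! : ℝ))) ?_ (Eventually.of_forall fun r => ?_)
    · exact aestronglyMeasurable_of_tendsto_ae atTop
        (fun n => Finset.aestronglyMeasurable_fun_sum (Finset.range n) fun k _ => hmeas k)
        (Eventually.of_forall fun r => (hsr r).hasSum.tendsto_sum_nat)
    · rw [← tsum_mul_right]
      exact tsum_of_norm_bounded (summable_inv_factorial.mul_right _).hasSum (fun k => hb k r)
  have e : ∀ r, Complex.Gamma (hook δ r) * f (hook δ r) * deriv (hook δ) r =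
      (∑' k, F k r) + gammaTail (hook δ r) * f (hook δ r) * deriv (hook δ) r := fun r => by
    rw [Gamma_eq_gammaPoles_add (hook_ne_neg_nat hδ r), add_mul, add_mul]
    congr 1
    rw [gammaPoles, ← tsum_mul_right, ← tsum_mul_right]
    refine tsum_congr fun k => ?_
    simp only [F]
    ring
  have h0 := hT.contourInt_eq_zero hδ hc
  unfold contourInt at h0 ⊢
  simp only [e]
  rw [integral_add hsumI (hi0 _ (hT.integrable hδ hc)), h0, add_zero, ← h.tsum_eq, ← tsum_mul_left]
  exact tsum_congr fun k => by ring

end gamma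


/-! ### The critical kernel as a sum over the poles -/

section kernel

theorem hookDecay_gauss {β δ c x : ℝ} (hβ : 0 < β) :
    HookDecay δ c fun t => Complex.exp (x * t - β * t ^ 2) := by
  refine ⟨by fun_prop, β / 2, by positivity,
    Real.exp (β * δ ^ 2 + x ^ 2 / (2 * β)), fun z _ h2 => ?_⟩
  rw [Complex.norm_exp, ← Real.exp_add]
  refine Real.exp_le_exp.2 ?_
  have e : (x * z - β * z ^ 2 : ℂ).re = x * z.re - β * (z.re ^ 2 - z.im ^ 2) := by
    simp [pow_two]
  rw [e]
  have h3 : z.im ^ 2 ≤ δ ^ 2 := by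
    rw [← sq_abs]; exact pow_le_pow_left₀ (abs_nonneg _) h2 2
  have h4 : x * z.re ≤ x ^ 2 / (2 * β) + β / 2 * z.re ^ 2 := by
    have : 0 ≤ (x / β - z.re) ^ 2 * (β / 2) := by positivity
    have e : (x / β - z.re) ^ 2 * (β / 2) = x ^ 2 / (2 * β) + β / 2 * z.re ^ 2 - x * z.re := by
      field_simp; ring
    linarith
  nlinarith

theorem norm_sub_ge_of_re {s z : ℂ} : s.re - z.re ≤ ‖s - z‖ := by
  have := Complex.re_le_norm (s - z)
  simpa using this

/-- The Cauchy kernel with pole on the line `Re s = b` does not affect `HookDecay δ b`. -/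
theorem HookDecay.div_sub {δ b : ℝ} {f : ℂ → ℂ} (hb : δ < b) (hf : HookDecay δ b f) {s : ℂ}
    (hs : s.re = b) : HookDecay δ b fun t => f t / (s - t) := by
  have h := hf.mul_bounded (g := fun t => (s - t)⁻¹) (A := (b - δ)⁻¹) ?_ ?_
  · simpa only [div_eq_inv_mul] using h
  · intro z hz
    have hz' : s - z ≠ 0 := fun h => by
      have h1 := congrArg Complex.re h
      simp only [Complex.sub_re, Complex.zero_re] at h1
      have : z.re < b := hz
      linarith
    exact ((differentiableAt_const s).sub differentiableAt_id).inv hz' |>.differentiableWithinAt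
  · intro z hz _
    rw [norm_inv]
    refine inv_anti₀ (by linarith) ?_
    have := norm_sub_ge_of_re (s := s) (z := z)
    linarith

theorem critW_eq (α : ℝ) (k : ℕ) :
    critW α k = (-1) ^ k / (k ! : ℂ) * Complex.exp (-(α / 2 * (k : ℂ) ^ 2)) := by
  unfold critW
  push_cast
  congr 2
  ring

theorem deriv_vline (b r : ℝ) : deriv (vline b) r = Complex.I := by
  have h : HasDerivAt (vline b) (1 * Complex.I) r :=
    ((hasDerivAt_id r).ofReal_comp.mul_const Complex.I).const_add (b : ℂ)
  simpa using h.deriv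

theorem contourInt_vline (b : ℝ) (f : ℂ → ℂ) :
    contourInt (vline b) f = 2 * Real.pi * Complex.I * lineInt b f := by
  unfold contourInt lineInt
  simp only [deriv_vline]
  rw [integral_mul_const]
  have : (2 * Real.pi : ℂ) ≠ 0 := by simp [Real.pi_ne_zero]
  field_simp

theorem summable_exp_div_factorial (x : ℝ) :
    Summable fun k : ℕ => 1 / (k ! : ℝ) * Real.exp |x| ^ k := by
  have := Real.summable_pow_div_factorial (Real.exp |x|)
  exact this.congr fun k => by ring

theorem norm_critW_mul_exp_le {α : ℝ} (hα : 0 ≤ α) (k : ℕ) (x : ℝ) :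
    ‖critW α k * Complex.exp (-(k : ℂ) * x)‖ ≤ 1 / (k ! : ℝ) * Real.exp |x| ^ k := by
  rw [norm_mul]
  refine mul_le_mul (norm_critW_le hα k) ?_ (norm_nonneg _) (by positivity)
  rw [Complex.norm_exp, ← Real.exp_nat_mul]
  refine Real.exp_le_exp.2 ?_
  have : (-(k : ℂ) * x).re = k * (-x) := by simp
  rw [this]
  exact mul_le_mul_of_nonneg_left (neg_le_abs x) (Nat.cast_nonneg k)

/-- Both `Gfun` and `Mmat` may be computed over any line to the right of the imaginary axis. -/
theorem differentiableOn_critSym_mul_exp_div {α : ℝ} (y : ℂ) (k : ℕ) {l u : ℝ} (hl : 0 < l) :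
    DifferentiableOn ℂ (fun s => critSym α s * Complex.exp (-y * s) / (s + k)) (vstrip l u) := by
  intro s hs
  have hne : s + k ≠ 0 := fun h => by
    have h1 := congrArg Complex.re h
    simp only [Complex.add_re, Complex.natCast_re, Complex.zero_re] at h1
    have : (0 : ℝ) ≤ k := Nat.cast_nonneg k
    linarith [hs.1]
  have := (differentiable_critSym α) s
  refine DifferentiableAt.differentiableWithinAt ?_
  fun_prop (disch := exact hne)

theorem inv_norm_add_nat_le {l u : ℝ} (hl : 0 < l) (k : ℕ) {s : ℂ} (hs : s ∈ vstrip l u) :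
    ‖(s + k)⁻¹‖ ≤ l⁻¹ := by
  rw [norm_inv]
  refine inv_anti₀ hl ?_
  have := Complex.re_le_norm (s + k)
  simp only [Complex.add_re, Complex.natCast_re] at this
  have : (0 : ℝ) ≤ k := Nat.cast_nonneg k
  linarith [hs.1]

theorem gaussDecay_critSym_mul_exp_div {α : ℝ} (hα : 0 < α) (y : ℂ) (k : ℕ) {l : ℝ} (hl : 0 < l)
    (u : ℝ) : GaussDecay l u fun s => critSym α s * Complex.exp (-y * s) / (s + k) := by
  simp only [div_eq_mul_inv]
  exact ((gaussDecay_critSym hα hl u).mul_exp y).mul_bounded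
    (A := l⁻¹) fun z hz => inv_norm_add_nat_le hl k hz

theorem Gfun_critSym_eq {α l u : ℝ} (hα : 0 < α) (hl : 0 < l) (hlu : l ≤ u) (k : ℕ) (y : ℂ) :
    Gfun l (critSym α) k y = Gfun u (critSym α) k y :=
  lineInt_shift hlu (differentiableOn_critSym_mul_exp_div y k hl)
    (gaussDecay_critSym_mul_exp_div hα y k hl u)

/-- The inner integral collects the residues at the poles of `Γ`, and the sum over the poles is then
exchanged with the integral over the line. -/
theorem Kcrit_eq_tsum_Gfun {α δ b : ℝ} (hα : 0 < α) (hδ : 0 < δ) (hb : δ < b) (x y : ℝ) :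
    Kcrit α δ b x y = sumKernel b (critSym α) (critW α) x y := by
  have hb0 : 0 < b := hδ.trans hb
  have hpi : (2 * Real.pi * Complex.I : ℂ) ≠ 0 := by simp [Real.pi_ne_zero]
  set F : ℂ → ℂ := fun s => ∑' k : ℕ, critW α k * Complex.exp (-(k : ℂ) * x) *
    (critSym α s * Complex.exp (-y * s) / (s + k))
  have hin : ∀ s : ℂ, s.re = b → (contourInt (hook δ) fun t =>
      Complex.Gamma t / Complex.Gamma s *
        (Complex.exp (α * s ^ 2 / 2 - y * s) / Complex.exp (α * t ^ 2 / 2 - x * t)) *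
        (1 / (s - t))) = 2 * Real.pi * Complex.I * F s := by
    intro s hs
    have h1 := ((hookDecay_gauss (β := α / 2) (c := b) (x := x) (by positivity)).div_sub hb
      hs).contourInt_Gamma_mul hδ hb
    have h2 : (contourInt (hook δ) fun t =>
      Complex.Gamma t / Complex.Gamma s *
        (Complex.exp (α * s ^ 2 / 2 - y * s) / Complex.exp (α * t ^ 2 / 2 - x * t)) *
        (1 / (s - t))) = critSym α s * Complex.exp (-y * s) * contourInt (hook δ) fun t =>
          Complex.Gamma t * (Complex.exp (x * t - (α / 2 : ℝ) * t ^ 2) / (s - t)) := by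
      unfold contourInt
      rw [← integral_const_mul]
      refine integral_congr_ae (Eventually.of_forall fun r => ?_)
      beta_reduce
      unfold critSym
      rw [show x * hook δ r - (α / 2 : ℝ) * hook δ r ^ 2 =
        -(α * hook δ r ^ 2 / 2 - x * hook δ r) by push_cast; ring, Complex.exp_neg,
        show α * s ^ 2 / 2 - y * s = α * s ^ 2 / 2 + -y * s by ring, Complex.exp_add]
      simp only [div_eq_mul_inv, one_mul]
      ring
    rw [h2, h1]
    simp only [F]
    rw [mul_left_comm, ← tsum_mul_left]
    congr 1
    refine tsum_congr fun k => ?_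
    rw [critW_eq, show (x : ℂ) * -k - (α / 2 : ℝ) * (-k : ℂ) ^ 2 =
      -(α / 2 * (k : ℂ) ^ 2) + -k * x by push_cast; ring, Complex.exp_add, sub_neg_eq_add]
    ring
  have hout : Kcrit α δ b x y = lineInt b F := by
    unfold Kcrit
    rw [contourInt_vline, lineInt_congr (G := fun s => (2 * Real.pi * Complex.I) * F s) hin,
      lineInt_const_mul]
    field_simp
  rw [hout]
  unfold lineInt sumKernel Gfun
  have hdec := fun k => gaussDecay_critSym_mul_exp_div hα (y : ℂ) k hb0 b
  have hcont := fun k => (differentiableOn_critSym_mul_exp_div (α := α) (y : ℂ) k (u := b)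
    hb0).continuousOn
  have hi : ∀ k : ℕ, Integrable fun τ : ℝ => critW α k * Complex.exp (-(k : ℂ) * x) *
      (critSym α (vline b τ) * Complex.exp (-y * vline b τ) / (vline b τ + k)) := fun k =>
    ((hdec k).integrable le_rfl le_rfl (hcont k)).const_mul _
  obtain ⟨κ, hκ, C, hC, hbd⟩ := ((gaussDecay_critSym hα hb0 b).mul_exp (y : ℂ)).bound
  have hs : Summable fun k : ℕ => ∫ τ : ℝ, ‖critW α k * Complex.exp (-(k : ℂ) * x) *
      (critSym α (vline b τ) * Complex.exp (-y * vline b τ) / (vline b τ + k))‖ := by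
    refine Summable.of_nonneg_of_le (fun k => by positivity) (fun k => ?_)
      ((summable_exp_div_factorial x).mul_right (∫ τ : ℝ, C * Real.exp (-κ * τ ^ 2) * b⁻¹))
    rw [← integral_const_mul]
    refine integral_mono (hi k).norm
      ((((integrable_exp_neg_mul_sq hκ).const_mul C).mul_const _).const_mul _) fun τ => ?_
    have hm := vline_mem_vstrip (le_refl b) le_rfl τ
    have h1 := hbd _ hm
    rw [vline_im] at h1
    have h2 := inv_norm_add_nat_le hb0 k hm
    rw [norm_mul, div_eq_mul_inv, norm_mul (critSym α _ * _)]
    exact mul_le_mul (norm_critW_mul_exp_le hα.le k x)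
      (mul_le_mul h1 h2 (norm_nonneg _) ((norm_nonneg _).trans h1))
      (by positivity) (by positivity)
  have h := hasSum_integral_of_summable_integral_norm hi hs
  rw [← h.tsum_eq, ← tsum_mul_left]
  refine tsum_congr fun k => ?_
  rw [integral_const_mul]
  unfold lineInt
  ring

/-- The double contour integral is the sum of the residues at the poles of the Gamma function. -/
theorem Kcrit_eq_sumKernel {α δ b : ℝ} (hα : 0 < α) (hδ : 0 < δ) (hb : δ < b) :
    Kcrit α δ b = sumKernel (b + 1) (critSym α) (critW α) := by
  ext x y
  rw [Kcrit_eq_tsum_Gfun hα hδ hb]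
  unfold sumKernel
  exact tsum_congr fun k => by rw [Gfun_critSym_eq hα (hδ.trans hb) (by linarith : b ≤ b + 1)]

theorem measurable_sumKernel {α c : ℝ} (hα : 0 < α) (hc : 1 ≤ c) :
    Measurable (Function.uncurry (sumKernel c (critSym α) (critW α))) := by
  have h := lineBound_critSym hα hc
  refine measurable_of_tendsto_metrizable (fun N => h.measurable_finKernel (critW α) N) ?_
  refine tendsto_pi_nhds.2 fun p => ?_
  have hs : Summable fun k : ℕ =>
      critW α k * Complex.exp (-(k : ℂ) * p.1) * Gfun c (critSym α) k p.2 := by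
    refine Summable.of_norm_bounded ((summable_exp_div_factorial p.1).mul_right
      (LineBound.const (α / 4) (symConst α c) * Real.exp (-c * p.2))) fun k => ?_
    rw [norm_mul]
    exact mul_le_mul (norm_critW_mul_exp_le hα.le k _) (h.norm_Gfun_real_le k _) (norm_nonneg _)
      (by positivity)
  have := hs.hasSum.tendsto_sum_nat
  refine this.congr fun N => ?_
  simp only [Function.uncurry, finKernel]
  rw [← Fin.sum_univ_eq_sum_range (fun k => critW α k * Complex.exp (-(k : ℂ) * p.1) *
    Gfun c (critSym α) k p.2)]

/-- The determinant of the infinite matrix attached to the critical kernel on `(a, ∞)`. -/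
def critDet (α b : ℝ) (a : ℂ) : ℂ := infDet (Mmat (b + 1) (critSym α) (critW α) a)

theorem gapTerm_eq_fredTerm (α δ b a : ℝ) (n : ℕ) :
    gapTerm α δ b a n = fredTerm (Ioi a) (Kcrit α δ b) n := rfl

/-- A bound for the critical kernel that is uniform in the first variable. -/
theorem exists_norm_Kcrit_le {α δ b : ℝ} (hα : 0 < α) (hδ : 0 < δ) (hb : δ < b) :
    ∃ C, 0 ≤ C ∧ ∀ x, 0 ≤ x → ∀ y, ‖Kcrit α δ b x y‖ ≤ C * Real.exp (-(b + 1) * y) := by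
  have h := lineBound_critSym (c := b + 1) hα (by linarith)
  have h0 : 0 ≤ ∑' k : ℕ, 1 / (k ! : ℝ) := tsum_nonneg fun k => by positivity
  refine ⟨_, mul_nonneg h0 h.const_nonneg, fun x hx y => ?_⟩
  · rw [Kcrit_eq_sumKernel hα hδ hb]
    exact h.norm_sumKernel_le (norm_critW_le hα.le) summable_inv_factorial hx y

theorem measurable_Kcrit {α δ b : ℝ} (hα : 0 < α) (hδ : 0 < δ) (hb : δ < b) :
    Measurable (Function.uncurry (Kcrit α δ b)) := by
  rw [Kcrit_eq_sumKernel hα hδ hb]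
  exact measurable_sumKernel hα (by linarith)

theorem integrableOn_const_mul_exp (C : ℝ) {c : ℝ} (hc : 0 < c) (a : ℝ) :
    IntegrableOn (fun y : ℝ => C * Real.exp (-c * y)) (Ioi a) :=
  (integrableOn_exp_mul_Ioi (by linarith) a).const_mul C

theorem integrableOn_corrDet {α δ b : ℝ} (hα : 0 < α) (hδ : 0 < δ) (hb : δ < b) {a : ℝ}
    (ha : 0 < a) (n : ℕ) :
    IntegrableOn (fun x : Fin n → ℝ => corrDet α δ b x) {x | ∀ j, a < x j} := by
  obtain ⟨C, -, hC⟩ := exists_norm_Kcrit_le hα hδ hb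
  exact integrableOn_corr measurableSet_Ioi (measurable_Kcrit hα hδ hb)
    (fun x hx y _ => hC x (ha.trans hx).le y) (integrableOn_const_mul_exp C (by linarith) a) n

theorem setIntegral_exp_le {c : ℝ} (hc : 1 ≤ c) {C a : ℝ} (hC : 0 ≤ C) (ha : 0 < a) :
    ∫ y in Ioi a, C * Real.exp (-c * y) ≤ C * Real.exp (-a) := by
  rw [integral_const_mul, integral_exp_mul_Ioi (by linarith)]
  refine mul_le_mul_of_nonneg_left ?_ hC
  rw [neg_div_neg_eq, div_le_iff₀ (by linarith)]
  have h1 : Real.exp (-c * a) ≤ Real.exp (-a) := Real.exp_le_exp.2 (by nlinarith)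
  nlinarith [Real.exp_pos (-a)]

theorem hadamardTerm_mono {s t : ℝ} (hs : 0 ≤ s) (hst : s ≤ t) (n : ℕ) :
    hadamardTerm s n ≤ hadamardTerm t n := by
  unfold hadamardTerm
  gcongr

theorem exists_norm_gapTerm_le {α δ b : ℝ} (hα : 0 < α) (hδ : 0 < δ) (hb : δ < b) :
    ∃ C, 0 ≤ C ∧ ∀ a, 0 < a → ∀ n,
      ‖gapTerm α δ b a n‖ ≤ hadamardTerm (C * Real.exp (-a)) n := by
  obtain ⟨C, hC0, hC⟩ := exists_norm_Kcrit_le hα hδ hb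
  refine ⟨C, hC0, fun a ha n => ?_⟩
  rw [gapTerm_eq_fredTerm]
  refine (norm_fredTerm_le measurableSet_Ioi (fun x hx y _ => hC x (ha.trans hx).le y)
    (integrableOn_const_mul_exp C (by linarith) a) n).trans (hadamardTerm_mono ?_ ?_ n)
  · exact integral_nonneg fun y => by positivity
  · exact setIntegral_exp_le (by linarith) hC0 ha

theorem summable_gapTerm {α δ b : ℝ} (hα : 0 < α) (hδ : 0 < δ) (hb : δ < b) {a : ℝ}
    (ha : 0 < a) : Summable (gapTerm α δ b a) := by
  obtain ⟨C, hC0, hC⟩ := exists_norm_gapTerm_le hα hδ hb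
  exact Summable.of_norm_bounded (summable_hadamardTerm (by positivity)) (hC a ha)

theorem gapTerm_zero (α δ b a : ℝ) : gapTerm α δ b a 0 = 1 := by
  unfold gapTerm corrDet
  simp [measureReal_def, volume_pi]

theorem gapProb_eq_tsum {α δ b : ℝ} (hα : 0 < α) (hδ : 0 < δ) (hb : δ < b) {a : ℝ}
    (ha : 0 < a) : gapProb α δ b a = ∑' n, gapTerm α δ b a n := by
  rw [(summable_gapTerm hα hδ hb ha).tsum_eq_zero_add, gapTerm_zero, gapProb]

theorem gapProb_eq_critDet {α δ b : ℝ} (hα : 0 < α) (hδ : 0 < δ) (hb : δ < b) {a : ℝ}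
    (ha : 0 < a) : gapProb α δ b a = critDet α b a := by
  rw [gapProb_eq_tsum hα hδ hb ha, critDet, ← tsum_fredTerm_eq_infDet hα (by linarith) ha,
    ← Kcrit_eq_sumKernel hα hδ hb]
  rfl

theorem exists_norm_one_sub_gapProb_le {α δ b : ℝ} (hα : 0 < α) (hδ : 0 < δ) (hb : δ < b) :
    ∃ C, 0 < C ∧ ∀ a, 0 < a → ‖1 - gapProb α δ b a‖ ≤ C * Real.exp (-a) := by
  obtain ⟨C, hC0, hC⟩ := exists_norm_gapTerm_le hα hδ hb
  have hs := summable_hadamardTerm hC0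
  have hs1 := (summable_nat_add_iff 1).2 hs
  refine ⟨∑' n, hadamardTerm C (n + 1) + 1, add_pos_of_nonneg_of_pos
    (tsum_nonneg fun n => hadamardTerm_nonneg hC0 _) one_pos, fun a ha => ?_⟩
  rw [gapProb, sub_add_cancel_left, norm_neg]
  refine (tsum_of_norm_bounded (hs1.mul_right (Real.exp (-a))).hasSum fun n =>
    (hC a ha (n + 1)).trans ?_).trans ?_
  · have h1 : Real.exp (-a) ^ n ≤ 1 :=
      pow_le_one₀ (Real.exp_pos _).le (Real.exp_le_one_iff.2 (by linarith))
    unfold hadamardTerm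
    rw [mul_pow, ← mul_assoc]
    refine mul_le_mul_of_nonneg_left ?_ (by positivity)
    rw [pow_succ]
    exact mul_le_of_le_one_left (Real.exp_pos _).le h1
  · rw [tsum_mul_right]
    gcongr
    linarith

theorem tendsto_critDet {α b : ℝ} (hα : 0 < α) (hb : 0 < b) :
    Tendsto (fun a : ℝ => critDet α b a) atTop (𝓝 1) := by
  obtain ⟨C, -, hC⟩ := exists_norm_one_sub_gapProb_le (b := b) hα (half_pos hb) (half_lt_self hb)
  have h0 : Tendsto (fun a : ℝ => C * Real.exp (-a)) atTop (𝓝 0) := by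
    simpa using (Real.tendsto_exp_neg_atTop_nhds_zero).const_mul C
  have h1 : Tendsto (fun a : ℝ => 1 - critDet α b a) atTop (𝓝 0) := by
    refine squeeze_zero_norm' ?_ h0
    filter_upwards [eventually_gt_atTop 0] with a ha
    rw [← gapProb_eq_critDet hα (half_pos hb) (half_lt_self hb) ha]
    exact hC a ha
  simpa using h1.const_sub 1

theorem exists_critDet_ne_zero {α b : ℝ} (hα : 0 < α) (hb : 0 < b) (a : ℝ) :
    ∃ d ≥ a, critDet α b d ≠ 0 :=
  ((eventually_ge_atTop a).and ((tendsto_critDet hα hb).eventually_ne one_ne_zero)).exists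

theorem differentiableAt_critDet {α b : ℝ} (hα : 0 < α) (hb : 0 < b) {a : ℂ}
    (ha : a ∈ halfStrip) : DifferentiableAt ℂ (critDet α b) a :=
  ((lineBound_critSym hα (by linarith)).hasDerivAt_infDet_Mmat (summable_norm_critW hα.le)
    ha).differentiableAt

theorem critDet_nonneg {α b : ℝ} (hα : 0 < α) (hb : 0 < b) {a : ℝ} (ha : 0 < a) :
    0 ≤ (critDet α b a).re ∧ (critDet α b a).im = 0 := by
  have hlim : Tendsto (fun d : ℝ => critDet α b a / critDet α b d) atTop (𝓝 (critDet α b a)) := by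
    have h := (tendsto_const_nhds (x := critDet α b a) (f := atTop)).div
      (tendsto_critDet hα hb) one_ne_zero
    rw [div_one] at h
    exact h
  have hcl : IsClosed {z : ℂ | 0 ≤ z.re ∧ z.im = 0} :=
    (isClosed_le continuous_const Complex.continuous_re).inter
      (isClosed_eq Complex.continuous_im continuous_const)
  refine hcl.mem_of_tendsto hlim ?_
  filter_upwards [eventually_ge_atTop a, (tendsto_critDet hα hb).eventually_ne one_ne_zero]
    with d hd hd0
  obtain ⟨p, q, hp, -, h1, -⟩ := ratio_infDet (c := b + 1) hα (by linarith) ha le_rfl hd hd0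
  have : critDet α b a / critDet α b d = p := by
    rw [div_eq_iff hd0]; exact h1
  rw [this]
  exact ⟨by simpa using hp, by simp⟩

/-- A zero of the determinant would propagate to the left by monotonicity and then to the whole
half line by analyticity. -/
theorem critDet_ne_zero {α b : ℝ} (hα : 0 < α) (hb : 0 < b) {a : ℝ} (ha : 0 < a) :
    critDet α b a ≠ 0 := by
  intro h0
  obtain ⟨d, hd, hd0⟩ := exists_critDet_ne_zero hα hb a
  have hz : ∀ x : ℝ, 0 < x → x ≤ a → critDet α b x = 0 := by
    intro x hx hxa
    obtain ⟨p, q, hp, hpq, h1, h2⟩ := ratio_infDet (c := b + 1) hα (by linarith) hx hxa hd hd0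
    change critDet α b x = _ * critDet α b d at h1
    change critDet α b a = _ * critDet α b d at h2
    rw [h0] at h2
    have hq : q = 0 := by exact_mod_cast (mul_eq_zero.1 h2.symm).resolve_right hd0
    have hp0 : p = 0 := le_antisymm (hpq.trans hq.le) hp
    rw [h1, hp0]; simp
  have han : AnalyticOnNhd ℂ (critDet α b) halfStrip :=
    DifferentiableOn.analyticOnNhd
      (fun z hz => (differentiableAt_critDet hα hb hz).differentiableWithinAt) isOpen_halfStrip
  have hfreq : ∃ᶠ z in 𝓝[≠] (a : ℂ), critDet α b z = 0 := by
    have ht : Tendsto (fun x : ℝ => (x : ℂ)) (𝓝[<] a) (𝓝[≠] (a : ℂ)) := by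
      refine tendsto_nhdsWithin_iff.2 ⟨(Complex.continuous_ofReal.tendsto a).mono_left
        nhdsWithin_le_nhds, ?_⟩
      filter_upwards [self_mem_nhdsWithin] with x hx
      simpa using (ne_of_lt hx : x ≠ a)
    refine ht.frequently (Eventually.frequently ?_)
    filter_upwards [Ioo_mem_nhdsLT ha] with x hx
    exact hz x hx.1 hx.2.le
  have := han.eqOn_zero_of_preconnected_of_frequently_eq_zero isPreconnected_halfStrip
    (ofReal_mem_halfStrip ha) hfreq
  exact hd0 (this (ofReal_mem_halfStrip (ha.trans_le hd)))

theorem gapProb_pos {α δ b : ℝ} (hα : 0 < α) (hδ : 0 < δ) (hb : δ < b) {a : ℝ} (ha : 0 < a) :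
    0 < (gapProb α δ b a).re ∧ (gapProb α δ b a).im = 0 := by
  rw [gapProb_eq_critDet hα hδ hb ha]
  obtain ⟨h1, h2⟩ := critDet_nonneg hα (hδ.trans hb) ha
  refine ⟨lt_of_le_of_ne h1 fun h => critDet_ne_zero hα (hδ.trans hb) ha ?_, h2⟩
  exact Complex.ext h.symm h2

/-- The derivative of the gap probability, in terms of the ratios in Cramer's rule. -/
theorem hasDerivAt_gapProb {α δ b : ℝ} (hα : 0 < α) (hδ : 0 < δ) (hb : δ < b) {a : ℝ}
    (ha : 0 < a) : HasDerivAt (gapProb α δ b)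
      (∑' j : ℕ, critW α j * Complex.exp (-a * j) *
        infDet (replaceCol (Mmat (b + 1) (critSym α) (critW α) a)
          (fun k => Gfun (b + 1) (critSym α) k a) j)) a := by
  have h := (lineBound_critSym (c := b + 1) hα (by linarith)).hasDerivAt_infDet_Mmat
    (summable_norm_critW hα.le) (ofReal_mem_halfStrip ha)
  refine (h.comp_ofReal).congr_of_eventuallyEq ?_
  filter_upwards [Ioi_mem_nhds ha] with x hx
  exact gapProb_eq_critDet hα hδ hb hx

end kernel


/-! ### Factorial moments and the gap probability -/

section gap

/-- The injective `n`-tuples of points of a finite set are counted by a falling factorial. -/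
theorem encard_injective_tuples {A : Set ℝ} (hA : A.Finite) (n : ℕ) :
    {x : Fin n → ℝ | Function.Injective x ∧ ∀ j, x j ∈ A}.encard =
      ((A.ncard.descFactorial n : ℕ) : ℕ∞) := by
  classical
  have := hA.fintype
  let e : {x : Fin n → ℝ | Function.Injective x ∧ ∀ j, x j ∈ A} ≃ (Fin n ↪ A) :=
    { toFun := fun x => ⟨fun j => ⟨x.1 j, x.2.2 j⟩, fun i j h =>
        x.2.1 (congrArg Subtype.val h)⟩
      invFun := fun f => ⟨fun j => f j, fun i j h => f.injective (Subtype.ext h),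
        fun j => (f j).2⟩
      left_inv := fun x => rfl
      right_inv := fun f => rfl }
  change ENat.card {x : Fin n → ℝ | Function.Injective x ∧ ∀ j, x j ∈ A} = _
  rw [ENat.card_congr e, ENat.card_eq_coe_fintype_card, Fintype.card_embedding_eq,
    Fintype.card_fin, Set.ncard_eq_toFinset_card', Set.toFinset_card]

theorem encard_injective_one (A : Set ℝ) :
    {x : Fin 1 → ℝ | Function.Injective x ∧ ∀ j, x j ∈ A}.encard = A.encard := by
  let e : {x : Fin 1 → ℝ | Function.Injective x ∧ ∀ j, x j ∈ A} ≃ A :=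
    { toFun := fun x => ⟨x.1 0, x.2.2 0⟩
      invFun := fun a => ⟨fun _ => a, Function.injective_of_subsingleton _, fun _ => a.2⟩
      left_inv := fun x => by
        apply Subtype.ext
        funext j
        rw [Subsingleton.elim j 0]
      right_inv := fun f => rfl }
  exact ENat.card_congr e

/-- If the Fredholm series of a determinantal point process converges absolutely on `S`, then it is
the probability of having no points in `S`: its terms are the signed factorial moments of the
number of points in `S`. -/
theorem IsDeterminantal.tsum_fredTerm {Ω : Type*} [MeasurableSpace Ω] {μ : Measure Ω}
    [IsProbabilityMeasure μ] {X : Ω → Set ℝ} {K : ℝ → ℝ → ℂ} (hX : IsDeterminantal μ X K)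
    {S : Set ℝ} (hS : MeasurableSet S)
    (hint : ∀ n : ℕ, IntegrableOn
      (fun x : Fin n → ℝ => (Matrix.of fun j k : Fin n => K (x j) (x k)).det) {x | ∀ j, x j ∈ S})
    (hsum : Summable fun n => ‖fredTerm S K n‖) :
    ∑' n, fredTerm S K n = ((μ.real {ω | X ω ∩ S = ∅} : ℝ) : ℂ) := by
  choose ρ hρ hcorr using hX.correlation
  set B : ∀ n : ℕ, Set (Fin n → ℝ) := fun n => {x | ∀ j, x j ∈ S}
  have hB : ∀ n, MeasurableSet (B n) := fun n => measurableSet_box hS n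
  have hset : ∀ n ω, {x : Fin n → ℝ | x ∈ B n ∧ Function.Injective x ∧ ∀ j, x j ∈ X ω} =
      {x : Fin n → ℝ | Function.Injective x ∧ ∀ j, x j ∈ X ω ∩ S} := by
    intro n ω
    ext x
    simp only [B, mem_ofPred_eq, mem_inter_iff, forall_and]
    tauto
  have hρi : ∀ n, IntegrableOn (fun x => (ρ n x : ℝ)) (B n) := fun n => by
    refine (hint n).re.congr (Eventually.of_forall fun x => ?_)
    change (Matrix.of fun j k : Fin n => K (x j) (x k)).det.re = _
    rw [← hρ n x, Complex.ofReal_re]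
  have hρl : ∀ n, ∫⁻ x in B n, (ρ n x : ℝ≥0∞) = ENNReal.ofReal (∫ x in B n, (ρ n x : ℝ)) :=
    fun n => by
    rw [ofReal_integral_eq_lintegral_ofReal (hρi n) (Eventually.of_forall fun x => (ρ n x).2)]
    exact lintegral_congr fun x => (ENNReal.ofReal_coe_nnreal).symm
  set N : Ω → ℝ≥0∞ := fun ω => ((X ω ∩ S).encard : ℝ≥0∞)
  have hN : Measurable N := hX.measurable_count S hS
  have hfin : ∀ᵐ ω ∂μ, (X ω ∩ S).Finite := by
    have h1 := hcorr 1 (B 1) (hB 1)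
    simp only [hset, encard_injective_one] at h1
    have h2 : ∫⁻ ω, N ω ∂μ ≠ ∞ := by
      rw [h1, hρl]; exact ENNReal.ofReal_ne_top
    filter_upwards [ae_lt_top hN h2] with ω hω
    rw [← Set.encard_lt_top_iff]
    simpa [N] using hω
  -- The number of points as a natural number; it is finite almost surely, since its mean is finite.
  set M : Ω → ℕ := fun ω => ⌊(N ω).toReal⌋₊
  have hM : Measurable M := Nat.measurable_floor.comp hN.ennreal_toReal
  have hMn : ∀ᵐ ω ∂μ, M ω = (X ω ∩ S).ncard := by
    filter_upwards [hfin] with ω hω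
    simp only [M, N]
    rw [← hω.cast_ncard_eq]
    simp
  have hmeasR : ∀ f : ℕ → ℝ, Measurable fun ω => f (M ω) := fun f =>
    (measurable_from_top (f := f)).comp hM
  -- the factorial moments of the number of points
  have hmom : ∀ n, ∫⁻ ω, ENNReal.ofReal ((M ω).descFactorial n : ℝ) ∂μ =
      ENNReal.ofReal (∫ x in B n, (ρ n x : ℝ)) := fun n => by
    rw [← hρl, ← hcorr n (B n) (hB n)]
    refine lintegral_congr_ae ?_
    filter_upwards [hfin, hMn] with ω h1 h2
    rw [hset, encard_injective_tuples h1, h2]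
    simp
  have hdi : ∀ n, Integrable (fun ω => ((M ω).descFactorial n : ℝ)) μ := fun n => by
    refine ⟨(hmeasR fun m => (m.descFactorial n : ℝ)).aestronglyMeasurable, ?_⟩
    rw [hasFiniteIntegral_iff_ofReal (Eventually.of_forall fun ω => Nat.cast_nonneg _), hmom]
    exact ENNReal.ofReal_lt_top
  have hdm : ∀ n, ∫ ω, ((M ω).descFactorial n : ℝ) ∂μ = ∫ x in B n, (ρ n x : ℝ) := fun n => by
    rw [integral_eq_lintegral_of_nonneg_ae (Eventually.of_forall fun ω => Nat.cast_nonneg _)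
      (hdi n).aestronglyMeasurable, hmom, ENNReal.toReal_ofReal]
    exact integral_nonneg fun x => (ρ n x).2
  have hterm : ∀ n, fredTerm S K n =
      (((-1) ^ n / (n ! : ℝ) * ∫ ω, ((M ω).descFactorial n : ℝ) ∂μ : ℝ) : ℂ) := fun n => by
    rw [hdm, fredTerm]
    push_cast
    congr 1
    rw [← integral_complex_ofReal]
    exact integral_congr_ae (Eventually.of_forall fun x => (hρ n x).symm)
  set F : ℕ → Ω → ℝ := fun n ω => (-1) ^ n * ((M ω).choose n : ℝ)
  have hF : ∀ n ω, F n ω = (-1) ^ n / (n ! : ℝ) * ((M ω).descFactorial n : ℝ) := fun n ω => by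
    simp only [F]
    rw [Nat.descFactorial_eq_factorial_mul_choose]
    have : (n ! : ℝ) ≠ 0 := by exact_mod_cast n.factorial_ne_zero
    push_cast
    field_simp
  have hFi : ∀ n, Integrable (F n) μ := fun n => by
    have := (hdi n).const_mul ((-1) ^ n / (n ! : ℝ))
    exact this.congr (Eventually.of_forall fun ω => (hF n ω).symm)
  have hFv : ∀ n, ((∫ ω, F n ω ∂μ : ℝ) : ℂ) = fredTerm S K n := fun n => by
    rw [hterm, ← integral_const_mul]
    simp only [hF]
  have hFn : ∀ n, ∫ ω, ‖F n ω‖ ∂μ = ‖fredTerm S K n‖ := fun n => by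
    rw [hterm, Complex.norm_real, norm_mul, Real.norm_of_nonneg
      (integral_nonneg fun ω => Nat.cast_nonneg _), ← integral_const_mul]
    refine integral_congr_ae (Eventually.of_forall fun ω => ?_)
    change ‖F n ω‖ = _
    rw [hF, norm_mul, Real.norm_of_nonneg (Nat.cast_nonneg (α := ℝ) _)]
  have h := hasSum_integral_of_summable_integral_norm hFi (by simpa only [hFn] using hsum)
  -- The alternating sum of binomial coefficients is the indicator of the event without points.
  have hval : ∀ ω, ∑' n, F n ω = {ω | M ω = 0}.indicator (fun _ => (1 : ℝ)) ω := fun ω => by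
    rw [tsum_eq_sum (s := Finset.range (M ω + 1)) fun n hn => by
      simp only [F]
      rw [Nat.choose_eq_zero_of_lt (by simpa using hn)]
      simp]
    have := Int.alternating_sum_range_choose (n := M ω)
    have h2 : (∑ n ∈ Finset.range (M ω + 1), F n ω) =
        ((∑ n ∈ Finset.range (M ω + 1), (-1) ^ n * ((M ω).choose n : ℤ) : ℤ) : ℝ) := by
      push_cast; rfl
    rw [h2, this]
    by_cases h0 : M ω = 0
    · rw [if_pos h0, indicator_of_mem (show ω ∈ {ω | M ω = 0} from h0)]; simp
    · rw [if_neg h0, indicator_of_notMem (show ω ∉ {ω | M ω = 0} from h0)]; simp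
  simp only [hval] at h
  have hM0 : MeasurableSet {ω | M ω = 0} := hM (measurableSet_singleton 0)
  rw [integral_indicator hM0, setIntegral_const, smul_eq_mul, mul_one] at h
  have hmu : μ.real {ω | M ω = 0} = μ.real {ω | X ω ∩ S = ∅} := by
    refine measureReal_congr ?_
    filter_upwards [hfin, hMn] with ω h1 h2
    refine propext ?_
    change M ω = 0 ↔ X ω ∩ S = ∅
    rw [h2, Set.ncard_eq_zero h1]
  rw [hmu] at h
  have h3 := (Complex.hasSum_ofReal (f := fun n => ∫ ω, F n ω ∂μ)).2 h
  simp only [hFv] at h3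
  exact h3.tsum_eq

theorem gapProb_eq_measure {α δ b : ℝ} (hα : 0 < α) (hδ : 0 < δ) (hb : δ < b) {Ω : Type*}
    [MeasurableSpace Ω] {μ : Measure Ω} [IsProbabilityMeasure μ] {X : Ω → Set ℝ}
    (hX : IsDeterminantal μ X (Kcrit α δ b)) {a : ℝ} (ha : 0 < a) :
    gapProb α δ b a = ((μ.real {ω | X ω ∩ Ioi a = ∅} : ℝ) : ℂ) := by
  rw [gapProb_eq_tsum hα hδ hb ha]
  exact hX.tsum_fredTerm measurableSet_Ioi (integrableOn_corrDet hα hδ hb ha)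
    (summable_gapTerm hα hδ hb ha).norm

end gap


/-! ### Integral operators on the contours -/

section kernelOp

/-- An integral operator against a curve, with kernel dominated by a product of square integrable
functions, is bounded on `L₂`. -/
theorem exists_kernelOp {μ : Measure ℂ} {c : ℝ → ℂ} (hc : Measurable c)
    (hμ : Measure.map c volume ≤ μ) {k : ℂ → ℝ → ℂ} (hk : Measurable (Function.uncurry k))
    {p : ℂ → ℝ} {q : ℝ → ℝ} (hp : MemLp p 2 μ) (hq : MemLp q 2)
    (hb : ∀ x r, ‖k x r‖ ≤ p x * q r) :
    ∃ T : Lp ℂ 2 μ →L[ℂ] Lp ℂ 2 μ, ∀ f : Lp ℂ 2 μ, T f =ᵐ[μ] fun x => ∫ r, k x r * f (c r) := by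
  have hae : ∀ {P : ℂ → Prop}, (∀ᵐ y ∂μ, P y) → ∀ᵐ r : ℝ, P (c r) := fun h =>
    ae_of_ae_map hc.aemeasurable (hμ.absolutelyContinuous.ae_le h)
  have hcomp : ∀ f : Lp ℂ 2 μ, MemLp (fun r => f (c r)) 2 := fun f =>
    (memLp_map_measure_iff ((Lp.stronglyMeasurable f).aestronglyMeasurable) hc.aemeasurable).1
      ((Lp.memLp f).mono_measure hμ)
  have hqf : ∀ f : Lp ℂ 2 μ, Integrable fun r => q r * ‖f (c r)‖ := fun f =>
    memLp_one_iff_integrable.1 ((hcomp f).norm.mul' hq)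
  have hkm : ∀ x, Measurable (k x) := fun x => hk.comp measurable_prodMk_left
  have hfm : ∀ f : Lp ℂ 2 μ, Measurable fun r => f (c r) := fun f =>
    (Lp.stronglyMeasurable f).measurable.comp hc
  have hint : ∀ (f : Lp ℂ 2 μ) x, Integrable fun r => k x r * f (c r) := fun f x => by
    refine ((hqf f).const_mul (p x)).mono' ((hkm x).mul (hfm f)).aestronglyMeasurable
      (Eventually.of_forall fun r => ?_)
    rw [norm_mul, ← mul_assoc]
    exact mul_le_mul_of_nonneg_right (hb x r) (norm_nonneg _)
  have hbd : ∀ (f : Lp ℂ 2 μ) x, ‖∫ r, k x r * f (c r)‖ ≤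
      (∫ r, q r * ‖f (c r)‖) * p x := fun f x => by
    rw [mul_comm, ← integral_const_mul]
    refine norm_integral_le_of_norm_le ((hqf f).const_mul _) (Eventually.of_forall fun r => ?_)
    rw [norm_mul, ← mul_assoc]
    exact mul_le_mul_of_nonneg_right (hb x r) (norm_nonneg _)
  -- Hölder's inequality bounds the functional `f ↦ ∫ q |f ∘ c|`
  have hhol : ∀ f : Lp ℂ 2 μ, |∫ r, q r * ‖f (c r)‖| ≤ (eLpNorm q 2 volume).toReal * ‖f‖ :=
    fun f => by
    have h1 : ENNReal.ofReal |∫ r, q r * ‖f (c r)‖| ≤ eLpNorm q 2 volume * eLpNorm f 2 μ := by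
      calc ENNReal.ofReal |∫ r, q r * ‖f (c r)‖| = ‖∫ r, q r * ‖f (c r)‖‖ₑ := by
            rw [← Real.norm_eq_abs, ofReal_norm]
        _ ≤ ∫⁻ r, ‖q r * ‖f (c r)‖‖ₑ := enorm_integral_le_lintegral_enorm _
        _ = eLpNorm (fun r => q r * ‖f (c r)‖) 1 volume := eLpNorm_one_eq_lintegral_enorm.symm
        _ ≤ (1 : ℝ≥0) * eLpNorm q 2 volume * eLpNorm (fun r => f (c r)) 2 volume :=
            eLpNorm_le_eLpNorm_mul_eLpNorm'_of_norm hq.1 (hcomp f).1 (fun s z => s * ‖z‖) 1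
              (Eventually.of_forall fun r => by simp)
        _ ≤ eLpNorm q 2 volume * eLpNorm f 2 μ := by
            rw [ENNReal.coe_one, one_mul]
            gcongr
            rw [show (fun r => f (c r)) = f ∘ c from rfl, ← eLpNorm_map_measure
              (Lp.stronglyMeasurable f).aestronglyMeasurable hc.aemeasurable]
            exact eLpNorm_mono_measure _ hμ
    have h2 := ENNReal.toReal_mono (ENNReal.mul_ne_top hq.2.ne (Lp.memLp f).2.ne) h1
    rwa [ENNReal.toReal_ofReal (abs_nonneg _), ENNReal.toReal_mul, ← Lp.norm_def] at h2
  have hmem : ∀ f : Lp ℂ 2 μ, MemLp (fun x => ∫ r, k x r * f (c r)) 2 μ := fun f => by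
    refine (hp.const_mul (∫ r, q r * ‖f (c r)‖)).mono ?_ (Eventually.of_forall fun x =>
      (hbd f x).trans (le_abs_self _))
    have : StronglyMeasurable (Function.uncurry fun x r => k x r * f (c r)) :=
      (hk.mul ((hfm f).comp measurable_snd)).stronglyMeasurable
    exact this.integral_prod_right.aestronglyMeasurable
  set P : Lp ℝ 2 μ := hp.toLp p
  let L : Lp ℂ 2 μ →ₗ[ℂ] Lp ℂ 2 μ :=
    { toFun := fun f => (hmem f).toLp _
      map_add' := fun f g => by
        rw [← MemLp.toLp_add]
        refine MemLp.toLp_congr _ _ (Eventually.of_forall fun x => ?_)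
        change _ = (∫ r, k x r * f (c r)) + ∫ r, k x r * g (c r)
        rw [← integral_add (hint f x) (hint g x)]
        refine integral_congr_ae ?_
        filter_upwards [hae (Lp.coeFn_add f g)] with r hr
        rw [hr, Pi.add_apply, mul_add]
      map_smul' := fun m f => by
        rw [RingHom.id_apply, ← MemLp.toLp_const_smul]
        refine MemLp.toLp_congr _ _ (Eventually.of_forall fun x => ?_)
        change _ = m * ∫ r, k x r * f (c r)
        rw [← integral_const_mul]
        refine integral_congr_ae ?_
        filter_upwards [hae (Lp.coeFn_smul m f)] with r hr
        rw [hr, Pi.smul_apply, smul_eq_mul]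
        ring }
  refine ⟨L.mkContinuous ((eLpNorm q 2 volume).toReal * ‖P‖) fun f => ?_, fun f =>
    (hmem f).coeFn_toLp⟩
  have h1 : ‖L f‖ ≤ ((eLpNorm q 2 volume).toReal * ‖f‖) * ‖P‖ := by
    refine Lp.norm_le_mul_norm_of_ae_le_mul ?_
    filter_upwards [(hmem f).coeFn_toLp, hp.coeFn_toLp] with x h1 h2
    change ‖((hmem f).toLp _ : Lp ℂ 2 μ) x‖ ≤ _ * ‖(hp.toLp p : Lp ℝ 2 μ) x‖
    rw [h1, h2]
    refine (hbd f x).trans ((le_abs_self _).trans ?_)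
    rw [abs_mul]
    exact mul_le_mul_of_nonneg_right (hhol f) (abs_nonneg _)
  refine h1.trans (le_of_eq (by ring))

theorem memLp_of_gauss {g : ℝ → ℂ} (hg : AEStronglyMeasurable g volume) {κ C : ℝ} (hκ : 0 < κ)
    (hb : ∀ r, ‖g r‖ ≤ C * Real.exp (-κ * r ^ 2)) : MemLp g 2 := by
  have h : MemLp (fun r : ℝ => C * Real.exp (-κ * r ^ 2)) 2 := by
    refine (memLp_two_iff_integrable_sq (by fun_prop)).2 ?_
    refine ((integrable_exp_neg_mul_sq (b := 2 * κ) (by positivity)).const_mul (C ^ 2)).congr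
      (Eventually.of_forall fun r => ?_)
    simp only
    rw [mul_pow, ← Real.exp_nat_mul]
    congr 2
    push_cast
    ring
  exact h.mono hg (Eventually.of_forall fun r => (hb r).trans (le_abs_self _))

variable {δ b : ℝ}

theorem memLp_arcLength {p : ℂ → ℂ} (hδ : 0 < δ) (hp : Measurable p)
    (h1 : MemLp (fun r => p (hook δ r)) 2) (h2 : MemLp (fun r => p (vline b r)) 2) :
    MemLp p 2 (arcLength δ b) := by
  have hm := hp.aestronglyMeasurable (μ := arcLength δ b)
  rw [memLp_two_iff_integrable_sq_norm hm]
  have hsq : AEStronglyMeasurable (fun x => ‖p x‖ ^ 2) (arcLength δ b) := hm.norm.pow 2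
  unfold arcLength at hsq ⊢
  refine Integrable.add_measure ?_ ?_
  · rw [integrable_map_measure (hsq.mono_measure (Measure.le_add_right le_rfl))
      (continuous_hook hδ).measurable.aemeasurable]
    exact (memLp_two_iff_integrable_sq_norm h1.1).1 h1
  · rw [integrable_map_measure (hsq.mono_measure (Measure.le_add_left le_rfl))
      (continuous_vline b).measurable.aemeasurable]
    exact (memLp_two_iff_integrable_sq_norm h2.1).1 h2

theorem map_hook_le (δ b : ℝ) : Measure.map (hook δ) volume ≤ arcLength δ b :=
  Measure.le_add_right le_rfl

theorem map_vline_le (δ b : ℝ) : Measure.map (vline b) volume ≤ arcLength δ b :=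
  Measure.le_add_left le_rfl

theorem ae_hook_of_ae (hδ : 0 < δ) {P : ℂ → Prop} (h : ∀ᵐ x ∂arcLength δ b, P x) :
    ∀ᵐ r : ℝ, P (hook δ r) :=
  ae_of_ae_map (continuous_hook hδ).measurable.aemeasurable
    ((map_hook_le δ b).absolutelyContinuous.ae_le h)

theorem ae_vline_of_ae {P : ℂ → Prop} (h : ∀ᵐ x ∂arcLength δ b, P x) :
    ∀ᵐ r : ℝ, P (vline b r) :=
  ae_of_ae_map (continuous_vline b).measurable.aemeasurable
    ((map_vline_le δ b).absolutelyContinuous.ae_le h)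

theorem range_vline (b : ℝ) : range (vline b) = {z | z.re = b} := by
  ext z
  refine ⟨fun ⟨r, hr⟩ => hr ▸ vline_re b r, fun h => ⟨z.im, ?_⟩⟩
  rw [← (show z.re = b from h)]
  exact (eq_vline z).symm

theorem isClosed_range_vline (b : ℝ) : IsClosed (range (vline b)) := by
  rw [range_vline]
  exact isClosed_eq Complex.continuous_re continuous_const

theorem isClosed_range_hook (hδ : 0 < δ) : IsClosed (range (hook δ)) := by
  have : range (hook δ) = {z | 0 ≤ z.re ∧ ‖z‖ = δ} ∪ {z | z.re ≤ 0 ∧ |z.im| = δ} := by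
    rw [range_hook hδ]
    ext z
    simp only [mem_ofPred_eq, mem_union]
    constructor
    · rintro (h | h)
      · exact Or.inl ⟨h.1.le, h.2⟩
      · exact Or.inr h
    · rintro (h | h)
      · rcases h.1.lt_or_eq with h0 | h0
        · exact Or.inl ⟨h0, h.2⟩
        · refine Or.inr ⟨h0.symm.le, ?_⟩
          rw [← h.2, Complex.norm_def, Complex.normSq_apply, ← h0, mul_zero, zero_add,
            Real.sqrt_mul_self_eq_abs]
      · exact Or.inr h
  rw [this]
  exact ((isClosed_le continuous_const Complex.continuous_re).inter
    (isClosed_eq continuous_norm continuous_const)).union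
    ((isClosed_le Complex.continuous_re continuous_const).inter
      (isClosed_eq (continuous_abs.comp Complex.continuous_im) continuous_const))

theorem hook_notMem_range_vline (hδ : 0 < δ) (hb : δ < b) (r : ℝ) :
    hook δ r ∉ range (vline b) := by
  rw [range_vline]
  exact fun h => absurd h ((hook_re_le hδ r).trans_lt hb).ne

theorem vline_notMem_range_hook (hδ : 0 < δ) (hb : δ < b) (r : ℝ) :
    vline b r ∉ range (hook δ) := by
  rintro ⟨s, hs⟩
  exact hook_notMem_range_vline hδ hb s ⟨r, hs.symm⟩

theorem measurable_Gamma : Measurable Complex.Gamma := by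
  have : Complex.Gamma = fun s => ((Complex.Gamma s)⁻¹)⁻¹ := by ext s; rw [inv_inv]
  rw [this]
  exact Complex.differentiable_one_div_Gamma.continuous.measurable.inv

theorem measurable_Qker (hδ : 0 < δ) (α a : ℝ) :
    Measurable (Function.uncurry (Qker α δ b a)) := by
  have h1 : Measurable ((range (vline b)).indicator (1 : ℂ → ℂ)) :=
    measurable_one.indicator (isClosed_range_vline b).measurableSet
  have h2 : Measurable ((range (hook δ)).indicator (1 : ℂ → ℂ)) :=
    measurable_one.indicator (isClosed_range_hook hδ).measurableSet
  have h3 := measurable_Gamma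
  unfold Qker Function.uncurry
  refine Measurable.div (Measurable.sub ?_ ?_) (by fun_prop)
  · exact (((h1.comp measurable_fst).mul (h2.comp measurable_snd)).mul
      (h3.comp measurable_snd)).mul (by fun_prop)
  · exact (((h2.comp measurable_fst).mul (h1.comp measurable_snd)).mul
      (h3.comp measurable_snd).inv).mul (by fun_prop)

/-- The kernel with second variable on `γ` only sees first variables on `γ̃`. -/
theorem Qker_hook (hδ : 0 < δ) (hb : δ < b) (α a : ℝ) (x : ℂ) (r : ℝ) :
    Qker α δ b a x (hook δ r) = (range (vline b)).indicator (fun x =>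
      Complex.exp (α * x ^ 2 / 4 - a * x) / (x - hook δ r) *
        (Complex.Gamma (hook δ r) * Complex.exp (a * hook δ r - (α / 4 : ℝ) * hook δ r ^ 2)) /
          (2 * Real.pi * Complex.I)) x := by
  unfold Qker
  rw [indicator_of_mem (mem_range_self r), indicator_of_notMem (hook_notMem_range_vline hδ hb r)]
  by_cases hx : x ∈ range (vline b)
  · rw [indicator_of_mem hx, indicator_of_mem hx,
      show (α * (x ^ 2 - hook δ r ^ 2) / 4 - a * (x - hook δ r) : ℂ) =
      (α * x ^ 2 / 4 - a * x) + (a * hook δ r - (α / 4 : ℝ) * hook δ r ^ 2) by push_cast; ring,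
      Complex.exp_add]
    simp only [Pi.one_apply, div_eq_mul_inv, mul_inv]
    ring
  · rw [indicator_of_notMem hx, indicator_of_notMem hx]
    simp

theorem Qker_vline (hδ : 0 < δ) (hb : δ < b) (α a : ℝ) (x : ℂ) (r : ℝ) :
    Qker α δ b a x (vline b r) = (range (hook δ)).indicator (fun x =>
      Complex.exp ((0 : ℝ) * x - (α / 4 : ℝ) * x ^ 2) / (vline b r - x) *
        critSym (α / 2) (vline b r) / (2 * Real.pi * Complex.I)) x := by
  unfold Qker critSym
  rw [indicator_of_mem (mem_range_self r), indicator_of_notMem (vline_notMem_range_hook hδ hb r)]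
  by_cases hx : x ∈ range (hook δ)
  · rw [indicator_of_mem hx, indicator_of_mem hx,
      show (-(α * (x ^ 2 - vline b r ^ 2) / 4) : ℂ) =
      ((0 : ℝ) * x - (α / 4 : ℝ) * x ^ 2) + ((α / 2 : ℝ) * vline b r ^ 2 / 2) by push_cast; ring,
      Complex.exp_add]
    have e : (vline b r - x)⁻¹ = -(x - vline b r)⁻¹ := by rw [← neg_sub, inv_neg]
    simp only [Pi.one_apply, div_eq_mul_inv, mul_inv, e]
    ring
  · rw [indicator_of_notMem hx, indicator_of_notMem hx]
    simp

/-- The restriction to the contour of a function in `HookDecay`. -/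
theorem HookDecay.exists_norm_hook_le {c : ℝ} {f : ℂ → ℂ} (hδ : 0 < δ) (hf : HookDecay δ c f) :
    ∃ κ > 0, ∃ C, ∀ r, ‖f (hook δ r)‖ ≤ C * Real.exp (-κ * r ^ 2) := by
  obtain ⟨κ, hκ, C, hC⟩ := hf.decay
  have hC0 : 0 ≤ C := by
    have h := (norm_nonneg _).trans (hC 0 (by simpa using hδ.le) (by simpa using hδ.le))
    simpa using h
  refine ⟨κ / 2, by positivity, C * Real.exp (κ * hookLen δ ^ 2), fun r => ?_⟩
  refine (hC _ (hook_re_le hδ r) (abs_hook_im_le hδ r)).trans ?_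
  rw [mul_assoc, ← Real.exp_add]
  refine mul_le_mul_of_nonneg_left (Real.exp_le_exp.2 ?_) hC0
  nlinarith [sq_hook_re_ge hδ r]

theorem exists_norm_Gamma_hook_le (hδ : 0 < δ) : ∃ C, 0 ≤ C ∧ ∀ r, ‖Complex.Gamma (hook δ r)‖ ≤ C := by
  obtain ⟨C, hC⟩ := exists_norm_gammaTail_le δ
  have h : ∀ r, ‖Complex.Gamma (hook δ r)‖ ≤ (∑' k : ℕ, 1 / (k ! : ℝ) * δ⁻¹) + C := fun r => by
    rw [Gamma_eq_gammaPoles_add (hook_ne_neg_nat hδ r)]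
    refine (norm_add_le _ _).trans (add_le_add ?_ (hC _ (hook_re_le hδ r)))
    refine tsum_of_norm_bounded (summable_inv_factorial.mul_right _).hasSum fun k => ?_
    rw [norm_div, norm_div, norm_pow, norm_neg, norm_one, one_pow, Complex.norm_natCast,
      div_eq_mul_inv _ ‖_ + _‖]
    exact mul_le_mul_of_nonneg_left (inv_anti₀ hδ (le_norm_hook_add hδ r k)) (by positivity)
  exact ⟨_, (norm_nonneg _).trans (h 0), h⟩

end kernelOp


/-! ### Invertibility of the integrable operator -/

section qOperator

variable {α δ b a : ℝ}

theorem norm_two_pi_I_inv_le : ‖(2 * Real.pi * Complex.I : ℂ)⁻¹‖ ≤ 1 := by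
  rw [norm_inv, norm_mul, norm_mul, Complex.norm_I, Complex.norm_real, Complex.norm_two,
    Real.norm_of_nonneg Real.pi_pos.le, mul_one]
  exact inv_le_one_of_one_le₀ (by linarith [Real.pi_gt_three])

theorem gaussDecay_quarter (hα : 0 < α) (a l u : ℝ) :
    GaussDecay l u fun x => Complex.exp (α * x ^ 2 / 4 - a * x) := by
  refine ((gaussDecay_gauss (α := α / 2) (by positivity) l u).mul_exp (a : ℂ)).congr fun z _ => ?_
  rw [← Complex.exp_add]
  congr 1
  push_cast
  ring

theorem GaussDecay.memLp_vline {c : ℝ} {F : ℂ → ℂ} (hF : GaussDecay c c F) (hm : Measurable F) :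
    MemLp (fun r => F (vline c r)) 2 := by
  obtain ⟨κ, hκ, C, hC⟩ := hF
  refine memLp_of_gauss (hm.comp (continuous_vline c).measurable).aestronglyMeasurable hκ
    (C := C) fun r => ?_
  simpa using hC _ (vline_mem_vstrip le_rfl le_rfl r)

/-- The block of the operator that integrates over `γ`. -/
theorem exists_hookOp (hα : 0 < α) (hδ : 0 < δ) (hb : δ < b) (a : ℝ) :
    ∃ T : Lp ℂ 2 (arcLength δ b) →L[ℂ] Lp ℂ 2 (arcLength δ b), ∀ f : Lp ℂ 2 (arcLength δ b),
      T f =ᵐ[arcLength δ b] fun x => ∫ r, Qker α δ b a x (hook δ r) * deriv (hook δ) r *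
        f (hook δ r) := by
  have hbδ : 0 < b - δ := by linarith
  set P : ℂ → ℂ := (range (vline b)).indicator fun x =>
    ((b - δ)⁻¹ : ℝ) * Complex.exp (α * x ^ 2 / 4 - a * x)
  set q : ℝ → ℂ := fun r => Complex.Gamma (hook δ r) *
    Complex.exp (a * hook δ r - (α / 4 : ℝ) * hook δ r ^ 2)
  have hP : MemLp P 2 (arcLength δ b) := by
    refine memLp_arcLength hδ ?_ ?_ ?_
    · exact Measurable.indicator (by fun_prop) (isClosed_range_vline b).measurableSet
    · have : (fun r => P (hook δ r)) = fun _ => 0 := funext fun r =>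
        indicator_of_notMem (hook_notMem_range_vline hδ hb r) _
      rw [this]; exact MemLp.zero
    · have : (fun r => P (vline b r)) = fun r => ((b - δ)⁻¹ : ℝ) *
          Complex.exp (α * (vline b r) ^ 2 / 4 - a * vline b r) := funext fun r =>
        indicator_of_mem (mem_range_self r) _
      rw [this]
      exact ((gaussDecay_quarter hα a b b).memLp_vline (by fun_prop)).const_mul _
  have hq : MemLp q 2 := by
    obtain ⟨C, hC0, hC⟩ := exists_norm_Gamma_hook_le hδ
    obtain ⟨κ, hκ, D, hD⟩ := (hookDecay_gauss (β := α / 4) (δ := δ) (c := b) (x := a)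
      (by positivity)).exists_norm_hook_le hδ
    have hh := (continuous_hook hδ).measurable
    refine memLp_of_gauss ((measurable_Gamma.comp hh).mul (by fun_prop)).aestronglyMeasurable hκ
      (C := C * D) fun r => ?_
    rw [norm_mul, mul_assoc]
    exact mul_le_mul (hC r) (hD r) (norm_nonneg _) hC0
  refine exists_kernelOp (k := fun x r => Qker α δ b a x (hook δ r) * deriv (hook δ) r)
    (continuous_hook hδ).measurable (map_hook_le δ b) ?_ hP.norm hq.norm fun x r => ?_
  · exact ((measurable_Qker hδ α a).comp (measurable_fst.prodMk
      ((continuous_hook hδ).measurable.comp measurable_snd))).mul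
      ((measurable_deriv _).comp measurable_snd)
  · rw [norm_mul, norm_deriv_hook hδ, mul_one, Qker_hook hδ hb]
    by_cases hx : x ∈ range (vline b)
    · simp only [P]
      rw [indicator_of_mem hx, indicator_of_mem hx, div_eq_mul_inv _ (2 * Real.pi * Complex.I : ℂ),
        norm_mul, norm_mul, norm_mul (_ : ℂ) (Complex.exp _), div_eq_mul_inv _ (x - _), norm_mul]
      have h1 : ‖(x - hook δ r)⁻¹‖ ≤ ‖(((b - δ)⁻¹ : ℝ) : ℂ)‖ := by
        rw [Complex.norm_real, Real.norm_of_nonneg (by positivity), norm_inv]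
        refine inv_anti₀ hbδ ?_
        rw [range_vline] at hx
        have h2 := norm_sub_ge_of_re (s := x) (z := hook δ r)
        have h3 := hook_re_le hδ r
        have h4 : x.re = b := hx
        linarith
      calc _ ≤ ‖Complex.exp (α * x ^ 2 / 4 - a * x)‖ * ‖(((b - δ)⁻¹ : ℝ) : ℂ)‖ * ‖q r‖ * 1 := by
            rw [← norm_mul (Complex.Gamma _)]
            gcongr
            exact norm_two_pi_I_inv_le
        _ = _ := by simp only [q, norm_mul]; ring
    · rw [indicator_of_notMem hx, norm_zero]
      positivity

/-- The block of the operator that integrates over `γ̃`. -/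
theorem exists_lineOp (hα : 0 < α) (hδ : 0 < δ) (hb : δ < b) (a : ℝ) :
    ∃ T : Lp ℂ 2 (arcLength δ b) →L[ℂ] Lp ℂ 2 (arcLength δ b), ∀ f : Lp ℂ 2 (arcLength δ b),
      T f =ᵐ[arcLength δ b] fun x => ∫ r, Qker α δ b a x (vline b r) * deriv (vline b) r *
        f (vline b r) := by
  have hbδ : 0 < b - δ := by linarith
  set P : ℂ → ℂ := (range (hook δ)).indicator fun x =>
    ((b - δ)⁻¹ : ℝ) * Complex.exp ((0 : ℝ) * x - (α / 4 : ℝ) * x ^ 2)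
  set q : ℝ → ℂ := fun r => critSym (α / 2) (vline b r)
  have hP : MemLp P 2 (arcLength δ b) := by
    refine memLp_arcLength hδ ?_ ?_ ?_
    · exact Measurable.indicator (by fun_prop) (isClosed_range_hook hδ).measurableSet
    · have : (fun r => P (hook δ r)) = fun r => ((b - δ)⁻¹ : ℝ) *
          Complex.exp ((0 : ℝ) * hook δ r - (α / 4 : ℝ) * (hook δ r) ^ 2) := funext fun r =>
        indicator_of_mem (mem_range_self r) _
      rw [this]
      obtain ⟨κ, hκ, D, hD⟩ := (hookDecay_gauss (β := α / 4) (δ := δ) (c := b) (x := 0)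
        (by positivity)).exists_norm_hook_le hδ
      have hh := continuous_hook hδ
      exact (memLp_of_gauss (Continuous.aestronglyMeasurable (by fun_prop)) hκ hD).const_mul _
    · have : (fun r => P (vline b r)) = fun _ => 0 := funext fun r =>
        indicator_of_notMem (vline_notMem_range_hook hδ hb r) _
      rw [this]; exact MemLp.zero
  have hq : MemLp q 2 := (gaussDecay_critSym (by positivity) (hδ.trans hb) b).memLp_vline
    (differentiable_critSym _).continuous.measurable
  refine exists_kernelOp (k := fun x r => Qker α δ b a x (vline b r) * deriv (vline b) r)
    (continuous_vline b).measurable (map_vline_le δ b) ?_ hP.norm hq.norm fun x r => ?_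
  · exact ((measurable_Qker hδ α a).comp (measurable_fst.prodMk
      ((continuous_vline b).measurable.comp measurable_snd))).mul
      ((measurable_deriv _).comp measurable_snd)
  · rw [norm_mul, deriv_vline, Complex.norm_I, mul_one, Qker_vline hδ hb]
    by_cases hx : x ∈ range (hook δ)
    · simp only [P]
      rw [indicator_of_mem hx, indicator_of_mem hx, div_eq_mul_inv _ (2 * Real.pi * Complex.I : ℂ),
        norm_mul, norm_mul, norm_mul (_ : ℂ) (Complex.exp _), div_eq_mul_inv _ (_ - x), norm_mul]
      have h1 : ‖(vline b r - x)⁻¹‖ ≤ ‖(((b - δ)⁻¹ : ℝ) : ℂ)‖ := by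
        rw [Complex.norm_real, Real.norm_of_nonneg (by positivity), norm_inv]
        refine inv_anti₀ hbδ ?_
        obtain ⟨s, rfl⟩ := hx
        have h2 := norm_sub_ge_of_re (s := vline b r) (z := hook δ s)
        have h3 := hook_re_le hδ s
        rw [vline_re] at h2
        linarith
      calc _ ≤ ‖Complex.exp ((0 : ℝ) * x - (α / 4 : ℝ) * x ^ 2)‖ * ‖(((b - δ)⁻¹ : ℝ) : ℂ)‖ *
            ‖q r‖ * 1 := by
            gcongr
            exact norm_two_pi_I_inv_le
        _ = _ := by ring
    · rw [indicator_of_notMem hx, norm_zero]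
      positivity

/-- The functional `L_k(f) = (2πi)⁻¹ ∫ Γ(w)⁻¹ e^{αw²/4} f(w) / (w + k) dw` over `γ̃`. -/
def lineFunctional (α b : ℝ) (f : ℂ → ℂ) (k : ℕ) : ℂ :=
  lineInt b fun w => critSym (α / 2) w * f w / (w + k)

/-- The coefficients `ξ_j = (-1)^j e^{-αj²/2 - aj} / j!`. -/
def critCoeff (α a : ℝ) (j : ℕ) : ℂ := critW α j * Complex.exp (-a * j)

/-- The function `x ↦ e^{αx²/4 - ax} ∑ ξ_j v_j / (x + j)` on `γ̃`, extended by zero. -/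
def lineSeries (α b a : ℝ) (v : ℕ → ℂ) : ℂ → ℂ :=
  (range (vline b)).indicator fun x =>
    Complex.exp (α * x ^ 2 / 4 - a * x) * ∑' j : ℕ, critCoeff α a j * v j / (x + j)

theorem norm_critCoeff_le (hα : 0 ≤ α) (ha : 0 ≤ a) (j : ℕ) : ‖critCoeff α a j‖ ≤ 1 / j ! := by
  rw [critCoeff, norm_mul]
  have h : ‖Complex.exp (-a * j)‖ ≤ 1 := by
    rw [Complex.norm_exp, Real.exp_le_one_iff]
    have : ((-a : ℂ) * j).re = -(a * j) := by simp
    rw [this]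
    have : 0 ≤ a * j := by positivity
    linarith
  calc _ ≤ 1 / (j ! : ℝ) * 1 := mul_le_mul (norm_critW_le hα j) h (norm_nonneg _) (by positivity)
    _ = _ := mul_one _

theorem critSym_half_mul (α a : ℝ) (w : ℂ) :
    critSym (α / 2) w * Complex.exp (α * w ^ 2 / 4 - a * w) =
      critSym α w * Complex.exp (-a * w) := by
  unfold critSym
  rw [mul_right_comm, mul_right_comm _ _ (Complex.exp (-a * w)), ← Complex.exp_add,
    ← Complex.exp_add]
  congr 2
  push_cast
  ring

theorem lineFunctional_congr {f g : ℂ → ℂ} (h : ∀ᵐ r : ℝ, f (vline b r) = g (vline b r)) (k : ℕ) :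
    lineFunctional α b f k = lineFunctional α b g k := by
  unfold lineFunctional lineInt
  congr 1
  refine integral_congr_ae ?_
  filter_upwards [h] with r hr
  rw [hr]

theorem integrable_critSym_mul (hα : 0 < α) (hb : 0 < b) {f : ℂ → ℂ}
    (hf : MemLp (fun r => f (vline b r)) 2) :
    Integrable fun r => critSym (α / 2) (vline b r) * f (vline b r) :=
  memLp_one_iff_integrable.1 (hf.mul' ((gaussDecay_critSym (by positivity) hb b).memLp_vline
    (differentiable_critSym _).continuous.measurable))

theorem vline_add_nat_lower (b r : ℝ) (k : ℕ) :
    min b 1 * (k + 1) ≤ ‖vline b r + k‖ := by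
  have h1 := Complex.re_le_norm (vline b r + k)
  simp only [Complex.add_re, vline_re, Complex.natCast_re] at h1
  have h2 : min b 1 ≤ b := min_le_left _ _
  have h3 : min b 1 ≤ 1 := min_le_right _ _
  have : (0 : ℝ) ≤ k := Nat.cast_nonneg k
  nlinarith

theorem integrable_div_vline_add (hb : 0 < b) {g : ℝ → ℂ} (hg : Integrable g) (k : ℕ) :
    Integrable fun r => g r / (vline b r + k) := by
  simp only [div_eq_mul_inv]
  have hc := continuous_vline b
  refine hg.mul_bdd (c := b⁻¹) (Continuous.aestronglyMeasurable (Continuous.inv₀ (by fun_prop)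
    fun r => vline_add_ne_zero hb r k)) (Eventually.of_forall fun r =>
      inv_norm_add_nat_le hb k (vline_mem_vstrip le_rfl le_rfl r))

theorem lineFunctional_add (hα : 0 < α) (hb : 0 < b) {f g : ℂ → ℂ}
    (hf : MemLp (fun r => f (vline b r)) 2) (hg : MemLp (fun r => g (vline b r)) 2) (k : ℕ) :
    lineFunctional α b (fun x => f x + g x) k =
      lineFunctional α b f k + lineFunctional α b g k := by
  unfold lineFunctional
  rw [← lineInt_add (integrable_div_vline_add hb (integrable_critSym_mul hα hb hf) k)
    (integrable_div_vline_add hb (integrable_critSym_mul hα hb hg) k)]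
  congr 1; ext w
  rw [mul_add, add_div]

theorem exists_norm_lineFunctional_le (hα : 0 < α) (hb : 0 < b) {f : ℂ → ℂ}
    (hf : MemLp (fun r => f (vline b r)) 2) :
    ∃ R, 0 ≤ R ∧ ∀ k : ℕ, ‖lineFunctional α b f k‖ ≤ R * (1 / (2 * ((k : ℝ) + 1))) := by
  have hi := integrable_critSym_mul hα hb hf
  have hm : 0 < min b 1 := lt_min hb one_pos
  refine ⟨‖(2 * Real.pi : ℂ)⁻¹‖ *
    (∫ r, ‖critSym (α / 2) (vline b r) * f (vline b r)‖ * (2 / min b 1)), by positivity,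
    fun k => ?_⟩
  unfold lineFunctional lineInt
  rw [norm_mul, mul_assoc, ← integral_mul_const]
  refine mul_le_mul_of_nonneg_left ?_ (norm_nonneg _)
  refine norm_integral_le_of_norm_le ((hi.norm.mul_const _).mul_const _)
    (Eventually.of_forall fun r => ?_)
  rw [norm_div, div_eq_mul_inv, mul_assoc]
  refine mul_le_mul_of_nonneg_left ?_ (norm_nonneg _)
  have h1 := vline_add_nat_lower b r k
  calc ‖vline b r + k‖⁻¹ ≤ (min b 1 * (k + 1))⁻¹ := inv_anti₀ (by positivity) h1
    _ = _ := by field_simp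

theorem summable_lineSeries (hα : 0 ≤ α) (ha : 0 ≤ a) (hb : 0 < b) {v : ℕ → ℂ} {B : ℝ}
    (hv : ∀ j, ‖v j‖ ≤ B) {x : ℂ} (hx : x.re = b) :
    Summable (fun j : ℕ => critCoeff α a j * v j / (x + j)) ∧
      ‖∑' j : ℕ, critCoeff α a j * v j / (x + j)‖ ≤ ∑' j : ℕ, 1 / (j ! : ℝ) * (B * b⁻¹) := by
  have hbd : ∀ j : ℕ, ‖critCoeff α a j * v j / (x + j)‖ ≤ 1 / (j ! : ℝ) * (B * b⁻¹) := fun j => by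
    rw [div_eq_mul_inv, norm_mul, norm_mul, mul_assoc]
    have hB := (norm_nonneg _).trans (hv 0)
    have h1 := norm_critCoeff_le (a := a) hα ha j
    have h2 := hv j
    have h3 := inv_norm_add_nat_le hb j (s := x) (u := b) ⟨hx.ge, hx.le⟩
    gcongr
  have hs := summable_inv_factorial.mul_right (B * b⁻¹)
  exact ⟨Summable.of_norm_bounded hs hbd, tsum_of_norm_bounded hs.hasSum hbd⟩

theorem memLp_lineSeries (hα : 0 < α) (ha : 0 ≤ a) (hδ : 0 < δ) (hb : δ < b) {v : ℕ → ℂ} {B : ℝ}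
    (hv : ∀ j, ‖v j‖ ≤ B) : MemLp (lineSeries α b a v) 2 (arcLength δ b) := by
  have hb0 := hδ.trans hb
  have hm : Measurable (lineSeries α b a v) := by
    refine measurable_of_tendsto_metrizable (f := fun N : ℕ => (range (vline b)).indicator fun x =>
      Complex.exp (α * x ^ 2 / 4 - a * x) *
        ∑ j ∈ Finset.range N, critCoeff α a j * v j / (x + j)) (fun N => ?_) ?_
    · exact Measurable.indicator (by fun_prop) (isClosed_range_vline b).measurableSet
    · refine tendsto_pi_nhds.2 fun x => ?_
      by_cases hx : x ∈ range (vline b)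
      · simp only [lineSeries, indicator_of_mem hx]
        rw [range_vline] at hx
        exact ((summable_lineSeries hα.le ha hb0 hv hx).1.hasSum.tendsto_sum_nat).const_mul _
      · simp only [lineSeries, indicator_of_notMem hx]
        exact tendsto_const_nhds
  refine memLp_arcLength hδ hm ?_ ?_
  · have : (fun r => lineSeries α b a v (hook δ r)) = fun _ => 0 := funext fun r =>
      indicator_of_notMem (hook_notMem_range_vline hδ hb r) _
    rw [this]; exact MemLp.zero
  · obtain ⟨κ, hκ, C, hC0, hC⟩ := (gaussDecay_quarter hα a b b).bound
    refine memLp_of_gauss (hm.comp (continuous_vline b).measurable).aestronglyMeasurable hκ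
      (C := C * ∑' j : ℕ, 1 / (j ! : ℝ) * (B * b⁻¹)) fun r => ?_
    rw [lineSeries, indicator_of_mem (mem_range_self r), norm_mul, mul_right_comm]
    have h1 := hC _ (vline_mem_vstrip le_rfl le_rfl r)
    rw [vline_im] at h1
    exact mul_le_mul h1 (summable_lineSeries hα.le ha hb0 hv (vline_re b r)).2 (norm_nonneg _)
      (by positivity)

theorem Mmat_critSym_eq (hα : 0 < α) {l u : ℝ} (hl : 0 < l) (hlu : l ≤ u) (w : ℕ → ℂ) (a : ℂ)
    (k j : ℕ) : Mmat l (critSym α) w a k j = Mmat u (critSym α) w a k j := by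
  unfold Mmat
  congr 1
  have e : ∀ s : ℂ, critSym α s * Complex.exp (-a * (s + j)) / ((s + k) * (s + j)) =
      critSym α s * Complex.exp (-a * s) / (s + k) * (Complex.exp (-a * j) * (s + j)⁻¹) := by
    intro s
    rw [mul_add, Complex.exp_add]
    simp only [div_eq_mul_inv, mul_inv]
    ring
  simp only [e]
  refine lineInt_shift hlu ?_ ?_
  · refine (differentiableOn_critSym_mul_exp_div a k hl).mul ?_
    intro s hs
    have hne : s + j ≠ 0 := fun h => by
      have h1 := congrArg Complex.re h
      simp only [Complex.add_re, Complex.natCast_re, Complex.zero_re] at h1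
      have : (0 : ℝ) ≤ j := Nat.cast_nonneg j
      linarith [hs.1]
    refine DifferentiableAt.differentiableWithinAt ?_
    fun_prop (disch := exact hne)
  · refine (gaussDecay_critSym_mul_exp_div hα a k hl u).mul_bounded
      (A := ‖Complex.exp (-a * j)‖ * l⁻¹) fun s hs => ?_
    rw [norm_mul]
    exact mul_le_mul_of_nonneg_left (inv_norm_add_nat_le hl j hs) (norm_nonneg _)

/-- In the variables `L_k(f)` the composition of the two blocks acts as the matrix `M`. -/
theorem lineFunctional_lineSeries (hα : 0 < α) (ha : 0 < a) (hb : 0 < b) {v : ℕ → ℂ} {B : ℝ}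
    (hv : ∀ j, ‖v j‖ ≤ B) (k : ℕ) : lineFunctional α b (lineSeries α b a v) k =
      ∑' j, Mmat (b + 1) (critSym α) (critW α) a k j * v j := by
  have hB := (norm_nonneg _).trans (hv 0)
  unfold lineFunctional lineInt
  have hcont := (differentiableOn_critSym_mul_exp_div (α := α) (a : ℂ) k (u := b) hb).continuousOn
  have hdec := gaussDecay_critSym_mul_exp_div hα (a : ℂ) k hb b
  have hg := hdec.integrable le_rfl le_rfl hcont
  have hi : ∀ j : ℕ, Integrable fun τ : ℝ => critCoeff α a j * v j *
      (critSym α (vline b τ) * Complex.exp (-a * vline b τ) / (vline b τ + k) /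
        (vline b τ + j)) := fun j => (integrable_div_vline_add hb hg j).const_mul _
  have hs : Summable fun j : ℕ => ∫ τ : ℝ, ‖critCoeff α a j * v j *
      (critSym α (vline b τ) * Complex.exp (-a * vline b τ) / (vline b τ + k) /
        (vline b τ + j))‖ := by
    refine Summable.of_nonneg_of_le (fun j => by positivity) (fun j => ?_)
      (summable_inv_factorial.mul_right (B * ∫ τ : ℝ, ‖critSym α (vline b τ) *
        Complex.exp (-a * vline b τ) / (vline b τ + k)‖ * b⁻¹))
    rw [← integral_const_mul, ← integral_const_mul]
    refine integral_mono (hi j).norm (((hg.norm.mul_const _).const_mul _).const_mul _) fun τ => ?_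
    rw [norm_mul, norm_mul, mul_assoc, div_eq_mul_inv _ (vline b τ + (j : ℂ)), norm_mul]
    have h1 := norm_critCoeff_le hα.le ha.le j
    have h2 := hv j
    have h3 := inv_norm_add_nat_le hb j (vline_mem_vstrip (le_refl b) le_rfl τ)
    gcongr
  have h := hasSum_integral_of_summable_integral_norm hi hs
  have e : ∀ τ : ℝ, critSym (α / 2) (vline b τ) * lineSeries α b a v (vline b τ) /
      (vline b τ + k) = ∑' j : ℕ, critCoeff α a j * v j *
      (critSym α (vline b τ) * Complex.exp (-a * vline b τ) / (vline b τ + k) /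
        (vline b τ + j)) := fun τ => by
    rw [lineSeries, indicator_of_mem (mem_range_self τ), ← mul_assoc, critSym_half_mul,
      mul_div_right_comm, ← tsum_mul_left]
    exact tsum_congr fun j => by ring
  simp only [e]
  rw [← h.tsum_eq, ← tsum_mul_left]
  refine tsum_congr fun j => ?_
  rw [← Mmat_critSym_eq hα hb (by linarith : b ≤ b + 1), integral_const_mul]
  unfold Mmat lineInt critCoeff
  have e2 : ∀ s : ℂ, critSym α s * Complex.exp (-a * (s + j)) / ((s + k) * (s + j)) =
      Complex.exp (-a * j) * (critSym α s * Complex.exp (-a * s) / (s + k) / (s + j)) := by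
    intro s
    rw [mul_add, Complex.exp_add]
    simp only [div_eq_mul_inv, mul_inv]
    ring
  simp only [e2]
  rw [integral_const_mul]
  ring

/-- Composing the two halves of the operator: the contour integral over `γ` collects the residues
at the poles of the Gamma function. -/
theorem integral_hook_integral_vline (hα : 0 < α) (hδ : 0 < δ) (hb : δ < b) (a : ℝ) {f : ℂ → ℂ}
    (hf : MemLp (fun r => f (vline b r)) 2) (x : ℂ) :
    ∫ r, Qker α δ b a x (hook δ r) * deriv (hook δ) r *
      (∫ s, Qker α δ b a (hook δ r) (vline b s) * deriv (vline b) s * f (vline b s)) =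
      lineSeries α b a (lineFunctional α b f) x := by
  have hb0 := hδ.trans hb
  by_cases hx : x ∈ range (vline b)
  swap
  · rw [lineSeries, indicator_of_notMem hx]
    simp only [Qker_hook hδ hb, indicator_of_notMem hx, zero_mul, integral_zero]
  have hxb : x.re = b := by rw [range_vline] at hx; exact hx
  have hi := integrable_critSym_mul hα hb0 hf
  set h : ℂ → ℂ := fun t => ∫ s, critSym (α / 2) (vline b s) * f (vline b s) / (vline b s - t)
  have hin : ∀ r, (∫ s, Qker α δ b a (hook δ r) (vline b s) * deriv (vline b) s *
      f (vline b s)) = (2 * Real.pi : ℂ)⁻¹ *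
        Complex.exp ((0 : ℝ) * hook δ r - (α / 4 : ℝ) * hook δ r ^ 2) * h (hook δ r) := fun r => by
    simp only [h]
    rw [← integral_const_mul]
    congr 1; ext s
    rw [Qker_vline hδ hb, indicator_of_mem (mem_range_self r), deriv_vline]
    simp only [div_eq_mul_inv, mul_inv]
    linear_combination ((2 : ℂ)⁻¹ * (Real.pi : ℂ)⁻¹ *
      Complex.exp ((0 : ℝ) * hook δ r - (α * 4⁻¹ : ℝ) * hook δ r ^ 2) *
      critSym (α * 2⁻¹) (vline b s) * f (vline b s) * (vline b s - hook δ r)⁻¹) *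
      (inv_mul_cancel₀ Complex.I_ne_zero)
  have hdec : HookDecay δ b fun t =>
      h t * Complex.exp (a * t - (α / 2 : ℝ) * t ^ 2) / (x - t) := by
    refine HookDecay.div_sub hb ?_ hxb
    refine (hookDecay_gauss (by positivity)).mul_bounded (A := ∫ s, ‖critSym (α / 2) (vline b s) *
      f (vline b s)‖ * (b - δ)⁻¹) ?_ fun t ht _ => ?_
    · intro t ht
      exact (differentiableAt_cauchy_line hi (ne_of_lt ht)).differentiableWithinAt
    · refine norm_integral_le_of_norm_le (hi.norm.mul_const _) (Eventually.of_forall fun s => ?_)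
      rw [norm_div, div_eq_mul_inv]
      refine mul_le_mul_of_nonneg_left (inv_anti₀ (by linarith) ?_) (norm_nonneg _)
      have := norm_sub_ge_of_re (s := vline b s) (z := t)
      rw [vline_re] at this
      linarith
  have hres := hdec.contourInt_Gamma_mul hδ hb
  have e1 : ∫ r, Qker α δ b a x (hook δ r) * deriv (hook δ) r *
      (∫ s, Qker α δ b a (hook δ r) (vline b s) * deriv (vline b) s * f (vline b s)) =
      Complex.exp (α * x ^ 2 / 4 - a * x) * (2 * Real.pi * Complex.I)⁻¹ * (2 * Real.pi : ℂ)⁻¹ *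
      contourInt (hook δ) fun z => Complex.Gamma z *
        (h z * Complex.exp (a * z - (α / 2 : ℝ) * z ^ 2) / (x - z)) := by
    unfold contourInt
    rw [← integral_const_mul]
    refine integral_congr_ae (Eventually.of_forall fun r => ?_)
    beta_reduce
    rw [hin, Qker_hook hδ hb, indicator_of_mem hx,
      show (a * hook δ r - (α / 2 : ℝ) * hook δ r ^ 2 : ℂ) =
        (a * hook δ r - (α / 4 : ℝ) * hook δ r ^ 2) +
        ((0 : ℝ) * hook δ r - (α / 4 : ℝ) * hook δ r ^ 2) by push_cast; ring, Complex.exp_add]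
    simp only [div_eq_mul_inv]
    ring
  rw [e1, hres, lineSeries, indicator_of_mem hx]
  have hpi : (2 * Real.pi * Complex.I : ℂ) ≠ 0 := by simp [Real.pi_ne_zero]
  have hcancel : ∀ E u S : ℂ, E * (2 * Real.pi * Complex.I)⁻¹ * u *
      (2 * Real.pi * Complex.I * S) = E * (u * S) := fun E u S => by
    linear_combination (E * u * S) * inv_mul_cancel₀ hpi
  rw [hcancel, ← tsum_mul_left]
  congr 1
  refine tsum_congr fun k => ?_
  have e3 : h (-k) = 2 * Real.pi * lineFunctional α b f k := by
    have hp2 : (2 * Real.pi : ℂ) ≠ 0 := by simp [Real.pi_ne_zero]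
    unfold lineFunctional lineInt
    rw [mul_inv_cancel_left₀ hp2]
    simp only [h, sub_neg_eq_add]
  rw [e3, critCoeff, critW_eq, show (a * -k - (α / 2 : ℝ) * (-k : ℂ) ^ 2 : ℂ) =
    -(α / 2 * (k : ℂ) ^ 2) + -a * k by push_cast; ring, Complex.exp_add, sub_neg_eq_add]
  have hp2 : (Real.pi : ℂ) ≠ 0 := by simp [Real.pi_ne_zero]
  field_simp

theorem integral_hook_eq_zero (hδ : 0 < δ) (hb : δ < b) (α a : ℝ) (f : ℂ → ℂ) (r : ℝ) :
    ∫ s, Qker α δ b a (hook δ r) (hook δ s) * deriv (hook δ) s * f (hook δ s) = 0 := by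
  simp only [Qker_hook hδ hb, indicator_of_notMem (hook_notMem_range_vline hδ hb r), zero_mul,
    integral_zero]

theorem integral_vline_eq_zero (hδ : 0 < δ) (hb : δ < b) (α a : ℝ) (f : ℂ → ℂ) (r : ℝ) :
    ∫ s, Qker α δ b a (vline b r) (vline b s) * deriv (vline b) s * f (vline b s) = 0 := by
  simp only [Qker_vline hδ hb, indicator_of_notMem (vline_notMem_range_hook hδ hb r), zero_mul,
    integral_zero]

/-- The operator factors as `1 - Q = (1 - A) (1 - A B) (1 - B)`, where `A` maps functions on `γ` to
functions on `γ̃` and `B` goes back; `A B` is the infinite matrix `Mmat` in disguise. -/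
theorem exists_isUnit_one_sub (hα : 0 < α) (hδ : 0 < δ) (hb : δ < b) (ha : 0 < a) :
    ∃ Q : Lp ℂ 2 (arcLength δ b) →L[ℂ] Lp ℂ 2 (arcLength δ b),
      IsQOperator α δ b a Q ∧ IsUnit (1 - Q) := by
  have hb0 := hδ.trans hb
  obtain ⟨A, hA⟩ := exists_hookOp hα hδ hb a
  obtain ⟨B, hB⟩ := exists_lineOp hα hδ hb a
  -- `A` maps into functions supported on `γ̃` and only sees functions on `γ`; for `B` conversely.
  have hAA : A * A = 0 := by
    ext1 f
    rw [mul_apply_eq_comp]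
    refine Lp.ext ?_
    filter_upwards [hA (A f), Lp.coeFn_zero ℂ 2 (arcLength δ b)] with x h1 h2
    rw [h1, _root_.zero_apply, h2, Pi.zero_apply]
    refine integral_eq_zero_of_ae ?_
    filter_upwards [ae_hook_of_ae hδ (hA f)] with r hr
    rw [hr, integral_hook_eq_zero hδ hb, mul_zero, Pi.zero_apply]
  have hBB : B * B = 0 := by
    ext1 f
    rw [mul_apply_eq_comp]
    refine Lp.ext ?_
    filter_upwards [hB (B f), Lp.coeFn_zero ℂ 2 (arcLength δ b)] with x h1 h2
    rw [h1, _root_.zero_apply, h2, Pi.zero_apply]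
    refine integral_eq_zero_of_ae ?_
    filter_upwards [ae_vline_of_ae (hB f)] with r hr
    rw [hr, integral_vline_eq_zero hδ hb, mul_zero, Pi.zero_apply]
  have hmem : ∀ f : Lp ℂ 2 (arcLength δ b), MemLp (fun r => f (vline b r)) 2 := fun f =>
    (memLp_map_measure_iff ((Lp.stronglyMeasurable f).aestronglyMeasurable)
      (continuous_vline b).measurable.aemeasurable).1
      ((Lp.memLp f).mono_measure (map_vline_le δ b))
  have hAB : ∀ f : Lp ℂ 2 (arcLength δ b),
      (A * B) f =ᵐ[arcLength δ b] lineSeries α b a (lineFunctional α b f) := fun f => by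
    rw [mul_apply_eq_comp]
    filter_upwards [hA (B f)] with x h1
    rw [h1, ← integral_hook_integral_vline hα hδ hb a (hmem f)]
    refine integral_congr_ae ?_
    filter_upwards [ae_hook_of_ae hδ (hB f)] with r hr
    rw [hr]
  have hcol := (lineBound_critSym (c := b + 1) hα (by linarith)).colBound
    (summable_norm_critW hα.le) (ofReal_mem_halfStrip ha)
  have hdet : infDet (Mmat (b + 1) (critSym α) (critW α) a) ≠ 0 := critDet_ne_zero hα hb0 ha
  -- `(A B) f` depends on `f` only through `L(f)`, and `L((A B) f) = M L(f)`. So the kernel of `1 - A B`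
  -- is that of `1 - M`, and `f = g + U` solves `(1 - A B) f = g` if `U` is the series with `v = L(f)`.
  have hunit : IsUnit (1 - A * B) := by
    rw [ContinuousLinearMap.isUnit_iff_bijective]
    constructor
    · rw [injective_iff_map_eq_zero]
      intro f hf
      have hf' : f = (A * B) f := by
        rw [_root_.sub_apply, one_apply_eq_self, sub_eq_zero] at hf
        exact hf
      have hfe : f =ᵐ[arcLength δ b] lineSeries α b a (lineFunctional α b f) := by
        have := hAB f
        rwa [← hf'] at this
      obtain ⟨R, hR0, hR⟩ := exists_norm_lineFunctional_le hα hb0 (hmem f)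
      have hbd : ∀ k, ‖lineFunctional α b f k‖ ≤ R := fun k => (hR k).trans (by
        refine mul_le_of_le_one_right hR0 ?_
        rw [div_le_one (by positivity)]
        linarith [(Nat.cast_nonneg k : (0 : ℝ) ≤ k)])
      have hzero := hcol.eq_zero_of_eq hdet hbd fun k => by
        rw [← lineFunctional_lineSeries hα ha hb0 hbd]
        exact lineFunctional_congr (ae_vline_of_ae hfe) k
      refine Lp.ext ?_
      filter_upwards [hfe, Lp.coeFn_zero ℂ 2 (arcLength δ b)] with x h1 h2
      rw [h1, h2, Pi.zero_apply, lineSeries]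
      simp [hzero]
    · intro g
      obtain ⟨R, hR0, hR⟩ := exists_norm_lineFunctional_le hα hb0 (hmem g)
      obtain ⟨⟨C, hC⟩, hv⟩ := hcol.exists_solution hdet hR0 hR
      set v : ℕ → ℂ := fun k => infDet (replaceCol (Mmat (b + 1) (critSym α) (critW α) a)
        (lineFunctional α b g) k) / infDet (Mmat (b + 1) (critSym α) (critW α) a)
      have hU := memLp_lineSeries hα ha.le hδ hb hC (v := v)
      have hUv := hU.coeFn_toLp
      set U := hU.toLp (lineSeries α b a v)
      have hL : lineFunctional α b (g + U : Lp ℂ 2 (arcLength δ b)) = v := by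
        ext k
        refine Eq.trans ?_ (hv k).symm
        rw [lineFunctional_congr (g := fun x => g x + U x)
          (ae_vline_of_ae (Lp.coeFn_add g U)), lineFunctional_add hα hb0 (hmem g) (hmem U),
          lineFunctional_congr (ae_vline_of_ae hUv), lineFunctional_lineSeries hα ha hb0 hC]
      refine ⟨g + U, ?_⟩
      rw [_root_.sub_apply, one_apply_eq_self]
      have : (A * B) (g + U) = U := by
        refine Lp.ext ?_
        filter_upwards [hAB (g + U), hUv] with x h1 h2
        rw [h1, hL, h2]
      rw [this, add_sub_cancel_right]
  refine ⟨A + B, fun f => ?_, ?_⟩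
  · filter_upwards [hA f, hB f, Lp.coeFn_add (A f) (B f)] with x h1 h2 h3
    rw [_root_.add_apply, h3, Pi.add_apply, h1, h2]
    unfold contourInt
    congr 1
    · exact integral_congr_ae (Eventually.of_forall fun r => mul_right_comm _ _ _)
    · exact integral_congr_ae (Eventually.of_forall fun r => mul_right_comm _ _ _)
  · have hfac : 1 - (A + B) = (1 - A) * (1 - A * B) * (1 - B) := by
      have h1 : (1 - A) * (1 - A * B) = 1 - A - A * B := by
        have : A * (A * B) = 0 := by rw [← mul_assoc, hAA, zero_mul]
        rw [sub_mul, one_mul, mul_sub, mul_one, this, sub_zero]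
        abel
      have h2 : A * B * B = 0 := by rw [mul_assoc, hBB, mul_zero]
      rw [h1, mul_sub, mul_one, sub_mul, sub_mul, one_mul, h2]
      abel
    rw [hfac]
    refine ((IsNilpotent.isUnit_one_sub ⟨2, ?_⟩).mul hunit).mul (IsNilpotent.isUnit_one_sub ⟨2, ?_⟩)
    · rw [pow_two, hAA]
    · rw [pow_two, hBB]

end qOperator


/-! ### Removing the contours: uniqueness for the Riemann–Hilbert problem -/

section morera

/-- A continuous function that is holomorphic off a vertical line is holomorphic: by Morera's
theorem it suffices to split a rectangle along the line. -/
theorem differentiableOn_of_off_vertical {f : ℂ → ℂ} {U : Set ℂ} (hU : IsOpen U) {c : ℝ}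
    (hc : ContinuousOn f U) (hd : ∀ z ∈ U, z.re ≠ c → DifferentiableAt ℂ f z) :
    DifferentiableOn ℂ f U := by
  refine (Complex.isConservativeOn_and_continuousOn_iff_isDifferentiableOn hU).1 ⟨?_, hc⟩
  intro z w hzw
  rw [← add_eq_zero_iff_eq_neg, Complex.wedgeIntegral_add_wedgeIntegral_eq]
  have hrect : ∀ x ∈ uIcc z.re w.re, ∀ y ∈ uIcc z.im w.im, (x + y * Complex.I : ℂ) ∈ U :=
    fun x hx y hy => hzw ⟨by simpa using hx, by simpa using hy⟩
  have hsub : ∀ z' w' : ℂ, z'.re ∈ uIcc z.re w.re → w'.re ∈ uIcc z.re w.re → z'.im = z.im →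
      w'.im = w.im → c ∉ Ioo (min z'.re w'.re) (max z'.re w'.re) →
      (∫ x : ℝ in z'.re..w'.re, f (x + z'.im * Complex.I)) -
      (∫ x : ℝ in z'.re..w'.re, f (x + w'.im * Complex.I)) +
      Complex.I • (∫ y : ℝ in z'.im..w'.im, f (w'.re + y * Complex.I)) -
      Complex.I • (∫ y : ℝ in z'.im..w'.im, f (z'.re + y * Complex.I)) = 0 := by
    intro z' w' h1 h2 h3 h4 h5
    have hmem : ∀ x : ℂ, x.re ∈ uIcc z'.re w'.re → x.im ∈ uIcc z'.im w'.im → x ∈ U := by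
      intro x hx hy
      rw [h3, h4] at hy
      have := hrect x.re (uIcc_subset_uIcc h1 h2 hx) x.im hy
      rwa [Complex.re_add_im] at this
    refine Complex.integral_boundary_rect_eq_zero_of_continuousOn_of_differentiableOn f z' w'
      (hc.mono fun x hx => hmem x hx.1 hx.2) fun x hx => ?_
    refine (hd x (hmem x (Ioo_subset_Icc_self hx.1) (Ioo_subset_Icc_self hx.2))
      fun h => h5 ?_).differentiableWithinAt
    rw [← h]; exact hx.1
  by_cases hcm : c ∈ uIcc z.re w.re
  swap
  · exact hsub z w left_mem_uIcc right_mem_uIcc rfl rfl fun h => hcm (Ioo_subset_Icc_self h)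
  have h1 := hsub z ⟨c, w.im⟩ left_mem_uIcc hcm rfl rfl (by
    intro h
    rcases le_total z.re c with h' | h'
    · simp [h'] at h
    · simp [h'] at h)
  have h2 := hsub ⟨c, z.im⟩ w hcm right_mem_uIcc rfl rfl (by
    intro h
    rcases le_total c w.re with h' | h'
    · simp [h'] at h
    · simp [h'] at h)
  have hii : ∀ y ∈ uIcc z.im w.im, ∀ p ∈ uIcc z.re w.re, ∀ q ∈ uIcc z.re w.re,
      IntervalIntegrable (fun x : ℝ => f (x + y * Complex.I)) volume p q := by
    intro y hy p hp q hq
    refine ContinuousOn.intervalIntegrable (hc.comp (by fun_prop) fun x hx => ?_)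
    exact hrect x (uIcc_subset_uIcc hp hq hx) y hy
  have e1 := intervalIntegral.integral_add_adjacent_intervals
    (hii z.im left_mem_uIcc z.re left_mem_uIcc c hcm)
    (hii z.im left_mem_uIcc c hcm w.re right_mem_uIcc)
  have e2 := intervalIntegral.integral_add_adjacent_intervals
    (hii w.im right_mem_uIcc z.re left_mem_uIcc c hcm)
    (hii w.im right_mem_uIcc c hcm w.re right_mem_uIcc)
  simp only at h1 h2
  rw [← e1, ← e2]
  linear_combination h1 + h2

/-- The same for a curve that a holomorphic chart `χ`, with inverse `ψ`, maps to a vertical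
line. -/
theorem differentiableAt_of_off_curve {f χ ψ : ℂ → ℂ} {z₀ : ℂ} {c : ℝ}
    (hχ : DifferentiableAt ℂ χ z₀) (hψ : Differentiable ℂ ψ)
    (hinv : ∀ᶠ z in 𝓝 z₀, ψ (χ z) = z) (hinv' : ∀ᶠ w in 𝓝 (χ z₀), χ (ψ w) = w)
    (hf : Continuous f)
    (hd : ∀ᶠ z in 𝓝 z₀, (χ z).re ≠ c → DifferentiableAt ℂ f z) : DifferentiableAt ℂ f z₀ := by
  have hψ0 : ψ (χ z₀) = z₀ := hinv.self_of_nhds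
  have hd' : ∀ᶠ w in 𝓝 (χ z₀), (χ (ψ w)).re ≠ c → DifferentiableAt ℂ f (ψ w) := by
    have : Tendsto ψ (𝓝 (χ z₀)) (𝓝 z₀) := by
      have := (hψ (χ z₀)).continuousAt.tendsto
      rwa [hψ0] at this
    exact this.eventually hd
  obtain ⟨U, hU, hUo, hzU⟩ := eventually_nhds_iff.1 (hd'.and hinv')
  have hG : DifferentiableOn ℂ (f ∘ ψ) U := by
    refine differentiableOn_of_off_vertical hUo (c := c) (hf.comp hψ.continuous).continuousOn
      fun w hw hwc => ?_
    obtain ⟨h1, h2⟩ := hU w hw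
    exact (h1 (by rwa [h2])).comp w (hψ w)
  have h3 : DifferentiableAt ℂ ((f ∘ ψ) ∘ χ) z₀ :=
    (hG.differentiableAt (hUo.mem_nhds hzU)).comp z₀ hχ
  refine h3.congr_of_eventuallyEq ?_
  filter_upwards [hinv] with z hz
  rw [Function.comp_apply, Function.comp_apply, hz]

variable {δ b : ℝ}

theorem isOpen_inner (δ : ℝ) : IsOpen (inner δ) :=
  (isOpen_lt continuous_norm continuous_const).union
    ((isOpen_lt Complex.continuous_re continuous_const).inter
      (isOpen_lt (continuous_abs.comp Complex.continuous_im) continuous_const))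

theorem isOpen_outer (b : ℝ) : IsOpen (outer b) :=
  isOpen_lt continuous_const Complex.continuous_re

theorem inner_union_range_hook (hδ : 0 < δ) :
    inner δ ∪ range (hook δ) = {z | ‖z‖ ≤ δ} ∪ {z | z.re ≤ 0 ∧ |z.im| ≤ δ} := by
  rw [range_hook hδ]
  ext z
  simp only [inner, mem_union, mem_ofPred_eq]
  constructor
  · rintro ((h | h) | (h | h))
    · exact Or.inl h.le
    · exact Or.inr ⟨h.1.le, h.2.le⟩
    · exact Or.inl h.2.le
    · exact Or.inr ⟨h.1, h.2.le⟩
  · have key : z.re ≤ 0 → |z.im| ≤ δ →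
        (‖z‖ < δ ∨ z.re < 0 ∧ |z.im| < δ) ∨ (0 < z.re ∧ ‖z‖ = δ ∨ z.re ≤ 0 ∧ |z.im| = δ) := by
      intro h1 h2
      rcases h2.lt_or_eq with h2 | h2
      · rcases h1.lt_or_eq with h1 | h1
        · exact Or.inl (Or.inr ⟨h1, h2⟩)
        · refine Or.inl (Or.inl ?_)
          rwa [Complex.norm_def, Complex.normSq_apply, h1, mul_zero, zero_add,
            Real.sqrt_mul_self_eq_abs]
      · exact Or.inr (Or.inr ⟨h1, h2⟩)
    rintro (h | h)
    · rcases h.lt_or_eq with h0 | h0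
      · exact Or.inl (Or.inl h0)
      · rcases lt_or_ge 0 z.re with h1 | h1
        · exact Or.inr (Or.inl ⟨h1, h0⟩)
        · exact key h1 ((Complex.abs_im_le_norm z).trans h)
    · exact key h.1 h.2

theorem isClosed_inner_union_range_hook (hδ : 0 < δ) : IsClosed (inner δ ∪ range (hook δ)) := by
  rw [inner_union_range_hook hδ]
  exact (isClosed_le continuous_norm continuous_const).union
    ((isClosed_le Complex.continuous_re continuous_const).inter
      (isClosed_le (continuous_abs.comp Complex.continuous_im) continuous_const))

theorem re_lt_of_mem_inner (hδ : 0 < δ) {z : ℂ} (hz : z ∈ inner δ) : z.re < δ := by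
  rcases hz with h | h
  · exact (Complex.re_le_norm z).trans_lt h
  · exact h.1.trans hδ

theorem abs_im_lt_of_mem_inner {z : ℂ} (hz : z ∈ inner δ) : |z.im| < δ := by
  rcases hz with h | h
  · exact (Complex.abs_im_le_norm z).trans_lt h
  · exact h.2

theorem isOpen_middle (hδ : 0 < δ) (b : ℝ) : IsOpen (middle δ b) := by
  have : middle δ b = {z | z.re < b} ∩ (inner δ ∪ range (hook δ))ᶜ := by
    ext z; simp [middle]
  rw [this]
  exact (isOpen_lt Complex.continuous_re continuous_const).inter
    (isClosed_inner_union_range_hook hδ).isOpen_compl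

theorem isClosed_contours (hδ : 0 < δ) (b : ℝ) : IsClosed (contours δ b) :=
  (isClosed_range_hook hδ).union (isClosed_range_vline b)

theorem compl_contours_subset (δ b : ℝ) :
    (contours δ b)ᶜ ⊆ inner δ ∪ middle δ b ∪ outer b := by
  intro z hz
  rw [contours, range_vline] at hz
  have h1 : z ∉ range (hook δ) := fun h => hz (Or.inl h)
  have h2 : z.re ≠ b := fun h => hz (Or.inr h)
  rcases lt_or_gt_of_ne h2 with h | h
  · by_cases hi : z ∈ inner δ
    · exact Or.inl (Or.inl hi)
    · exact Or.inl (Or.inr ⟨h, hi, h1⟩)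
  · exact Or.inr h

theorem outer_subset_compl (hδ : 0 < δ) (hb : δ < b) : outer b ⊆ (contours δ b)ᶜ := by
  rintro z hz (⟨r, rfl⟩ | h)
  · exact absurd (hook_re_le hδ r) (not_le.2 (hb.trans hz))
  · rw [range_vline] at h
    exact absurd h (ne_of_gt hz)

theorem nhdsWithin_compl_hook_le (hδ : 0 < δ) (hb : δ < b) {z : ℂ} (hz : z ∈ range (hook δ)) :
    𝓝[(contours δ b)ᶜ] z ≤ 𝓝[inner δ] z ⊔ 𝓝[middle δ b] z := by
  have h1 : 𝓝[outer b] z = ⊥ := by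
    rw [← notMem_closure_iff_nhdsWithin_eq_bot]
    intro h
    have h2 : closure (outer b) ⊆ {w | b ≤ w.re} := closure_minimal (fun w hw => (le_of_lt hw : b ≤ w.re))
      (isClosed_le continuous_const Complex.continuous_re)
    obtain ⟨r, rfl⟩ := hz
    exact absurd (h2 h) (not_le.2 ((hook_re_le hδ r).trans_lt hb))
  refine (nhdsWithin_mono z (compl_contours_subset δ b)).trans ?_
  rw [nhdsWithin_union, nhdsWithin_union, h1, sup_bot_eq]

theorem nhdsWithin_compl_vline_le (hδ : 0 < δ) (hb : δ < b) {z : ℂ} (hz : z ∈ range (vline b)) :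
    𝓝[(contours δ b)ᶜ] z ≤ 𝓝[middle δ b] z ⊔ 𝓝[outer b] z := by
  have h1 : 𝓝[inner δ] z = ⊥ := by
    rw [← notMem_closure_iff_nhdsWithin_eq_bot]
    intro h
    have h2 : closure (inner δ) ⊆ {w | w.re ≤ δ} :=
      closure_minimal (fun w hw => (re_lt_of_mem_inner hδ hw).le)
      (isClosed_le Complex.continuous_re continuous_const)
    rw [range_vline] at hz
    have h3 : z.re ≤ δ := h2 h
    have h4 : z.re = b := hz
    linarith
  refine (nhdsWithin_mono z (compl_contours_subset δ b)).trans ?_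
  rw [nhdsWithin_union, nhdsWithin_union, h1, bot_sup_eq]

theorem dense_compl_contours (hδ : 0 < δ) (hb : δ < b) : Dense (contours δ b)ᶜ := by
  intro z
  by_cases hz : z ∈ contours δ b
  swap
  · exact subset_closure hz
  rcases hz with hz | hz
  · -- push a point of `γ` outwards along the ray from the origin
    have ht : Tendsto (fun t : ℝ => (((1 + t : ℝ) : ℂ)) * z) (𝓝[>] 0) (𝓝 z) := by
      have h : Tendsto (fun t : ℝ => (((1 + t : ℝ) : ℂ)) * z) (𝓝 0) (𝓝 (((1 + 0 : ℝ) : ℂ) * z)) :=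
        Continuous.tendsto (by fun_prop) 0
      simp only [add_zero, Complex.ofReal_one, one_mul] at h
      exact h.mono_left nhdsWithin_le_nhds
    have hzb : z.re < b := by
      obtain ⟨r, rfl⟩ := hz
      exact (hook_re_le hδ r).trans_lt hb
    refine mem_closure_of_tendsto ht ?_
    have hre := (Complex.continuous_re.tendsto z).comp ht
    filter_upwards [self_mem_nhdsWithin, hre.eventually (Iio_mem_nhds hzb)] with t ht0 htb
    have ht1 : (0 : ℝ) < t := ht0
    rintro (h | h)
    · rw [range_hook hδ] at hz h
      simp only [mem_ofPred_eq, Complex.re_ofReal_mul, Complex.im_ofReal_mul, norm_mul, abs_mul,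
        Complex.norm_real, Real.norm_eq_abs, abs_of_pos (by linarith : 0 < 1 + t)] at hz h
      rcases hz with hz | hz <;> rcases h with h | h
      · rw [hz.2] at h; nlinarith [h.2]
      · nlinarith [h.1, hz.1]
      · have : (1 + t) * z.re ≤ 0 := mul_nonpos_of_nonneg_of_nonpos (by linarith) hz.1
        linarith [h.1]
      · rw [hz.2] at h; nlinarith [h.2]
    · rw [range_vline] at h
      exact absurd h (ne_of_lt htb)
  · have ht : Tendsto (fun t : ℝ => z + (t : ℂ)) (𝓝[>] 0) (𝓝 z) := by
      have h : Tendsto (fun t : ℝ => z + (t : ℂ)) (𝓝 0) (𝓝 (z + ((0 : ℝ) : ℂ))) :=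
        Continuous.tendsto (by fun_prop) 0
      simp only [Complex.ofReal_zero, add_zero] at h
      exact h.mono_left nhdsWithin_le_nhds
    refine mem_closure_of_tendsto ht ?_
    filter_upwards [self_mem_nhdsWithin] with t ht0
    refine outer_subset_compl hδ hb ?_
    rw [range_vline] at hz
    have h1 : z.re = b := hz
    have h2 : (0 : ℝ) < t := ht0
    simp only [outer, mem_ofPred_eq, Complex.add_re, Complex.ofReal_re]
    linarith

/-- A function without jumps across the contours extends to an entire function, hence is constant
if it has a limit at infinity. -/
theorem eqOn_const_of_no_jump (hδ : 0 < δ) (hb : δ < b) {f : ℂ → ℂ} {L : ℂ}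
    (hf : AnalyticOnNhd ℂ f (contours δ b)ᶜ)
    (h1 : ∀ z ∈ range (hook δ), ∃ l, Tendsto f (𝓝[inner δ] z) (𝓝 l) ∧
      Tendsto f (𝓝[middle δ b] z) (𝓝 l))
    (h2 : ∀ z ∈ range (vline b), ∃ l, Tendsto f (𝓝[middle δ b] z) (𝓝 l) ∧
      Tendsto f (𝓝[outer b] z) (𝓝 l))
    (hL : Tendsto f (atInfinity δ b) (𝓝 L)) : ∀ z ∈ (contours δ b)ᶜ, f z = L := by
  set A := (contours δ b)ᶜ
  have hA : IsOpen A := (isClosed_contours hδ b).isOpen_compl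
  have hdense : Dense A := dense_compl_contours hδ hb
  have hlim : ∀ z, ∃ y, Tendsto f (𝓝[A] z) (𝓝 y) := by
    intro z
    by_cases hz : z ∈ A
    · exact ⟨f z, (hf z hz).continuousAt.continuousWithinAt⟩
    rcases not_not.1 hz with hz | hz
    · obtain ⟨l, ha, hb'⟩ := h1 z hz
      exact ⟨l, (ha.sup hb').mono_left (nhdsWithin_compl_hook_le hδ hb hz)⟩
    · obtain ⟨l, ha, hb'⟩ := h2 z hz
      exact ⟨l, (ha.sup hb').mono_left (nhdsWithin_compl_vline_le hδ hb hz)⟩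
  -- The extension `g` is continuous. It is holomorphic across the line, the arc and the rays by Morera's
  -- theorem, after a change of coordinates that makes them vertical, and at the two corners because
  -- isolated singularities of continuous functions are removable.
  set g := extendFrom A f
  have hg : Continuous g := continuous_extendFrom hdense hlim
  have hgf : ∀ z ∈ A, g z = f z := extendFrom_extends hf.continuousOn
  have hgA : ∀ z ∈ A, DifferentiableAt ℂ g z := fun z hz =>
    (hf z hz).differentiableAt.congr_of_eventuallyEq
      (by filter_upwards [hA.mem_nhds hz] with w hw using hgf w hw)
  have hvl : ∀ z ∈ range (vline b), DifferentiableAt ℂ g z := by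
    intro z hz
    rw [range_vline] at hz
    have hzb : z.re = b := hz
    refine differentiableAt_of_off_curve (χ := id) (ψ := id) (c := b) differentiableAt_id
      differentiable_id (Eventually.of_forall fun _ => rfl) (Eventually.of_forall fun _ => rfl) hg ?_
    filter_upwards [(isOpen_lt continuous_const Complex.continuous_re).mem_nhds
      (show δ < z.re by rw [hzb]; exact hb)] with w hw hwb
    refine hgA w ?_
    rintro (⟨r, rfl⟩ | h)
    · exact absurd (hook_re_le hδ r) (not_le.2 hw)
    · rw [range_vline] at h; exact hwb h
  have hnvl : ∀ {w : ℂ}, w.re < b → w ∉ range (hook δ) → w ∈ A := by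
    rintro w hw hw' (h | h)
    · exact hw' h
    · rw [range_vline] at h; exact absurd h hw.ne
  have harc : ∀ z : ℂ, 0 < z.re → ‖z‖ = δ → DifferentiableAt ℂ g z := by
    intro z hz hzn
    have hs : z ∈ Complex.slitPlane := Or.inl hz
    have hz0 : z ≠ 0 := Complex.slitPlane_ne_zero hs
    refine differentiableAt_of_off_curve (χ := Complex.log) (ψ := Complex.exp) (c := Real.log δ)
      (Complex.differentiableAt_log hs) Complex.differentiable_exp ?_ ?_ hg ?_
    · filter_upwards [isOpen_ne.mem_nhds hz0] with w hw using Complex.exp_log hw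
    · have him : (Complex.log z).im ∈ Ioo (-Real.pi) Real.pi := by
        rw [Complex.log_im]
        exact ⟨Complex.neg_pi_lt_arg z, lt_of_le_of_ne (Complex.arg_le_pi z)
          (Complex.slitPlane_arg_ne_pi hs)⟩
      filter_upwards [Complex.continuous_im.continuousAt (isOpen_Ioo.mem_nhds him)] with w hw
      exact Complex.log_exp hw.1 hw.2.le
    · filter_upwards [(isOpen_lt continuous_const Complex.continuous_re).mem_nhds hz,
        (isOpen_lt Complex.continuous_re continuous_const).mem_nhds
          (show z.re < b from ((Complex.re_le_norm z).trans hzn.le).trans_lt hb)] with w hw hwb hwc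
      refine hgA w (hnvl hwb fun h => hwc ?_)
      have hw0 : 0 < w.re := hw
      rw [range_hook hδ] at h
      rw [Complex.log_re]
      rcases h with h | h
      · rw [h.2]
      · exact absurd h.1 (not_le.2 hw0)
  have hray : ∀ z : ℂ, z.re < 0 → |z.im| = δ → DifferentiableAt ℂ g z := by
    intro z hz hzi
    have hI : ∀ w : ℂ, -Complex.I * (Complex.I * w) = w := fun w => by
      rw [← mul_assoc, neg_mul, Complex.I_mul_I, neg_neg, one_mul]
    have hI' : ∀ w : ℂ, Complex.I * (-Complex.I * w) = w := fun w => by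
      rw [← mul_assoc, mul_neg, Complex.I_mul_I, neg_neg, one_mul]
    have hzi0 : z.im ≠ 0 := fun h => by rw [h, abs_zero] at hzi; exact hδ.ne hzi
    refine differentiableAt_of_off_curve (χ := fun w => Complex.I * w)
      (ψ := fun w => -Complex.I * w) (c := -z.im) (by fun_prop) (by fun_prop)
      (Eventually.of_forall hI) (Eventually.of_forall hI') hg ?_
    have hcont : ContinuousAt (fun w : ℂ => w.im * z.im) z := by fun_prop
    filter_upwards [(isOpen_lt Complex.continuous_re continuous_const).mem_nhds hz,
      hcont (Ioi_mem_nhds (show 0 < z.im * z.im from mul_self_pos.2 hzi0))] with w hw hwz hwc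
    have hw0 : w.re < 0 := hw
    have hwz' : 0 < w.im * z.im := hwz
    refine hgA w (hnvl (hw0.trans (hδ.trans hb)) fun h => hwc ?_)
    rw [range_hook hδ] at h
    rcases h with h | h
    · exact absurd h.1 (not_lt.2 hw0.le)
    · have h3 : |w.im| = |z.im| := h.2.trans hzi.symm
      rw [Complex.I_mul_re, neg_inj]
      rcases abs_eq_abs.1 h3 with h4 | h4
      · exact h4
      · rw [h4] at hwz'; nlinarith [mul_self_pos.2 hzi0]
  have hcorner : ∀ z : ℂ, z.re = 0 → |z.im| = δ → DifferentiableAt ℂ g z := by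
    intro z hz hzi
    have hzi0 : z.im ≠ 0 := fun h => by rw [h, abs_zero] at hzi; exact hδ.ne hzi
    refine (Complex.analyticAt_of_differentiable_on_punctured_nhds_of_continuousAt ?_
      hg.continuousAt).differentiableAt
    have hcont : ContinuousAt (fun w : ℂ => w.im * z.im) z := by fun_prop
    filter_upwards [self_mem_nhdsWithin, mem_nhdsWithin_of_mem_nhds
      (hcont (Ioi_mem_nhds (show 0 < z.im * z.im from mul_self_pos.2 hzi0))),
      mem_nhdsWithin_of_mem_nhds ((isOpen_lt Complex.continuous_re continuous_const).mem_nhds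
          (show z.re < b by rw [hz]; exact hδ.trans hb))] with w hwne hwz hwb
    have hwz' : 0 < w.im * z.im := hwz
    by_cases hw : w ∈ range (hook δ)
    swap
    · exact hgA w (hnvl hwb hw)
    rw [range_hook hδ] at hw
    rcases hw with h | h
    · exact harc w h.1 h.2
    rcases h.1.lt_or_eq with h3 | h3
    · exact hray w h3 h.2
    exfalso
    refine hwne (Complex.ext (h3.trans hz.symm) ?_)
    rcases abs_eq_abs.1 (h.2.trans hzi.symm) with h4 | h4
    · exact h4
    · rw [h4] at hwz'; nlinarith [mul_self_pos.2 hzi0]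
  have hdiff : Differentiable ℂ g := by
    intro z
    by_cases hz : z ∈ A
    · exact hgA z hz
    rcases not_not.1 hz with hz | hz
    · rw [range_hook hδ] at hz
      rcases hz with h | h
      · exact harc z h.1 h.2
      rcases h.1.lt_or_eq with h3 | h3
      · exact hray z h3 h.2
      · exact hcorner z h3 h.2
    · exact hvl z hz
  -- The complement of the contours is dense, so the limit at infinity holds for `g` without restriction.
  have hgL : Tendsto g (cocompact ℂ) (𝓝 L) := by
    rw [← Metric.cobounded_eq_cocompact]
    refine (closed_nhds_basis L).tendsto_right_iff.2 fun V hV => ?_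
    have := hL.eventually (Filter.eventually_mem_set.2 hV.1)
    rw [atInfinity, eventually_inf_principal] at this
    obtain ⟨R, -, hR⟩ := (Metric.hasBasis_cobounded_compl_closedBall (0 : ℂ)).eventually_iff.1 this
    refine (Metric.hasBasis_cobounded_compl_closedBall (0 : ℂ)).eventually_iff.2
      ⟨R, trivial, fun z hz => ?_⟩
    have hzc : z ∈ closure ((Metric.closedBall (0 : ℂ) R)ᶜ ∩ A) :=
      hdense.open_subset_closure_inter Metric.isClosed_closedBall.isOpen_compl hz
    have : (Metric.closedBall (0 : ℂ) R)ᶜ ∩ A ⊆ g ⁻¹' V := fun w hw => by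
      rw [mem_preimage, hgf w hw.2]
      exact hR hw.1 hw.2
    exact closure_minimal this (hV.2.preimage hg) hzc
  intro z hz
  rw [← hgf z hz]
  exact hdiff.apply_eq_of_tendsto_cocompact z hgL

theorem det_jumpMatrix (hδ : 0 < δ) (hb : δ < b) (α a : ℝ) (z : ℂ) :
    (jumpMatrix α δ b a z).det = 1 := by
  unfold jumpMatrix
  rw [Matrix.det_fin_two_of]
  by_cases hz : z ∈ range (vline b)
  · have : z ∉ range (hook δ) := by
      obtain ⟨r, rfl⟩ := hz
      exact vline_notMem_range_hook hδ hb r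
    rw [indicator_of_notMem this]
    ring
  · rw [indicator_of_notMem hz]
    ring

theorem IsSolution.det_eq_one {α a : ℝ} {Y : ℂ → Matrix (Fin 2) (Fin 2) ℂ} (hδ : 0 < δ)
    (hb : δ < b) (hY : IsSolution α δ b a Y) : ∀ z ∈ (contours δ b)ᶜ, (Y z).det = 1 := by
  have hdet : ∀ {l : Filter ℂ} {M : Matrix (Fin 2) (Fin 2) ℂ}, Tendsto Y l (𝓝 M) →
      Tendsto (fun z => (Y z).det) l (𝓝 M.det) := fun h =>
    ((continuous_id.matrix_det).tendsto _).comp h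
  refine eqOn_const_of_no_jump hδ hb ?_ ?_ ?_ ?_
  · simp only [Matrix.det_fin_two]
    exact ((hY.analytic 0 0).mul (hY.analytic 1 1)).sub ((hY.analytic 0 1).mul (hY.analytic 1 0))
  · intro z hz
    obtain ⟨Yp, Ym, h1, h2, h3⟩ := hY.jump_hook z hz
    refine ⟨Ym.det, ?_, hdet h2⟩
    have := hdet h1
    rwa [h3, Matrix.det_mul, det_jumpMatrix hδ hb, mul_one] at this
  · intro z hz
    obtain ⟨Yp, Ym, h1, h2, h3⟩ := hY.jump_vline z hz
    refine ⟨Ym.det, ?_, hdet h2⟩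
    have := hdet h1
    rwa [h3, Matrix.det_mul, det_jumpMatrix hδ hb, mul_one] at this
  · simpa using hdet hY.normalized

/-- Two solutions agree: `Y' * adjugate Y` has no jumps. -/
theorem IsSolution.eqOn {α a : ℝ} {Y Y' : ℂ → Matrix (Fin 2) (Fin 2) ℂ} (hδ : 0 < δ)
    (hb : δ < b) (hY : IsSolution α δ b a Y) (hY' : IsSolution α δ b a Y') :
    EqOn Y' Y (contours δ b)ᶜ := by
  have hmul : ∀ {l : Filter ℂ} {M M' : Matrix (Fin 2) (Fin 2) ℂ}, Tendsto Y l (𝓝 M) →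
      Tendsto Y' l (𝓝 M') → ∀ i j, Tendsto (fun z => (Y' z * (Y z).adjugate) i j) l
        (𝓝 ((M' * M.adjugate) i j)) := fun h h' i j => by
    have h1 := h'.mul (((continuous_id.matrix_adjugate).tendsto _).comp h)
    exact tendsto_pi_nhds.1 (tendsto_pi_nhds.1 h1 i) j
  have hjump : ∀ z (M M' : Matrix (Fin 2) (Fin 2) ℂ),
      (M' * jumpMatrix α δ b a z) * (M * jumpMatrix α δ b a z).adjugate = M' * M.adjugate := by
    intro z M M'
    rw [Matrix.adjugate_mul_distrib, mul_assoc, ← mul_assoc (jumpMatrix α δ b a z),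
      Matrix.mul_adjugate, det_jumpMatrix hδ hb, one_smul, one_mul]
  have hadj : ∀ k j, AnalyticOnNhd ℂ (fun z => (Y z).adjugate k j) (contours δ b)ᶜ := by
    intro k j
    simp only [Matrix.adjugate_fin_two]
    fin_cases k <;> fin_cases j
    · exact hY.analytic 1 1
    · exact (hY.analytic 0 1).neg
    · exact (hY.analytic 1 0).neg
    · exact hY.analytic 0 0
  have hone : ∀ i j, ∀ z ∈ (contours δ b)ᶜ,
      (Y' z * (Y z).adjugate) i j = (1 : Matrix (Fin 2) (Fin 2) ℂ) i j := by
    intro i j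
    refine eqOn_const_of_no_jump hδ hb ?_ ?_ ?_ ?_
    · simp only [Matrix.mul_apply, Fin.sum_univ_two]
      exact ((hY'.analytic i 0).mul (hadj 0 j)).add ((hY'.analytic i 1).mul (hadj 1 j))
    · intro z hz
      obtain ⟨Yp, Ym, h1, h2, h3⟩ := hY.jump_hook z hz
      obtain ⟨Yp', Ym', h1', h2', h3'⟩ := hY'.jump_hook z hz
      refine ⟨_, ?_, hmul h2 h2' i j⟩
      have := hmul h1 h1' i j
      rwa [h3, h3', hjump] at this
    · intro z hz
      obtain ⟨Yp, Ym, h1, h2, h3⟩ := hY.jump_vline z hz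
      obtain ⟨Yp', Ym', h1', h2', h3'⟩ := hY'.jump_vline z hz
      refine ⟨_, ?_, hmul h2 h2' i j⟩
      have := hmul h1 h1' i j
      rwa [h3, h3', hjump] at this
    · simpa using hmul hY.normalized hY'.normalized i j
  intro z hz
  have h1 : Y' z * (Y z).adjugate = 1 := by
    ext i j
    exact hone i j z hz
  have h2 : (Y z).adjugate * Y z = 1 := by
    rw [Matrix.adjugate_mul, hY.det_eq_one hδ hb z hz, one_smul]
  calc Y' z = Y' z * ((Y z).adjugate * Y z) := by rw [h2, mul_one]
    _ = Y z := by rw [← mul_assoc, h1, one_mul]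

end morera


/-! ### Expansions at infinity -/

section expansions

/-- The sum of simple poles `∑ c_k / (z + k)` at the non-positive integers. -/
def poleSum (c : ℕ → ℂ) (z : ℂ) : ℂ := ∑' k : ℕ, c k / (z + k)

variable {c : ℕ → ℂ} {B d : ℝ}

theorem norm_div_add_nat_le (hd : 0 < d) (hB : 0 ≤ B) (hc : ∀ k, ‖c k‖ ≤ 1 / k ! * B) {z : ℂ}
    (k : ℕ) (hz : d ≤ ‖z + k‖) : ‖c k / (z + k)‖ ≤ 1 / (k ! : ℝ) * (B * d⁻¹) := by
  rw [norm_div, div_eq_mul_inv, ← mul_assoc]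
  have := hc k
  gcongr

theorem summable_poleSum (hd : 0 < d) (hB : 0 ≤ B) (hc : ∀ k, ‖c k‖ ≤ 1 / k ! * B) {z : ℂ}
    (hz : ∀ k : ℕ, d ≤ ‖z + k‖) : Summable fun k : ℕ => c k / (z + k) :=
  Summable.of_norm_bounded (summable_inv_factorial.mul_right _)
    fun k => norm_div_add_nat_le hd hB hc k (hz k)

theorem norm_poleSum_le (hd : 0 < d) (hB : 0 ≤ B) (hc : ∀ k, ‖c k‖ ≤ 1 / k ! * B) {z : ℂ}
    (hz : ∀ k : ℕ, d ≤ ‖z + k‖) : ‖poleSum c z‖ ≤ ∑' k : ℕ, 1 / (k ! : ℝ) * (B * d⁻¹) :=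
  tsum_of_norm_bounded (summable_inv_factorial.mul_right _).hasSum
    fun k => norm_div_add_nat_le hd hB hc k (hz k)

theorem differentiableAt_poleSum (hB : 0 ≤ B) (hc : ∀ k, ‖c k‖ ≤ 1 / k ! * B) {z : ℂ}
    (hz : ∀ k : ℕ, z ≠ -k) : DifferentiableAt ℂ (poleSum c) z := by
  obtain ⟨d, hd, hz'⟩ := exists_le_norm_add_nat hz
  have hball : ∀ w ∈ Metric.ball z (d / 2), ∀ k : ℕ, d / 2 ≤ ‖w + k‖ := by
    intro w hw k
    have h1 := hz' k
    have h2 : ‖z + k‖ ≤ ‖w + k‖ + ‖w - z‖ := by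
      have := norm_sub_le (w + k) (w - z)
      rwa [show w + k - (w - z) = z + k by ring] at this
    have h3 : ‖w - z‖ < d / 2 := by rwa [Metric.mem_ball, dist_eq_norm] at hw
    linarith
  refine DifferentiableOn.differentiableAt (s := Metric.ball z (d / 2)) ?_
    (Metric.ball_mem_nhds z (by positivity))
  refine Complex.differentiableOn_tsum_of_summable_norm
    (summable_inv_factorial.mul_right (B * (d / 2)⁻¹)) (fun k w hw => ?_) Metric.isOpen_ball
    fun k w hw => norm_div_add_nat_le (by positivity) hB hc k (hball w hw k)
  have : w + k ≠ 0 := norm_pos_iff.1 ((half_pos hd).trans_le (hball w hw k))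
  exact DifferentiableAt.differentiableWithinAt (by fun_prop (disch := exact this))

theorem norm_inv_add_le (hd : 0 < d) {z w : ℂ} (hz : z ≠ 0) (h : d ≤ ‖z + w‖) :
    ‖(z + w)⁻¹‖ ≤ (1 + ‖w‖ / d) / ‖z‖ := by
  have h0 : z + w ≠ 0 := norm_pos_iff.1 (hd.trans_le h)
  have e : (z + w)⁻¹ = (1 - w * (z + w)⁻¹) / z := by field_simp; ring
  rw [e, norm_div]
  gcongr
  refine (norm_sub_le _ _).trans ?_
  rw [norm_one, norm_mul, norm_inv, ← div_eq_mul_inv]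
  gcongr

/-- The expansion of a sum of poles, uniformly away from the poles. -/
theorem exists_norm_poleSum_sub_le (hd : 0 < d) (hB : 0 ≤ B) (hc : ∀ k, ‖c k‖ ≤ 1 / k ! * B) :
    ∃ C, ∀ z : ℂ, z ≠ 0 → (∀ k : ℕ, d ≤ ‖z + k‖) →
      ‖poleSum c z - ((∑' k, c k) / z + (-∑' k : ℕ, k * c k) / z ^ 2)‖ ≤ C / ‖z‖ ^ 3 := by
  have hk : ∀ k : ℕ, (k : ℝ) ≤ 2 ^ k := fun k => by exact_mod_cast Nat.lt_two_pow_self.le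
  have h8 := (Real.summable_pow_div_factorial 8).mul_right (B * (1 + d⁻¹))
  have hs1 : Summable c := Summable.of_norm_bounded (summable_inv_factorial.mul_right _) hc
  have hs2 : Summable fun k : ℕ => (k : ℂ) * c k := by
    refine Summable.of_norm_bounded ((Real.summable_pow_div_factorial 2).mul_right B) fun k => ?_
    rw [norm_mul, Complex.norm_natCast]
    calc (k : ℝ) * ‖c k‖ ≤ 2 ^ k * (1 / k ! * B) :=
          mul_le_mul (hk k) (hc k) (norm_nonneg _) (by positivity)
      _ = _ := by ring
  refine ⟨∑' k : ℕ, 8 ^ k / (k ! : ℝ) * (B * (1 + d⁻¹)), fun z hz hzk => ?_⟩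
  have hs0 := summable_poleSum hd hB hc hzk
  rw [poleSum, ← tsum_div_const, ← tsum_neg, ← tsum_div_const,
    ← (hs1.div_const z).tsum_add (hs2.neg.div_const _),
    ← hs0.tsum_sub ((hs1.div_const z).add (hs2.neg.div_const _)), ← tsum_div_const]
  refine tsum_of_norm_bounded (h8.div_const _).hasSum fun k => ?_
  have hne : z + k ≠ 0 := norm_pos_iff.1 (hd.trans_le (hzk k))
  -- One factor `1 / z` is still hidden in `1 / (z + k)`; extracting it costs the factor `1 + k / d`.
  have e : c k / (z + k) - (c k / z + -(k * c k) / z ^ 2) =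
      c k * k ^ 2 * (z + k)⁻¹ / z ^ 2 := by field_simp; ring
  rw [e, norm_div, norm_mul, norm_mul, norm_pow, norm_pow, Complex.norm_natCast]
  have h1 := norm_inv_add_le hd hz (hzk k)
  rw [Complex.norm_natCast] at h1
  have h2 : (k : ℝ) ^ 2 * (1 + k / d) ≤ 8 ^ k * (1 + d⁻¹) := by
    have h3 : (k : ℝ) ^ 2 ≤ (2 ^ k) ^ 2 := pow_le_pow_left₀ (by positivity) (hk k) 2
    have h4 : (1 : ℝ) ≤ 2 ^ k := one_le_pow₀ (by norm_num)
    have h5 : (1 : ℝ) + k / d ≤ 2 ^ k * (1 + d⁻¹) := by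
      rw [mul_add, mul_one, div_eq_mul_inv]
      gcongr
      exact hk k
    calc (k : ℝ) ^ 2 * (1 + k / d) ≤ (2 ^ k) ^ 2 * (2 ^ k * (1 + d⁻¹)) :=
          mul_le_mul h3 h5 (by positivity) (by positivity)
      _ = (2 ^ 3) ^ k * (1 + d⁻¹) := by rw [← pow_mul, ← pow_mul, ← mul_assoc, ← pow_add]; ring_nf
      _ = _ := by norm_num
  have hz0 := norm_pos_iff.2 hz
  calc ‖c k‖ * (k : ℝ) ^ 2 * ‖(z + k)⁻¹‖ / ‖z‖ ^ 2
      ≤ (1 / k ! * B) * (k : ℝ) ^ 2 * ((1 + k / d) / ‖z‖) / ‖z‖ ^ 2 := by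
        have := hc k
        gcongr
    _ = (1 / k ! * B) * ((k : ℝ) ^ 2 * (1 + k / d)) / ‖z‖ ^ 3 := by field_simp
    _ ≤ (1 / k ! * B) * (8 ^ k * (1 + d⁻¹)) / ‖z‖ ^ 3 := by gcongr
    _ = _ := by ring

theorem GaussDecay.integrable_div_sub {c : ℝ} {F : ℂ → ℂ} (hF : GaussDecay c c F)
    (hFc : ContinuousOn F (vstrip c c)) {z : ℂ} (hd : 0 < d) (hz : d ≤ |c - z.re|) :
    Integrable fun τ => F (vline c τ) / (vline c τ - z) := by
  have hi := hF.integrable le_rfl le_rfl hFc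
  have hn : ∀ τ, d ≤ ‖vline c τ - z‖ := fun τ => hz.trans (by
    simpa using Complex.abs_re_le_norm (vline c τ - z))
  simp only [div_eq_mul_inv]
  refine hi.mul_bdd (c := d⁻¹) ?_ (Eventually.of_forall fun τ => ?_)
  · refine (Continuous.inv₀ ((continuous_vline c).sub continuous_const)
      fun τ => norm_pos_iff.1 (hd.trans_le (hn τ))).aestronglyMeasurable
  · rw [norm_inv]
    exact inv_anti₀ hd (hn τ)

/-- The expansion of a Cauchy transform, uniformly away from the line of integration. -/
theorem GaussDecay.exists_norm_cauchy_sub_le {c : ℝ} {F : ℂ → ℂ} (hF : GaussDecay c c F)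
    (hFc : ContinuousOn F (vstrip c c)) (hd : 0 < d) :
    ∃ C, ∀ z : ℂ, z ≠ 0 → d ≤ |c - z.re| →
      ‖lineInt c (fun w => F w / (w - z)) -
        (-lineInt c F / z + (-lineInt c fun w => F w * (w + 0)) / z ^ 2)‖ ≤ C / ‖z‖ ^ 3 := by
  have hF1 := hF.mul_id 0
  have hF2 := hF1.mul_id 0
  have hF3 := hF2.mul_id 0
  have hid : ContinuousOn (fun w : ℂ => w + 0) (vstrip c c) := by fun_prop
  have hi := hF.integrable le_rfl le_rfl hFc
  have hi1 := hF1.integrable le_rfl le_rfl (hFc.mul hid)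
  have hi2 := hF2.integrable le_rfl le_rfl ((hFc.mul hid).mul hid)
  have hi3 := hF3.integrable le_rfl le_rfl (((hFc.mul hid).mul hid).mul hid)
  refine ⟨∫ τ, (‖F (vline c τ) * (vline c τ + 0) * (vline c τ + 0)‖ +
    ‖F (vline c τ) * (vline c τ + 0) * (vline c τ + 0) * (vline c τ + 0)‖ * d⁻¹),
    fun z hz hzd => ?_⟩
  have h0 := hF.integrable_div_sub hFc hd hzd
  have e : lineInt c (fun w => F w / (w - z)) -
      (-lineInt c F / z + (-lineInt c fun w => F w * (w + 0)) / z ^ 2) =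
      (2 * Real.pi : ℂ)⁻¹ * ∫ τ, (F (vline c τ) / (vline c τ - z) + (F (vline c τ) / z +
        F (vline c τ) * (vline c τ + 0) / z ^ 2)) := by
    have h12 : Integrable fun τ => F (vline c τ) / z + F (vline c τ) * (vline c τ + 0) / z ^ 2 :=
      (hi.div_const _).add (hi1.div_const _)
    rw [integral_add h0 h12, integral_add (hi.div_const _) (hi1.div_const _), integral_div,
      integral_div]
    unfold lineInt
    ring
  have hπ : ‖(2 * Real.pi : ℂ)⁻¹‖ ≤ 1 := by
    rw [norm_inv, norm_mul, Complex.norm_ofNat, Complex.norm_real,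
      Real.norm_of_nonneg Real.pi_pos.le]
    exact inv_le_one_of_one_le₀ (by linarith [Real.two_le_pi])
  rw [e, norm_mul, ← integral_div]
  refine (mul_le_of_le_one_left (norm_nonneg _) hπ).trans ?_
  refine norm_integral_le_of_norm_le ((hi2.norm.add (hi3.norm.mul_const _)).div_const _)
    (Eventually.of_forall fun τ => ?_)
  set w := vline c τ with hw
  have hn : d ≤ ‖-z + w‖ := hzd.trans (by
    rw [show -z + w = w - z by ring]
    simpa [hw] using Complex.abs_re_le_norm (vline c τ - z))
  have h1 := norm_inv_add_le hd (neg_ne_zero.2 hz) hn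
  rw [norm_neg] at h1
  have hne : w - z ≠ 0 := by
    rw [show w - z = -z + w by ring]; exact norm_pos_iff.1 (hd.trans_le hn)
  have hz0 := norm_pos_iff.2 hz
  have e2 : F w / (w - z) + (F w / z + F w * (w + 0) / z ^ 2) =
      F w * w * w * (-z + w)⁻¹ / z ^ 2 := by
    rw [show -z + w = w - z by ring]; field_simp; ring
  rw [e2]
  simp only [add_zero, norm_div, norm_mul, norm_pow]
  calc ‖F w‖ * ‖w‖ * ‖w‖ * ‖(-z + w)⁻¹‖ / ‖z‖ ^ 2
      ≤ ‖F w‖ * ‖w‖ * ‖w‖ * ((1 + ‖w‖ / d) / ‖z‖) / ‖z‖ ^ 2 := by gcongr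
    _ = _ := by field_simp

/-- A series of difference quotients: the poles of `∑ (-1)^k U(z) / (k! (z + k))` are removed. -/
theorem differentiableOn_tsum_dslope {U : ℂ → ℂ} {x : ℝ} (hx : 0 < x)
    (hU : DifferentiableOn ℂ U {z | z.re < x}) (hB : ∀ k : ℕ, ‖U (-k)‖ ≤ B) :
    DifferentiableOn ℂ (fun z => ∑' k : ℕ, (-1) ^ k / (k ! : ℂ) * dslope U (-k) z)
      {z | z.re < x} := by
  have hopen : IsOpen {z : ℂ | z.re < x} := isOpen_lt Complex.continuous_re continuous_const
  have hds : ∀ k : ℕ, DifferentiableOn ℂ (dslope U (-k)) {z | z.re < x} := fun k => by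
    refine (Complex.differentiableOn_dslope (hopen.mem_nhds ?_)).2 hU
    have : (0 : ℝ) ≤ k := Nat.cast_nonneg k
    change ((-k : ℂ)).re < x
    simp only [Complex.neg_re, Complex.natCast_re]
    linarith
  intro z hz
  obtain ⟨r, hr, hball⟩ := Metric.nhds_basis_closedBall.mem_iff.1 (hopen.mem_nhds hz)
  have hcpt := isCompact_closedBall z r
  obtain ⟨D, hD⟩ := hcpt.exists_bound_of_continuousOn (hU.continuousOn.mono hball)
  choose E hE using fun k =>
    hcpt.exists_bound_of_continuousOn ((hds k).continuousOn.mono hball)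
  obtain ⟨N, hN⟩ := exists_nat_ge (‖z‖ + r + 1)
  have hzb : z ∈ Metric.closedBall z r := Metric.mem_closedBall_self hr.le
  have hD0 := (norm_nonneg _).trans (hD z hzb)
  have hB0 := (norm_nonneg _).trans (hB 0)
  have hE0 : ∀ k, 0 ≤ E k := fun k => (norm_nonneg _).trans (hE k z hzb)
  refine (DifferentiableOn.differentiableAt (s := Metric.ball z r) ?_
    (Metric.ball_mem_nhds z hr)).differentiableWithinAt
  refine Complex.differentiableOn_tsum_of_summable_norm
    (summable_inv_factorial.mul_right (∑ k ∈ Finset.range N, E k + (D + B)))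
    (fun k => ((hds k).mono (Metric.ball_subset_closedBall.trans hball)).const_mul _)
    Metric.isOpen_ball fun k w hw => ?_
  have hw' := Metric.ball_subset_closedBall hw
  rw [norm_mul, norm_div, norm_pow, norm_neg, norm_one, one_pow, Complex.norm_natCast]
  refine mul_le_mul_of_nonneg_left ?_ (by positivity)
  have hS : 0 ≤ ∑ k ∈ Finset.range N, E k := Finset.sum_nonneg fun k _ => hE0 k
  -- The finitely many terms with a pole near the disc are bounded by compactness, the others by
  -- `|U(w) - U(-k)| / |w + k|` with denominator at least one.
  rcases lt_or_ge k N with hk | hk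
  · have := Finset.single_le_sum (fun k _ => hE0 k) (Finset.mem_range.2 hk)
    have := hE k w hw'
    linarith
  · have h1 : 1 ≤ ‖w - -(k : ℂ)‖ := by
      have h2 : ‖(k : ℂ)‖ ≤ ‖w - -(k : ℂ)‖ + ‖w‖ := by
        have := norm_sub_le (w - -(k : ℂ)) w
        rwa [show w - -(k : ℂ) - w = k by ring] at this
      have h3 : ‖w‖ ≤ ‖w - z‖ + ‖z‖ := by simpa using norm_add_le (w - z) z
      rw [Complex.norm_natCast] at h2
      rw [Metric.mem_closedBall, dist_eq_norm] at hw'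
      have : (N : ℝ) ≤ k := by exact_mod_cast hk
      linarith
    have hne : w ≠ -(k : ℂ) := fun h => by rw [h] at h1; simp at h1; linarith
    rw [dslope_of_ne _ hne, slope_def_field, norm_div]
    have h4 : ‖U w - U (-k)‖ ≤ D + B := (norm_sub_le _ _).trans (add_le_add (hD w hw') (hB k))
    have := (div_le_self (norm_nonneg (U w - U (-k))) h1).trans h4
    linarith

end expansions


/-! ### The rows of the solution of the Riemann–Hilbert problem -/

section rows

variable {α δ b a c d l u : ℝ} {e₁ e₂ : ℂ} {v : ℕ → ℂ} {B : ℝ}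

/-- The first entry of a row to the right of `γ`: the constant `e₁` plus the poles with residues
`ξ_k v_k`. -/
def rowS (α a : ℝ) (e₁ : ℂ) (v : ℕ → ℂ) (z : ℂ) : ℂ :=
  e₁ + poleSum (fun k => critCoeff α a k * v k) z

/-- The jump of the second entry of a row across `γ̃`. -/
def rowF (α a : ℝ) (e₁ : ℂ) (v : ℕ → ℂ) (w : ℂ) : ℂ :=
  rowS α a e₁ v w * (critSym α w * Complex.exp (-a * w))

/-- The second entry of a row: `e₂` plus the Cauchy transform over the line `Re w = c` of the jump.
Moving the line continues the entry analytically across `γ̃`. -/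
def rowT (α a : ℝ) (e₁ e₂ : ℂ) (v : ℕ → ℂ) (c : ℝ) (z : ℂ) : ℂ :=
  e₂ + lineInt c fun w => rowF α a e₁ v w / (w - z)

/-- The entry `rowT` times the exponential factor of the jump across `γ`. -/
def rowU (α b a : ℝ) (e₁ e₂ : ℂ) (v : ℕ → ℂ) (z : ℂ) : ℂ :=
  Complex.exp (a * z - (α / 2 : ℝ) * z ^ 2) * rowT α a e₁ e₂ v (b + 1) z

/-- The first entry of a row to the left of `γ`: this is `rowS - Γ * rowU`, written with the
Mittag-Leffler expansion of `Γ` so that the poles are visibly absent. -/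
def rowE (α b a : ℝ) (e₁ e₂ : ℂ) (v : ℕ → ℂ) (z : ℂ) : ℂ :=
  e₁ - ∑' k : ℕ, (-1) ^ k / (k ! : ℂ) * dslope (rowU α b a e₁ e₂ v) (-k) z -
    gammaTail z * rowU α b a e₁ e₂ v z

/-- The sequence `v` consists of the values of `rowT` at the poles of the Gamma function. This
linear system makes the poles of `rowS - Γ * rowU` cancel. -/
structure IsRow (α b a : ℝ) (e₁ e₂ : ℂ) (v : ℕ → ℂ) (B : ℝ) : Prop where
  bound : ∀ k, ‖v k‖ ≤ B
  eq : ∀ k : ℕ, v k = rowT α a e₁ e₂ v (b + 1) (-k)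

theorem norm_critCoeff_mul_le (hα : 0 ≤ α) (ha : 0 ≤ a) (hv : ∀ k, ‖v k‖ ≤ B) (k : ℕ) :
    ‖critCoeff α a k * v k‖ ≤ 1 / k ! * B := by
  rw [norm_mul]
  exact mul_le_mul (norm_critCoeff_le hα ha k) (hv k) (norm_nonneg _) (by positivity)

theorem ne_neg_natCast_of_re_pos {z : ℂ} (hz : 0 < z.re) (k : ℕ) : z ≠ -k := fun h => by
  rw [h] at hz
  simp only [Complex.neg_re, Complex.natCast_re] at hz
  have : (0 : ℝ) ≤ k := Nat.cast_nonneg k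
  linarith

theorem differentiableAt_rowS (hα : 0 ≤ α) (ha : 0 ≤ a) (hv : ∀ k, ‖v k‖ ≤ B) (e₁ : ℂ) {z : ℂ}
    (hz : ∀ k : ℕ, z ≠ -k) : DifferentiableAt ℂ (rowS α a e₁ v) z :=
  (differentiableAt_poleSum ((norm_nonneg _).trans (hv 0))
    (norm_critCoeff_mul_le hα ha hv) hz).const_add e₁

theorem differentiableOn_rowF (hα : 0 ≤ α) (ha : 0 ≤ a) (hv : ∀ k, ‖v k‖ ≤ B) (e₁ : ℂ)
    (hl : 0 < l) : DifferentiableOn ℂ (rowF α a e₁ v) (vstrip l u) := fun z hz =>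
  ((differentiableAt_rowS hα ha hv e₁
    (ne_neg_natCast_of_re_pos (hl.trans_le hz.1))).mul
      ((differentiable_critSym α z).mul (by fun_prop))).differentiableWithinAt

theorem gaussDecay_rowF (hα : 0 < α) (ha : 0 ≤ a) (hv : ∀ k, ‖v k‖ ≤ B) (e₁ : ℂ)
    (hl : 0 < l) (u : ℝ) : GaussDecay l u (rowF α a e₁ v) := by
  refine (((gaussDecay_critSym hα hl u).mul_exp a).mul_bounded (G := rowS α a e₁ v)
    (A := ‖e₁‖ + ∑' k : ℕ, 1 / (k ! : ℝ) * (B * l⁻¹)) fun z hz => ?_).congr fun z _ => mul_comm _ _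
  refine (norm_add_le _ _).trans (add_le_add_right ?_ _)
  refine norm_poleSum_le hl ((norm_nonneg _).trans (hv 0)) (norm_critCoeff_mul_le hα.le ha hv)
    fun k => ?_
  have := Complex.re_le_norm (z + k)
  simp only [Complex.add_re, Complex.natCast_re] at this
  have : (0 : ℝ) ≤ k := Nat.cast_nonneg k
  linarith [hz.1]

theorem differentiableAt_rowT (hα : 0 < α) (ha : 0 ≤ a) (hv : ∀ k, ‖v k‖ ≤ B) (e₁ e₂ : ℂ)
    (hc : 0 < c) {z : ℂ} (hz : z.re ≠ c) : DifferentiableAt ℂ (rowT α a e₁ e₂ v c) z :=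
  ((differentiableAt_cauchy_line ((gaussDecay_rowF hα ha hv e₁ hc c).integrable le_rfl le_rfl
    (differentiableOn_rowF hα.le ha hv e₁ hc).continuousOn) hz).const_mul _).const_add e₂

theorem exists_norm_rowT_le (hα : 0 < α) (ha : 0 ≤ a) (hv : ∀ k, ‖v k‖ ≤ B) (e₁ e₂ : ℂ)
    (hc : 0 < c) (hd : 0 < d) :
    ∃ C, ∀ z : ℂ, z.re ≤ c - d → ‖rowT α a e₁ e₂ v c z‖ ≤ C := by
  obtain ⟨κ, hκ, C, hC0, hC⟩ := (gaussDecay_rowF hα ha hv e₁ hc c).bound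
  refine ⟨‖e₂‖ + C * d⁻¹ * √(Real.pi / κ), fun z hz => (norm_add_le _ _).trans
    (add_le_add_right (norm_lineInt_le hκ fun τ => ?_) _)⟩
  have h1 := hC _ (vline_mem_vstrip le_rfl le_rfl τ)
  rw [vline_im] at h1
  have h2 : d ≤ ‖vline c τ - z‖ := by
    have := norm_sub_ge_of_re (s := vline c τ) (z := z)
    rw [vline_re] at this
    linarith
  rw [norm_div, div_eq_mul_inv, mul_right_comm]
  gcongr

/-- The jump of the second entry across `γ̃`. -/
theorem rowT_eq_add (hα : 0 < α) (ha : 0 ≤ a) (hv : ∀ k, ‖v k‖ ≤ B) (e₁ e₂ : ℂ)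
    (hl : 0 < l) {z : ℂ} (h1 : l < z.re) (h2 : z.re < u) :
    rowT α a e₁ e₂ v u z = rowT α a e₁ e₂ v l z + rowF α a e₁ v z := by
  have := lineInt_sub_lineInt_div (differentiableOn_rowF hα.le ha hv e₁ hl)
    (gaussDecay_rowF hα ha hv e₁ hl u) h1 h2
  rw [← this, rowT, rowT]
  ring

theorem differentiableOn_rowU (hα : 0 < α) (ha : 0 ≤ a) (hv : ∀ k, ‖v k‖ ≤ B) (e₁ e₂ : ℂ)
    (hb : 0 < b) : DifferentiableOn ℂ (rowU α b a e₁ e₂ v) {z | z.re < b + 1} := fun z hz =>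
  (DifferentiableAt.mul (by fun_prop) (differentiableAt_rowT hα ha hv e₁ e₂ (by positivity)
    (ne_of_lt hz))).differentiableWithinAt

theorem IsRow.rowU_neg (h : IsRow α b a e₁ e₂ v B) (k : ℕ) :
    rowU α b a e₁ e₂ v (-k) = Complex.exp (-(α / 2 * (k : ℂ) ^ 2)) * Complex.exp (-a * k) * v k := by
  rw [h.eq k, rowU, ← Complex.exp_add]
  congr 2
  push_cast
  ring

theorem IsRow.norm_rowU_neg_le (hα : 0 ≤ α) (ha : 0 ≤ a) (h : IsRow α b a e₁ e₂ v B) (k : ℕ) :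
    ‖rowU α b a e₁ e₂ v (-k)‖ ≤ B := by
  rw [h.rowU_neg, norm_mul, ← Complex.exp_add, Complex.norm_exp]
  have e : (-(α / 2 * (k : ℂ) ^ 2) + -a * k).re = -(α / 2 * k ^ 2 + a * k) := by
    rw [show (-(α / 2 * (k : ℂ) ^ 2) + -a * k) = ((-(α / 2 * k ^ 2 + a * k) : ℝ) : ℂ) by
      push_cast; ring, Complex.ofReal_re]
  rw [e]
  have h1 : 0 ≤ α / 2 * k ^ 2 + a * k := by positivity
  exact (mul_le_of_le_one_left (norm_nonneg _) (Real.exp_le_one_iff.2 (by linarith))).trans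
    (h.bound k)

theorem IsRow.differentiableOn_rowE (hα : 0 < α) (ha : 0 ≤ a) (hb : 0 < b)
    (h : IsRow α b a e₁ e₂ v B) : DifferentiableOn ℂ (rowE α b a e₁ e₂ v) {z | z.re < b + 1} := by
  have hU := differentiableOn_rowU hα ha h.bound e₁ e₂ hb
  exact ((differentiableOn_tsum_dslope (by positivity) hU (h.norm_rowU_neg_le hα.le ha)).const_sub
    e₁).sub (differentiable_gammaTail.differentiableOn.mul hU)

/-- The jump of the first entry across `γ`. -/
theorem IsRow.rowE_eq (hα : 0 < α) (ha : 0 ≤ a) (h : IsRow α b a e₁ e₂ v B) {z : ℂ}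
    (hz : ∀ k : ℕ, z ≠ -k) :
    rowE α b a e₁ e₂ v z = rowS α a e₁ v z - Complex.Gamma z * rowU α b a e₁ e₂ v z := by
  obtain ⟨d, hd, hdz⟩ := exists_le_norm_add_nat hz
  have hs := summable_poleSum hd ((norm_nonneg _).trans (h.bound 0))
    (norm_critCoeff_mul_le hα.le ha h.bound) hdz
  have hg := summable_inv_factorial_div hd hdz
  have e : ∑' k : ℕ, (-1) ^ k / (k ! : ℂ) * dslope (rowU α b a e₁ e₂ v) (-k) z =
      gammaPoles z * rowU α b a e₁ e₂ v z - poleSum (fun k => critCoeff α a k * v k) z := by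
    rw [gammaPoles, poleSum, ← tsum_mul_right, ← (hg.mul_right _).tsum_sub hs]
    refine tsum_congr fun k => ?_
    rw [dslope_of_ne _ (hz k), slope_def_field, h.rowU_neg, critCoeff, critW_eq, sub_neg_eq_add]
    ring
  rw [rowE, e, rowS, Gamma_eq_gammaPoles_add hz]
  ring

/-- The linear system for `v` in terms of the matrix `M`. -/
theorem isRow_of_eq (hα : 0 < α) (ha : 0 < a) (hb : 0 < b) (hv : ∀ k, ‖v k‖ ≤ B)
    (h : ∀ k, v k = e₂ + e₁ * Gfun (b + 1) (critSym α) k a +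
      ∑' j, Mmat (b + 1) (critSym α) (critW α) a k j * v j) : IsRow α b a e₁ e₂ v B := by
  have hb1 : 0 < b + 1 := by positivity
  refine ⟨hv, fun k => ?_⟩
  have hL := lineFunctional_lineSeries hα ha hb1 hv k
  have hM : ∀ j, Mmat (b + 1 + 1) (critSym α) (critW α) a k j =
      Mmat (b + 1) (critSym α) (critW α) a k j := fun j =>
    (Mmat_critSym_eq hα hb1 (by linarith) _ _ k j).symm
  simp only [hM] at hL
  have h0 := differentiableOn_rowF (u := b + 1) hα.le ha.le hv 0 hb1
  have h1 := gaussDecay_rowF hα ha.le hv 0 hb1 (b + 1)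
  have hne : ∀ z ∈ vstrip (b + 1) (b + 1), z + k ≠ 0 := fun z hz h =>
    ne_neg_natCast_of_re_pos (hb1.trans_le hz.1) k (eq_neg_of_add_eq_zero_left h)
  have hi1 : Integrable fun τ => rowF α a 0 v (vline (b + 1) τ) / (vline (b + 1) τ + k) := by
    simp only [div_eq_mul_inv]
    exact (h1.mul_bounded fun z hz => inv_norm_add_nat_le hb1 k hz).integrable le_rfl le_rfl
      (h0.continuousOn.mul (ContinuousOn.inv₀ (by fun_prop) hne))
  have hi2 := ((gaussDecay_critSym_mul_exp_div hα a k hb1 (b + 1)).integrable le_rfl le_rfl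
    (differentiableOn_critSym_mul_exp_div a k hb1).continuousOn).const_mul e₁
  have e1 : lineInt (b + 1) (fun w => rowF α a 0 v w / (w + k)) =
      lineFunctional α (b + 1) (lineSeries α (b + 1) a v) k := by
    refine lineInt_congr fun w hw => ?_
    have hw' : w ∈ range (vline (b + 1)) := by rw [range_vline]; exact hw
    rw [lineSeries, indicator_of_mem hw', ← mul_assoc, critSym_half_mul, rowF, rowS, zero_add,
      poleSum, mul_comm]
  have e2 : lineInt (b + 1) (fun w => rowF α a e₁ v w / (w - -k)) =
      lineInt (b + 1) (fun w => rowF α a 0 v w / (w + k) +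
        e₁ * (critSym α w * Complex.exp (-a * w) / (w + k))) := by
    refine lineInt_congr fun w _ => ?_
    simp only [rowF, rowS, sub_neg_eq_add]
    ring
  rw [rowT, e2, lineInt_add hi1 hi2, lineInt_const_mul, e1, hL, h k, Gfun]
  ring

/-- The linear system is solved by Cramer's rule, because `det (1 - M)` does not vanish. -/
theorem exists_isRow (hα : 0 < α) (ha : 0 < a) (hb : 0 < b) (e₁ e₂ : ℂ) :
    ∃ B, IsRow α b a e₁ e₂ (fun k => e₂ +
      infDet (replaceCol (Mmat (b + 1) (critSym α) (critW α) a)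
        (fun k => e₁ * Gfun (b + 1) (critSym α) k a +
          e₂ * ∑' j, Mmat (b + 1) (critSym α) (critW α) a k j) k) / critDet α b a) B := by
  have hline := lineBound_critSym (c := b + 1) hα (by linarith)
  have hcol := hline.colBound (summable_norm_critW hα.le) (ofReal_mem_halfStrip ha)
  have hK := hline.const_nonneg
  set M := Mmat (b + 1) (critSym α) (critW α) a with hM
  set K := LineBound.const (α / 4) (symConst α (b + 1)) with hKdef
  set ε : ℕ → ℝ := fun j => ‖critW α j‖ * (2 * K)
  set η : ℕ → ℝ := fun k => 1 / (2 * ((k : ℝ) + 1)) with hη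
  have hη0 := hcol.eta_nonneg
  have hε0 : 0 ≤ ∑' j, ε j := tsum_nonneg hcol.eps_nonneg
  have hη1 : ∀ k, η k ≤ 1 := fun k => by
    have : (0 : ℝ) ≤ k := Nat.cast_nonneg k
    rw [hη]
    exact (div_le_one (by positivity)).2 (by linarith)
  have hsM : ∀ k, Summable fun j => M k j := fun k =>
    Summable.of_norm_bounded (hcol.summable.mul_right _) fun j => hcol.bound k j
  have hr : ∀ k, ‖e₁ * Gfun (b + 1) (critSym α) k a + e₂ * ∑' j, M k j‖ ≤
      (‖e₁‖ * (2 * K) + ‖e₂‖ * ∑' j, ε j) * η k := fun k => by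
    have h1 : ‖Gfun (b + 1) (critSym α) k a‖ ≤ 2 * K * η k := by
      refine (hline.norm_Gfun_le (ofReal_mem_halfStrip ha).2 k).trans ?_
      have h2 : Real.exp (-((a : ℂ).re * (b + 1))) ≤ 1 := by
        rw [Real.exp_le_one_iff, Complex.ofReal_re]
        have : 0 < a * (b + 1) := by positivity
        linarith
      calc K * Real.exp (-((a : ℂ).re * (b + 1))) / (k + 1) ≤ K * 1 / (k + 1) := by gcongr
        _ = _ := by rw [hη]; field_simp
    have h2 : ‖∑' j, M k j‖ ≤ (∑' j, ε j) * η k := by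
      rw [← tsum_mul_right]
      exact tsum_of_norm_bounded (hcol.summable.mul_right _).hasSum fun j => hcol.bound k j
    calc _ ≤ ‖e₁‖ * (2 * K * η k) + ‖e₂‖ * ((∑' j, ε j) * η k) := by
          refine (norm_add_le _ _).trans ?_
          rw [norm_mul, norm_mul]
          gcongr
      _ = _ := by ring
  obtain ⟨⟨C, hC⟩, hw⟩ := hcol.exists_solution (critDet_ne_zero hα hb ha) (by positivity) hr
  change ∀ k, ‖_ / critDet α b a‖ ≤ C at hC
  change ∀ k, _ / critDet α b a = _ + ∑' j, M k j * (_ / critDet α b a) at hw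
  set w : ℕ → ℂ := fun k => infDet (replaceCol M (fun k => e₁ * Gfun (b + 1) (critSym α) k a +
          e₂ * ∑' j, M k j) k) / critDet α b a
  have hC0 := (norm_nonneg _).trans (hC 0)
  have hsw : ∀ k, Summable fun j => M k j * w j := fun k => by
    refine Summable.of_norm_bounded ((hcol.summable.mul_right (η k)).mul_right C) fun j => ?_
    rw [norm_mul]
    exact mul_le_mul (hcol.bound k j) (hC j) (norm_nonneg _)
      (mul_nonneg (hcol.eps_nonneg j) (hη0 k))
  refine ⟨‖e₂‖ + C, isRow_of_eq hα ha hb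
    (fun k => (norm_add_le _ _).trans (add_le_add_right (hC k) _)) fun k => ?_⟩
  change e₂ + w k = e₂ + _ + ∑' j, M k j * (e₂ + w j)
  have hwk : w k = _ + ∑' j, M k j * w j := hw k
  simp only [mul_add]
  rw [((hsM k).mul_right e₂).tsum_add (hsw k), tsum_mul_right, hwk]
  ring

end rows


/-! ### Expansions of the rows -/

section rowExpansions

variable {α δ b a d h : ℝ} {e₁ e₂ : ℂ} {v : ℕ → ℂ} {B : ℝ}

theorem exists_norm_rowS_sub_le (hα : 0 ≤ α) (ha : 0 ≤ a) (hv : ∀ k, ‖v k‖ ≤ B) (e₁ : ℂ)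
    (hd : 0 < d) : ∃ C, ∀ z : ℂ, z ≠ 0 → (∀ k : ℕ, d ≤ ‖z + k‖) →
      ‖rowS α a e₁ v z - (e₁ + (∑' k, critCoeff α a k * v k) / z +
        (-∑' k : ℕ, k * (critCoeff α a k * v k)) / z ^ 2)‖ ≤ C / ‖z‖ ^ 3 := by
  obtain ⟨C, hC⟩ := exists_norm_poleSum_sub_le hd ((norm_nonneg _).trans (hv 0))
    (norm_critCoeff_mul_le hα ha hv)
  refine ⟨C, fun z hz hzk => (le_of_eq ?_).trans (hC z hz hzk)⟩
  rw [rowS]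
  congr 1
  ring

/-- Both continuations of the second entry have the same expansion. -/
theorem exists_norm_rowT_sub_le (hα : 0 < α) (ha : 0 ≤ a) (hv : ∀ k, ‖v k‖ ≤ B) (e₁ e₂ : ℂ)
    {l u : ℝ} (hl : 0 < l) (hlb : l < b) (hbu : b < u) :
    ∃ q₁ q₂ C, ∀ z : ℂ, z ≠ 0 →
      (z.re ≤ b → ‖rowT α a e₁ e₂ v u z - (e₂ + q₁ / z + q₂ / z ^ 2)‖ ≤ C / ‖z‖ ^ 3) ∧
      (b ≤ z.re → ‖rowT α a e₁ e₂ v l z - (e₂ + q₁ / z + q₂ / z ^ 2)‖ ≤ C / ‖z‖ ^ 3) := by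
  have hlu := hlb.trans hbu
  have hd := differentiableOn_rowF (u := u) hα.le ha hv e₁ hl
  have hg := gaussDecay_rowF hα ha hv e₁ hl u
  have hsub : ∀ c, l ≤ c → c ≤ u → vstrip c c ⊆ vstrip l u := fun c h1 h2 z hz =>
    ⟨h1.trans hz.1, hz.2.trans h2⟩
  obtain ⟨C, hC⟩ := (hg.mono hlu.le le_rfl).exists_norm_cauchy_sub_le
    (hd.continuousOn.mono (hsub u hlu.le le_rfl)) (sub_pos.2 hbu)
  obtain ⟨C', hC'⟩ := (hg.mono le_rfl hlu.le).exists_norm_cauchy_sub_le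
    (hd.continuousOn.mono (hsub l le_rfl hlu.le)) (sub_pos.2 hlb)
  refine ⟨-lineInt u (rowF α a e₁ v), -lineInt u fun w => rowF α a e₁ v w * (w + 0), max C C',
    fun z hz => ⟨fun hzb => ?_, fun hzb => ?_⟩⟩
  · have h1 := hC z hz ((sub_le_sub_left hzb u).trans (le_abs_self _))
    refine (le_of_eq ?_).trans (h1.trans ?_)
    · rw [rowT]; congr 1; ring
    · gcongr; exact le_max_left _ _
  · have h1 := hC' z hz (by rw [abs_sub_comm]; exact (sub_le_sub_right hzb l).trans (le_abs_self _))
    have e : lineInt l (fun w => rowF α a e₁ v w * (w + 0)) =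
        lineInt u fun w => rowF α a e₁ v w * (w + 0) :=
      lineInt_shift hlu.le (hd.mul (by fun_prop)) (hg.mul_id 0)
    rw [lineInt_shift hlu.le hd hg, e] at h1
    refine (le_of_eq ?_).trans (h1.trans ?_)
    · rw [rowT]; congr 1; ring
    · gcongr; exact le_max_right _ _

/-- In a horizontal half strip `rowU` is smaller than any power; the cube suffices. -/
theorem exists_norm_rowU_le (hα : 0 < α) (ha : 0 ≤ a) (hv : ∀ k, ‖v k‖ ≤ B) (e₁ e₂ : ℂ)
    (hb : 0 < b) (hh : 1 ≤ h) : ∃ C ≥ 0, ∀ z : ℂ, z ≠ 0 → z.re ≤ 1 / 2 → |z.im| ≤ h →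
      ‖rowU α b a e₁ e₂ v z‖ ≤ C / ‖z‖ ^ 3 := by
  obtain ⟨D, hD⟩ := exists_norm_rowT_le (c := b + 1) (d := 1 / 2) hα ha hv e₁ e₂ (by positivity)
    (by norm_num)
  have hD0 := (norm_nonneg _).trans (hD 0 (by simp; linarith))
  obtain ⟨κ, hκ, C, hC⟩ := (hookDecay_gauss (δ := h) (c := 0) (x := a)
    (half_pos hα)).decay
  have hC0 : 0 ≤ C := by
    have := (norm_nonneg _).trans (hC 0 (by simp; linarith) (by simp; linarith))
    simpa using this
  refine ⟨C * Real.exp (κ * h ^ 2) * (1 + 2 / κ ^ 2) * D, by positivity, fun z hz h1 h2 => ?_⟩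
  have hz0 := norm_pos_iff.2 hz
  have h3 : ‖Complex.exp (a * z - (α / 2 : ℝ) * z ^ 2)‖ ≤
      C * Real.exp (κ * h ^ 2) * (1 + 2 / κ ^ 2) / ‖z‖ ^ 3 := by
    refine (hC z (by linarith) h2).trans ?_
    have h4 : ‖z‖ ^ 2 ≤ z.re ^ 2 + h ^ 2 := by
      rw [← Complex.normSq_eq_norm_sq, Complex.normSq_apply, ← pow_two, ← pow_two]
      have := pow_le_pow_left₀ (abs_nonneg _) h2 2
      rw [sq_abs] at this
      linarith
    have h5 : Real.exp (-κ * z.re ^ 2) ≤ Real.exp (κ * h ^ 2) / Real.exp (κ * ‖z‖ ^ 2) := by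
      rw [← Real.exp_sub]
      exact Real.exp_le_exp.2 (by nlinarith)
    -- In the strip the Gaussian decays in all directions, hence faster than any power.
    have h6 : ‖z‖ ^ 3 ≤ (1 + 2 / κ ^ 2) * Real.exp (κ * ‖z‖ ^ 2) := by
      have h7 : (1 : ℝ) ≤ Real.exp (κ * ‖z‖ ^ 2) := Real.one_le_exp (by positivity)
      have h8 : (κ * ‖z‖ ^ 2) ^ 2 / 2 ≤ Real.exp (κ * ‖z‖ ^ 2) := by
        simpa using Real.pow_div_factorial_le_exp (κ * ‖z‖ ^ 2) (by positivity) 2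
      have h9 : ‖z‖ ^ 3 ≤ 1 + ‖z‖ ^ 4 := by
        rcases le_total ‖z‖ 1 with h | h
        · have := pow_le_one₀ hz0.le h (n := 3)
          have : 0 ≤ ‖z‖ ^ 4 := by positivity
          linarith
        · have := pow_le_pow_right₀ h (by norm_num : 3 ≤ 4)
          linarith
      have h10 : ‖z‖ ^ 4 = 2 / κ ^ 2 * ((κ * ‖z‖ ^ 2) ^ 2 / 2) := by field_simp
      have h11 : ‖z‖ ^ 4 ≤ 2 / κ ^ 2 * Real.exp (κ * ‖z‖ ^ 2) := by
        rw [h10]; gcongr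
      linarith
    calc C * Real.exp (-κ * z.re ^ 2) ≤ C * (Real.exp (κ * h ^ 2) / Real.exp (κ * ‖z‖ ^ 2)) := by
          gcongr
      _ = C * Real.exp (κ * h ^ 2) * (Real.exp (κ * ‖z‖ ^ 2))⁻¹ := by ring
      _ ≤ C * Real.exp (κ * h ^ 2) * ((1 + 2 / κ ^ 2) / ‖z‖ ^ 3) := by
          gcongr
          rw [inv_eq_one_div, div_le_div_iff₀ (Real.exp_pos _) (by positivity)]
          linarith
      _ = _ := by ring
  rw [rowU, norm_mul]
  calc _ ≤ C * Real.exp (κ * h ^ 2) * (1 + 2 / κ ^ 2) / ‖z‖ ^ 3 * D :=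
        mul_le_mul h3 (hD z (by linarith)) (norm_nonneg _) (by positivity)
    _ = _ := by ring

/-- A bound that holds away from the non-positive integers extends to small discs around them by
the maximum principle. -/
theorem norm_le_of_norm_le_off_poles {f : ℂ → ℂ} {R C : ℝ} (hR : 0 ≤ R) (hC : 0 ≤ C)
    (hf : ∀ z : ℂ, z ≠ 0 → z.re < 1 → DifferentiableAt ℂ f z)
    (hb : ∀ w : ℂ, R ≤ ‖w‖ → w ≠ 0 → w.re ≤ 1 / 2 → |w.im| ≤ h + 1 → (∀ k : ℕ, 1 / 2 ≤ ‖w + k‖) →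
      ‖f w‖ ≤ C / ‖w‖ ^ 3) {z : ℂ} (hz : R + 2 ≤ ‖z‖) (hre : z.re ≤ 0) (him : |z.im| ≤ h) :
    ‖f z‖ ≤ 8 * C / ‖z‖ ^ 3 := by
  have hz0 : 0 < ‖z‖ := by linarith
  by_cases hk : ∀ k : ℕ, 1 / 2 ≤ ‖z + k‖
  · refine (hb z (by linarith) (norm_pos_iff.1 hz0) (by linarith) (by linarith) hk).trans ?_
    gcongr
    linarith
  push Not at hk
  obtain ⟨m, hm⟩ := hk
  have hmem : z ∈ Metric.ball (-(m : ℂ)) (1 / 2) := by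
    rwa [Metric.mem_ball, dist_eq_norm, sub_neg_eq_add]
  have hclose : ∀ w ∈ Metric.closedBall (-(m : ℂ)) (1 / 2), ‖z‖ ≤ ‖w‖ + 1 ∧ ‖w - z‖ ≤ 1 := by
    intro w hw
    have h1 : ‖w - z‖ ≤ 1 := by
      rw [← dist_eq_norm]
      have h2 := dist_triangle_right w z (-(m : ℂ))
      rw [Metric.mem_ball] at hmem
      rw [Metric.mem_closedBall] at hw
      linarith
    refine ⟨?_, h1⟩
    have := norm_sub_le w (w - z)
    rw [sub_sub_cancel] at this
    linarith
  have hre' : ∀ w ∈ Metric.closedBall (-(m : ℂ)) (1 / 2), w.re ≤ 1 / 2 := by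
    intro w hw
    rw [Metric.mem_closedBall, dist_eq_norm, sub_neg_eq_add] at hw
    have h1 := (Complex.re_le_norm (w + m)).trans hw
    simp only [Complex.add_re, Complex.natCast_re] at h1
    have : (0 : ℝ) ≤ m := Nat.cast_nonneg m
    linarith
  have hcb : closure (Metric.ball (-(m : ℂ)) (1 / 2)) = Metric.closedBall (-(m : ℂ)) (1 / 2) :=
    closure_ball _ (by norm_num)
  refine Complex.norm_le_of_forall_mem_frontier_norm_le (U := Metric.ball (-(m : ℂ)) (1 / 2))
    Metric.isBounded_ball (DifferentiableOn.diffContOnCl fun w hw => ?_) (fun w hw => ?_)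
    (subset_closure hmem)
  · rw [hcb] at hw
    have := (hclose w hw).1
    exact (hf w (norm_pos_iff.1 (by linarith))
      (by linarith [hre' w hw])).differentiableWithinAt
  · rw [frontier_ball _ (by norm_num)] at hw
    have hw' := Metric.sphere_subset_closedBall hw
    obtain ⟨h1, h2⟩ := hclose w hw'
    rw [mem_sphere_iff_norm, sub_neg_eq_add] at hw
    have hw0 : 0 < ‖w‖ := by linarith
    refine (hb w (by linarith) (norm_pos_iff.1 hw0) (hre' w hw') ?_ fun k => ?_).trans ?_
    · have h3 := (Complex.abs_im_le_norm (w - z)).trans h2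
      rw [Complex.sub_im] at h3
      have h4 := abs_add_le (w.im - z.im) z.im
      rw [sub_add_cancel] at h4
      linarith
    · rcases eq_or_ne k m with rfl | hkm
      · exact hw.ge
      · have h3 : (1 : ℝ) ≤ ‖((k : ℂ) - m)‖ := by
          have : (1 : ℤ) ≤ |(k : ℤ) - m| := Int.one_le_abs (sub_ne_zero.2 (by exact_mod_cast hkm))
          have e : ((k : ℂ) - m) = (((k : ℤ) - m : ℤ) : ℂ) := by push_cast; rfl
          rw [e, Complex.norm_intCast]
          exact_mod_cast this
        have h4 := norm_sub_le (w + k) (w + m)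
        rw [add_sub_add_left_eq_sub] at h4
        linarith
    · have h3 : ‖z‖ ≤ 2 * ‖w‖ := by linarith
      have h4 : ‖z‖ ^ 3 ≤ 8 * ‖w‖ ^ 3 := by
        calc ‖z‖ ^ 3 ≤ (2 * ‖w‖) ^ 3 := pow_le_pow_left₀ hz0.le h3 3
          _ = _ := by ring
      rw [div_le_div_iff₀ (by positivity) (by positivity)]
      nlinarith

/-- Away from its poles, the Gamma function is bounded on left half planes. -/
theorem exists_norm_Gamma_le (hd : 0 < d) (A : ℝ) :
    ∃ C, ∀ z : ℂ, z.re ≤ A → (∀ k : ℕ, d ≤ ‖z + k‖) → ‖Complex.Gamma z‖ ≤ C := by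
  obtain ⟨C, hC⟩ := exists_norm_gammaTail_le A
  have hc : ∀ k : ℕ, ‖((-1) ^ k / (k ! : ℂ) : ℂ)‖ ≤ 1 / k ! * 1 := fun k => by
    rw [norm_div, norm_pow, norm_neg, norm_one, one_pow, Complex.norm_natCast, mul_one]
  refine ⟨∑' k : ℕ, 1 / (k ! : ℝ) * (1 * d⁻¹) + C, fun z hz hzk => ?_⟩
  have hne : ∀ k : ℕ, z ≠ -k := fun k h => by
    have := hzk k
    rw [h] at this
    simp at this
    linarith
  rw [Gamma_eq_gammaPoles_add hne]
  exact (norm_add_le _ _).trans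
    (add_le_add (norm_poleSum_le hd zero_le_one hc hzk) (hC z hz))

/-- To the left of `γ` the first entry has the same expansion as to the right: away from the poles the
two differ by `Γ * rowU`, which decays like a Gaussian. -/
theorem IsRow.exists_norm_rowE_sub_le (hα : 0 < α) (ha : 0 ≤ a) (hb : 0 < b)
    (hrow : IsRow α b a e₁ e₂ v B) (hh : 0 ≤ h) :
    ∃ C R, ∀ z : ℂ, R ≤ ‖z‖ → z.re ≤ 0 → |z.im| ≤ h →
      ‖rowE α b a e₁ e₂ v z - (e₁ + (∑' k, critCoeff α a k * v k) / z +
        (-∑' k : ℕ, k * (critCoeff α a k * v k)) / z ^ 2)‖ ≤ C / ‖z‖ ^ 3 := by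
  obtain ⟨C₁, h₁⟩ := exists_norm_rowS_sub_le (d := 1 / 2) hα.le ha hrow.bound e₁ (by norm_num)
  obtain ⟨C₂, hC₂, h₂⟩ := exists_norm_rowU_le (h := h + 1) hα ha hrow.bound e₁ e₂ hb (by linarith)
  obtain ⟨C₃, h₃⟩ := exists_norm_Gamma_le (d := 1 / 2) (by norm_num) (1 / 2)
  refine ⟨8 * (|C₁| + |C₃| * C₂), 2, fun z hz hre him => norm_le_of_norm_le_off_poles
    (f := fun z => rowE α b a e₁ e₂ v z - (e₁ + (∑' k, critCoeff α a k * v k) / z +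
        (-∑' k : ℕ, k * (critCoeff α a k * v k)) / z ^ 2)) le_rfl (by positivity)
    (fun w hw hw1 => ?_) (fun w _ hw hwre hwim hwk => ?_) (by linarith) hre him⟩
  · refine (((hrow.differentiableOn_rowE hα ha hb).differentiableAt
      ((isOpen_lt Complex.continuous_re continuous_const).mem_nhds
        (show w.re < b + 1 by linarith))).sub ?_)
    fun_prop (disch := first | exact hw | exact pow_ne_zero 2 hw)
  · have hne : ∀ k : ℕ, w ≠ -k := fun k h => by
      have := hwk k
      rw [h] at this
      simp at this
      linarith
    rw [hrow.rowE_eq hα ha hne, sub_right_comm]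
    refine (norm_sub_le _ _).trans ?_
    rw [add_div, norm_mul, mul_div_assoc]
    have h5 := h₂ w hw hwre hwim
    refine add_le_add ((h₁ w hw hwk).trans ?_) (mul_le_mul ((h₃ w hwre hwk).trans (le_abs_self _))
      h5 (norm_nonneg _) (abs_nonneg _))
    gcongr
    exact le_abs_self _

end rowExpansions


/-! ### The solution of the Riemann–Hilbert problem -/

section solution

variable {α δ b a : ℝ} {v : Fin 2 → ℕ → ℂ} {B : Fin 2 → ℝ}

/-- The matrix function with columns `F` and `G`. -/
def ofColumns (F G : Fin 2 → ℂ → ℂ) (z : ℂ) : Matrix (Fin 2) (Fin 2) ℂ :=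
  Matrix.of fun i j => if j = 0 then F i z else G i z

/-- The first column of the solution; the row `i` tends to the row `i` of the identity matrix. -/
def solCol₀ (α δ b a : ℝ) (v : Fin 2 → ℕ → ℂ) (i : Fin 2) (z : ℂ) : ℂ :=
  open Classical in
  if z ∈ inner δ then
    rowE α b a ((1 : Matrix (Fin 2) (Fin 2) ℂ) i 0) ((1 : Matrix (Fin 2) (Fin 2) ℂ) i 1) (v i) z
  else rowS α a ((1 : Matrix (Fin 2) (Fin 2) ℂ) i 0) (v i) z

/-- The second column of the solution. Moving the line of integration away from `γ̃`, to the side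
opposite to `z`, does not change the Cauchy transform, and gives its boundary values for free. -/
def solCol₁ (α δ b a : ℝ) (v : Fin 2 → ℕ → ℂ) (i : Fin 2) (z : ℂ) : ℂ :=
  rowT α a ((1 : Matrix (Fin 2) (Fin 2) ℂ) i 0) ((1 : Matrix (Fin 2) (Fin 2) ℂ) i 1) (v i)
    (if z.re < b then b + 1 else (δ + b) / 2) z

/-- The solution of the Riemann–Hilbert problem. -/
def solution (α δ b a : ℝ) (v : Fin 2 → ℕ → ℂ) : ℂ → Matrix (Fin 2) (Fin 2) ℂ :=
  ofColumns (solCol₀ α δ b a v) (solCol₁ α δ b a v)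

theorem neg_natCast_mem_inner (hδ : 0 < δ) (k : ℕ) : (-(k : ℂ)) ∈ inner δ := by
  rcases Nat.eq_zero_or_pos k with rfl | hk
  · exact Or.inl (by simpa using hδ)
  · refine Or.inr ⟨?_, by simpa using hδ⟩
    simpa using hk

theorem le_norm_add_nat_of_notMem_inner {z : ℂ} (hz : z ∉ inner δ) (k : ℕ) : δ ≤ ‖z + k‖ := by
  by_contra! h
  have him : |z.im| ≤ ‖z + k‖ := by simpa using Complex.abs_im_le_norm (z + k)
  rcases lt_or_ge z.re 0 with h1 | h1
  · exact hz (Or.inr ⟨h1, him.trans_lt h⟩)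
  · refine hz (Or.inl (lt_of_le_of_lt ?_ h))
    have hk : (0 : ℝ) ≤ k := Nat.cast_nonneg k
    rw [← sq_le_sq₀ (norm_nonneg _) (norm_nonneg _), Complex.sq_norm, Complex.sq_norm,
      Complex.normSq_apply, Complex.normSq_apply]
    simp only [Complex.add_re, Complex.natCast_re, Complex.add_im, Complex.natCast_im, add_zero]
    nlinarith [mul_nonneg h1 hk]

theorem eventually_atInfinity {δ b : ℝ} (R : ℝ) :
    ∀ᶠ z in atInfinity δ b, R ≤ ‖z‖ ∧ z ∈ (contours δ b)ᶜ :=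
  ((tendsto_norm_cobounded_atTop.eventually_ge_atTop R).filter_mono inf_le_left).and
    (mem_inf_of_right (mem_principal_self _))

theorem tendsto_ofReal_atInfinity (hδ : 0 < δ) (hb : δ < b) :
    Tendsto (fun x : ℝ => (x : ℂ)) atTop (atInfinity δ b) := by
  refine tendsto_inf.2 ⟨?_, tendsto_principal.2 ?_⟩
  · rw [← tendsto_norm_atTop_iff_cobounded]
    simpa using tendsto_abs_atTop_atTop
  · filter_upwards [eventually_gt_atTop b] with x hx
    exact outer_subset_compl hδ hb (by simpa [outer] using hx)

theorem tendsto_div_pow_atInfinity (c : ℂ) (n : ℕ) :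
    Tendsto (fun z : ℂ => c / z ^ (n + 1)) (atInfinity δ b) (𝓝 0) := by
  have h : Tendsto (fun z : ℂ => c * z⁻¹ ^ (n + 1)) (cobounded ℂ) (𝓝 (c * 0 ^ (n + 1))) :=
    (tendsto_inv₀_cobounded.pow (n + 1)).const_mul c
  rw [zero_pow (by omega), mul_zero] at h
  refine (h.mono_left inf_le_left).congr fun z => ?_
  rw [inv_pow, div_eq_mul_inv]

theorem HasExpansion.tendsto {Y : ℂ → Matrix (Fin 2) (Fin 2) ℂ} {Y₁ Y₂ : Matrix (Fin 2) (Fin 2) ℂ}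
    (h : HasExpansion δ b Y Y₁ Y₂) : Tendsto Y (atInfinity δ b) (𝓝 1) := by
  refine tendsto_pi_nhds.2 fun i => tendsto_pi_nhds.2 fun j => ?_
  have h1 := (h i j).trans_tendsto (tendsto_div_pow_atInfinity 1 2)
  have h2 := h1.add ((((tendsto_div_pow_atInfinity (δ := δ) (b := b) (Y₁ i j) 0)).const_add
    ((1 : Matrix (Fin 2) (Fin 2) ℂ) i j)).add (tendsto_div_pow_atInfinity (Y₂ i j) 1))
  simp only [add_zero, zero_add] at h2
  refine h2.congr fun z => ?_
  simp

/-- The coefficient of `1 / z` in the expansion at infinity is unique. -/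
theorem HasExpansion.unique (hδ : 0 < δ) (hb : δ < b) {Y : ℂ → Matrix (Fin 2) (Fin 2) ℂ}
    {Y₁ Y₂ Y₁' Y₂' : Matrix (Fin 2) (Fin 2) ℂ} (h : HasExpansion δ b Y Y₁ Y₂)
    (h' : HasExpansion δ b Y Y₁' Y₂') : Y₁ = Y₁' := by
  ext i j
  have : (atInfinity δ b).NeBot := (tendsto_ofReal_atInfinity hδ hb).neBot
  have hz : (fun z : ℂ => z * (1 / z ^ 3)) =ᶠ[atInfinity δ b] fun z => 1 / z ^ (1 + 1) := by
    filter_upwards [eventually_atInfinity 1] with z hz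
    have : z ≠ 0 := norm_pos_iff.1 (by linarith [hz.1])
    field_simp
  have h1 := ((isBigO_refl (fun z : ℂ => z) _).mul ((h' i j).sub (h i j))).trans_tendsto
    ((tendsto_div_pow_atInfinity 1 1).congr' hz.symm)
  have h2 := h1.add (tendsto_div_pow_atInfinity (Y₂' i j - Y₂ i j) 0)
  rw [add_zero] at h2
  have h3 : Tendsto (fun _ : ℂ => Y₁ i j - Y₁' i j) (atInfinity δ b) (𝓝 0) := by
    refine h2.congr' ?_
    filter_upwards [eventually_atInfinity 1] with z hz
    have : z ≠ 0 := norm_pos_iff.1 (by linarith [hz.1])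
    field_simp
    ring
  exact sub_eq_zero.1 (tendsto_nhds_unique tendsto_const_nhds h3)

theorem differentiableAt_solCol₀ (hα : 0 < α) (hδ : 0 < δ) (hb : δ < b) (ha : 0 < a)
    (hv : ∀ i, IsRow α b a ((1 : Matrix (Fin 2) (Fin 2) ℂ) i 0)
      ((1 : Matrix (Fin 2) (Fin 2) ℂ) i 1) (v i) (B i)) (i : Fin 2) {z : ℂ}
    (hz : z ∈ (contours δ b)ᶜ) : DifferentiableAt ℂ (solCol₀ α δ b a v i) z := by
  have hb0 := hδ.trans hb
  have hS : ∀ {U : Set ℂ}, IsOpen U → z ∈ U → (∀ w ∈ U, w ∉ inner δ) →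
      DifferentiableAt ℂ (solCol₀ α δ b a v i) z := fun {U} hU hzU hd => by
    refine (differentiableAt_rowS hα.le ha.le (hv i).bound ((1 : Matrix (Fin 2) (Fin 2) ℂ) i 0)
      fun k hk =>
      hd z hzU (by rw [hk]; exact neg_natCast_mem_inner hδ k)).congr_of_eventuallyEq ?_
    filter_upwards [hU.mem_nhds hzU] with w hw
    exact if_neg (hd w hw)
  rcases compl_contours_subset δ b hz with (h | h) | h
  · refine (((hv i).differentiableOn_rowE hα ha.le hb0).differentiableAt
      ((isOpen_lt Complex.continuous_re continuous_const).mem_nhds (show z.re < b + 1 by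
        linarith [re_lt_of_mem_inner hδ h]))).congr_of_eventuallyEq ?_
    filter_upwards [(isOpen_inner δ).mem_nhds h] with w hw
    exact if_pos hw
  · exact hS (isOpen_middle hδ b) h fun w hw => hw.2.1
  · exact hS (isOpen_outer b) h fun w hw hw' =>
      absurd hw (not_lt.2 ((re_lt_of_mem_inner hδ hw').trans hb).le)

theorem differentiableAt_solCol₁ (hα : 0 < α) (hδ : 0 < δ) (hb : δ < b) (ha : 0 < a)
    (hv : ∀ i, IsRow α b a ((1 : Matrix (Fin 2) (Fin 2) ℂ) i 0)
      ((1 : Matrix (Fin 2) (Fin 2) ℂ) i 1) (v i) (B i)) (i : Fin 2) {z : ℂ}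
    (hz : z ∈ (contours δ b)ᶜ) : DifferentiableAt ℂ (solCol₁ α δ b a v i) z := by
  have hb0 := hδ.trans hb
  have hne : z.re ≠ b := fun h => hz (Or.inr (by rw [range_vline]; exact h))
  rcases lt_or_gt_of_ne hne with h | h
  · refine (differentiableAt_rowT hα ha.le (hv i).bound ((1 : Matrix (Fin 2) (Fin 2) ℂ) i 0)
      ((1 : Matrix (Fin 2) (Fin 2) ℂ) i 1)
      (by positivity : 0 < b + 1) (by linarith : z.re < b + 1).ne).congr_of_eventuallyEq ?_
    filter_upwards [(isOpen_lt Complex.continuous_re continuous_const).mem_nhds h] with w hw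
    rw [solCol₁, if_pos hw]
  · refine (differentiableAt_rowT hα ha.le (hv i).bound ((1 : Matrix (Fin 2) (Fin 2) ℂ) i 0)
      ((1 : Matrix (Fin 2) (Fin 2) ℂ) i 1)
      (by positivity : 0 < (δ + b) / 2) (by linarith : (δ + b) / 2 < z.re).ne').congr_of_eventuallyEq ?_
    filter_upwards [(isOpen_lt continuous_const Complex.continuous_re).mem_nhds h] with w hw
    rw [solCol₁, if_neg (not_lt.2 (le_of_lt hw))]

theorem tendsto_ofColumns {Y : ℂ → Matrix (Fin 2) (Fin 2) ℂ} {F G : Fin 2 → ℂ → ℂ} {s : Set ℂ}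
    {z : ℂ} (hF : ∀ i, DifferentiableAt ℂ (F i) z) (hG : ∀ i, DifferentiableAt ℂ (G i) z)
    (hY : ∀ w ∈ s, Y w = ofColumns F G w) : Tendsto Y (𝓝[s] z) (𝓝 (ofColumns F G z)) := by
  refine Tendsto.congr' (f₁ := ofColumns F G) ?_ ?_
  · filter_upwards [self_mem_nhdsWithin] with w hw
    exact (hY w hw).symm
  · refine tendsto_pi_nhds.2 fun i => tendsto_pi_nhds.2 fun j => Tendsto.mono_left ?_ inf_le_left
    simp only [ofColumns, Matrix.of_apply]
    split_ifs
    · exact (hF i).continuousAt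
    · exact (hG i).continuousAt

theorem hasExpansion_solution (hα : 0 < α) (hδ : 0 < δ) (hb : δ < b) (ha : 0 < a)
    (hv : ∀ i, IsRow α b a ((1 : Matrix (Fin 2) (Fin 2) ℂ) i 0)
      ((1 : Matrix (Fin 2) (Fin 2) ℂ) i 1) (v i) (B i)) :
    ∃ Y₁ Y₂, HasExpansion δ b (solution α δ b a v) Y₁ Y₂ ∧
      Y₁ 0 0 = ∑' k, critCoeff α a k * v 0 k := by
  have hb0 := hδ.trans hb
  choose q₁ q₂ C hT using fun i => exists_norm_rowT_sub_le hα ha.le (hv i).bound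
    ((1 : Matrix (Fin 2) (Fin 2) ℂ) i 0) ((1 : Matrix (Fin 2) (Fin 2) ℂ) i 1)
    (by positivity : 0 < (δ + b) / 2) (by linarith : (δ + b) / 2 < b) (by linarith : b < b + 1)
  choose C' hS using fun i => exists_norm_rowS_sub_le hα.le ha.le (hv i).bound
    ((1 : Matrix (Fin 2) (Fin 2) ℂ) i 0) hδ
  choose C'' R hE using fun i => (hv i).exists_norm_rowE_sub_le hα ha.le hb0 hδ.le
  refine ⟨Matrix.of fun i j => if j = 0 then ∑' k, critCoeff α a k * v i k else q₁ i,
    Matrix.of fun i j => if j = 0 then -∑' k : ℕ, k * (critCoeff α a k * v i k) else q₂ i, ?_,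
    by simp⟩
  intro i j
  refine IsBigO.of_bound (max (C i) (max (C' i) (C'' i))) ?_
  filter_upwards [eventually_atInfinity (max (R i) (max 1 δ))] with z hz
  obtain ⟨hz, -⟩ := hz
  have hR : R i ≤ ‖z‖ := (le_max_left _ _).trans hz
  have h1 : 1 ≤ ‖z‖ := ((le_max_left _ _).trans (le_max_right _ _)).trans hz
  have hδz : δ ≤ ‖z‖ := ((le_max_right _ _).trans (le_max_right _ _)).trans hz
  have hz0 : z ≠ 0 := norm_pos_iff.1 (by linarith)
  rw [norm_div, norm_one, norm_pow, mul_one_div]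
  suffices h : ∃ D, D ≤ max (C i) (max (C' i) (C'' i)) ∧ ‖solution α δ b a v z i j - _‖ ≤ D / ‖z‖ ^ 3 by
    obtain ⟨D, hD, h⟩ := h
    refine h.trans ?_
    gcongr
  simp only [solution, ofColumns, Matrix.of_apply]
  by_cases hj : j = 0
  · subst hj
    simp only [if_true, solCol₀]
    split_ifs with hin
    · refine ⟨C'' i, (le_max_right _ _).trans (le_max_right _ _), hE i z hR ?_
        (abs_im_lt_of_mem_inner hin).le⟩
      rcases hin with h | h
      · exact absurd h (not_lt.2 hδz)
      · exact h.1.le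
    · exact ⟨C' i, (le_max_left _ _).trans (le_max_right _ _), hS i z hz0
        (le_norm_add_nat_of_notMem_inner hin)⟩
  · have hj1 : j = 1 := by omega
    subst hj1
    simp only [one_ne_zero, if_false, solCol₁]
    refine ⟨C i, le_max_left _ _, ?_⟩
    split_ifs with hre
    · exact (hT i z hz0).1 hre.le
    · exact (hT i z hz0).2 (not_lt.1 hre)

theorem isSolution_solution (hα : 0 < α) (hδ : 0 < δ) (hb : δ < b) (ha : 0 < a)
    (hv : ∀ i, IsRow α b a ((1 : Matrix (Fin 2) (Fin 2) ℂ) i 0)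
      ((1 : Matrix (Fin 2) (Fin 2) ℂ) i 1) (v i) (B i)) :
    IsSolution α δ b a (solution α δ b a v) := by
  have hb0 := hδ.trans hb
  have hl : 0 < (δ + b) / 2 := by positivity
  set E : Fin 2 → ℂ → ℂ := fun i => rowE α b a ((1 : Matrix (Fin 2) (Fin 2) ℂ) i 0)
    ((1 : Matrix (Fin 2) (Fin 2) ℂ) i 1) (v i) with hE
  set S : Fin 2 → ℂ → ℂ := fun i => rowS α a ((1 : Matrix (Fin 2) (Fin 2) ℂ) i 0) (v i) with hS
  set T : ℝ → Fin 2 → ℂ → ℂ := fun c i => rowT α a ((1 : Matrix (Fin 2) (Fin 2) ℂ) i 0)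
    ((1 : Matrix (Fin 2) (Fin 2) ℂ) i 1) (v i) c with hT
  -- On each component the solution is given by functions that are holomorphic up to the contours.
  have hin : ∀ w ∈ inner δ, solution α δ b a v w = ofColumns E (T (b + 1)) w := fun w hw => by
    ext i j
    simp only [solution, ofColumns, solCol₀, solCol₁, if_pos hw,
      if_pos ((re_lt_of_mem_inner hδ hw).trans hb), hE, hT]
  have hmid : ∀ w ∈ middle δ b, solution α δ b a v w = ofColumns S (T (b + 1)) w := fun w hw => by
    ext i j
    simp only [solution, ofColumns, solCol₀, solCol₁, if_neg hw.2.1, if_pos hw.1, hS, hT]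
  have hout : ∀ w ∈ outer b, solution α δ b a v w = ofColumns S (T ((δ + b) / 2)) w := fun w hw => by
    have h1 : ¬ w.re < b := not_lt.2 (le_of_lt hw)
    have h2 : w ∉ inner δ := fun h => h1 ((re_lt_of_mem_inner hδ h).trans hb)
    ext i j
    simp only [solution, ofColumns, solCol₀, solCol₁, if_neg h2, if_neg h1, hS, hT]
  have hTd : ∀ {c : ℝ}, 0 < c → ∀ {z : ℂ}, z.re ≠ c → ∀ i, DifferentiableAt ℂ (T c i) z :=
    fun hc _ hz i => differentiableAt_rowT hα ha.le (hv i).bound _ _ hc hz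
  have hSd : ∀ {z : ℂ}, (∀ k : ℕ, z ≠ -k) → ∀ i, DifferentiableAt ℂ (S i) z :=
    fun hz i => differentiableAt_rowS hα.le ha.le (hv i).bound _ hz
  have hEd : ∀ {z : ℂ}, z.re < b + 1 → ∀ i, DifferentiableAt ℂ (E i) z := fun hz i =>
    ((hv i).differentiableOn_rowE hα ha.le hb0).differentiableAt
      ((isOpen_lt Complex.continuous_re continuous_const).mem_nhds hz)
  obtain ⟨Y₁, Y₂, hY, -⟩ := hasExpansion_solution hα hδ hb ha hv
  refine ⟨fun i j => ?_, ?_, ?_, hY.tendsto⟩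
  · refine DifferentiableOn.analyticOnNhd (fun z hz => DifferentiableAt.differentiableWithinAt ?_)
      (isClosed_contours hδ b).isOpen_compl
    simp only [solution, ofColumns, Matrix.of_apply]
    split_ifs
    · exact differentiableAt_solCol₀ hα hδ hb ha hv i hz
    · exact differentiableAt_solCol₁ hα hδ hb ha hv i hz
  · rintro z ⟨r, rfl⟩
    have hre := hook_re_le hδ r
    have hne := hook_ne_neg_nat hδ r
    have hreb : (hook δ r).re ≠ b + 1 := by linarith
    refine ⟨_, _, tendsto_ofColumns (hEd (by linarith)) (hTd (by positivity) hreb) hin,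
      tendsto_ofColumns (hSd hne) (hTd (by positivity) hreb) hmid, ?_⟩
    have hexp : ∀ z : ℂ, Complex.exp (-(α * z ^ 2 / 2) + a * z) =
        Complex.exp (a * z - (α / 2 : ℝ) * z ^ 2) := fun z => by
      congr 1; push_cast; ring
    ext i j
    rw [Matrix.mul_apply, Fin.sum_univ_two]
    fin_cases j
    · simp [ofColumns, jumpMatrix, hE, hS, hT, (hv i).rowE_eq hα ha.le hne, rowU, hexp]
      ring
    · simp [ofColumns, jumpMatrix, hook_notMem_range_vline hδ hb r]
  · rintro z hz
    have hre : z.re = b := by rwa [range_vline] at hz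
    have hne : ∀ k : ℕ, z ≠ -k := ne_neg_natCast_of_re_pos (by linarith)
    have hnot : z ∉ range (hook δ) := by
      obtain ⟨r, rfl⟩ := hz
      exact vline_notMem_range_hook hδ hb r
    refine ⟨_, _, tendsto_ofColumns (hSd hne) (hTd (by positivity) (by linarith)) hmid,
      tendsto_ofColumns (hSd hne) (hTd hl (by linarith)) hout, ?_⟩
    have hexp : critSym α z * Complex.exp (-a * z) =
        (Complex.Gamma z)⁻¹ * Complex.exp (α * z ^ 2 / 2 - a * z) := by
      rw [critSym, mul_comm (Complex.exp _), mul_assoc, ← Complex.exp_add]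
      congr 2; ring
    ext i j
    rw [Matrix.mul_apply, Fin.sum_univ_two]
    fin_cases j
    · simp [ofColumns, jumpMatrix, hnot]
    · have h := rowT_eq_add hα ha.le (hv i).bound ((1 : Matrix (Fin 2) (Fin 2) ℂ) i 0)
        ((1 : Matrix (Fin 2) (Fin 2) ℂ) i 1) hl (z := z) (u := b + 1) (by linarith) (by linarith)
      simp only [ofColumns, jumpMatrix, hS, hT, Matrix.of_apply, h, rowF, hexp]
      simp [hz]
      ring

/-- The problem has a solution whose first coefficient at infinity is the logarithmic derivative of
the gap probability: by Cramer's rule `∑ ξ_k v_k` is Jacobi's formula for the derivative of the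
determinant, divided by the determinant. -/
theorem exists_isSolution (hα : 0 < α) (hδ : 0 < δ) (hb : δ < b) (ha : 0 < a) :
    ∃ Y, IsSolution α δ b a Y ∧ ∃ Y₁ Y₂, HasExpansion δ b Y Y₁ Y₂ ∧
      deriv (gapProb α δ b) a / gapProb α δ b a = Y₁ 0 0 := by
  choose B hv using fun i => exists_isRow hα ha (hδ.trans hb)
    ((1 : Matrix (Fin 2) (Fin 2) ℂ) i 0) ((1 : Matrix (Fin 2) (Fin 2) ℂ) i 1)
  obtain ⟨Y₁, Y₂, hY, h00⟩ := hasExpansion_solution hα hδ hb ha hv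
  refine ⟨_, isSolution_solution hα hδ hb ha hv, Y₁, Y₂, hY, ?_⟩
  rw [h00, (hasDerivAt_gapProb hα hδ hb ha).deriv, gapProb_eq_critDet hα hδ hb ha, ← tsum_div_const]
  refine tsum_congr fun k => ?_
  simp only [Matrix.one_apply_eq, Matrix.one_apply_ne (zero_ne_one : (0 : Fin 2) ≠ 1), one_mul,
    zero_mul, add_zero, zero_add, critCoeff]
  rw [mul_div_assoc]

end solution

end CritRH

end

theorem proposition7p2 (α δ b : ℝ) (hα : 0 < α) (hδ : 0 < δ) (hb : δ < b) :
    -- for every `a > 0` the series for `P(a)` converges absolutely, and `P(a) > 0`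
    (∀ a : ℝ, 0 < a →
      (∀ n : ℕ, IntegrableOn (fun x : Fin n → ℝ => CritRH.corrDet α δ b x)
        {x | ∀ j, a < x j}) ∧
      Summable (CritRH.gapTerm α δ b a) ∧
      0 < (CritRH.gapProb α δ b a).re ∧ (CritRH.gapProb α δ b a).im = 0) ∧
    -- `P(a)` is the gap probability of the determinantal point process with kernel `K_crit`
    (∀ (Ω : Type*) [MeasurableSpace Ω] (μ : Measure Ω) [IsProbabilityMeasure μ]
      (X : Ω → Set ℝ), CritRH.IsDeterminantal μ X (CritRH.Kcrit α δ b) →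
      ∀ a : ℝ, 0 < a →
        CritRH.gapProb α δ b a = ((μ.real {ω | X ω ∩ Ioi a = ∅} : ℝ) : ℂ)) ∧
    -- `|1 - P(a)| ≤ C e^{-a/2}`
    (∃ C : ℝ, 0 < C ∧ ∀ a : ℝ, 0 < a →
      ‖1 - CritRH.gapProb α δ b a‖ ≤ C * Real.exp (-a / 2)) ∧
    -- `I - Q_a` is invertible on `L₂(γ ∪ γ̃)`
    (∀ a : ℝ, 0 < a →
      ∃ Q : Lp ℂ 2 (CritRH.arcLength δ b) →L[ℂ] Lp ℂ 2 (CritRH.arcLength δ b),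
        CritRH.IsQOperator α δ b a Q ∧ IsUnit (1 - Q)) ∧
    -- the problem Y-RH has a unique solution, it has an expansion at infinity, and
    -- `P'(a) / P(a) = (Y₁(a))₁₁`
    (∀ a : ℝ, 0 < a →
      DifferentiableAt ℝ (CritRH.gapProb α δ b) a ∧
      ∃ Y : ℂ → Matrix (Fin 2) (Fin 2) ℂ,
        CritRH.IsSolution α δ b a Y ∧
        (∀ Y', CritRH.IsSolution α δ b a Y' → EqOn Y' Y (CritRH.contours δ b)ᶜ) ∧
        (∃ Y₁ Y₂, CritRH.HasExpansion δ b Y Y₁ Y₂) ∧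
        ∀ Y₁ Y₂, CritRH.HasExpansion δ b Y Y₁ Y₂ →
          deriv (CritRH.gapProb α δ b) a / CritRH.gapProb α δ b a = Y₁ 0 0) := by
  refine ⟨fun a ha => ⟨CritRH.integrableOn_corrDet hα hδ hb ha,
    CritRH.summable_gapTerm hα hδ hb ha, CritRH.gapProb_pos hα hδ hb ha⟩, ?_, ?_,
    fun a ha => CritRH.exists_isUnit_one_sub hα hδ hb ha, fun a ha => ?_⟩
  · intro Ω _ μ _ X hX a ha
    exact CritRH.gapProb_eq_measure hα hδ hb hX ha
  · obtain ⟨C, hC, h⟩ := CritRH.exists_norm_one_sub_gapProb_le hα hδ hb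
    refine ⟨C, hC, fun a ha => (h a ha).trans ?_⟩
    gcongr
    linarith
  · obtain ⟨Y, hY, Y₁, Y₂, hexp, hderiv⟩ := CritRH.exists_isSolution hα hδ hb ha
    refine ⟨(CritRH.hasDerivAt_gapProb hα hδ hb ha).differentiableAt, Y, hY,
      fun Y' hY' => hY.eqOn hδ hb hY', ⟨Y₁, Y₂, hexp⟩, fun Z₁ Z₂ hZ => ?_⟩
    rw [hderiv, hexp.unique hδ hb hZ]
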